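/- Fix integers $p,q\ge 0$. Consider a sequence (indexed by $k\to\infty$; the index is suppressed) of normal ANOVA models $$y=X\beta+\sum_{i=1}^q Z_iv_i+e,\qquad y\in\mathbb R^{n},$$ where $X$ is a known $n\times p$ matrix of rank $p<n$, $Z_i$ is a known $n\times r_i$ matrix, $\beta\in\mathbb R^p$, and $v_1,\dots,v_q,e$ are independent with $v_i\sim N(0,\sigma_iI_{r_i})$, $e\sim N(0,\sigma_0I_n)$. The true $\sigma=(\sigma_0,\dots,\sigma_q)$ is a fixed interior point of $\Theta=\{\sigma:\sigma_i\ge0,\ 0\le i\le q\}$. Put $Z=(Z_1,\dots,Z_q)$, $v=(v_1',\dots,v_q')'$, $G=\mathrm{diag}(\sigma_1I_{r_1},\dots,\sigma_qI_{r_q})$, $Z_0=I_n$, $V_i=Z_iZ_i'$, $\Sigma=\sum_{i=0}^q\sigma_iV_i$, $P=\Sigma^{-1}-\Sigma^{-1}X(X'\Sigma^{-1}X)^{-1}X'\Sigma^{-1}$, and let $T$ be an $n\times(n-p)$ matrix of rank $n-p$ with $T'X=0$. Let $\Theta_+=\{\tau\in\Theta:\Sigma(\tau)\text{ is positive definite}\}$.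 For $\mu=l'\beta+m'v$ let $$t(\sigma)=t(\sigma,y)=l'\tilde\beta+s(\sigma)'(y-X\tilde\beta),\quad \tilde\beta=(X'\Sigma^{-1}X)^{-1}X'\Sigma^{-1}y,\quad s(\sigma)=\Sigma^{-1}ZGm$$ be the BLUP, and let $\ell$ be one of $$\ell_R(\sigma)=-\tfrac12[\log|T'\Sigma T|+y'Py],\qquad \ell_P(\sigma)=-\tfrac12[\log|\Sigma|+y'Py].$$ Let $A=E[\partial^2\ell(\sigma)/\partial\sigma^2]$ (a negative definite matrix for large $k$), $\|B\|_2=[\mathrm{tr}(B'B)]^{1/2}$, $d_i=\|Z_i'PZ_i\|_2$, $d_*=\min_id_i$ and $D=\mathrm{diag}(d_0,\dots,d_q)$. Suppose that 1. the entries of $l$ and the norms $|m|$ are bounded; 2. (infinitely informative, asymptotically identifiable) $d_i\to\infty$ for $0\le i\le q$, and the smallest eigenvalue of the matrix $\big(\mathrm{tr}(PV_iPV_j)/(d_id_j)\big)_{0\le i,j\le q}$ has positive limit inferior; 3. the fixed-effect combinations entering the predictor and its $\sigma$-derivatives are consistently estimable: $c'(X'\Sigma^{-1}X)^{-1}c\to0$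 for $c=l-X's(\sigma)$ and for $c=X'\partial s(\sigma)/\partial\sigma_i$, $0\le i\le q$; 4. there are $\alpha\ge0$, $b>2$, $\delta>0$ such that $t(\tau,y)=\sum_{j=1}^K\lambda_j(\tau)W_j(y)$ for all $\tau\in\Theta_+$ and all $y$, where $K=O(d_*^\alpha)$, the $W_j$ are measurable, each $\lambda_j$ is $C^2$ at every $\tau$ with $|\tau-\sigma|\le\delta$, and the following are bounded: $\max_jE|W_j(y)|^b$, $\max_j\sup_{\tau\in\Theta_+}|\lambda_j(\tau)|$, $\sum_j|\partial\lambda_j(\sigma)/\partial\sigma|$, $\sum_j\sup_{|\tau-\sigma|\le\delta}\|\partial^2\lambda_j(\tau)/\partial\sigma^2\|$. Call a sequence of measurable statistics $\hat\sigma=\hat\sigma(y)\in\Theta_+$ that are even ($\hat\sigma(-y)=\hat\sigma(y)$) and translation invariant ($\hat\sigma(y+Xb)=\hat\sigma(y)$ for all $b\in\mathbb R^p$) a REML estimator (if $\ell=\ell_R$) or ML estimator (if $\ell=\ell_P$) if for all $0<\rho<1$ and $g>0$, outside an event of probability $O(d_*^{-g})$, it satisfies $\partial\ell(\hat\sigma)/\partial\sigma=0$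 and $|D(\hat\sigma-\sigma)|<d_*^{1-\rho}$. Then, both for REML and for ML, such estimators exist, and for every one of them $E[t(\hat\sigma)-\mu]^2$ is finite and $$\mathrm{MSE}[t(\hat\sigma)]=E[t(\hat\sigma)-\mu]^2=g_1(\sigma)+g_2(\sigma)+g_3(\sigma)+o(d_*^{-2}),$$ where $$g_1=m'(G-GZ'\Sigma^{-1}ZG)m,\qquad g_2=(l-X's)'(X'\Sigma^{-1}X)^{-1}(l-X's),$$ $$g_3=\mathrm{tr}\{[\nabla s]'\Sigma[\nabla s](-A)^{-1}\},\qquad \nabla s=\partial s/\partial\sigma'.$$ -/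

import Mathlib

open MeasureTheory ProbabilityTheory Filter Topology Asymptotics
open scoped Matrix

noncomputable section

namespace EmpBLUP

/-- Vectors of variance components, with the Euclidean norm; coordinate `0` is the error variance,
coordinate `i.succ` is the variance of the `i`-th random effect. -/
abbrev Param (q : ℕ) : Type := EuclideanSpace ℝ (Fin (q + 1))

/-- The parameter space of the ANOVA model: all variance components are nonnegative. -/
def paramSpace (q : ℕ) : Set (Param q) := {σ | ∀ i, 0 ≤ σ i}

/-- Partial derivative in the `i`-th variance component. -/
def pderiv {q : ℕ} (i : Fin (q + 1)) (f : Param q → ℝ) (σ : Param q) : ℝ :=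
  fderiv ℝ f σ (EuclideanSpace.single i 1)

/-- The norm `‖B‖₂ = [tr (B'B)]^{1/2}`. -/
def frob {a b : ℕ} (B : Matrix (Fin a) (Fin b) ℝ) : ℝ := Real.sqrt (Matrix.trace (Bᵀ * B))

/-- The known quantities of one ANOVA model `y = X β + ∑ i, Z i (v i) + e`, a target
`l'β + m'v`, and a matrix `T` of error contrasts (used in the restricted likelihood). -/
structure Design (p q : ℕ) where
  n : ℕ
  r : Fin q → ℕ
  X : Matrix (Fin n) (Fin p) ℝ
  Z : (i : Fin q) → Matrix (Fin n) (Fin (r i)) ℝ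
  T : Matrix (Fin n) (Fin (n - p)) ℝ
  l : Fin p → ℝ
  m : ((i : Fin q) × Fin (r i)) → ℝ
  p_lt_n : p < n
  rank_X : X.rank = p
  rank_T : T.rank = n - p
  T_mul_X : Tᵀ * X = 0

/-- Two estimation methods: restricted and ordinary maximum likelihood. -/
inductive Method where
  | reml : Method
  | ml : Method

namespace Design

variable {p q : ℕ} (D : Design p q)

/-- Index set of the stacked vector `v = (v₁', …, v_q')'`. -/
abbrev RE : Type := (i : Fin q) × Fin (D.r i)

/-- Sample space of one model: the pairs `(v, e)`. -/
abbrev Omega : Type := (D.RE → ℝ) × (Fin D.n → ℝ)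

/-- `Z = (Z₁, …, Z_q)`. -/
def Zfull : Matrix (Fin D.n) D.RE ℝ := Matrix.of fun a j => D.Z j.1 a j.2

/-- `G = diag (σ₁ I, …, σ_q I)`, the covariance matrix of `v`. -/
def G (σ : Param q) : Matrix D.RE D.RE ℝ := Matrix.diagonal fun j => σ j.1.succ

/-- `V₀ = I` and `V_i = Z_i Z_i'`. -/
def V (i : Fin (q + 1)) : Matrix (Fin D.n) (Fin D.n) ℝ :=
  Fin.cases 1 (fun j => D.Z j * (D.Z j)ᵀ) i

/-- `Σ = ∑ σ_i V_i`, the covariance matrix of `y`. -/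
def cov (σ : Param q) : Matrix (Fin D.n) (Fin D.n) ℝ := ∑ i, σ i • D.V i

/-- The parameters at which the BLUP and the likelihoods are defined: nonnegative variance
components with nonsingular covariance matrix. -/
def admissible : Set (Param q) := {σ | σ ∈ paramSpace q ∧ (D.cov σ).PosDef}

/-- `(X' Σ⁻¹ X)⁻¹`. -/
def M (σ : Param q) : Matrix (Fin p) (Fin p) ℝ := (D.Xᵀ * (D.cov σ)⁻¹ * D.X)⁻¹

/-- `P = Σ⁻¹ - Σ⁻¹ X (X' Σ⁻¹ X)⁻¹ X' Σ⁻¹`. -/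
def P (σ : Param q) : Matrix (Fin D.n) (Fin D.n) ℝ :=
  (D.cov σ)⁻¹ - (D.cov σ)⁻¹ * D.X * D.M σ * D.Xᵀ * (D.cov σ)⁻¹

/-- The generalized least squares estimator of `β`. -/
def betaTilde (σ : Param q) (y : Fin D.n → ℝ) : Fin p → ℝ :=
  (D.M σ * D.Xᵀ * (D.cov σ)⁻¹) *ᵥ y

/-- `s(σ) = Σ⁻¹ Z G m`. -/
def s (σ : Param q) : Fin D.n → ℝ := ((D.cov σ)⁻¹ * D.Zfull * D.G σ) *ᵥ D.m

/-- The BLUP `t(σ, y) = l' β̃ + s(σ)' (y - X β̃)`. -/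
def t (σ : Param q) (y : Fin D.n → ℝ) : ℝ :=
  D.l ⬝ᵥ D.betaTilde σ y + D.s σ ⬝ᵥ (y - D.X *ᵥ D.betaTilde σ y)

/-- The vector `∂s/∂σ_i`. -/
def ds (σ : Param q) (i : Fin (q + 1)) : Fin D.n → ℝ := fun a => pderiv i (fun τ => D.s τ a) σ

/-- The matrix `∇s = ∂s/∂σ'`. -/
def gradS (σ : Param q) : Matrix (Fin D.n) (Fin (q + 1)) ℝ := Matrix.of fun a i => D.ds σ i a

/-- The law of `(v, e)`: independent coordinates, those of `v_i` being `N(0, σ_i)` and those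
of `e` being `N(0, σ₀)`. -/
def law (σ : Param q) : Measure D.Omega :=
  (Measure.pi fun j : D.RE => gaussianReal 0 (σ j.1.succ).toNNReal).prod
    (Measure.pi fun _ : Fin D.n => gaussianReal 0 (σ 0).toNNReal)

/-- The observations `y = X β + Z v + e`. -/
def obs (β : Fin p → ℝ) (ω : D.Omega) : Fin D.n → ℝ := D.X *ᵥ β + D.Zfull *ᵥ ω.1 + ω.2

/-- The mixed effect `l'β + m'v`. -/
def target (β : Fin p → ℝ) (ω : D.Omega) : ℝ := D.l ⬝ᵥ β + D.m ⬝ᵥ ω.1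

/-- The prediction error `t(σ̂) - (l'β + m'v)` of the empirical BLUP. -/
def predError (β : Fin p → ℝ) (est : (Fin D.n → ℝ) → Param q) (ω : D.Omega) : ℝ :=
  D.t (est (D.obs β ω)) (D.obs β ω) - D.target β ω

/-- `MSE[t(σ̂)]`, the expectation being taken at `(β, σ)`. -/
def MSE (β : Fin p → ℝ) (σ : Param q) (est : (Fin D.n → ℝ) → Param q) : ℝ :=
  ∫ ω, D.predError β est ω ^ 2 ∂(D.law σ)

/-- The log restricted likelihood `l_R` and the profile loglikelihood `l_P`, up to additive
constants that do not depend on `σ`. -/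
def crit : Method → Param q → (Fin D.n → ℝ) → ℝ
  | .reml, σ, y => -(1 / 2) * (Real.log (D.Tᵀ * D.cov σ * D.T).det + y ⬝ᵥ (D.P σ *ᵥ y))
  | .ml, σ, y => -(1 / 2) * (Real.log (D.cov σ).det + y ⬝ᵥ (D.P σ *ᵥ y))

/-- The matrix `A = E[∂²l(σ)/∂σ²]`. -/
def A (meth : Method) (β : Fin p → ℝ) (σ : Param q) : Matrix (Fin (q + 1)) (Fin (q + 1)) ℝ :=
  Matrix.of fun i j =>
    ∫ ω, pderiv i (fun σ₁ => pderiv j (fun σ₂ => D.crit meth σ₂ (D.obs β ω)) σ₁) σ ∂(D.law σ)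

/-- The variance `c' (X' Σ⁻¹ X)⁻¹ c` of the best linear unbiased estimator of `c'β`. -/
def blueVar (σ : Param q) (c : Fin p → ℝ) : ℝ := c ⬝ᵥ (D.M σ *ᵥ c)

/-- `g₁ = m' (G - G Z' Σ⁻¹ Z G) m`. -/
def g₁ (σ : Param q) : ℝ :=
  D.m ⬝ᵥ ((D.G σ - D.G σ * D.Zfullᵀ * (D.cov σ)⁻¹ * D.Zfull * D.G σ) *ᵥ D.m)

/-- `g₂ = (l - X's)' (X' Σ⁻¹ X)⁻¹ (l - X's)`. -/
def g₂ (σ : Param q) : ℝ := D.blueVar σ (D.l - D.Xᵀ *ᵥ D.s σ)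

/-- `g₃ = tr {(∇s)' Σ (∇s) (-A)⁻¹}`; here `-A` is the (positive definite) information matrix. -/
def g₃ (meth : Method) (β : Fin p → ℝ) (σ : Param q) : ℝ :=
  Matrix.trace ((D.gradS σ)ᵀ * D.cov σ * D.gradS σ * (-D.A meth β σ)⁻¹)

/-- `d_i = ‖Z_i' P Z_i‖₂`, with `Z₀ = I`. -/
def d (σ : Param q) (i : Fin (q + 1)) : ℝ :=
  Fin.cases (frob (D.P σ)) (fun j => frob ((D.Z j)ᵀ * D.P σ * D.Z j)) i

/-- `d_* = min_i d_i`. -/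
def dstar (σ : Param q) : ℝ := Finset.univ.inf' Finset.univ_nonempty (D.d σ)

/-- The matrix of the correlations `tr(P V_i P V_j) / (d_i d_j)`. -/
def cor (σ : Param q) : Matrix (Fin (q + 1)) (Fin (q + 1)) ℝ :=
  Matrix.of fun i j =>
    Matrix.trace (D.P σ * D.V i * D.P σ * D.V j) / (D.d σ i * D.d σ j)

/-- The Euclidean length `|D(τ - σ)|`, where `D = diag(d₀, …, d_q)`. -/
def scaledDist (σ τ : Param q) : ℝ := Real.sqrt (∑ i, (D.d σ i * (τ i - σ i)) ^ 2)

end Design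

variable {p q : ℕ}

/-- The models are infinitely informative at `σ`: every `d_i` tends to infinity. -/
def InfinitelyInformative (D : ℕ → Design p q) (σ : Param q) : Prop :=
  ∀ i, Tendsto (fun k => (D k).d σ i) atTop atTop

/-- The models are asymptotically identifiable at `σ`: the smallest eigenvalue of the
correlation matrix has a positive limit inferior. -/
def AsymptoticallyIdentifiable (D : ℕ → Design p q) (σ : Param q) : Prop :=
  ∃ c > 0, ∀ᶠ k in atTop, ∀ x : Fin (q + 1) → ℝ, c * (x ⬝ᵥ x) ≤ x ⬝ᵥ ((D k).cor σ *ᵥ x)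

/-- The fixed-effect combinations that enter the predictor and its derivatives in `σ` are
estimated consistently: the BLUE of `(l - X's)'β` and those of `(X' ∂s/∂σ_i)'β` have
variances tending to zero. -/
def FixedPartNegligible (D : ℕ → Design p q) (σ : Param q) : Prop :=
  Tendsto (fun k => (D k).blueVar σ ((D k).l - (D k).Xᵀ *ᵥ (D k).s σ)) atTop (𝓝 0) ∧
  ∀ i, Tendsto (fun k => (D k).blueVar σ ((D k).Xᵀ *ᵥ (D k).ds σ i)) atTop (𝓝 0)

/-- The BLUP has an expansion `t(σ, y) = ∑_{j ≤ K} λ_j(σ) W_j(y)` with `K = O(d_*^α)`, such that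
`E|W_j(y)|^b` (for some `b > 2`), `sup |λ_j|`, `∑ |∂λ_j(σ)|` and
`∑ sup_{|τ - σ| ≤ δ} ‖∂²λ_j(τ)‖` are bounded. -/
def HasExpansion (D : ℕ → Design p q) (β : Fin p → ℝ) (σ : Param q) : Prop :=
  ∃ (α b δ C : ℝ) (K : ℕ → ℕ) (lam : (k : ℕ) → Fin (K k) → Param q → ℝ)
    (W : (k : ℕ) → Fin (K k) → (Fin (D k).n → ℝ) → ℝ) (B : (k : ℕ) → Fin (K k) → ℝ),
    0 ≤ α ∧ 2 < b ∧ 0 < δ ∧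
    ((fun k => (K k : ℝ)) =O[atTop] fun k => (D k).dstar σ ^ α) ∧
    (∀ k, ∀ τ ∈ (D k).admissible, ∀ y, (D k).t τ y = ∑ j, lam k j τ * W k j y) ∧
    (∀ k j, Measurable (W k j)) ∧
    (∀ k j, Integrable (fun ω => |W k j ((D k).obs β ω)| ^ b) ((D k).law σ) ∧
      ∫ ω, |W k j ((D k).obs β ω)| ^ b ∂((D k).law σ) ≤ C) ∧
    (∀ k j, ∀ τ ∈ (D k).admissible, |lam k j τ| ≤ C) ∧
    (∀ k, ∑ j, ‖fderiv ℝ (lam k j) σ‖ ≤ C) ∧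
    (∀ k j, ∀ τ ∈ Metric.closedBall σ δ,
      ContDiffAt ℝ 2 (lam k j) τ ∧ ‖iteratedFDeriv ℝ 2 (lam k j) τ‖ ≤ B k j) ∧
    (∀ k, ∑ j, B k j ≤ C)

/-- A REML (or ML) estimator of `σ`, for the sequence of models `D` with true parameters
`(β, σ)`: an even and translation invariant statistic with admissible values that, outside
events whose probabilities are smaller than any power of `1/d_*`, is a solution of the score
equation at distance `|D(σ̂ - σ)| < d_*^{1-ρ}` from the true `σ`, for every `ρ` in `(0,1)`. -/
structure IsScoreEstimator (meth : Method) (D : ℕ → Design p q) (β : Fin p → ℝ) (σ : Param q)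
    (est : (k : ℕ) → (Fin (D k).n → ℝ) → Param q) : Prop where
  measurable : ∀ k, Measurable (est k)
  mem : ∀ k y, est k y ∈ (D k).admissible
  even : ∀ k y, est k (-y) = est k y
  invariant : ∀ k y (b : Fin p → ℝ), est k (y + (D k).X *ᵥ b) = est k y
  root : ∀ ρ : ℝ, 0 < ρ → ρ < 1 → ∀ g : ℝ, 0 < g →
    (fun k => ((D k).law σ).real {ω | ¬ (
        fderiv ℝ (fun τ => (D k).crit meth τ ((D k).obs β ω)) (est k ((D k).obs β ω)) = 0 ∧
        (D k).scaledDist σ (est k ((D k).obs β ω)) < (D k).dstar σ ^ (1 - ρ))})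
      =O[atTop] fun k => (D k).dstar σ ^ (-g)

end EmpBLUP

end

/-! Write the data as `y = Xβ + H w` with `w` standard Gaussian and `H Hᵀ = Σ`. The prediction error
is the error of the BLUP at the true `σ` plus `Δ = t(σ̂) - t(σ)`. The first part is a linear form in
`w` whose coefficient vector `errVec` is annihilated by the projection `Q = Hᵀ P H`. The reflection
`2Q - 1` preserves the law of `w`, moves the data only along the range of `X`, and reverses the sign
of that linear form. Since `Δ` is translation invariant, the cross moment vanishes
(`integral_errVec_mul`), so the mean square error is `g₁ + g₂ + E Δ²` (`MSE_eq`). It remains to show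
`E Δ² = g₃ + o(d_*⁻²)`.

Both `P` and `Σ⁻¹` satisfy an exact resolvent identity in the variance components
(`IsResolvent.sub_eq`). After whitening, the components `V_i` turn into matrices `Bm` of operator
norm at most `1/σ_i`; for `P` their Frobenius norm is `d_i`. Consequently the score increment
between any two parameters near `σ` agrees with the increment predicted by `A`, up to a relative
error of order `(1 + ℓ + ℓ')/d_*` (with `ℓ`, `ℓ'` the scaled distances to `σ`) times one random
variable `ctrl` that does not depend on the parameters and has bounded moments of all orders
(`score_increment_le`). Asymptotic identifiability makes `-A` coercive in the scale `d`, for ML as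
well as REML, because exchanging `P` for `Σ⁻¹` perturbs the traces by a bounded amount
(`neg_hess_coercive`).

Existence follows: unless `ctrl` or the score at `σ` is large, which has probability below every
power of `1/d_*` by Markov's inequality, a Newton map with the fixed matrix `A` is a contraction
near `σ`, and its fixed point solves the score equation (`newtonEst_spec`,
`isScoreEstimator_newtonEst`).

For an arbitrary score estimator, the same increments linearize the root, and the `C²` coefficients
of the expansion linearize `t`. On the good event `Δ` differs from an explicit cubic polynomial
`lin` in `w` by at most `R²/d_*²` times a variable with bounded second moment, where `R =
d_*^{1/8}`. Off that event a crude bound through the `W_j`, their moments of order `b > 2` and the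
rarity of the event suffice. Together `E (Δ - lin)² = O(d_*⁻³)` (`integral_sub_sq_le_of_rpow`).
Finally `E lin²` is computed from Gaussian moments of quadratic forms up to order three: to leading
order the derivatives of `t` and the score behave as if independent, which yields the trace `g₃`;
the remaining terms are `O(d_*⁻⁴)` or carry a factor that vanishes because the fixed effects are
estimated consistently (`abs_integral_lin_sq_sub_le`). -/

noncomputable section
namespace EmpBLUP

set_option linter.unusedSectionVars false

/-! ### Moments of quadratic forms in standard Gaussian vectors -/

section StdGaussian

variable {ι : Type} [Fintype ι] [DecidableEq ι]

/-- The standard Gaussian measure on `ι → ℝ`. -/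
def stdG (ι : Type) [Fintype ι] : Measure (ι → ℝ) := Measure.pi fun _ => gaussianReal 0 1

instance (ι : Type) [Fintype ι] : IsProbabilityMeasure (stdG ι) := by
  unfold stdG; infer_instance

/-- Linear isometries preserve `stdGaussian` on a Euclidean space; `WithLp.toLp 2` transports this
to the product measure. -/
theorem measurePreserving_orthogonal {O : Matrix ι ι ℝ} (hO : Oᵀ * O = 1) :
    MeasurePreserving (fun w => O *ᵥ w) (stdG ι) (stdG ι) := by
  have hmeas : Measurable fun w : ι → ℝ => O *ᵥ w :=
    (Continuous.matrix_mulVec continuous_const continuous_id).measurable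
  refine ⟨hmeas, ?_⟩
  let f : EuclideanSpace ℝ ι →ₗᵢ[ℝ] EuclideanSpace ℝ ι :=
    { toLinearMap := Matrix.toEuclideanLin O
      norm_map' := fun x => by
        have h : ‖Matrix.toEuclideanLin O x‖ ^ 2 = ‖x‖ ^ 2 := by
          rw [EuclideanSpace.real_norm_sq_eq, EuclideanSpace.real_norm_sq_eq]
          have h1 : ∀ v : ι → ℝ, ∑ i, v i ^ 2 = v ⬝ᵥ v := fun v => by
            simp [dotProduct, sq]
          rw [h1 (fun i => x i)]
          have h2 : ∑ i, (Matrix.toEuclideanLin O x) i ^ 2 = (O *ᵥ x.ofLp) ⬝ᵥ (O *ᵥ x.ofLp) := by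
            rw [← h1]; rfl
          rw [h2, Matrix.dotProduct_mulVec, ← Matrix.mulVec_transpose, Matrix.mulVec_mulVec, hO,
            Matrix.one_mulVec]
        exact (sq_eq_sq₀ (norm_nonneg _) (norm_nonneg _)).1 h }
  let g := f.toLinearIsometryEquiv rfl
  have h1 : Measure.map (WithLp.toLp 2) ((stdG ι).map fun w => O *ᵥ w)
      = Measure.map (WithLp.toLp 2) (stdG ι) := by
    rw [Measure.map_map (by fun_prop) hmeas]
    have h2 : (WithLp.toLp 2 ∘ fun w : ι → ℝ => O *ᵥ w) = g ∘ WithLp.toLp 2 := by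
      ext w; rfl
    rw [h2, ← Measure.map_map (by fun_prop) (by fun_prop)]
    have h3 : Measure.map (WithLp.toLp 2) (stdG ι) = stdGaussian (EuclideanSpace ℝ ι) :=
      map_pi_eq_stdGaussian
    rw [h3, stdGaussian_map g]
  have h4 := congrArg (Measure.map (WithLp.ofLp : EuclideanSpace ℝ ι → ι → ℝ)) h1
  have h5 : ∀ μ : Measure (ι → ℝ), Measure.map (WithLp.ofLp : EuclideanSpace ℝ ι → ι → ℝ)
      (Measure.map (WithLp.toLp 2) μ) = μ := fun μ => by
    rw [Measure.map_map (by fun_prop) (by fun_prop)]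
    exact Measure.map_id
  rwa [h5, h5] at h4

theorem integrable_pow_gaussianReal (n : ℕ) : Integrable (fun x : ℝ => x ^ n) (gaussianReal 0 1) := by
  have h : MemLp id (n : ENNReal) (gaussianReal 0 1) :=
    memLp_id_gaussianReal' _ (ENNReal.natCast_ne_top n)
  have h1 := h.integrable_norm_pow'
  refine (integrable_norm_iff (by fun_prop)).1 ?_
  simpa using h1

/-- Integration by parts: the derivative of `x ^ (n + 1) * φ x`, with `φ' = -x φ`, integrates to
zero. -/
theorem integral_pow_add_two_gaussianReal (n : ℕ) :
    ∫ x, x ^ (n + 2) ∂(gaussianReal 0 1) = (n + 1) * ∫ x, x ^ n ∂(gaussianReal 0 1) := by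
  have hi : ∀ m : ℕ, Integrable fun x : ℝ => x ^ m * gaussianPDFReal 0 1 x := fun m => by
    have h := integrable_pow_gaussianReal m
    rw [gaussianReal_of_var_ne_zero 0 one_ne_zero,
      integrable_withDensity_iff_integrable_smul' (measurable_gaussianPDF 0 1)
        (ae_of_all _ fun x => gaussianPDF_lt_top)] at h
    simpa [toReal_gaussianPDF, mul_comm] using h
  have hd : ∀ x : ℝ, HasDerivAt (gaussianPDFReal 0 1) (-x * gaussianPDFReal 0 1 x) x := fun x => by
    have h1 : HasDerivAt (fun y : ℝ => -y ^ 2 / 2) (-x) x := by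
      have := ((hasDerivAt_pow 2 x).neg).div_const 2
      refine this.congr_deriv (by simp; ring)
    have h2 := (h1.exp).const_mul (√(2 * Real.pi * 1))⁻¹
    have h3 : gaussianPDFReal 0 1 = fun y => (√(2 * Real.pi * 1))⁻¹ * Real.exp (-y ^ 2 / 2) := by
      ext y; simp [gaussianPDFReal]
    rw [h3]
    refine h2.congr_deriv (by ring)
  have h0 := integral_eq_zero_of_hasDerivAt_of_integrable
    (f := fun x : ℝ => x ^ (n + 1) * gaussianPDFReal 0 1 x)
    (f' := fun x => (n + 1 : ℝ) * (x ^ n * gaussianPDFReal 0 1 x)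
      - x ^ (n + 2) * gaussianPDFReal 0 1 x)
    (fun x => by
      have := (hasDerivAt_pow (n + 1) x).mul (hd x)
      refine this.congr_deriv ?_
      push_cast
      ring)
    (((hi n).const_mul _).sub (hi (n + 2))) (hi (n + 1))
  rw [integral_sub ((hi n).const_mul _) (hi (n + 2)), integral_const_mul] at h0
  rw [integral_gaussianReal_eq_integral_smul one_ne_zero,
    integral_gaussianReal_eq_integral_smul one_ne_zero]
  have hcomm : ∀ m : ℕ, ∫ x, gaussianPDFReal 0 1 x • x ^ m = ∫ x, x ^ m * gaussianPDFReal 0 1 x :=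
    fun m => integral_congr_ae (ae_of_all _ fun x => mul_comm _ _)
  rw [hcomm, hcomm]
  linarith

theorem integral_sq_gaussianReal : ∫ x, x ^ 2 ∂(gaussianReal 0 1) = 1 := by
  have := integral_pow_add_two_gaussianReal 0
  simpa using this

theorem integral_pow_four_gaussianReal : ∫ x, x ^ 4 ∂(gaussianReal 0 1) = 3 := by
  have := integral_pow_add_two_gaussianReal 2
  rw [integral_sq_gaussianReal] at this
  norm_num at this ⊢; exact this

theorem integral_pow_six_gaussianReal : ∫ x, x ^ 6 ∂(gaussianReal 0 1) = 15 := by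
  have := integral_pow_add_two_gaussianReal 4
  rw [integral_pow_four_gaussianReal] at this
  norm_num at this ⊢; exact this

/-- Exponents up to three suffice, since at most three centered quadratic forms are ever multiplied.
The value `0` at `c = 1` is what kills the off-diagonal terms later. -/
theorem integral_sq_sub_one_pow (c : ℕ) (hc : c = 0 ∨ c = 1 ∨ c = 2 ∨ c = 3) :
    ∫ x, (x ^ 2 - 1) ^ c ∂(gaussianReal 0 1) =
      if c = 0 then 1 else if c = 1 then 0 else if c = 2 then 2 else 8 := by
  have i2 := integrable_pow_gaussianReal 2
  have i4 := integrable_pow_gaussianReal 4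
  have i6 := integrable_pow_gaussianReal 6
  have i0 : Integrable (fun _ : ℝ => (1 : ℝ)) (gaussianReal 0 1) := integrable_const _
  rcases hc with rfl | rfl | rfl | rfl
  · simp
  · simp only [pow_one]
    rw [integral_sub i2 i0, integral_sq_gaussianReal]; simp
  · have : ∀ x : ℝ, (x ^ 2 - 1) ^ 2 = x ^ 4 - 2 * x ^ 2 + 1 := fun x => by ring
    simp_rw [this]
    have j : Integrable (fun x : ℝ => x ^ 4 - 2 * x ^ 2) (gaussianReal 0 1) :=
      i4.sub (i2.const_mul 2)
    rw [integral_add j i0, integral_sub i4 (i2.const_mul 2),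
      integral_const_mul, integral_sq_gaussianReal, integral_pow_four_gaussianReal]
    norm_num
  · have : ∀ x : ℝ, (x ^ 2 - 1) ^ 3 = x ^ 6 - 3 * x ^ 4 + 3 * x ^ 2 - 1 := fun x => by ring
    simp_rw [this]
    have j : Integrable (fun x : ℝ => x ^ 6 - 3 * x ^ 4) (gaussianReal 0 1) :=
      i6.sub (i4.const_mul 3)
    have j' : Integrable (fun x : ℝ => x ^ 6 - 3 * x ^ 4 + 3 * x ^ 2) (gaussianReal 0 1) :=
      j.add (i2.const_mul 3)
    rw [integral_sub j' i0, integral_add j (i2.const_mul 3), integral_sub i6 (i4.const_mul 3),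
      integral_const_mul, integral_const_mul, integral_sq_gaussianReal,
      integral_pow_four_gaussianReal, integral_pow_six_gaussianReal]
    norm_num

theorem integrable_sq_sub_one_pow (c : ℕ) :
    Integrable (fun x : ℝ => (x ^ 2 - 1) ^ c) (gaussianReal 0 1) := by
  have : ∀ x : ℝ, (x ^ 2 - 1) ^ c
      = ∑ m ∈ Finset.range (c + 1), (x ^ (2 * m) * (-1) ^ (c - m) * (c.choose m : ℝ)) := fun x => by
    rw [sub_eq_add_neg, add_pow]
    simp_rw [pow_mul]
  simp_rw [this]
  exact integrable_finsetSum _ fun m _ =>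
    ((integrable_pow_gaussianReal (2 * m)).mul_const _).mul_const _

/-- The integral equals `e^{-a} (1 - 2a)^{-1/2}`, whose logarithm is quadratic in `a` near zero. The
Gaussian-type bound keeps a product over many coordinates under control by the sum of the squared
coefficients alone. -/
theorem exp_mul_sq_sub_one {a : ℝ} (ha : |a| ≤ 1 / 8) :
    Integrable (fun x : ℝ => Real.exp (a * (x ^ 2 - 1))) (gaussianReal 0 1) ∧
    ∫ x, Real.exp (a * (x ^ 2 - 1)) ∂(gaussianReal 0 1) ≤ Real.exp (2 * a ^ 2) := by
  obtain ⟨ha1, ha2⟩ := abs_le.1 ha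
  have hb : 0 < 1 / 2 - a := by linarith
  have hpdf : ∀ x : ℝ, gaussianPDFReal 0 1 x * Real.exp (a * (x ^ 2 - 1))
      = (√(2 * Real.pi))⁻¹ * Real.exp (-a) * Real.exp (-(1 / 2 - a) * x ^ 2) := fun x => by
    simp only [gaussianPDFReal, NNReal.coe_one, mul_one, sub_zero]
    rw [mul_assoc, mul_assoc, ← Real.exp_add, ← Real.exp_add]
    congr 2; ring
  constructor
  · rw [gaussianReal_of_var_ne_zero 0 one_ne_zero,
      integrable_withDensity_iff_integrable_smul' (measurable_gaussianPDF 0 1)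
        (ae_of_all _ fun x => gaussianPDF_lt_top)]
    simp only [toReal_gaussianPDF, smul_eq_mul]
    simp_rw [hpdf]
    exact (integrable_exp_neg_mul_sq hb).const_mul _
  · rw [integral_gaussianReal_eq_integral_smul one_ne_zero]
    simp only [smul_eq_mul]
    simp_rw [hpdf]
    rw [integral_const_mul, integral_gaussian]
    have hpi := Real.pi_pos
    have hX : (√(2 * Real.pi))⁻¹ * Real.exp (-a) * √(Real.pi / (1 / 2 - a))
        = Real.exp (-a) * (√(1 - 2 * a))⁻¹ := by
      have : Real.pi / (1 / 2 - a) = (2 * Real.pi) * (1 - 2 * a)⁻¹ := by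
        field_simp
      rw [this, Real.sqrt_mul (x := 2 * Real.pi) (by positivity), Real.sqrt_inv]
      have : √(2 * Real.pi) ≠ 0 := by positivity
      field_simp
    rw [hX]
    have h1 : 0 < 1 - 2 * a := by linarith
    -- it suffices to compare squares
    have key : Real.exp (-(2 * a + 4 * a ^ 2)) ≤ 1 - 2 * a := by
      -- With `1 + v ≤ exp v` the comparison reduces to `1 ≤ 1 - 8 a ^ 3`, which is right for
      -- negative `a` only; for positive `a` the quadratic term of the exponential is needed.
      rcases le_or_gt 0 a with h0 | h0
      · set v := 2 * a + 4 * a ^ 2 with hv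
        have hv0 : 0 ≤ v := by positivity
        have h2 := Real.quadratic_le_exp_of_nonneg hv0
        rw [Real.exp_neg]
        have h3 : (Real.exp v)⁻¹ ≤ (1 + v + v ^ 2 / 2)⁻¹ := inv_anti₀ (by positivity) h2
        have h4 : (1 + v + v ^ 2 / 2)⁻¹ ≤ 1 - v + v ^ 2 / 2 := by
          rw [inv_le_iff_one_le_mul₀ (by positivity)]
          nlinarith [sq_nonneg (v ^ 2)]
        have h5 : 1 - v + v ^ 2 / 2 ≤ 1 - 2 * a := by
          have : v ^ 2 / 2 ≤ 4 * a ^ 2 := by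
            have : v = 2 * a * (1 + 2 * a) := by rw [hv]; ring
            rw [this, mul_pow]
            have : (1 + 2 * a) ^ 2 ≤ 2 := by nlinarith
            nlinarith [sq_nonneg a]
          linarith
        linarith
      · have h2 := Real.add_one_le_exp (2 * a + 4 * a ^ 2)
        rw [Real.exp_neg]
        have hp : 0 < 2 * a + 4 * a ^ 2 + 1 := by nlinarith
        refine (inv_anti₀ hp h2).trans ?_
        rw [inv_le_iff_one_le_mul₀ hp]
        have : (1 - 2 * a) * (2 * a + 4 * a ^ 2 + 1) = 1 - 8 * a ^ 3 := by ring
        rw [this]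
        have : a ^ 3 ≤ 0 := by
          have := mul_nonneg (sq_nonneg a) (neg_nonneg.2 h0.le)
          nlinarith
        linarith
    have hs : Real.exp (-(a + 2 * a ^ 2)) ≤ √(1 - 2 * a) := by
      apply Real.le_sqrt_of_sq_le
      rw [← Real.exp_nat_mul]
      refine le_trans (le_of_eq ?_) key
      congr 1; push_cast; ring
    have hs0 : 0 < √(1 - 2 * a) := Real.sqrt_pos.2 h1
    rw [← div_eq_mul_inv, div_le_iff₀ hs0]
    calc Real.exp (-a) = Real.exp (2 * a ^ 2) * Real.exp (-(a + 2 * a ^ 2)) := by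
          rw [← Real.exp_add]; congr 1; ring
      _ ≤ _ := by gcongr

/-- The centered quadratic form `w'Sw - tr S`. -/
def quadC (S : Matrix ι ι ℝ) (w : ι → ℝ) : ℝ := w ⬝ᵥ (S *ᵥ w) - S.trace

theorem continuous_quadC (S : Matrix ι ι ℝ) : Continuous (quadC S) := by
  unfold quadC
  exact (continuous_id.dotProduct (continuous_const.matrix_mulVec continuous_id)).sub
    continuous_const

theorem quadC_add (S R : Matrix ι ι ℝ) (w : ι → ℝ) : quadC (S + R) w = quadC S w + quadC R w := by
  simp [quadC, Matrix.add_mulVec, dotProduct_add]; ring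

theorem quadC_sub (S R : Matrix ι ι ℝ) (w : ι → ℝ) : quadC (S - R) w = quadC S w - quadC R w := by
  simp [quadC, Matrix.sub_mulVec, dotProduct_sub]; ring

theorem quadC_smul (c : ℝ) (S : Matrix ι ι ℝ) (w : ι → ℝ) : quadC (c • S) w = c * quadC S w := by
  simp [quadC, Matrix.smul_mulVec, dotProduct_smul]; ring

theorem quadC_transpose (S : Matrix ι ι ℝ) (w : ι → ℝ) : quadC Sᵀ w = quadC S w := by
  simp only [quadC, Matrix.trace_transpose]
  rw [Matrix.mulVec_transpose, dotProduct_comm, ← Matrix.dotProduct_mulVec]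

/-- By the spectral theorem and rotation invariance a centered quadratic form is distributed as a
weighted sum of independent centered squares. The power sums of the weights are traces of powers of
`S`, so the dimension never enters. -/
theorem exists_diagonalization {S : Matrix ι ι ℝ} (hS : Sᵀ = S) :
    ∃ (c : ι → ℝ) (O : Matrix ι ι ℝ), Oᵀ * O = 1 ∧
      (∀ w, quadC S (O *ᵥ w) = ∑ i, c i * (w i ^ 2 - 1)) ∧
      ∑ i, c i ^ 2 = (S * S).trace ∧ ∑ i, c i ^ 3 = (S * S * S).trace := by
  have hH : S.IsHermitian := by
    rw [Matrix.IsHermitian, Matrix.conjTranspose_eq_transpose_of_trivial]; exact hS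
  set O : Matrix ι ι ℝ := hH.eigenvectorUnitary.1 with hOdef
  have hO1 : Oᵀ * O = 1 := by
    have := Unitary.coe_star_mul_self hH.eigenvectorUnitary
    rwa [Matrix.star_eq_conjTranspose, Matrix.conjTranspose_eq_transpose_of_trivial] at this
  set Λ : Matrix ι ι ℝ := Matrix.diagonal hH.eigenvalues with hΛ
  have hsp : S = O * Λ * Oᵀ := by
    have := hH.spectral_theorem
    rw [Unitary.conjStarAlgAut_apply, Matrix.star_eq_conjTranspose,
      Matrix.conjTranspose_eq_transpose_of_trivial] at this
    exact this
  have hSS : S * S = O * (Λ * Λ) * Oᵀ := by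
    rw [hsp]
    calc O * Λ * Oᵀ * (O * Λ * Oᵀ) = O * Λ * (Oᵀ * O) * Λ * Oᵀ := by simp only [Matrix.mul_assoc]
      _ = _ := by rw [hO1]; simp only [Matrix.mul_assoc, Matrix.one_mul]
  have hSSS : S * S * S = O * (Λ * Λ * Λ) * Oᵀ := by
    rw [hSS]; nth_rewrite 1 [hsp]
    calc O * (Λ * Λ) * Oᵀ * (O * Λ * Oᵀ) = O * (Λ * Λ) * (Oᵀ * O) * Λ * Oᵀ := by
          simp only [Matrix.mul_assoc]
      _ = _ := by rw [hO1]; simp only [Matrix.mul_assoc, Matrix.one_mul]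
  have htr : ∀ M : Matrix ι ι ℝ, (O * M * Oᵀ).trace = M.trace := fun M => by
    rw [Matrix.trace_mul_comm, ← Matrix.mul_assoc, hO1, Matrix.one_mul]
  refine ⟨hH.eigenvalues, O, hO1, fun w => ?_, ?_, ?_⟩
  · unfold quadC
    have h1 : (O *ᵥ w) ⬝ᵥ (S *ᵥ (O *ᵥ w)) = w ⬝ᵥ (Λ *ᵥ w) := by
      rw [Matrix.mulVec_mulVec, ← Matrix.vecMul_transpose, ← Matrix.dotProduct_mulVec,
        Matrix.mulVec_mulVec]
      congr 2
      rw [hsp]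
      calc Oᵀ * (O * Λ * Oᵀ * O) = (Oᵀ * O) * Λ * (Oᵀ * O) := by simp only [Matrix.mul_assoc]
        _ = Λ := by rw [hO1]; simp
    rw [h1]
    have h2 : S.trace = Λ.trace := by rw [hsp, htr]
    rw [h2, hΛ, Matrix.trace_diagonal, dotProduct, ← Finset.sum_sub_distrib]
    refine Finset.sum_congr rfl fun i _ => ?_
    rw [Matrix.mulVec_diagonal]; ring
  · rw [hSS, htr, hΛ, Matrix.diagonal_mul_diagonal, Matrix.trace_diagonal]
    exact Finset.sum_congr rfl fun i _ => by ring
  · rw [hSSS, htr, hΛ, Matrix.diagonal_mul_diagonal, Matrix.diagonal_mul_diagonal,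
      Matrix.trace_diagonal]
    exact Finset.sum_congr rfl fun i _ => by ring

theorem exp_diag {c : ι → ℝ} (hc : ∀ i, |c i| ≤ 1 / 8) :
    Integrable (fun w : ι → ℝ => Real.exp (∑ i, c i * (w i ^ 2 - 1))) (stdG ι) ∧
    ∫ w, Real.exp (∑ i, c i * (w i ^ 2 - 1)) ∂(stdG ι) ≤ Real.exp (2 * ∑ i, c i ^ 2) := by
  simp_rw [Real.exp_sum]
  constructor
  · exact Integrable.fintype_prod (f := fun i x => Real.exp (c i * (x ^ 2 - 1)))
      fun i => (exp_mul_sq_sub_one (hc i)).1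
  · unfold stdG
    rw [integral_fintype_prod_eq_prod (f := fun i x => Real.exp (c i * (x ^ 2 - 1))),
      Finset.mul_sum, Real.exp_sum]
    exact Finset.prod_le_prod (fun i _ => integral_nonneg fun x => (Real.exp_pos _).le)
      fun i _ => (exp_mul_sq_sub_one (hc i)).2

/-- All absolute moments of a centered quadratic form with matrix of Frobenius norm at most one
are bounded by universal constants. -/
theorem quadC_moment {S : Matrix ι ι ℝ} (hS : Sᵀ = S) (h1 : (S * S).trace ≤ 1) (m : ℕ) :
    Integrable (fun w => |quadC S w| ^ m) (stdG ι) ∧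
      ∫ w, |quadC S w| ^ m ∂(stdG ι) ≤ 8 ^ m * m.factorial * (2 * Real.exp 1) := by
  obtain ⟨c, O, hO, hq, hc2, -⟩ := exists_diagonalization hS
  have hci : ∀ i, c i ^ 2 ≤ 1 := fun i =>
    (Finset.single_le_sum (f := fun i => c i ^ 2) (fun j _ => sq_nonneg _)
      (Finset.mem_univ i)).trans (hc2 ▸ h1)
  have hci' : ∀ i, |c i| ≤ 1 := fun i => by
    rw [← sq_le_one_iff_abs_le_one]; exact hci i
  have hmp := measurePreserving_orthogonal hO
  -- Powers are dominated by exponentials. The scale `1/8` brings every coefficient, which is at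
  -- most one in absolute value, into the range of `exp_mul_sq_sub_one`.
  have hpt : ∀ w : ι → ℝ, |∑ i, c i * (w i ^ 2 - 1)| ^ m ≤ 8 ^ m * m.factorial *
      (Real.exp (∑ i, (c i / 8) * (w i ^ 2 - 1)) + Real.exp (∑ i, (-c i / 8) * (w i ^ 2 - 1))) := by
    intro w
    set X := ∑ i, c i * (w i ^ 2 - 1) with hX
    have e1 : ∑ i, (c i / 8) * (w i ^ 2 - 1) = X / 8 := by
      rw [hX, Finset.sum_div]; exact Finset.sum_congr rfl fun i _ => by ring
    have e2 : ∑ i, (-c i / 8) * (w i ^ 2 - 1) = -(X / 8) := by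
      rw [hX, Finset.sum_div, ← Finset.sum_neg_distrib]
      exact Finset.sum_congr rfl fun i _ => by ring
    rw [e1, e2]
    have h2 := Real.pow_div_factorial_le_exp (x := |X / 8|) (abs_nonneg _) m
    have h3 : Real.exp |X / 8| ≤ Real.exp (X / 8) + Real.exp (-(X / 8)) := by
      rcases abs_cases (X / 8) with ⟨h, -⟩ | ⟨h, -⟩ <;> rw [h] <;>
        linarith [Real.exp_pos (X / 8), Real.exp_pos (-(X / 8))]
    have h4 : |X| ^ m = 8 ^ m * m.factorial * (|X / 8| ^ m / m.factorial) := by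
      rw [abs_div, div_pow, abs_of_pos (by norm_num : (0 : ℝ) < 8)]
      have : (m.factorial : ℝ) ≠ 0 := by positivity
      field_simp
    rw [h4]
    gcongr
    linarith
  have b1 : ∀ i, |c i / 8| ≤ 1 / 8 := fun i => by
    rw [abs_div, abs_of_pos (by norm_num : (0 : ℝ) < 8)]; linarith [hci' i]
  have b2 : ∀ i, |-c i / 8| ≤ 1 / 8 := fun i => by
    rw [abs_div, abs_neg, abs_of_pos (by norm_num : (0 : ℝ) < 8)]; linarith [hci' i]
  obtain ⟨i1, l1⟩ := exp_diag b1
  obtain ⟨i2, l2⟩ := exp_diag b2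
  have hint : Integrable (fun w : ι → ℝ => |∑ i, c i * (w i ^ 2 - 1)| ^ m) (stdG ι) := by
    refine ((i1.add i2).const_mul (8 ^ m * m.factorial : ℝ)).mono' ?_ ?_
    · exact Continuous.aestronglyMeasurable (by fun_prop)
    · refine ae_of_all _ fun w => ?_
      rw [Real.norm_of_nonneg (by positivity)]
      exact hpt w
  have hcont : AEStronglyMeasurable (fun w => |quadC S w| ^ m) (stdG ι) :=
    ((continuous_quadC S).abs.pow m).aestronglyMeasurable
  have hcomp : (fun w => |quadC S w| ^ m) ∘ (fun w => O *ᵥ w)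
      = fun w : ι → ℝ => |∑ i, c i * (w i ^ 2 - 1)| ^ m := by
    ext w; simp [hq w]
  constructor
  · rw [← hmp.integrable_comp hcont, hcomp]; exact hint
  · have hE : ∫ w, |quadC S w| ^ m ∂(stdG ι)
        = ∫ w, |∑ i, c i * (w i ^ 2 - 1)| ^ m ∂(stdG ι) := by
      have h := integral_map (μ := stdG ι) hmp.measurable.aemeasurable
        (f := fun w => |quadC S w| ^ m) (by rw [hmp.map_eq]; exact hcont)
      rw [hmp.map_eq] at h
      rw [h]
      exact integral_congr_ae (ae_of_all _ fun w => congrFun hcomp w)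
    rw [hE]
    refine (integral_mono hint ((i1.add i2).const_mul (8 ^ m * m.factorial : ℝ)) hpt).trans ?_
    rw [integral_const_mul]
    gcongr
    rw [integral_add' i1 i2]
    have hs : ∑ i, (c i / 8) ^ 2 ≤ 1 / 64 := by
      have : ∑ i, (c i / 8) ^ 2 = (∑ i, c i ^ 2) / 64 := by
        rw [Finset.sum_div]; exact Finset.sum_congr rfl fun i _ => by ring
      rw [this]; linarith [hc2 ▸ h1]
    have hs' : ∑ i, (-c i / 8) ^ 2 ≤ 1 / 64 := by
      refine le_trans (le_of_eq ?_) hs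
      exact Finset.sum_congr rfl fun i _ => by ring
    have e1 : Real.exp (2 * ∑ i, (c i / 8) ^ 2) ≤ Real.exp 1 := Real.exp_le_exp.2 (by linarith)
    have e2 : Real.exp (2 * ∑ i, (-c i / 8) ^ 2) ≤ Real.exp 1 := Real.exp_le_exp.2 (by linarith)
    linarith

theorem prod_coord_moment (c : ι → ℕ) (hc : ∀ i, c i = 0 ∨ c i = 1 ∨ c i = 2 ∨ c i = 3) :
    Integrable (fun w : ι → ℝ => ∏ l, (w l ^ 2 - 1) ^ c l) (stdG ι) ∧
    ∫ w, ∏ l, (w l ^ 2 - 1) ^ c l ∂(stdG ι) =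
      ∏ l, (if c l = 0 then 1 else if c l = 1 then 0 else if c l = 2 then 2 else 8 : ℝ) := by
  constructor
  · exact Integrable.fintype_prod (f := fun i x => (x ^ 2 - 1) ^ c i)
      fun i => integrable_sq_sub_one_pow (c i)
  · unfold stdG
    rw [integral_fintype_prod_eq_prod (f := fun i x => (x ^ 2 - 1) ^ c i)]
    exact Finset.prod_congr rfl fun i _ => integral_sq_sub_one_pow (c i) (hc i)

theorem prod_pow_single (i : ι) (f : ι → ℝ) : ∏ l, f l ^ (Pi.single i 1 : ι → ℕ) l = f i := by
  rw [Finset.prod_eq_single i]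
  · simp
  · intro b _ hb; simp [Pi.single_eq_of_ne hb]
  · simp

theorem coord_moment_two (i j : ι) :
    Integrable (fun w : ι → ℝ => (w i ^ 2 - 1) * (w j ^ 2 - 1)) (stdG ι) ∧
    ∫ w, (w i ^ 2 - 1) * (w j ^ 2 - 1) ∂(stdG ι) = if i = j then 2 else 0 := by
  have hf : (fun w : ι → ℝ => (w i ^ 2 - 1) * (w j ^ 2 - 1)) = fun w =>
      ∏ l, (w l ^ 2 - 1) ^ ((Pi.single i 1 : ι → ℕ) l + (Pi.single j 1 : ι → ℕ) l) := by
    ext w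
    simp_rw [pow_add, Finset.prod_mul_distrib]
    rw [prod_pow_single i fun l => w l ^ 2 - 1, prod_pow_single j fun l => w l ^ 2 - 1]
  have hm := prod_coord_moment
    (fun l : ι => (Pi.single i 1 : ι → ℕ) l + (Pi.single j 1 : ι → ℕ) l) (fun l => by
      simp only [Pi.single_apply]; split_ifs <;> simp)
  rw [hf]
  refine ⟨hm.1, hm.2.trans ?_⟩
  split_ifs with h
  · subst h
    rw [Finset.prod_eq_single i]
    · simp
    · intro b _ hb; simp [Pi.single_eq_of_ne hb]
    · simp
  · refine Finset.prod_eq_zero (Finset.mem_univ i) ?_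
    simp [Pi.single_eq_of_ne h]

/-- By independence an index that occurs exactly once contributes the factor zero, and among three
indices that fails only if all coincide. -/
theorem coord_moment_three (i j k : ι) :
    Integrable (fun w : ι → ℝ => (w i ^ 2 - 1) * (w j ^ 2 - 1) * (w k ^ 2 - 1)) (stdG ι) ∧
    ∫ w, (w i ^ 2 - 1) * (w j ^ 2 - 1) * (w k ^ 2 - 1) ∂(stdG ι)
      = if i = j ∧ j = k then 8 else 0 := by
  have hf : (fun w : ι → ℝ => (w i ^ 2 - 1) * (w j ^ 2 - 1) * (w k ^ 2 - 1)) = fun w =>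
      ∏ l, (w l ^ 2 - 1) ^ ((Pi.single i 1 : ι → ℕ) l + (Pi.single j 1 : ι → ℕ) l
        + (Pi.single k 1 : ι → ℕ) l) := by
    ext w
    simp_rw [pow_add, Finset.prod_mul_distrib]
    rw [prod_pow_single i fun l => w l ^ 2 - 1, prod_pow_single j fun l => w l ^ 2 - 1,
      prod_pow_single k fun l => w l ^ 2 - 1]
  have hm := prod_coord_moment
    (fun l : ι => (Pi.single i 1 : ι → ℕ) l + (Pi.single j 1 : ι → ℕ) l
        + (Pi.single k 1 : ι → ℕ) l) (fun l => by
      simp only [Pi.single_apply]; split_ifs <;> simp)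
  rw [hf]
  refine ⟨hm.1, hm.2.trans ?_⟩
  split_ifs with h
  · obtain ⟨rfl, rfl⟩ := h
    rw [Finset.prod_eq_single i]
    · simp
    · intro b _ hb; simp [Pi.single_eq_of_ne hb]
    · simp
  · by_cases hij : i = j
    · subst hij
      have hik : i ≠ k := fun h' => h ⟨rfl, h'⟩
      refine Finset.prod_eq_zero (Finset.mem_univ k) ?_
      simp [Pi.single_eq_of_ne hik.symm]
    · by_cases hjk : j = k
      · subst hjk
        refine Finset.prod_eq_zero (Finset.mem_univ i) ?_
        simp [Pi.single_eq_of_ne hij]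
      · by_cases hik : i = k
        · subst hik
          refine Finset.prod_eq_zero (Finset.mem_univ j) ?_
          simp [Pi.single_eq_of_ne hjk]
        · refine Finset.prod_eq_zero (Finset.mem_univ i) ?_
          simp [Pi.single_eq_of_ne hij, Pi.single_eq_of_ne hik]

theorem integral_comp_orthogonal {O : Matrix ι ι ℝ} (hO : Oᵀ * O = 1) {f : (ι → ℝ) → ℝ}
    (hf : AEStronglyMeasurable f (stdG ι)) :
    ∫ w, f (O *ᵥ w) ∂(stdG ι) = ∫ w, f w ∂(stdG ι) := by
  have hmp := measurePreserving_orthogonal hO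
  have h := integral_map (μ := stdG ι) hmp.measurable.aemeasurable (f := f)
    (by rw [hmp.map_eq]; exact hf)
  rw [hmp.map_eq] at h
  exact h.symm

theorem integral_quadC_sq {S : Matrix ι ι ℝ} (hS : Sᵀ = S) :
    ∫ w, quadC S w ^ 2 ∂(stdG ι) = 2 * (S * S).trace := by
  obtain ⟨c, O, hO, hq, hc2, -⟩ := exists_diagonalization hS
  rw [← integral_comp_orthogonal hO (f := fun w => quadC S w ^ 2)
    ((continuous_quadC S).pow 2).aestronglyMeasurable]
  simp_rw [hq]
  have : ∀ w : ι → ℝ, (∑ i, c i * (w i ^ 2 - 1)) ^ 2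
      = ∑ i, ∑ j, c i * c j * ((w i ^ 2 - 1) * (w j ^ 2 - 1)) := fun w => by
    rw [sq, Finset.sum_mul_sum]
    exact Finset.sum_congr rfl fun i _ => Finset.sum_congr rfl fun j _ => by ring
  simp_rw [this]
  rw [integral_finsetSum _ fun i _ => integrable_finsetSum _ fun j _ =>
    (coord_moment_two i j).1.const_mul _, ← hc2, Finset.mul_sum]
  refine Finset.sum_congr rfl fun i _ => ?_
  rw [integral_finsetSum _ fun j _ => (coord_moment_two i j).1.const_mul _]
  simp_rw [integral_const_mul, (coord_moment_two i _).2]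
  simp; ring

theorem integral_quadC_cube {S : Matrix ι ι ℝ} (hS : Sᵀ = S) :
    ∫ w, quadC S w ^ 3 ∂(stdG ι) = 8 * (S * S * S).trace := by
  obtain ⟨c, O, hO, hq, -, hc3⟩ := exists_diagonalization hS
  rw [← integral_comp_orthogonal hO (f := fun w => quadC S w ^ 3)
    ((continuous_quadC S).pow 3).aestronglyMeasurable]
  simp_rw [hq]
  have : ∀ w : ι → ℝ, (∑ i, c i * (w i ^ 2 - 1)) ^ 3
      = ∑ i, ∑ j, ∑ k, c i * c j * c k * ((w i ^ 2 - 1) * (w j ^ 2 - 1) * (w k ^ 2 - 1)) :=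
    fun w => by
    rw [pow_succ, sq, Finset.sum_mul_sum, Finset.sum_mul]
    refine Finset.sum_congr rfl fun i _ => ?_
    rw [Finset.sum_mul]
    refine Finset.sum_congr rfl fun j _ => ?_
    rw [Finset.mul_sum]
    exact Finset.sum_congr rfl fun k _ => by ring
  simp_rw [this]
  rw [integral_finsetSum _ fun i _ => integrable_finsetSum _ fun j _ =>
    integrable_finsetSum _ fun k _ => (coord_moment_three i j k).1.const_mul _, ← hc3,
    Finset.mul_sum]
  refine Finset.sum_congr rfl fun i _ => ?_
  rw [integral_finsetSum _ fun j _ =>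
    integrable_finsetSum _ fun k _ => (coord_moment_three i j k).1.const_mul _]
  rw [Finset.sum_eq_single i]
  · rw [integral_finsetSum _ fun k _ => (coord_moment_three i i k).1.const_mul _]
    simp_rw [integral_const_mul, (coord_moment_three i i _).2]
    simp; ring
  · intro j _ hj
    rw [integral_finsetSum _ fun k _ => (coord_moment_three i j k).1.const_mul _]
    simp_rw [integral_const_mul, (coord_moment_three i j _).2]
    simp [Ne.symm hj]
  · simp

end StdGaussian
end EmpBLUP

end

noncomputable section
namespace EmpBLUP

set_option linter.unusedSectionVars false

open scoped Matrix.Norms.L2Operator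

/-! ### Euclidean, operator and Frobenius norms -/

section Norms

variable {a b c : Type} [Fintype a] [Fintype b] [Fintype c]
  [DecidableEq a] [DecidableEq b] [DecidableEq c]

/-- The Euclidean length of a vector. -/
def vn (v : a → ℝ) : ℝ := ‖WithLp.toLp 2 v‖

theorem vn_nonneg (v : a → ℝ) : 0 ≤ vn v := norm_nonneg _

theorem vn_sq (v : a → ℝ) : vn v ^ 2 = v ⬝ᵥ v := by
  rw [vn, EuclideanSpace.real_norm_sq_eq]
  simp [dotProduct, sq]

theorem vn_add_le (u v : a → ℝ) : vn (u + v) ≤ vn u + vn v := norm_add_le _ _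

theorem vn_sub_le (u v : a → ℝ) : vn (u - v) ≤ vn u + vn v := norm_sub_le _ _

theorem vn_smul (r : ℝ) (v : a → ℝ) : vn (r • v) = |r| * vn v := norm_smul r (WithLp.toLp 2 v)

theorem vn_sum_le {κ : Type} (s : Finset κ) (f : κ → a → ℝ) :
    vn (∑ i ∈ s, f i) ≤ ∑ i ∈ s, vn (f i) := by
  unfold vn
  rw [WithLp.toLp_sum]
  exact norm_sum_le _ _

theorem abs_dotProduct_le (u v : a → ℝ) : |u ⬝ᵥ v| ≤ vn u * vn v := by
  have h := abs_real_inner_le_norm (WithLp.toLp 2 v) (WithLp.toLp 2 u)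
  rw [EuclideanSpace.inner_eq_star_dotProduct] at h
  simpa [vn, mul_comm] using h

theorem vn_mulVec_le (A : Matrix a b ℝ) (v : b → ℝ) : vn (A *ᵥ v) ≤ ‖A‖ * vn v :=
  Matrix.l2_opNorm_mulVec A (WithLp.toLp 2 v)

theorem opNorm_le {A : Matrix a b ℝ} {r : ℝ} (hr : 0 ≤ r) (h : ∀ v, vn (A *ᵥ v) ≤ r * vn v) :
    ‖A‖ ≤ r := by
  rw [Matrix.l2_opNorm_def]
  exact ContinuousLinearMap.opNorm_le_bound _ hr fun x => h x.ofLp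

theorem opNorm_transpose (A : Matrix a b ℝ) : ‖Aᵀ‖ = ‖A‖ := by
  rw [← Matrix.conjTranspose_eq_transpose_of_trivial, Matrix.l2_opNorm_conjTranspose]

/-- The Frobenius norm. -/
def fro (A : Matrix a b ℝ) : ℝ := vn fun x : a × b => A x.1 x.2

theorem fro_nonneg (A : Matrix a b ℝ) : 0 ≤ fro A := vn_nonneg _

theorem fro_sq (A : Matrix a b ℝ) : fro A ^ 2 = (Aᵀ * A).trace := by
  rw [fro, vn_sq, dotProduct, Fintype.sum_prod_type, Finset.sum_comm]
  simp [Matrix.trace, Matrix.mul_apply]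

theorem fro_sq_eq_sum (A : Matrix a b ℝ) : fro A ^ 2 = ∑ j, vn (fun i => A i j) ^ 2 := by
  rw [fro, vn_sq, dotProduct, Fintype.sum_prod_type, Finset.sum_comm]
  simp [vn_sq, dotProduct]

theorem fro_transpose (A : Matrix a b ℝ) : fro Aᵀ = fro A := by
  rw [← sq_eq_sq₀ (fro_nonneg _) (fro_nonneg _), fro_sq, fro_sq, Matrix.transpose_transpose,
    Matrix.trace_mul_comm]

theorem fro_add_le (A B : Matrix a b ℝ) : fro (A + B) ≤ fro A + fro B := vn_add_le _ _

theorem fro_smul (r : ℝ) (A : Matrix a b ℝ) : fro (r • A) = |r| * fro A := vn_smul r _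

theorem abs_trace_mul_le (A : Matrix a b ℝ) (B : Matrix b a ℝ) :
    |(A * B).trace| ≤ fro A * fro B := by
  have h := abs_dotProduct_le (fun x : a × b => A x.1 x.2) (fun x : a × b => Bᵀ x.1 x.2)
  have e : (A * B).trace = (fun x : a × b => A x.1 x.2) ⬝ᵥ (fun x : a × b => Bᵀ x.1 x.2) := by
    rw [dotProduct, Fintype.sum_prod_type]
    simp [Matrix.trace, Matrix.mul_apply]
  rw [e]
  refine h.trans (le_of_eq ?_)
  rw [← fro_transpose B]; rfl

theorem fro_mul_le (A : Matrix a b ℝ) (B : Matrix b c ℝ) : fro (A * B) ≤ ‖A‖ * fro B := by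
  rw [← sq_le_sq₀ (fro_nonneg _) (mul_nonneg (norm_nonneg _) (fro_nonneg _)), mul_pow,
    fro_sq_eq_sum, fro_sq_eq_sum, Finset.mul_sum]
  refine Finset.sum_le_sum fun j _ => ?_
  rw [← mul_pow]
  exact pow_le_pow_left₀ (vn_nonneg _) (vn_mulVec_le A fun i => B i j) 2

theorem fro_mul_le' (A : Matrix a b ℝ) (B : Matrix b c ℝ) : fro (A * B) ≤ fro A * ‖B‖ := by
  rw [← fro_transpose, Matrix.transpose_mul, mul_comm, ← opNorm_transpose, ← fro_transpose A]
  exact fro_mul_le _ _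

theorem fro_vecMulVec (u : a → ℝ) (v : b → ℝ) : fro (Matrix.vecMulVec u v) = vn u * vn v := by
  rw [← sq_eq_sq₀ (fro_nonneg _) (mul_nonneg (vn_nonneg _) (vn_nonneg _)), mul_pow, fro_sq_eq_sum,
    vn_sq v, dotProduct, Finset.mul_sum]
  refine Finset.sum_congr rfl fun j _ => ?_
  have : (fun i => Matrix.vecMulVec u v i j) = v j • u := by
    ext i; simp [Matrix.vecMulVec_apply, mul_comm]
  rw [this, vn_smul, mul_pow, sq_abs]; ring

end Norms

/-! ### Families of random variables with uniformly bounded moments -/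

section UnifMom

variable {K : Type} {Ω : K → Type} [∀ k, MeasurableSpace (Ω k)] {μ : ∀ k, Measure (Ω k)}

/-- A family of random variables all of whose absolute moments are bounded. -/
def UnifMom (μ : ∀ k, Measure (Ω k)) (Y : ∀ k, Ω k → ℝ) : Prop :=
  (∀ k, AEStronglyMeasurable (Y k) (μ k)) ∧ ∀ m : ℕ, ∃ C : ℝ, ∀ k,
    Integrable (fun ω => |Y k ω| ^ m) (μ k) ∧ ∫ ω, |Y k ω| ^ m ∂(μ k) ≤ C

variable {Y Z : ∀ k, Ω k → ℝ}

theorem UnifMom.mono (hY : UnifMom μ Y) (hZ : ∀ k, AEStronglyMeasurable (Z k) (μ k))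
    (h : ∀ k ω, |Z k ω| ≤ |Y k ω|) : UnifMom μ Z := by
  refine ⟨hZ, fun m => ?_⟩
  obtain ⟨C, hC⟩ := hY.2 m
  have hle : ∀ k ω, |Z k ω| ^ m ≤ |Y k ω| ^ m := fun k ω =>
    pow_le_pow_left₀ (abs_nonneg _) (h k ω) m
  have hi : ∀ k, Integrable (fun ω => |Z k ω| ^ m) (μ k) := fun k => by
    refine (hC k).1.mono' ((hZ k).norm.pow m) (ae_of_all _ fun ω => ?_)
    rw [Real.norm_of_nonneg (by positivity)]
    exact hle k ω
  exact ⟨C, fun k => ⟨hi k, (integral_mono (hi k) (hC k).1 (hle k)).trans (hC k).2⟩⟩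

theorem unifMom_const [∀ k, IsProbabilityMeasure (μ k)] {c : K → ℝ} {C : ℝ}
    (hc : ∀ k, |c k| ≤ C) : UnifMom μ fun k _ => c k := by
  refine ⟨fun k => aestronglyMeasurable_const, fun m => ⟨C ^ m, fun k => ?_⟩⟩
  refine ⟨integrable_const _, ?_⟩
  simp only [integral_const, probReal_univ, smul_eq_mul, one_mul]
  exact pow_le_pow_left₀ (abs_nonneg _) (hc k) m

theorem UnifMom.mul (hY : UnifMom μ Y) (hZ : UnifMom μ Z) :
    UnifMom μ fun k ω => Y k ω * Z k ω := by
  refine ⟨fun k => (hY.1 k).mul (hZ.1 k), fun m => ?_⟩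
  obtain ⟨C, hC⟩ := hY.2 (2 * m)
  obtain ⟨C', hC'⟩ := hZ.2 (2 * m)
  have hle : ∀ k ω, |Y k ω * Z k ω| ^ m ≤ |Y k ω| ^ (2 * m) + |Z k ω| ^ (2 * m) := fun k ω => by
    rw [abs_mul, mul_pow, mul_comm 2 m, pow_mul, pow_mul]
    nlinarith [sq_nonneg (|Y k ω| ^ m - |Z k ω| ^ m), sq_nonneg (|Y k ω| ^ m),
      sq_nonneg (|Z k ω| ^ m)]
  have hi : ∀ k, Integrable (fun ω => |Y k ω * Z k ω| ^ m) (μ k) := fun k => by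
    refine ((hC k).1.add (hC' k).1).mono' (((hY.1 k).mul (hZ.1 k)).norm.pow m)
      (ae_of_all _ fun ω => ?_)
    rw [Real.norm_of_nonneg (by positivity)]
    exact hle k ω
  refine ⟨C + C', fun k => ⟨hi k, ?_⟩⟩
  refine (integral_mono (hi k) ((hC k).1.add (hC' k).1) (hle k)).trans ?_
  rw [integral_add' (hC k).1 (hC' k).1]
  exact add_le_add (hC k).2 (hC' k).2

theorem UnifMom.add (hY : UnifMom μ Y) (hZ : UnifMom μ Z) :
    UnifMom μ fun k ω => Y k ω + Z k ω := by
  refine ⟨fun k => (hY.1 k).add (hZ.1 k), fun m => ?_⟩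
  obtain ⟨C, hC⟩ := hY.2 m
  obtain ⟨C', hC'⟩ := hZ.2 m
  have hle : ∀ k ω, |Y k ω + Z k ω| ^ m ≤ 2 ^ m * (|Y k ω| ^ m + |Z k ω| ^ m) := fun k ω => by
    have h1 : |Y k ω + Z k ω| ≤ 2 * max |Y k ω| |Z k ω| := by
      refine (abs_add_le _ _).trans ?_
      linarith [le_max_left |Y k ω| |Z k ω|, le_max_right |Y k ω| |Z k ω|]
    refine (pow_le_pow_left₀ (abs_nonneg _) h1 m).trans ?_
    rw [mul_pow]
    gcongr
    rcases max_cases |Y k ω| |Z k ω| with ⟨h, -⟩ | ⟨h, -⟩ <;> rw [h]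
    · linarith [pow_nonneg (abs_nonneg (Z k ω)) m]
    · linarith [pow_nonneg (abs_nonneg (Y k ω)) m]
  have hi : ∀ k, Integrable (fun ω => |Y k ω + Z k ω| ^ m) (μ k) := fun k => by
    refine (((hC k).1.add (hC' k).1).const_mul (2 ^ m)).mono' (((hY.1 k).add (hZ.1 k)).norm.pow m)
      (ae_of_all _ fun ω => ?_)
    rw [Real.norm_of_nonneg (by positivity)]
    exact hle k ω
  refine ⟨2 ^ m * (C + C'), fun k => ⟨hi k, ?_⟩⟩
  refine (integral_mono (hi k) (((hC k).1.add (hC' k).1).const_mul (2 ^ m)) (hle k)).trans ?_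
  rw [integral_const_mul, integral_add' (hC k).1 (hC' k).1]
  gcongr
  · exact (hC k).2
  · exact (hC' k).2

theorem UnifMom.abs (hY : UnifMom μ Y) : UnifMom μ fun k ω => |Y k ω| :=
  hY.mono (fun k => (hY.1 k).norm) fun _ _ => (abs_abs _).le

theorem UnifMom.const_mul [∀ k, IsProbabilityMeasure (μ k)] (hY : UnifMom μ Y) (c : ℝ) :
    UnifMom μ fun k ω => c * Y k ω :=
  (unifMom_const (c := fun _ => c) fun _ => le_rfl).mul hY

theorem unifMom_sum [∀ k, IsProbabilityMeasure (μ k)] {J : Type} (s : Finset J)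
    {F : J → ∀ k, Ω k → ℝ} (h : ∀ j ∈ s, UnifMom μ (F j)) :
    UnifMom μ fun k ω => ∑ j ∈ s, F j k ω := by
  classical
  induction s using Finset.induction_on with
  | empty => simpa using unifMom_const (μ := μ) (c := fun _ => 0) (C := 0) (by simp)
  | insert j s hj ih =>
    have := (h j (Finset.mem_insert_self j s)).add
      (ih fun i hi => h i (Finset.mem_insert_of_mem hi))
    simpa [Finset.sum_insert hj] using this

theorem UnifMom.integral_bdd (hY : UnifMom μ Y) :
    ∃ C : ℝ, ∀ k, Integrable (Y k) (μ k) ∧ ∫ ω, |Y k ω| ∂(μ k) ≤ C := by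
  obtain ⟨C, hC⟩ := hY.2 1
  refine ⟨C, fun k => ?_⟩
  have := hC k
  simp only [pow_one] at this
  exact ⟨(integrable_norm_iff (hY.1 k)).1 this.1, this.2⟩

theorem UnifMom.integrable (hY : UnifMom μ Y) (k : K) : Integrable (Y k) (μ k) := by
  obtain ⟨C, hC⟩ := hY.integral_bdd
  exact (hC k).1

theorem UnifMom.pow [∀ k, IsProbabilityMeasure (μ k)] (hY : UnifMom μ Y) (m : ℕ) :
    UnifMom μ fun k ω => Y k ω ^ m := by
  induction m with
  | zero => simpa using unifMom_const (μ := μ) (c := fun _ => 1) (C := 1) (by simp)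
  | succ m ih => simpa [pow_succ] using ih.mul hY

/-- Markov's inequality of all orders. -/
theorem UnifMom.tail [∀ k, IsProbabilityMeasure (μ k)] (hY : UnifMom μ Y) (m : ℕ) :
    ∃ C : ℝ, 0 ≤ C ∧ ∀ k (r : ℝ), 0 < r → (μ k).real {ω | r ≤ |Y k ω|} ≤ C / r ^ m := by
  obtain ⟨C, hC⟩ := hY.2 m
  refine ⟨|C|, abs_nonneg _, fun k r hr => ?_⟩
  rw [le_div_iff₀ (by positivity), mul_comm]
  have h := mul_meas_ge_le_integral_of_nonneg (μ := μ k) (f := fun ω => |Y k ω| ^ m)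
    (ae_of_all _ fun ω => by positivity) (hC k).1 (r ^ m)
  have hsub : {ω | r ≤ |Y k ω|} ⊆ {ω | r ^ m ≤ |Y k ω| ^ m} := fun ω hω =>
    pow_le_pow_left₀ hr.le hω m
  calc r ^ m * (μ k).real {ω | r ≤ |Y k ω|}
      ≤ r ^ m * (μ k).real {ω | r ^ m ≤ |Y k ω| ^ m} := by
        gcongr
        exact measure_ne_top _ _
    _ ≤ ∫ ω, |Y k ω| ^ m ∂(μ k) := h
    _ ≤ C := (hC k).2
    _ ≤ |C| := le_abs_self C

end UnifMom

/-! ### Linear and quadratic Gaussian forms in growing dimension -/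

section GaussianForms

/-- Only the symmetric part of `S` matters, and rescaling makes its Frobenius norm at most one,
where `quadC_moment` is free of the dimension. -/
theorem unifMom_quadC {K : Type} {ι : K → Type} [∀ k, Fintype (ι k)] [∀ k, DecidableEq (ι k)]
    {S : ∀ k, Matrix (ι k) (ι k) ℝ} {r : ℝ} (hr : ∀ k, fro (S k) ≤ r) :
    UnifMom (fun k => stdG (ι k)) fun k w => quadC (S k) w := by
  -- The added one keeps the scale positive even for `r = 0`.
  set ρ : ℝ := |r| + 1
  have hρ : 0 < ρ := by positivity
  set R : ∀ k, Matrix (ι k) (ι k) ℝ := fun k => (1 / (2 * ρ)) • (S k + (S k)ᵀ) with hR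
  have hRs : ∀ k, (R k)ᵀ = R k := fun k => by
    simp [hR, Matrix.transpose_add, add_comm]
  have hRf : ∀ k, fro (R k) ≤ 1 := fun k => by
    rw [hR, fro_smul, abs_of_pos (by positivity), div_mul_eq_mul_div, one_mul,
      div_le_one (by positivity)]
    refine (fro_add_le _ _).trans ?_
    rw [fro_transpose]
    have := (hr k).trans (le_abs_self r)
    simp only [ρ]; linarith
  have hRt : ∀ k, (R k * R k).trace ≤ 1 := fun k => by
    have := fro_sq (R k)
    rw [hRs] at this
    rw [← this]
    exact pow_le_one₀ (fro_nonneg _) (hRf k)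
  have hRq : ∀ k w, quadC (S k) w = ρ * quadC (R k) w := fun k w => by
    rw [hR, quadC_smul, quadC_add, quadC_transpose]
    field_simp; ring
  have hU : UnifMom (fun k => stdG (ι k)) fun k w => quadC (R k) w :=
    ⟨fun k => (continuous_quadC _).aestronglyMeasurable,
      fun m => ⟨_, fun k => quadC_moment (hRs k) (hRt k) m⟩⟩
  have := hU.const_mul ρ
  simp_rw [hRq]
  exact this

theorem dotProduct_sq_eq_quadC {ι : Type} [Fintype ι] [DecidableEq ι] (g h w : ι → ℝ) :
    (g ⬝ᵥ w) * (h ⬝ᵥ w) = quadC (Matrix.vecMulVec g h) w + g ⬝ᵥ h := by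
  rw [quadC, Matrix.trace_vecMulVec, Matrix.vecMulVec_mulVec]
  simp only [op_smul_eq_smul, dotProduct_smul, smul_eq_mul]
  rw [dotProduct_comm w g]; ring

/-- Reduction to a quadratic form of rank one through `|x| ≤ x ^ 2 + 1`. -/
theorem unifMom_dotProduct {K : Type} {ι : K → Type} [∀ k, Fintype (ι k)]
    [∀ k, DecidableEq (ι k)] {h : ∀ k, ι k → ℝ} {r : ℝ} (hr : ∀ k, vn (h k) ≤ r) :
    UnifMom (fun k => stdG (ι k)) fun k w => h k ⬝ᵥ w := by
  have hq : UnifMom (fun k => stdG (ι k)) fun k w =>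
      quadC (Matrix.vecMulVec (h k) (h k)) w + (h k ⬝ᵥ h k + 1) := by
    refine (unifMom_quadC (r := r * r) fun k => ?_).add (unifMom_const (C := r * r + 1) fun k => ?_)
    · rw [fro_vecMulVec]
      exact mul_self_le_mul_self (vn_nonneg _) (hr k)
    · rw [← vn_sq, abs_of_nonneg (by positivity), sq]
      gcongr
      · exact vn_nonneg _
      · exact (vn_nonneg _).trans (hr k)
      · exact hr k
      · exact hr k
  refine hq.mono (fun k => Continuous.aestronglyMeasurable
    (continuous_const.dotProduct continuous_id)) fun k w => ?_
  have e : quadC (Matrix.vecMulVec (h k) (h k)) w + (h k ⬝ᵥ h k + 1) = (h k ⬝ᵥ w) ^ 2 + 1 := by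
    rw [sq, dotProduct_sq_eq_quadC]; ring
  rw [e, abs_of_nonneg (by positivity : 0 ≤ (h k ⬝ᵥ w) ^ 2 + 1)]
  nlinarith [abs_nonneg (h k ⬝ᵥ w), sq_abs (h k ⬝ᵥ w), sq_nonneg (|h k ⬝ᵥ w| - 1)]

variable {ι : Type} [Fintype ι] [DecidableEq ι]

/-- Families with one member; they serve to read off integrability of products of forms. -/
theorem single_unifMom_quadC (S : Matrix ι ι ℝ) :
    UnifMom (fun _ : Unit => stdG ι) fun _ w => quadC S w :=
  unifMom_quadC (ι := fun _ : Unit => ι) (S := fun _ => S) fun _ => le_rfl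

theorem single_unifMom_dotProduct (h : ι → ℝ) :
    UnifMom (fun _ : Unit => stdG ι) fun _ w => h ⬝ᵥ w :=
  unifMom_dotProduct (ι := fun _ : Unit => ι) (h := fun _ => h) fun _ => le_rfl

theorem integrable_quadC (S : Matrix ι ι ℝ) : Integrable (fun w => quadC S w) (stdG ι) :=
  (single_unifMom_quadC S).integrable ()

theorem integrable_quadC_mul (S R : Matrix ι ι ℝ) :
    Integrable (fun w => quadC S w * quadC R w) (stdG ι) :=
  ((single_unifMom_quadC S).mul (single_unifMom_quadC R)).integrable ()

theorem integrable_quadC_mul_mul (S R A : Matrix ι ι ℝ) :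
    Integrable (fun w => quadC S w * quadC R w * quadC A w) (stdG ι) :=
  (((single_unifMom_quadC S).mul (single_unifMom_quadC R)).mul
    (single_unifMom_quadC A)).integrable ()

theorem integral_eval_mul_self (i j : ι) :
    ∫ w, w i * w j ∂(stdG ι) = if i = j then 1 else 0 := by
  unfold stdG
  have h : ∀ w : ι → ℝ, w i * w j = ∏ l, (w l) ^ ((Pi.single i 1 : ι → ℕ) l
      + (Pi.single j 1 : ι → ℕ) l) := fun w => by
    simp_rw [pow_add, Finset.prod_mul_distrib]
    rw [prod_pow_single i w, prod_pow_single j w]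
  simp_rw [h]
  rw [integral_fintype_prod_eq_prod (f := fun l x => x ^ ((Pi.single i 1 : ι → ℕ) l
      + (Pi.single j 1 : ι → ℕ) l))]
  split_ifs with hij
  · subst hij
    rw [Finset.prod_eq_single i]
    · simp [integral_sq_gaussianReal]
    · intro b _ hb; simp [Pi.single_eq_of_ne hb]
    · simp
  · refine Finset.prod_eq_zero (Finset.mem_univ i) ?_
    simp [Pi.single_eq_of_ne hij, integral_id_gaussianReal]

theorem integral_quadC (S : Matrix ι ι ℝ) : ∫ w, quadC S w ∂(stdG ι) = 0 := by
  have hi : ∀ i j : ι, Integrable (fun w : ι → ℝ => w i * w j) (stdG ι) := fun i j => by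
    have := ((single_unifMom_dotProduct (Pi.single i 1 : ι → ℝ)).mul
      (single_unifMom_dotProduct (Pi.single j 1 : ι → ℝ))).integrable ()
    simpa using this
  have e : ∀ w : ι → ℝ, w ⬝ᵥ (S *ᵥ w) = ∑ i, ∑ j, S i j * (w i * w j) := fun w => by
    simp only [dotProduct, Matrix.mulVec, Finset.mul_sum]
    exact Finset.sum_congr rfl fun i _ => Finset.sum_congr rfl fun j _ => by ring
  unfold quadC
  rw [integral_sub _ (integrable_const _)]
  · simp_rw [e]
    rw [integral_finsetSum _ fun i _ => integrable_finsetSum _ fun j _ =>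
      (hi i j).const_mul (S i j)]
    have h2 : ∀ i : ι, ∫ w, ∑ j, S i j * (w i * w j) ∂(stdG ι) = S i i := fun i => by
      rw [integral_finsetSum _ fun j _ => (hi i j).const_mul (S i j)]
      simp_rw [integral_const_mul, integral_eval_mul_self]
      simp
    simp_rw [h2]
    simp [Matrix.trace]
  · simp_rw [e]
    exact integrable_finsetSum _ fun i _ => integrable_finsetSum _ fun j _ =>
      (hi i j).const_mul (S i j)

theorem integral_dotProduct_mul (g h : ι → ℝ) :
    ∫ w, (g ⬝ᵥ w) * (h ⬝ᵥ w) ∂(stdG ι) = g ⬝ᵥ h := by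
  simp_rw [dotProduct_sq_eq_quadC]
  rw [integral_add (integrable_quadC _) (integrable_const _), integral_quadC]
  simp

theorem integral_quadC_mul {S R : Matrix ι ι ℝ} (hS : Sᵀ = S) (hR : Rᵀ = R) :
    ∫ w, quadC S w * quadC R w ∂(stdG ι) = 2 * (S * R).trace := by
  have e : ∀ w, quadC S w * quadC R w
      = (1 / 4) * (quadC (S + R) w ^ 2 - quadC (S - R) w ^ 2) := fun w => by
    rw [quadC_add, quadC_sub]; ring
  have hi : ∀ A : Matrix ι ι ℝ, Integrable (fun w => quadC A w ^ 2) (stdG ι) := fun A => by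
    simpa [sq] using integrable_quadC_mul A A
  simp_rw [e]
  rw [integral_const_mul, integral_sub (hi _) (hi _),
    integral_quadC_sq (by rw [Matrix.transpose_add, hS, hR]),
    integral_quadC_sq (by rw [Matrix.transpose_sub, hS, hR])]
  simp only [Matrix.add_mul, Matrix.sub_mul, Matrix.mul_add, Matrix.mul_sub, Matrix.trace_add,
    Matrix.trace_sub]
  rw [Matrix.trace_mul_comm R S]; ring

/-- Polarization: the alternating sum of the cubes of `S ± R ± A` is 24 times the product. The
traces of all orderings of the three matrices agree, by cyclicity together with transposition of
symmetric factors. -/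
theorem integral_quadC_mul_mul {S R A : Matrix ι ι ℝ} (hS : Sᵀ = S) (hR : Rᵀ = R) (hA : Aᵀ = A) :
    ∫ w, quadC S w * quadC R w * quadC A w ∂(stdG ι) = 8 * (S * R * A).trace := by
  have e : ∀ w, quadC S w * quadC R w * quadC A w
      = (1 / 24) * ((quadC (S + R + A) w ^ 3 - quadC (S + R - A) w ^ 3)
        - (quadC (S - R + A) w ^ 3 - quadC (S - R - A) w ^ 3)) := fun w => by
    simp only [quadC_add, quadC_sub]; ring
  have hi : ∀ A : Matrix ι ι ℝ, Integrable (fun w => quadC A w ^ 3) (stdG ι) := fun A => by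
    simpa [pow_succ] using integrable_quadC_mul_mul A A A
  have hi2 : ∀ A B : Matrix ι ι ℝ, Integrable (fun w => quadC A w ^ 3 - quadC B w ^ 3) (stdG ι) :=
    fun A B => (hi A).sub (hi B)
  simp_rw [e]
  rw [integral_const_mul, integral_sub (hi2 _ _) (hi2 _ _),
    integral_sub (hi _) (hi _), integral_sub (hi _) (hi _),
    integral_quadC_cube (by simp [Matrix.transpose_add, hS, hR, hA]),
    integral_quadC_cube (by simp [Matrix.transpose_add, Matrix.transpose_sub, hS, hR, hA]),
    integral_quadC_cube (by simp [Matrix.transpose_add, Matrix.transpose_sub, hS, hR, hA]),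
    integral_quadC_cube (by simp [Matrix.transpose_sub, hS, hR, hA])]
  have t1 : (S * A * R).trace = (S * R * A).trace := by
    rw [← Matrix.trace_transpose, Matrix.transpose_mul, Matrix.transpose_mul, hS, hR, hA,
      ← Matrix.mul_assoc, Matrix.trace_mul_comm, ← Matrix.mul_assoc]
  have c1 := Matrix.trace_mul_cycle S R A
  have c2 := Matrix.trace_mul_cycle A S R
  have c3 := Matrix.trace_mul_cycle S A R
  have c4 := Matrix.trace_mul_cycle R S A
  simp only [Matrix.add_mul, Matrix.sub_mul, Matrix.mul_add, Matrix.mul_sub, Matrix.trace_add,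
    Matrix.trace_sub]
  linarith

/-- If `F` is invariant under the reflection `w ↦ (2Q - 1) w` in the range of a symmetric
projection `Q` and `Q c = 0`, then `c'w` and `F w` are uncorrelated. -/
theorem integral_dotProduct_mul_eq_zero {Q : Matrix ι ι ℝ} (hQ : Qᵀ = Q) (hQQ : Q * Q = Q)
    {c : ι → ℝ} (hc : Q *ᵥ c = 0) {F : (ι → ℝ) → ℝ} (hF : Measurable F)
    (hinv : ∀ w, F ((2 • Q - 1) *ᵥ w) = F w) : ∫ w, (c ⬝ᵥ w) * F w ∂(stdG ι) = 0 := by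
  have hO : (2 • Q - 1)ᵀ * (2 • Q - 1) = 1 := by
    rw [Matrix.transpose_sub, Matrix.transpose_smul, hQ, Matrix.transpose_one]
    simp only [Matrix.sub_mul, Matrix.mul_sub, Matrix.smul_mul, Matrix.mul_smul, hQQ,
      Matrix.mul_one, Matrix.one_mul]
    module
  have hm : Measurable fun w => (c ⬝ᵥ w) * F w :=
    (Continuous.measurable (continuous_const.dotProduct continuous_id)).mul hF
  have h := integral_comp_orthogonal hO (f := fun w => (c ⬝ᵥ w) * F w) hm.aestronglyMeasurable
  -- Because `Q c = 0`, the reflection sends `c` to `-c`. It preserves the measure and `F`, so the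
  -- integral equals its own negative.
  have e : ∀ w, (c ⬝ᵥ ((2 • Q - 1) *ᵥ w)) * F ((2 • Q - 1) *ᵥ w) = -((c ⬝ᵥ w) * F w) := fun w => by
    rw [hinv, Matrix.dotProduct_mulVec, ← Matrix.mulVec_transpose, Matrix.transpose_sub,
      Matrix.transpose_smul, hQ, Matrix.transpose_one, Matrix.sub_mulVec, Matrix.smul_mulVec, hc]
    simp
  simp_rw [e] at h
  rw [integral_neg] at h
  linarith

end GaussianForms
end EmpBLUP

end

/-! ### Resolvents of the covariance matrix and their whitened form -/

noncomputable section
namespace EmpBLUP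

set_option linter.unusedSectionVars false

open scoped Matrix.Norms.L2Operator

theorem pos_of_mem_interior {q : ℕ} {σ : Param q} (hσ : σ ∈ interior (paramSpace q)) (i : Fin (q + 1)) :
    0 < σ i := by
  obtain ⟨ε, hε, hb⟩ := Metric.isOpen_iff.1 isOpen_interior σ hσ
  have hmem : σ - EuclideanSpace.single i (ε / 2) ∈ Metric.ball σ ε := by
    rw [mem_ball_iff_norm]
    have : σ - EuclideanSpace.single i (ε / 2) - σ = -EuclideanSpace.single i (ε / 2) := by abel
    rw [this, norm_neg, PiLp.norm_single, Real.norm_of_nonneg (by positivity)]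
    linarith
  have := interior_subset (hb hmem) i
  simp only [PiLp.sub_apply, PiLp.single_apply, if_true] at this
  linarith

theorem quad_nonneg_of_posSemidef {a : Type} [Fintype a] {S : Matrix a a ℝ} (h : S.PosSemidef)
    (v : a → ℝ) : 0 ≤ v ⬝ᵥ (S *ᵥ v) := by
  simpa using h.dotProduct_mulVec_nonneg v

theorem transpose_eq_of_posDef {a : Type} [Fintype a] {S : Matrix a a ℝ} (h : S.PosDef) : Sᵀ = S := by
  have := h.isHermitian
  rwa [Matrix.IsHermitian, Matrix.conjTranspose_eq_transpose_of_trivial] at this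

/-- The Cauchy–Schwarz inequality of a positive semidefinite form. -/
theorem sq_dotProduct_mulVec_le {a : Type} [Fintype a] {S : Matrix a a ℝ} (h : S.PosSemidef)
    (u v : a → ℝ) : (u ⬝ᵥ (S *ᵥ v)) ^ 2 ≤ (u ⬝ᵥ (S *ᵥ u)) * (v ⬝ᵥ (S *ᵥ v)) := by
  have hS : Sᵀ = S := by
    have := h.isHermitian
    rwa [Matrix.IsHermitian, Matrix.conjTranspose_eq_transpose_of_trivial] at this
  have hsym : v ⬝ᵥ (S *ᵥ u) = u ⬝ᵥ (S *ᵥ v) := by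
    rw [Matrix.dotProduct_mulVec, ← Matrix.mulVec_transpose, hS, dotProduct_comm]
  have hd := discrim_le_zero (a := v ⬝ᵥ (S *ᵥ v)) (b := 2 * (u ⬝ᵥ (S *ᵥ v)))
    (c := u ⬝ᵥ (S *ᵥ u)) fun x => by
      have := quad_nonneg_of_posSemidef h (u + x • v)
      simp only [Matrix.mulVec_add, Matrix.mulVec_smul, add_dotProduct, dotProduct_add,
        smul_dotProduct, dotProduct_smul, smul_eq_mul, hsym] at this
      linarith
  rw [discrim] at hd
  linarith

namespace Design

variable {p q : ℕ} (D : Design p q)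

theorem V_zero : D.V 0 = 1 := rfl

theorem V_succ (j : Fin q) : D.V j.succ = D.Z j * (D.Z j)ᵀ := rfl

theorem V_posSemidef (i : Fin (q + 1)) : (D.V i).PosSemidef := by
  refine Fin.cases ?_ (fun j => ?_) i
  · rw [V_zero]; exact Matrix.PosSemidef.one
  · rw [V_succ, ← Matrix.conjTranspose_eq_transpose_of_trivial]
    exact Matrix.posSemidef_self_mul_conjTranspose _

theorem V_transpose (i : Fin (q + 1)) : (D.V i)ᵀ = D.V i := by
  have := (D.V_posSemidef i).isHermitian
  rwa [Matrix.IsHermitian, Matrix.conjTranspose_eq_transpose_of_trivial] at this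

theorem cov_sub (τ τ' : Param q) : D.cov τ' - D.cov τ = ∑ i, (τ' i - τ i) • D.V i := by
  simp only [cov, sub_smul, Finset.sum_sub_distrib]

theorem cov_posDef {τ : Param q} (h : ∀ i, 0 ≤ τ i) (h0 : 0 < τ 0) : (D.cov τ).PosDef := by
  rw [cov, Fin.sum_univ_succ]
  refine Matrix.PosDef.add_posSemidef ?_
    (Matrix.posSemidef_sum _ fun i _ => (D.V_posSemidef i.succ).smul (h i.succ))
  rw [V_zero]
  exact Matrix.PosDef.one.smul h0

theorem mem_admissible {τ : Param q} (h : ∀ i, 0 < τ i) : τ ∈ D.admissible :=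
  ⟨fun i => (h i).le, D.cov_posDef (fun i => (h i).le) (h 0)⟩

theorem X_injective : Function.Injective D.X.mulVec := by
  have h1 : Module.finrank ℝ (LinearMap.range D.X.mulVecLin) = p := D.rank_X
  have h2 := LinearMap.finrank_range_add_finrank_ker D.X.mulVecLin
  rw [h1, Module.finrank_fin_fun] at h2
  have h3 : Module.finrank ℝ (LinearMap.ker D.X.mulVecLin) = 0 := by omega
  have h4 := Submodule.finrank_eq_zero.1 h3
  exact LinearMap.ker_eq_bot.1 h4

section

variable {D} {τ τ' : Param q}

theorem cov_transpose (h : (D.cov τ).PosDef) : (D.cov τ)ᵀ = D.cov τ := transpose_eq_of_posDef h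

theorem cov_inv_transpose (h : (D.cov τ).PosDef) : ((D.cov τ)⁻¹)ᵀ = (D.cov τ)⁻¹ :=
  transpose_eq_of_posDef h.inv

theorem cov_mul_inv (h : (D.cov τ).PosDef) : D.cov τ * (D.cov τ)⁻¹ = 1 :=
  Matrix.mul_nonsing_inv _ ((Matrix.isUnit_iff_isUnit_det _).1 h.isUnit)

theorem cov_inv_mul (h : (D.cov τ).PosDef) : (D.cov τ)⁻¹ * D.cov τ = 1 :=
  Matrix.nonsing_inv_mul _ ((Matrix.isUnit_iff_isUnit_det _).1 h.isUnit)

theorem info_posDef (h : (D.cov τ).PosDef) : (D.Xᵀ * (D.cov τ)⁻¹ * D.X).PosDef := by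
  have := h.inv.conjTranspose_mul_mul_same (B := D.X) D.X_injective
  rwa [Matrix.conjTranspose_eq_transpose_of_trivial] at this

theorem M_posDef (h : (D.cov τ).PosDef) : (D.M τ).PosDef := (info_posDef h).inv

theorem M_transpose (h : (D.cov τ).PosDef) : (D.M τ)ᵀ = D.M τ := transpose_eq_of_posDef (M_posDef h)

theorem M_mul_info (h : (D.cov τ).PosDef) : D.M τ * (D.Xᵀ * (D.cov τ)⁻¹ * D.X) = 1 :=
  Matrix.nonsing_inv_mul _ ((Matrix.isUnit_iff_isUnit_det _).1 (info_posDef h).isUnit)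

theorem P_transpose (h : (D.cov τ).PosDef) : (D.P τ)ᵀ = D.P τ := by
  simp only [P, Matrix.transpose_sub, Matrix.transpose_mul, cov_inv_transpose h, M_transpose h,
    Matrix.transpose_transpose, Matrix.mul_assoc]

theorem P_mul_X (h : (D.cov τ).PosDef) : D.P τ * D.X = 0 := by
  have : (D.cov τ)⁻¹ * D.X * D.M τ * D.Xᵀ * (D.cov τ)⁻¹ * D.X
      = (D.cov τ)⁻¹ * D.X * (D.M τ * (D.Xᵀ * (D.cov τ)⁻¹ * D.X)) := by
    simp only [Matrix.mul_assoc]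
  rw [P, Matrix.sub_mul, this, M_mul_info h, Matrix.mul_one, sub_self]

theorem X_mul_P (h : (D.cov τ).PosDef) : D.Xᵀ * D.P τ = 0 := by
  have := congrArg Matrix.transpose (P_mul_X h)
  rwa [Matrix.transpose_mul, P_transpose h, Matrix.transpose_zero] at this

theorem cov_mul_P (h : (D.cov τ).PosDef) :
    D.cov τ * D.P τ = 1 - D.X * D.M τ * D.Xᵀ * (D.cov τ)⁻¹ := by
  rw [P, Matrix.mul_sub, cov_mul_inv h]
  congr 1
  calc D.cov τ * ((D.cov τ)⁻¹ * D.X * D.M τ * D.Xᵀ * (D.cov τ)⁻¹)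
      = (D.cov τ * (D.cov τ)⁻¹) * D.X * D.M τ * D.Xᵀ * (D.cov τ)⁻¹ := by
        simp only [Matrix.mul_assoc]
    _ = _ := by rw [cov_mul_inv h, Matrix.one_mul]

theorem cov_inv_sub_P : (D.cov τ)⁻¹ - D.P τ = (D.cov τ)⁻¹ * D.X * D.M τ * D.Xᵀ * (D.cov τ)⁻¹ := by
  rw [P, sub_sub_cancel]

end

/-- Matrix functions that behave like the inverse of `cov` on a fixed subspace. -/
structure IsResolvent (Λ : Param q → Matrix (Fin D.n) (Fin D.n) ℝ) : Prop where
  symm : ∀ {τ}, (D.cov τ).PosDef → (Λ τ)ᵀ = Λ τ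
  mul_cov_mul : ∀ {τ τ'}, (D.cov τ).PosDef → (D.cov τ').PosDef → Λ τ' * D.cov τ * Λ τ = Λ τ'

theorem isResolvent_inv : D.IsResolvent fun τ => (D.cov τ)⁻¹ where
  symm := cov_inv_transpose
  mul_cov_mul h _ := by rw [Matrix.mul_assoc, cov_mul_inv h, Matrix.mul_one]

/-- `cov τ * P τ` differs from the identity by a matrix with left factor `X`, and `P τ'` annihilates
`X` whatever `τ'` is. -/
theorem isResolvent_P : D.IsResolvent D.P where
  symm := P_transpose
  mul_cov_mul {τ τ'} h h' := by
    rw [Matrix.mul_assoc, cov_mul_P h, Matrix.mul_sub, Matrix.mul_one]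
    simp only [← Matrix.mul_assoc]
    rw [P_mul_X h']; simp

variable {D}

namespace IsResolvent

variable {Λ : Param q → Matrix (Fin D.n) (Fin D.n) ℝ} (hΛ : D.IsResolvent Λ) {τ τ' : Param q}
include hΛ

theorem mul_cov_mul' (h : (D.cov τ).PosDef) (h' : (D.cov τ').PosDef) :
    Λ τ * D.cov τ * Λ τ' = Λ τ' := by
  have := congrArg Matrix.transpose (hΛ.mul_cov_mul h h')
  rwa [Matrix.transpose_mul, Matrix.transpose_mul, hΛ.symm h, hΛ.symm h', cov_transpose h,
    ← Matrix.mul_assoc] at this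

/-- The resolvent identity: sandwich the difference of the covariance matrices, which is linear in
the parameter, between the two resolvents. Being exact, it yields both the derivatives and the
uniform bounds on increments. -/
theorem sub_eq (h : (D.cov τ).PosDef) (h' : (D.cov τ').PosDef) :
    Λ τ - Λ τ' = -∑ i, (τ i - τ' i) • (Λ τ * D.V i * Λ τ') := by
  have e : Λ τ * (D.cov τ - D.cov τ') * Λ τ' = Λ τ' - Λ τ := by
    rw [Matrix.mul_sub, Matrix.sub_mul, hΛ.mul_cov_mul' h h', hΛ.mul_cov_mul h' h]
  rw [cov_sub, Matrix.mul_sum, Matrix.sum_mul] at e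
  simp only [Matrix.mul_smul, Matrix.smul_mul] at e
  rw [e, neg_sub]

end IsResolvent

variable (D)

/-- Index set of the standardized noise. -/
abbrev Noise : Type := D.RE ⊕ Fin D.n

/-- The random effects are `v = J w`, where `w` is standardized noise. -/
def J (σ : Param q) : Matrix D.RE D.Noise ℝ :=
  Matrix.fromCols (Matrix.diagonal fun j : D.RE => √(σ j.1.succ)) 0

/-- The centered observations are `y - Xβ = H w`, where `w` is standardized noise. -/
def H (σ : Param q) : Matrix (Fin D.n) D.Noise ℝ :=
  Matrix.fromCols (D.Zfull * Matrix.diagonal fun j : D.RE => √(σ j.1.succ))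
    (√(σ 0) • (1 : Matrix (Fin D.n) (Fin D.n) ℝ))

theorem Zfull_mul_transpose (σ : Param q) :
    D.Zfull * D.G σ * D.Zfullᵀ = ∑ j : Fin q, σ j.succ • D.V j.succ := by
  ext a b
  rw [G, Matrix.mul_apply]
  simp_rw [Matrix.mul_diagonal]
  simp only [Matrix.mul_apply, Matrix.transpose_apply, Matrix.sum_apply, Matrix.smul_apply, V_succ, smul_eq_mul, Finset.mul_sum]
  rw [Fintype.sum_sigma]
  refine Finset.sum_congr rfl fun j _ => Finset.sum_congr rfl fun i _ => ?_
  simp only [Zfull, Matrix.of_apply]; ring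

variable {D} {σ : Param q}

theorem sqrt_diag_mul (hσ : ∀ i, 0 < σ i) :
    (Matrix.diagonal fun j : D.RE => √(σ j.1.succ)) * (Matrix.diagonal fun j : D.RE => √(σ j.1.succ))
      = D.G σ := by
  rw [Matrix.diagonal_mul_diagonal, G]
  congr 1; ext j
  exact Real.mul_self_sqrt (hσ _).le

theorem J_mul_transpose (hσ : ∀ i, 0 < σ i) : D.J σ * (D.J σ)ᵀ = D.G σ := by
  rw [J, Matrix.transpose_fromCols, Matrix.fromCols_mul_fromRows, Matrix.diagonal_transpose,
    sqrt_diag_mul hσ]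
  simp

theorem H_mul_J_transpose (hσ : ∀ i, 0 < σ i) : D.H σ * (D.J σ)ᵀ = D.Zfull * D.G σ := by
  rw [J, H, Matrix.transpose_fromCols, Matrix.fromCols_mul_fromRows, Matrix.diagonal_transpose,
    Matrix.mul_assoc, sqrt_diag_mul hσ]
  simp

theorem H_mul_transpose (hσ : ∀ i, 0 < σ i) : D.H σ * (D.H σ)ᵀ = D.cov σ := by
  rw [H, Matrix.transpose_fromCols, Matrix.fromCols_mul_fromRows, Matrix.transpose_mul,
    Matrix.diagonal_transpose, cov, Fin.sum_univ_succ, ← Zfull_mul_transpose, V_zero, add_comm]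
  congr 1
  · rw [Matrix.transpose_smul, Matrix.transpose_one, Matrix.smul_mul, Matrix.one_mul, smul_smul,
      Real.mul_self_sqrt (hσ 0).le]
  · rw [← sqrt_diag_mul hσ]; simp only [Matrix.mul_assoc]

variable (D) in
/-- The whitened resolvent. -/
def Gam (σ : Param q) (Λ : Param q → Matrix (Fin D.n) (Fin D.n) ℝ) (τ : Param q) :
    Matrix D.Noise D.Noise ℝ := (D.H σ)ᵀ * Λ τ * D.H σ

variable (D) in
/-- The whitened covariance components. -/
def Bm (σ : Param q) (Λ : Param q → Matrix (Fin D.n) (Fin D.n) ℝ) (i : Fin (q + 1)) :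
    Matrix D.Noise D.Noise ℝ := (D.H σ)ᵀ * Λ σ * D.V i * Λ σ * D.H σ

namespace IsResolvent

variable {Λ : Param q → Matrix (Fin D.n) (Fin D.n) ℝ} (hΛ : D.IsResolvent Λ) (hσ : ∀ i, 0 < σ i)
  {τ τ' : Param q}
include hΛ hσ

theorem pd : (D.cov σ).PosDef := D.cov_posDef (fun i => (hσ i).le) (hσ 0)

theorem Gam_transpose (h : (D.cov τ).PosDef) : (D.Gam σ Λ τ)ᵀ = D.Gam σ Λ τ := by
  simp only [Gam, Matrix.transpose_mul, Matrix.transpose_transpose, hΛ.symm h, Matrix.mul_assoc]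

theorem Bm_transpose (i : Fin (q + 1)) : (D.Bm σ Λ i)ᵀ = D.Bm σ Λ i := by
  simp only [Bm, Matrix.transpose_mul, Matrix.transpose_transpose, hΛ.symm (hΛ.pd hσ),
    V_transpose, Matrix.mul_assoc]

/-- The inner product `H Hᵀ = cov σ` is absorbed by the resolvent property. This cancellation is the
whole point of whitening. -/
theorem Gam_mul_Bm (h : (D.cov τ).PosDef) (i : Fin (q + 1)) :
    D.Gam σ Λ τ * D.Bm σ Λ i = (D.H σ)ᵀ * Λ τ * D.V i * Λ σ * D.H σ := by
  calc _ = (D.H σ)ᵀ * (Λ τ * (D.H σ * (D.H σ)ᵀ) * Λ σ) * D.V i * Λ σ * D.H σ := by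
        simp only [Gam, Bm, Matrix.mul_assoc]
    _ = _ := by rw [H_mul_transpose hσ, hΛ.mul_cov_mul (hΛ.pd hσ) h]

theorem Gam_mul_Bm_mul_Gam (h : (D.cov τ).PosDef) (h' : (D.cov τ').PosDef) (i : Fin (q + 1)) :
    D.Gam σ Λ τ * D.Bm σ Λ i * D.Gam σ Λ τ' = (D.H σ)ᵀ * (Λ τ * D.V i * Λ τ') * D.H σ := by
  rw [hΛ.Gam_mul_Bm hσ h]
  calc _ = (D.H σ)ᵀ * Λ τ * D.V i * (Λ σ * (D.H σ * (D.H σ)ᵀ) * Λ τ') * D.H σ := by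
        simp only [Gam, Matrix.mul_assoc]
    _ = _ := by
      rw [H_mul_transpose hσ, hΛ.mul_cov_mul' (hΛ.pd hσ) h']; simp only [Matrix.mul_assoc]

/-- At `τ = σ`, together with symmetry, this makes the whitened resolvent an orthogonal projection.
-/
theorem Gam_mul_Gam (h : (D.cov τ).PosDef) : D.Gam σ Λ τ * D.Gam σ Λ σ = D.Gam σ Λ τ := by
  calc _ = (D.H σ)ᵀ * (Λ τ * (D.H σ * (D.H σ)ᵀ) * Λ σ) * D.H σ := by
        simp only [Gam, Matrix.mul_assoc]
    _ = _ := by rw [H_mul_transpose hσ, hΛ.mul_cov_mul (hΛ.pd hσ) h]; rfl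

theorem proj_mul_Bm (i : Fin (q + 1)) : D.Gam σ Λ σ * D.Bm σ Λ i = D.Bm σ Λ i :=
  hΛ.Gam_mul_Bm hσ (hΛ.pd hσ) i

theorem Bm_mul_proj (i : Fin (q + 1)) : D.Bm σ Λ i * D.Gam σ Λ σ = D.Bm σ Λ i := by
  have := congrArg Matrix.transpose (hΛ.proj_mul_Bm hσ i)
  rwa [Matrix.transpose_mul, hΛ.Bm_transpose hσ, hΛ.Gam_transpose hσ (hΛ.pd hσ)] at this

/-- In whitened form the perturbation is a combination of the fixed matrices `Bm`; the parameters
enter only through the coefficients and the two outer factors. -/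
theorem Gam_sub (h : (D.cov τ).PosDef) (h' : (D.cov τ').PosDef) :
    D.Gam σ Λ τ - D.Gam σ Λ τ'
      = -(D.Gam σ Λ τ * (∑ i, (τ i - τ' i) • D.Bm σ Λ i) * D.Gam σ Λ τ') := by
  have e : D.Gam σ Λ τ - D.Gam σ Λ τ' = (D.H σ)ᵀ * (Λ τ - Λ τ') * D.H σ := by
    rw [Matrix.mul_sub, Matrix.sub_mul]; rfl
  rw [e, hΛ.sub_eq h h', Matrix.mul_sum, Matrix.sum_mul, Matrix.mul_neg, Matrix.neg_mul,
    Matrix.mul_sum, Matrix.sum_mul]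
  congr 1
  refine Finset.sum_congr rfl fun i _ => ?_
  simp only [Matrix.mul_smul, Matrix.smul_mul]
  rw [hΛ.Gam_mul_Bm_mul_Gam hσ h h']

/-- Traces in the score can be computed after whitening: the extra factor `Λ σ` created by `Bm` is
absorbed by `H Hᵀ = cov σ`, used cyclically. -/
theorem trace_mul_V (h : (D.cov τ).PosDef) (i : Fin (q + 1)) :
    (Λ τ * D.V i).trace = (D.Gam σ Λ τ * D.Bm σ Λ i).trace := by
  rw [hΛ.Gam_mul_Bm hσ h]
  have : (D.H σ)ᵀ * Λ τ * D.V i * Λ σ * D.H σ = (D.H σ)ᵀ * (Λ τ * D.V i * Λ σ * D.H σ) := by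
    simp only [Matrix.mul_assoc]
  rw [this, Matrix.trace_mul_comm (D.H σ)ᵀ]
  have : Λ τ * D.V i * Λ σ * D.H σ * (D.H σ)ᵀ = Λ τ * (D.V i * Λ σ * (D.H σ * (D.H σ)ᵀ)) := by
    simp only [Matrix.mul_assoc]
  rw [this, H_mul_transpose hσ, Matrix.trace_mul_comm (Λ τ) (D.V i * Λ σ * D.cov σ)]
  have : D.V i * Λ σ * D.cov σ * Λ τ = D.V i * (Λ σ * D.cov σ * Λ τ) := by
    simp only [Matrix.mul_assoc]
  rw [this, hΛ.mul_cov_mul' (hΛ.pd hσ) h, Matrix.trace_mul_comm]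

theorem trace_mul_V_mul_V (h : (D.cov τ).PosDef) (h' : (D.cov τ').PosDef) (i j : Fin (q + 1)) :
    (Λ τ * D.V j * Λ τ' * D.V i).trace
      = (D.Gam σ Λ τ * D.Bm σ Λ j * D.Gam σ Λ τ' * D.Bm σ Λ i).trace := by
  rw [hΛ.Gam_mul_Bm_mul_Gam hσ h h']
  have e1 : (D.H σ)ᵀ * (Λ τ * D.V j * Λ τ') * D.H σ * D.Bm σ Λ i
      = (D.H σ)ᵀ * (Λ τ * D.V j * (Λ τ' * (D.H σ * (D.H σ)ᵀ) * Λ σ) * D.V i * Λ σ * D.H σ) := by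
    simp only [Bm, Matrix.mul_assoc]
  rw [e1, H_mul_transpose hσ, hΛ.mul_cov_mul (hΛ.pd hσ) h', Matrix.trace_mul_comm (D.H σ)ᵀ]
  have e2 : Λ τ * D.V j * Λ τ' * D.V i * Λ σ * D.H σ * (D.H σ)ᵀ
      = Λ τ * (D.V j * Λ τ' * D.V i * Λ σ * (D.H σ * (D.H σ)ᵀ)) := by
    simp only [Matrix.mul_assoc]
  rw [e2, H_mul_transpose hσ, Matrix.trace_mul_comm (Λ τ)]
  have e3 : D.V j * Λ τ' * D.V i * Λ σ * D.cov σ * Λ τ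
      = D.V j * Λ τ' * D.V i * (Λ σ * D.cov σ * Λ τ) := by
    simp only [Matrix.mul_assoc]
  rw [e3, hΛ.mul_cov_mul' (hΛ.pd hσ) h, Matrix.trace_mul_comm _ (Λ τ)]
  simp only [Matrix.mul_assoc]

theorem trace_Bm_mul_Bm (i j : Fin (q + 1)) :
    (D.Bm σ Λ j * D.Bm σ Λ i).trace = (Λ σ * D.V j * Λ σ * D.V i).trace := by
  rw [hΛ.trace_mul_V_mul_V hσ (hΛ.pd hσ) (hΛ.pd hσ), hΛ.proj_mul_Bm hσ, hΛ.Bm_mul_proj hσ]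

theorem vn_sq_proj_le (v : D.Noise → ℝ) : vn (D.Gam σ Λ σ *ᵥ v) ^ 2 = v ⬝ᵥ (D.Gam σ Λ σ *ᵥ v) := by
  rw [vn_sq, Matrix.dotProduct_mulVec, ← Matrix.mulVec_transpose, hΛ.Gam_transpose hσ (hΛ.pd hσ),
    Matrix.mulVec_mulVec, hΛ.Gam_mul_Gam hσ (hΛ.pd hσ), dotProduct_comm]

theorem vn_proj_le (v : D.Noise → ℝ) : vn (D.Gam σ Λ σ *ᵥ v) ≤ vn v := by
  have h1 := hΛ.vn_sq_proj_le hσ v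
  have h2 := (le_abs_self _).trans (abs_dotProduct_le v (D.Gam σ Λ σ *ᵥ v))
  rw [← h1, sq] at h2
  rcases (vn_nonneg (D.Gam σ Λ σ *ᵥ v)).eq_or_lt with h | h
  · rw [← h]; exact vn_nonneg _
  · exact le_of_mul_le_mul_right h2 h

theorem opNorm_proj_le : ‖D.Gam σ Λ σ‖ ≤ 1 :=
  opNorm_le zero_le_one fun v => by rw [one_mul]; exact hΛ.vn_proj_le hσ v

/-- As quadratic forms `σ_i V_i ≤ Σ`, since all components are positive semidefinite. Whitening
turns `Σ` into a projection, which is at most the identity. -/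
theorem smul_Bm_quad_le (i : Fin (q + 1)) (v : D.Noise → ℝ) :
    σ i * (v ⬝ᵥ (D.Bm σ Λ i *ᵥ v)) ≤ vn v ^ 2 := by
  set u : Fin D.n → ℝ := (Λ σ * D.H σ) *ᵥ v with hu
  have hq : ∀ S : Matrix (Fin D.n) (Fin D.n) ℝ,
      v ⬝ᵥ (((D.H σ)ᵀ * Λ σ * S * Λ σ * D.H σ) *ᵥ v) = u ⬝ᵥ (S *ᵥ u) := fun S => by
    have : (D.H σ)ᵀ * Λ σ * S * Λ σ * D.H σ = (Λ σ * D.H σ)ᵀ * (S * (Λ σ * D.H σ)) := by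
      rw [Matrix.transpose_mul, hΛ.symm (hΛ.pd hσ)]; simp only [Matrix.mul_assoc]
    rw [this, ← Matrix.mulVec_mulVec, Matrix.dotProduct_mulVec, Matrix.vecMul_transpose,
      ← Matrix.mulVec_mulVec v S]
  have h1 : σ i * (u ⬝ᵥ (D.V i *ᵥ u)) ≤ u ⬝ᵥ (D.cov σ *ᵥ u) := by
    rw [cov, Matrix.sum_mulVec, dotProduct_sum]
    have := Finset.single_le_sum (f := fun j => u ⬝ᵥ ((σ j • D.V j) *ᵥ u))
      (fun j _ => quad_nonneg_of_posSemidef ((D.V_posSemidef j).smul (hσ j).le) u)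
      (Finset.mem_univ i)
    refine le_trans (le_of_eq ?_) this
    rw [Matrix.smul_mulVec, dotProduct_smul, smul_eq_mul]
  have h2 : u ⬝ᵥ (D.cov σ *ᵥ u) = v ⬝ᵥ (D.Gam σ Λ σ *ᵥ v) := by
    rw [← hq]
    have : (D.H σ)ᵀ * Λ σ * D.cov σ * Λ σ * D.H σ
        = (D.H σ)ᵀ * (Λ σ * D.cov σ * Λ σ) * D.H σ := by simp only [Matrix.mul_assoc]
    rw [this, hΛ.mul_cov_mul (hΛ.pd hσ) (hΛ.pd hσ)]; rfl
  rw [Bm, hq]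
  refine h1.trans ?_
  rw [h2, ← hΛ.vn_sq_proj_le hσ]
  exact pow_le_pow_left₀ (vn_nonneg _) (hΛ.vn_proj_le hσ v) 2

theorem Bm_posSemidef (i : Fin (q + 1)) : (D.Bm σ Λ i).PosSemidef := by
  have := (D.V_posSemidef i).conjTranspose_mul_mul_same (Λ σ * D.H σ)
  rw [Matrix.conjTranspose_eq_transpose_of_trivial, Matrix.transpose_mul,
    hΛ.symm (hΛ.pd hσ)] at this
  refine (Eq.subst (motive := Matrix.PosSemidef) ?_ this)
  simp only [Bm, Matrix.mul_assoc]

/-- For a positive semidefinite matrix a bound on the form bounds the norm: apply the Cauchy–Schwarz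
inequality of the form to `v` and its image `u`. -/
theorem opNorm_Bm_le (i : Fin (q + 1)) : ‖D.Bm σ Λ i‖ ≤ 1 / σ i := by
  have hi := hσ i
  refine opNorm_le (by positivity) fun v => ?_
  set u := D.Bm σ Λ i *ᵥ v with hu
  have h1 : ∀ x, x ⬝ᵥ (D.Bm σ Λ i *ᵥ x) ≤ 1 / σ i * vn x ^ 2 := fun x => by
    rw [one_div, ← div_eq_inv_mul, le_div_iff₀ hi, mul_comm]
    exact hΛ.smul_Bm_quad_le hσ i x
  have h2 := sq_dotProduct_mulVec_le (hΛ.Bm_posSemidef hσ i) u v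
  rw [← hu, ← vn_sq] at h2
  have h3 : (vn u ^ 2) ^ 2 ≤ (1 / σ i * vn u ^ 2) * (1 / σ i * vn v ^ 2) := by
    refine h2.trans (mul_le_mul (h1 u) (h1 v) ?_ (by positivity))
    exact quad_nonneg_of_posSemidef (hΛ.Bm_posSemidef hσ i) v
  rcases (vn_nonneg u).eq_or_lt with h | h
  · rw [← h]; exact mul_nonneg (by positivity) (vn_nonneg _)
  · have h4 : vn u ^ 2 ≤ (1 / σ i * vn v) ^ 2 := by
      refine le_of_mul_le_mul_right (a := vn u ^ 2) ?_ (by positivity)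
      calc vn u ^ 2 * vn u ^ 2 = (vn u ^ 2) ^ 2 := by ring
        _ ≤ _ := h3
        _ = _ := by ring
    exact (sq_le_sq₀ h.le (mul_nonneg (by positivity) (vn_nonneg _))).1 h4

theorem Gam_quad (h : (D.cov τ).PosDef) (v : D.Noise → ℝ) :
    v ⬝ᵥ (D.Gam σ Λ τ *ᵥ v)
      = (Λ τ *ᵥ (D.H σ *ᵥ v)) ⬝ᵥ (D.cov τ *ᵥ (Λ τ *ᵥ (D.H σ *ᵥ v))) := by
  have e : D.Gam σ Λ τ = (Λ τ * D.H σ)ᵀ * (D.cov τ * (Λ τ * D.H σ)) := by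
    have : (Λ τ * D.H σ)ᵀ * (D.cov τ * (Λ τ * D.H σ))
        = (D.H σ)ᵀ * (Λ τ * D.cov τ * Λ τ) * D.H σ := by
      rw [Matrix.transpose_mul, hΛ.symm h]; simp only [Matrix.mul_assoc]
    rw [this, hΛ.mul_cov_mul h h]; rfl
  rw [e, ← Matrix.mulVec_mulVec, Matrix.dotProduct_mulVec, Matrix.vecMul_transpose]
  simp only [Matrix.mulVec_mulVec]

/-- If `τ ≥ σ/2` componentwise then `Σ(σ) ≤ 2 Σ(τ)`, so the squared length of the image of `v` is at
most `2 v ⬝ᵥ (Γ(τ) v)`; Cauchy–Schwarz and cancellation of one factor finish. -/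
theorem opNorm_Gam_le (hτ : ∀ i, σ i / 2 ≤ τ i) : ‖D.Gam σ Λ τ‖ ≤ 2 := by
  have hτ0 : ∀ i, 0 < τ i := fun i => lt_of_lt_of_le (half_pos (hσ i)) (hτ i)
  have h : (D.cov τ).PosDef := D.cov_posDef (fun i => (hτ0 i).le) (hτ0 0)
  refine opNorm_le zero_le_two fun v => ?_
  set u := Λ τ *ᵥ (D.H σ *ᵥ v) with hu
  have h1 : vn (D.Gam σ Λ τ *ᵥ v) ^ 2 = u ⬝ᵥ (D.cov σ *ᵥ u) := by
    have : D.Gam σ Λ τ *ᵥ v = (D.H σ)ᵀ *ᵥ u := by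
      rw [hu, Gam]; simp only [Matrix.mulVec_mulVec, Matrix.mul_assoc]
    rw [vn_sq, this, ← H_mul_transpose hσ, ← Matrix.mulVec_mulVec, Matrix.dotProduct_mulVec u,
      ← Matrix.mulVec_transpose]
  have h2 : u ⬝ᵥ (D.cov σ *ᵥ u) ≤ 2 * (u ⬝ᵥ (D.cov τ *ᵥ u)) := by
    simp only [cov, Matrix.sum_mulVec, dotProduct_sum, Finset.mul_sum, Matrix.smul_mulVec,
      dotProduct_smul, smul_eq_mul]
    refine Finset.sum_le_sum fun i _ => ?_
    have := quad_nonneg_of_posSemidef (D.V_posSemidef i) u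
    nlinarith [hτ i]
  rw [← hΛ.Gam_quad hσ h] at h2
  have h3 := (le_abs_self _).trans (abs_dotProduct_le v (D.Gam σ Λ τ *ᵥ v))
  rcases (vn_nonneg (D.Gam σ Λ τ *ᵥ v)).eq_or_lt with h0 | h0
  · rw [← h0]; exact mul_nonneg zero_le_two (vn_nonneg _)
  · refine le_of_mul_le_mul_right (a := vn (D.Gam σ Λ τ *ᵥ v)) ?_ h0
    rw [← sq, h1]
    linarith

end IsResolvent

end Design
end EmpBLUP

end

/-! ### Uniform control of the increments of the score -/

noncomputable section
namespace EmpBLUP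

set_option linter.unusedSectionVars false

open scoped Matrix.Norms.L2Operator

namespace Design

variable {p q : ℕ} (D : Design p q)

/-- The resolvent that enters the log-determinant term of the criterion. -/
def Lam : Method → Param q → Matrix (Fin D.n) (Fin D.n) ℝ
  | .reml => D.P
  | .ml => fun τ => (D.cov τ)⁻¹

theorem isResolvent_Lam (meth : Method) : D.IsResolvent (D.Lam meth) := by
  cases meth
  · exact D.isResolvent_P
  · exact D.isResolvent_inv

/-- The partial derivatives of the criterion. -/
def score (meth : Method) (τ : Param q) (y : Fin D.n → ℝ) (i : Fin (q + 1)) : ℝ :=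
  1 / 2 * (y ⬝ᵥ ((D.P τ * D.V i * D.P τ) *ᵥ y)) - 1 / 2 * (D.Lam meth τ * D.V i).trace

/-- The expected Hessian of the criterion. -/
def hess (meth : Method) (σ : Param q) : Matrix (Fin (q + 1)) (Fin (q + 1)) ℝ :=
  Matrix.of fun i j => 1 / 2 * (D.Bm σ (D.Lam meth) i * D.Bm σ (D.Lam meth) j).trace
    - (D.Bm σ D.P i * D.Bm σ D.P j).trace

/-- The scaled `ℓ¹` distance to `σ`. -/
def scaledL1 (σ τ : Param q) : ℝ := ∑ i, D.d σ i * |τ i - σ i|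

/-- A random variable that dominates the stochastic terms of the score increments. -/
def ctrl (σ : Param q) (w : D.Noise → ℝ) : ℝ :=
  1 + ∑ i, ∑ j, |quadC (D.Bm σ D.P i * D.Bm σ D.P j) w| / D.d σ j

variable {D} {σ τ τ' : Param q}

theorem d_nonneg (i : Fin (q + 1)) : 0 ≤ D.d σ i := by
  refine Fin.cases ?_ (fun j => ?_) i
  · exact Real.sqrt_nonneg _
  · exact Real.sqrt_nonneg _

theorem dstar_le (i : Fin (q + 1)) : D.dstar σ ≤ D.d σ i :=
  Finset.inf'_le _ (Finset.mem_univ i)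

/-- The link between the information scales `d_i` of the hypotheses and the whitened matrices: both
squares are the trace of `P V_i P V_i`. -/
theorem fro_Bm (hσ : ∀ i, 0 < σ i) (i : Fin (q + 1)) : fro (D.Bm σ D.P i) = D.d σ i := by
  have hP := D.isResolvent_P
  have hs := hP.symm (hP.pd hσ)
  rw [← sq_eq_sq₀ (fro_nonneg _) (d_nonneg i), fro_sq, hP.Bm_transpose hσ, hP.trace_Bm_mul_Bm hσ]
  have key : ∀ {a b : ℕ} (S : Matrix (Fin a) (Fin b) ℝ),
      Real.sqrt (Matrix.trace (Sᵀ * S)) ^ 2 = Matrix.trace (Sᵀ * S) := fun S => by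
    rw [← fro_sq, Real.sqrt_sq (fro_nonneg _)]
  refine Fin.cases ?_ (fun j => ?_) i
  · change _ = Real.sqrt _ ^ 2
    rw [key, hs, V_zero, Matrix.mul_one, Matrix.mul_one]
  · change _ = Real.sqrt _ ^ 2
    rw [key, V_succ]
    have e1 : ((D.Z j)ᵀ * D.P σ * D.Z j)ᵀ * ((D.Z j)ᵀ * D.P σ * D.Z j)
        = (D.Z j)ᵀ * (D.P σ * (D.Z j * (D.Z j)ᵀ) * D.P σ * D.Z j) := by
      rw [Matrix.transpose_mul, Matrix.transpose_mul, hs, Matrix.transpose_transpose]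
      simp only [Matrix.mul_assoc]
    rw [e1, Matrix.trace_mul_comm (D.Z j)ᵀ]
    simp only [Matrix.mul_assoc]

theorem scaledL1_nonneg : 0 ≤ D.scaledL1 σ τ :=
  Finset.sum_nonneg fun i _ => mul_nonneg (d_nonneg i) (abs_nonneg _)

theorem sum_abs_le (h1 : 0 < D.dstar σ) : ∑ i, |τ i - σ i| ≤ D.scaledL1 σ τ / D.dstar σ := by
  rw [le_div_iff₀ h1, scaledL1, Finset.sum_mul]
  refine Finset.sum_le_sum fun i _ => ?_
  rw [mul_comm]
  exact mul_le_mul_of_nonneg_right (dstar_le i) (abs_nonneg _)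

theorem one_le_ctrl (w : D.Noise → ℝ) : 1 ≤ D.ctrl σ w := by
  rw [ctrl, le_add_iff_nonneg_right]
  exact Finset.sum_nonneg fun i _ => Finset.sum_nonneg fun j _ =>
    div_nonneg (abs_nonneg _) (d_nonneg j)

theorem abs_quadC_le_ctrl (h1 : 1 ≤ D.dstar σ) (i j : Fin (q + 1)) (w : D.Noise → ℝ) :
    |quadC (D.Bm σ D.P i * D.Bm σ D.P j) w| ≤ D.d σ j * (D.ctrl σ w - 1) := by
  have hd : 0 < D.d σ j := by linarith [dstar_le (D := D) (σ := σ) j]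
  have h2 : |quadC (D.Bm σ D.P i * D.Bm σ D.P j) w| / D.d σ j ≤ D.ctrl σ w - 1 := by
    rw [ctrl, add_sub_cancel_left]
    refine le_trans ?_ (Finset.single_le_sum (f := fun i => ∑ j,
      |quadC (D.Bm σ D.P i * D.Bm σ D.P j) w| / D.d σ j) (fun i _ => Finset.sum_nonneg fun j _ =>
        div_nonneg (abs_nonneg _) (d_nonneg j)) (Finset.mem_univ i))
    exact Finset.single_le_sum (f := fun j =>
      |quadC (D.Bm σ D.P i * D.Bm σ D.P j) w| / D.d σ j) (fun j _ =>
        div_nonneg (abs_nonneg _) (d_nonneg j)) (Finset.mem_univ j)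
  rwa [div_le_iff₀ hd, mul_comm] at h2

/-- The squared length has mean `d_i ^ 2`, and its fluctuation, a centered quadratic form, is at
most `d_i (ctrl - 1) ≤ d_i ^ 2 (ctrl - 1)`. -/
theorem vn_Bm_mulVec_le (hσ : ∀ i, 0 < σ i) (h1 : 1 ≤ D.dstar σ) (i : Fin (q + 1))
    (w : D.Noise → ℝ) : vn (D.Bm σ D.P i *ᵥ w) ≤ D.d σ i * √(D.ctrl σ w) := by
  have hP := D.isResolvent_P
  have hd : 1 ≤ D.d σ i := h1.trans (dstar_le i)
  have hU := one_le_ctrl (D := D) (σ := σ) w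
  rw [← sq_le_sq₀ (vn_nonneg _) (by positivity), mul_pow, Real.sq_sqrt (by linarith)]
  have e : vn (D.Bm σ D.P i *ᵥ w) ^ 2 = quadC (D.Bm σ D.P i * D.Bm σ D.P i) w + D.d σ i ^ 2 := by
    rw [vn_sq, quadC, ← fro_Bm hσ, fro_sq, hP.Bm_transpose hσ, sub_add_cancel,
      Matrix.dotProduct_mulVec, ← Matrix.mulVec_transpose, hP.Bm_transpose hσ, Matrix.mulVec_mulVec,
      dotProduct_comm]
  rw [e]
  have := (le_abs_self _).trans (abs_quadC_le_ctrl (σ := σ) h1 i i w)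
  nlinarith [mul_nonneg (sub_nonneg.2 hd) (sub_nonneg.2 hU)]

/-- The set of parameters on which the score increments are controlled. -/
structure Near (D : Design p q) (σ τ : Param q) (κ : ℝ) : Prop where
  half_le : ∀ i, σ i / 2 ≤ τ i
  le_dstar : 2 * κ * D.scaledL1 σ τ ≤ D.dstar σ

theorem posDef_of_half_le (hσ : ∀ i, 0 < σ i) (h : ∀ i, σ i / 2 ≤ τ i) : (D.cov τ).PosDef :=
  have hτ0 : ∀ i, 0 < τ i := fun i => lt_of_lt_of_le (half_pos (hσ i)) (h i)
  D.cov_posDef (fun i => (hτ0 i).le) (hτ0 0)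

section Bounds

variable {κ : ℝ} (hσ : ∀ i, 0 < σ i) (hκ : ∀ i, 1 / σ i ≤ κ) (h1 : 1 ≤ D.dstar σ)
include hσ hκ

theorem kappa_pos : 0 < κ := lt_of_lt_of_le (one_div_pos.2 (hσ 0)) (hκ 0)

include h1

/-- The resolvent identity has three factors, of norms at most `2`, `κ ℓ / d_*` (with `ℓ` the scaled
distance) and `1`. -/
theorem opNorm_Gam_sub_le {Λ : Param q → Matrix (Fin D.n) (Fin D.n) ℝ} (hΛ : D.IsResolvent Λ)
    (hτ : D.Near σ τ κ) :
    ‖D.Gam σ Λ τ - D.Gam σ Λ σ‖ ≤ 2 * κ * D.scaledL1 σ τ / D.dstar σ := by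
  have hκ0 := kappa_pos hσ hκ
  have hpd := posDef_of_half_le (D := D) hσ hτ.half_le
  rw [hΛ.Gam_sub hσ hpd (hΛ.pd hσ), norm_neg]
  have hsum : ‖∑ i, (τ i - σ i) • D.Bm σ Λ i‖ ≤ κ * (D.scaledL1 σ τ / D.dstar σ) := by
    refine (norm_sum_le _ _).trans ?_
    refine le_trans ?_ (mul_le_mul_of_nonneg_left (sum_abs_le (by linarith)) hκ0.le)
    rw [Finset.mul_sum]
    refine Finset.sum_le_sum fun i _ => ?_
    rw [norm_smul, Real.norm_eq_abs, mul_comm]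
    exact mul_le_mul_of_nonneg_right ((hΛ.opNorm_Bm_le hσ i).trans (hκ i)) (abs_nonneg _)
  have hnn : 0 ≤ D.scaledL1 σ τ / D.dstar σ := div_nonneg scaledL1_nonneg (by linarith)
  calc _ ≤ ‖D.Gam σ Λ τ‖ * ‖∑ i, (τ i - σ i) • D.Bm σ Λ i‖ * ‖D.Gam σ Λ σ‖ :=
        (norm_mul_le _ _).trans (mul_le_mul_of_nonneg_right (norm_mul_le _ _) (norm_nonneg _))
    _ ≤ 2 * (κ * (D.scaledL1 σ τ / D.dstar σ)) * 1 := by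
        gcongr
        · exact hΛ.opNorm_Gam_le hσ hτ.half_le
        · exact hΛ.opNorm_proj_le hσ
    _ = _ := by ring

/-- The two resolvents are replaced one at a time by the projection at `σ`, which fixes every `Bm`.
Each replacement is small in operator norm and meets a product of two Frobenius norms. -/
theorem trace_increment_le {Λ : Param q → Matrix (Fin D.n) (Fin D.n) ℝ} (hΛ : D.IsResolvent Λ)
    {c₁ : ℝ} (hc₁ : ∀ i, fro (D.Bm σ Λ i) ≤ c₁ * D.d σ i) (hτ : D.Near σ τ κ)
    (hτ' : D.Near σ τ' κ) (i j : Fin (q + 1)) :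
    |(Λ τ * D.V j * Λ τ' * D.V i).trace - (D.Bm σ Λ j * D.Bm σ Λ i).trace|
      ≤ c₁ ^ 2 * (D.d σ i * D.d σ j) *
        (4 * κ * (D.scaledL1 σ τ + D.scaledL1 σ τ') / D.dstar σ) := by
  have hκ0 := kappa_pos hσ hκ
  have hpd := posDef_of_half_le (D := D) hσ hτ.half_le
  have hpd' := posDef_of_half_le (D := D) hσ hτ'.half_le
  have hE := opNorm_Gam_sub_le hσ hκ h1 hΛ hτ
  have hE' := opNorm_Gam_sub_le hσ hκ h1 hΛ hτ'
  rw [hΛ.trace_mul_V_mul_V hσ hpd hpd']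
  set E := D.Gam σ Λ τ - D.Gam σ Λ σ with hEd
  set E' := D.Gam σ Λ τ' - D.Gam σ Λ σ with hEd'
  have e : (D.Gam σ Λ τ * D.Bm σ Λ j * D.Gam σ Λ τ' * D.Bm σ Λ i).trace
      - (D.Bm σ Λ j * D.Bm σ Λ i).trace
      = ((E * D.Bm σ Λ j) * (D.Gam σ Λ τ' * D.Bm σ Λ i)).trace
        + (D.Bm σ Λ j * (E' * D.Bm σ Λ i)).trace := by
    rw [hEd, hEd']
    simp only [Matrix.sub_mul, Matrix.mul_sub, Matrix.trace_sub, hΛ.proj_mul_Bm hσ]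
    simp only [Matrix.mul_assoc]
    ring
  have d0 : ∀ i, 0 ≤ D.d σ i := fun i => d_nonneg i
  have hj := hc₁ j
  have hi := hc₁ i
  have hj0 : 0 ≤ c₁ * D.d σ j := (fro_nonneg _).trans hj
  have hG := hΛ.opNorm_Gam_le hσ hτ'.half_le
  have s1 : 0 ≤ D.scaledL1 σ τ := scaledL1_nonneg
  have s2 : 0 ≤ D.scaledL1 σ τ' := scaledL1_nonneg
  have t1 : |((E * D.Bm σ Λ j) * (D.Gam σ Λ τ' * D.Bm σ Λ i)).trace|
      ≤ (2 * κ * D.scaledL1 σ τ / D.dstar σ * (c₁ * D.d σ j)) * (2 * (c₁ * D.d σ i)) := by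
    refine (abs_trace_mul_le _ _).trans ?_
    have a1 : fro (E * D.Bm σ Λ j) ≤ 2 * κ * D.scaledL1 σ τ / D.dstar σ * (c₁ * D.d σ j) :=
      (fro_mul_le _ _).trans (mul_le_mul hE hj (fro_nonneg _) ((norm_nonneg _).trans hE))
    have a2 : fro (D.Gam σ Λ τ' * D.Bm σ Λ i) ≤ 2 * (c₁ * D.d σ i) :=
      (fro_mul_le _ _).trans (mul_le_mul hG hi (fro_nonneg _) zero_le_two)
    exact mul_le_mul a1 a2 (fro_nonneg _) ((fro_nonneg _).trans a1)
  have t2 : |(D.Bm σ Λ j * (E' * D.Bm σ Λ i)).trace|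
      ≤ (c₁ * D.d σ j) * (2 * κ * D.scaledL1 σ τ' / D.dstar σ * (c₁ * D.d σ i)) := by
    refine (abs_trace_mul_le _ _).trans ?_
    have a1 : fro (E' * D.Bm σ Λ i) ≤ 2 * κ * D.scaledL1 σ τ' / D.dstar σ * (c₁ * D.d σ i) :=
      (fro_mul_le _ _).trans (mul_le_mul hE' hi (fro_nonneg _) ((norm_nonneg _).trans hE'))
    exact mul_le_mul hj a1 (fro_nonneg _) hj0
  rw [e]
  refine (abs_add_le _ _).trans ((add_le_add t1 t2).trans ?_)
  have hx : 0 ≤ c₁ ^ 2 * (D.d σ i * D.d σ j) * (2 * κ * D.scaledL1 σ τ' / D.dstar σ) := by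
    have := d0 i; have := d0 j
    positivity
  have e2 : c₁ ^ 2 * (D.d σ i * D.d σ j) *
        (4 * κ * (D.scaledL1 σ τ + D.scaledL1 σ τ') / D.dstar σ)
      = (2 * κ * D.scaledL1 σ τ / D.dstar σ * (c₁ * D.d σ j)) * (2 * (c₁ * D.d σ i))
        + (c₁ * D.d σ j) * (2 * κ * D.scaledL1 σ τ' / D.dstar σ * (c₁ * D.d σ i))
        + c₁ ^ 2 * (D.d σ i * D.d σ j) * (2 * κ * D.scaledL1 σ τ' / D.dstar σ) := by ring
  rw [e2]
  linarith

/-- Since `Bm` absorbs the projection, `(Γ(τ) - Q) w = -Γ(τ) ∑ (τ_k - σ_k) B_k w`. The noise enters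
only through the vectors `B_k w`, which do not depend on `τ`; this is why the bound may be used at a
data-dependent parameter. -/
theorem vn_Bm_Gam_sub_le (hτ : D.Near σ τ κ) (i : Fin (q + 1)) (w : D.Noise → ℝ) :
    vn (D.Bm σ D.P i *ᵥ ((D.Gam σ D.P τ - D.Gam σ D.P σ) *ᵥ w))
      ≤ D.d σ i * √(D.ctrl σ w) * (2 * κ * D.scaledL1 σ τ / D.dstar σ) := by
  have hP := D.isResolvent_P
  have hκ0 := kappa_pos hσ hκ
  have hpd := posDef_of_half_le (D := D) hσ hτ.half_le
  have hds : 0 < D.dstar σ := by linarith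
  have e : (D.Gam σ D.P τ - D.Gam σ D.P σ) *ᵥ w
      = -(D.Gam σ D.P τ *ᵥ ∑ k, (τ k - σ k) • (D.Bm σ D.P k *ᵥ w)) := by
    rw [hP.Gam_sub hσ hpd (hP.pd hσ), Matrix.neg_mulVec]
    congr 1
    rw [Matrix.mul_assoc, Matrix.sum_mul, ← Matrix.mulVec_mulVec, Matrix.sum_mulVec]
    congr 1
    refine Finset.sum_congr rfl fun k _ => ?_
    rw [Matrix.smul_mul, hP.Bm_mul_proj hσ, Matrix.smul_mulVec]
  have hs : vn (∑ k, (τ k - σ k) • (D.Bm σ D.P k *ᵥ w)) ≤ D.scaledL1 σ τ * √(D.ctrl σ w) := by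
    refine (vn_sum_le _ _).trans ?_
    rw [scaledL1, Finset.sum_mul]
    refine Finset.sum_le_sum fun k _ => ?_
    rw [vn_smul]
    calc _ ≤ |τ k - σ k| * (D.d σ k * √(D.ctrl σ w)) :=
          mul_le_mul_of_nonneg_left (vn_Bm_mulVec_le hσ h1 k w) (abs_nonneg _)
      _ = _ := by ring
  have hneg : ∀ v : D.Noise → ℝ, vn (-v) = vn v := fun v => norm_neg (WithLp.toLp 2 v)
  rw [e, Matrix.mulVec_neg, hneg]
  have hds' := dstar_le (D := D) (σ := σ) i
  have sn : 0 ≤ D.scaledL1 σ τ := scaledL1_nonneg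
  calc _ ≤ κ * (2 * (D.scaledL1 σ τ * √(D.ctrl σ w))) := by
        refine (vn_mulVec_le _ _).trans ?_
        refine mul_le_mul ((hP.opNorm_Bm_le hσ i).trans (hκ i)) ?_ (vn_nonneg _) hκ0.le
        refine (vn_mulVec_le _ _).trans ?_
        exact mul_le_mul (hP.opNorm_Gam_le hσ hτ.half_le) hs (vn_nonneg _) zero_le_two
    _ = (2 * κ * D.scaledL1 σ τ * √(D.ctrl σ w)) * 1 := by ring
    -- A factor `d_i / d_* ≥ 1` is inserted so that the bound scales like that of `vn_Bm_mulVec_le`.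
    _ ≤ (2 * κ * D.scaledL1 σ τ * √(D.ctrl σ w)) * (D.d σ i / D.dstar σ) := by
        gcongr
        rwa [le_div_iff₀ hds, one_mul]
    _ = _ := by ring

-- Split `B_i Γ(τ) w = a_i + b_i` with `a_i = B_i w` and `b_i` of relative size `e`, and `Γ(τ') = Q
-- + E'`. The main term `a_j ⬝ᵥ a_i` has the subtracted trace as its mean; its fluctuation is at
-- most `d_i ctrl ≤ d_i d_j ctrl / d_*`. All other terms carry a factor `e` or `e'`, and `e ≤ 1`
-- absorbs the products.
set_option maxHeartbeats 800000 in
theorem quad_increment_le (hτ : D.Near σ τ κ) (hτ' : D.Near σ τ' κ) (i j : Fin (q + 1))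
    (w : D.Noise → ℝ) :
    |(D.Bm σ D.P j *ᵥ (D.Gam σ D.P τ *ᵥ w)) ⬝ᵥ
        (D.Gam σ D.P τ' *ᵥ (D.Bm σ D.P i *ᵥ (D.Gam σ D.P τ *ᵥ w)))
        - (D.Bm σ D.P j * D.Bm σ D.P i).trace|
      ≤ D.d σ i * D.d σ j * D.ctrl σ w *
        ((1 + 8 * κ * (D.scaledL1 σ τ + D.scaledL1 σ τ')) / D.dstar σ) := by
  have hP := D.isResolvent_P
  have hκ0 := kappa_pos hσ hκ
  have hds : 0 < D.dstar σ := by linarith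
  have hE' := opNorm_Gam_sub_le hσ hκ h1 hP hτ'
  set Q := D.Gam σ D.P σ with hQ
  set E' := D.Gam σ D.P τ' - Q with hEd'
  set a : Fin (q + 1) → D.Noise → ℝ := fun i => D.Bm σ D.P i *ᵥ w with ha
  set b : Fin (q + 1) → D.Noise → ℝ := fun i => D.Bm σ D.P i *ᵥ ((D.Gam σ D.P τ - Q) *ᵥ w) with hb
  set e := 2 * κ * D.scaledL1 σ τ / D.dstar σ with he
  set e' := 2 * κ * D.scaledL1 σ τ' / D.dstar σ with he'
  have he0 : 0 ≤ e := by
    have : 0 ≤ D.scaledL1 σ τ := scaledL1_nonneg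
    positivity
  have he0' : 0 ≤ e' := (norm_nonneg _).trans hE'
  have he1 : e ≤ 1 := by rw [he, div_le_one hds]; exact hτ.le_dstar
  set r := √(D.ctrl σ w) with hr
  have hr0 : 0 ≤ r := Real.sqrt_nonneg _
  have hU := one_le_ctrl (D := D) (σ := σ) w
  have hrr : r * r = D.ctrl σ w := Real.mul_self_sqrt (by linarith)
  have hab : ∀ i, D.Bm σ D.P i *ᵥ (D.Gam σ D.P τ *ᵥ w) = a i + b i := fun i => by
    rw [ha, hb]
    simp only [Matrix.sub_mulVec, Matrix.mulVec_sub]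
    rw [Matrix.mulVec_mulVec w (D.Bm σ D.P i) Q, hQ, hP.Bm_mul_proj hσ]
    abel
  have haN : ∀ i, vn (a i) ≤ D.d σ i * r := fun i => vn_Bm_mulVec_le hσ h1 i w
  have hbN : ∀ i, vn (b i) ≤ D.d σ i * r * e := fun i => vn_Bm_Gam_sub_le hσ hκ h1 hτ i w
  have hQa : ∀ i, Q *ᵥ a i = a i := fun i => by
    rw [ha]; simp only [Matrix.mulVec_mulVec]; rw [hP.proj_mul_Bm hσ]
  have hQv : ∀ v, vn (Q *ᵥ v) ≤ vn v := hP.vn_proj_le hσ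
  have hG : D.Gam σ D.P τ' = Q + E' := by rw [hEd']; abel
  have di : 0 ≤ D.d σ i := d_nonneg i
  have dj : 0 ≤ D.d σ j := d_nonneg j
  rw [hab, hab, hG, Matrix.add_mulVec, Matrix.mulVec_add, hQa]
  have haa : a j ⬝ᵥ a i - (D.Bm σ D.P j * D.Bm σ D.P i).trace
      = quadC (D.Bm σ D.P j * D.Bm σ D.P i) w := by
    rw [quadC, ha]
    simp only
    rw [← Matrix.mulVec_mulVec, Matrix.dotProduct_mulVec w, ← Matrix.mulVec_transpose,
      hP.Bm_transpose hσ]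
  have split : (a j + b j) ⬝ᵥ (a i + Q *ᵥ b i + E' *ᵥ (a i + b i))
        - (D.Bm σ D.P j * D.Bm σ D.P i).trace
      = quadC (D.Bm σ D.P j * D.Bm σ D.P i) w + a j ⬝ᵥ (Q *ᵥ b i) + b j ⬝ᵥ a i
        + b j ⬝ᵥ (Q *ᵥ b i) + (a j + b j) ⬝ᵥ (E' *ᵥ (a i + b i)) := by
    rw [← haa]
    simp only [add_dotProduct, dotProduct_add]
    ring
  have m1 : |a j ⬝ᵥ (Q *ᵥ b i)| ≤ (D.d σ j * r) * (D.d σ i * r * e) :=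
    (abs_dotProduct_le _ _).trans
      (mul_le_mul (haN j) ((hQv _).trans (hbN i)) (vn_nonneg _) (by positivity))
  have m2 : |b j ⬝ᵥ a i| ≤ (D.d σ j * r * e) * (D.d σ i * r) :=
    (abs_dotProduct_le _ _).trans
      (mul_le_mul (hbN j) (haN i) (vn_nonneg _) (by positivity))
  have m3 : |b j ⬝ᵥ (Q *ᵥ b i)| ≤ (D.d σ j * r * e) * (D.d σ i * r * e) :=
    (abs_dotProduct_le _ _).trans
      (mul_le_mul (hbN j) ((hQv _).trans (hbN i)) (vn_nonneg _) (by positivity))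
  have habN : ∀ i, vn (a i + b i) ≤ D.d σ i * r * (1 + e) := fun i => by
    refine (vn_add_le _ _).trans ((add_le_add (haN i) (hbN i)).trans (le_of_eq (by ring)))
  have m4 : |(a j + b j) ⬝ᵥ (E' *ᵥ (a i + b i))|
      ≤ (D.d σ j * r * (1 + e)) * (e' * (D.d σ i * r * (1 + e))) := by
    refine (abs_dotProduct_le _ _).trans
      (mul_le_mul (habN j) ?_ (vn_nonneg _) (by positivity))
    exact (vn_mulVec_le _ _).trans (mul_le_mul hE' (habN i) (vn_nonneg _) he0')
  have m5 : |quadC (D.Bm σ D.P j * D.Bm σ D.P i) w| ≤ D.d σ i * D.d σ j * D.ctrl σ w / D.dstar σ := by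
    refine (abs_quadC_le_ctrl h1 j i w).trans ?_
    rw [le_div_iff₀ hds]
    have : D.dstar σ ≤ D.d σ j := dstar_le j
    calc D.d σ i * (D.ctrl σ w - 1) * D.dstar σ ≤ D.d σ i * D.ctrl σ w * D.d σ j := by
          gcongr
          linarith
      _ = _ := by ring
  rw [split]
  have tot : |quadC (D.Bm σ D.P j * D.Bm σ D.P i) w + a j ⬝ᵥ (Q *ᵥ b i) + b j ⬝ᵥ a i
        + b j ⬝ᵥ (Q *ᵥ b i) + (a j + b j) ⬝ᵥ (E' *ᵥ (a i + b i))|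
      ≤ D.d σ i * D.d σ j * D.ctrl σ w / D.dstar σ + (D.d σ j * r) * (D.d σ i * r * e)
        + (D.d σ j * r * e) * (D.d σ i * r) + (D.d σ j * r * e) * (D.d σ i * r * e)
        + (D.d σ j * r * (1 + e)) * (e' * (D.d σ i * r * (1 + e))) := by
    refine (abs_add_le _ _).trans (add_le_add ?_ m4)
    refine (abs_add_le _ _).trans (add_le_add ?_ m3)
    refine (abs_add_le _ _).trans (add_le_add ?_ m2)
    exact (abs_add_le _ _).trans (add_le_add m5 m1)
  refine tot.trans ?_
  have hk : D.d σ i * D.d σ j * D.ctrl σ w / D.dstar σ + (D.d σ j * r) * (D.d σ i * r * e)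
        + (D.d σ j * r * e) * (D.d σ i * r) + (D.d σ j * r * e) * (D.d σ i * r * e)
        + (D.d σ j * r * (1 + e)) * (e' * (D.d σ i * r * (1 + e)))
      = D.d σ i * D.d σ j * D.ctrl σ w * (1 / D.dstar σ + (2 * e + e * e + (1 + e) ^ 2 * e')) := by
    rw [← hrr]; ring
  rw [hk]
  have hfin : 2 * e + e * e + (1 + e) ^ 2 * e' ≤ 4 * e + 4 * e' := by
    have h2 : e * e ≤ e := mul_le_of_le_one_left he0 he1
    have h3 : (1 + e) ^ 2 ≤ 4 := by
      have : (1 + e) ^ 2 = 1 + 2 * e + e * e := by ring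
      linarith
    have h4 := mul_le_mul_of_nonneg_right h3 he0'
    linarith
  have hr2 : (1 + 8 * κ * (D.scaledL1 σ τ + D.scaledL1 σ τ')) / D.dstar σ
      = 1 / D.dstar σ + (4 * e + 4 * e') := by rw [he, he']; ring
  rw [hr2]
  have h0 : 0 ≤ D.ctrl σ w := by linarith
  exact mul_le_mul_of_nonneg_left (add_le_add_right hfin _)
    (mul_nonneg (mul_nonneg di dj) h0)

end Bounds

theorem quad_P_V_P (hσ : ∀ i, 0 < σ i) (h : (D.cov τ).PosDef) (i : Fin (q + 1)) (β : Fin p → ℝ)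
    (w : D.Noise → ℝ) :
    (D.X *ᵥ β + D.H σ *ᵥ w) ⬝ᵥ ((D.P τ * D.V i * D.P τ) *ᵥ (D.X *ᵥ β + D.H σ *ᵥ w))
      = w ⬝ᵥ ((D.Gam σ D.P τ * D.Bm σ D.P i * D.Gam σ D.P τ) *ᵥ w) := by
  have hP := D.isResolvent_P
  have e1 : (D.P τ * D.V i * D.P τ) *ᵥ (D.X *ᵥ β + D.H σ *ᵥ w)
      = (D.P τ * D.V i * D.P τ * D.H σ) *ᵥ w := by
    rw [Matrix.mulVec_add, Matrix.mulVec_mulVec, Matrix.mul_assoc _ (D.P τ) D.X, P_mul_X h]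
    simp [Matrix.mulVec_mulVec]
  have e2 : ∀ v : Fin D.n → ℝ, (D.X *ᵥ β) ⬝ᵥ (D.P τ *ᵥ v) = 0 := fun v => by
    rw [Matrix.dotProduct_mulVec, ← Matrix.mulVec_transpose, hP.symm h, Matrix.mulVec_mulVec,
      P_mul_X h]
    simp
  have e3 : (D.P τ * D.V i * D.P τ * D.H σ) *ᵥ w = D.P τ *ᵥ ((D.V i * D.P τ * D.H σ) *ᵥ w) := by
    rw [Matrix.mulVec_mulVec]; simp only [Matrix.mul_assoc]
  rw [e1, add_dotProduct, e3, e2, zero_add, ← e3, hP.Gam_mul_Bm_mul_Gam hσ h h,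
    Matrix.mul_assoc (D.H σ)ᵀ, ← Matrix.mulVec_mulVec w (D.H σ)ᵀ, Matrix.dotProduct_mulVec w,
    Matrix.vecMul_transpose]

/-- An exact finite-difference formula, by the resolvent identity in each occurrence of the
parameter. It serves twice: for the uniform bound on increments, and as the slope from which the
second derivatives of the criterion are read off. -/
theorem score_sub (meth : Method) (h : (D.cov τ).PosDef)
    (h' : (D.cov τ').PosDef) (i : Fin (q + 1)) (y : Fin D.n → ℝ) :
    D.score meth τ y i - D.score meth τ' y i = ∑ j, (τ j - τ' j) *
      (1 / 2 * (D.Lam meth τ * D.V j * D.Lam meth τ' * D.V i).trace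
        - 1 / 2 * (y ⬝ᵥ ((D.P τ * D.V j * D.P τ' * D.V i * D.P τ) *ᵥ y)
          + y ⬝ᵥ ((D.P τ' * D.V i * D.P τ * D.V j * D.P τ') *ᵥ y))) := by
  have hP := D.isResolvent_P
  have hL := D.isResolvent_Lam meth
  have e1 : D.P τ * D.V i * D.P τ - D.P τ' * D.V i * D.P τ'
      = -∑ j, (τ j - τ' j) • (D.P τ * D.V j * D.P τ' * D.V i * D.P τ
        + D.P τ' * D.V i * D.P τ * D.V j * D.P τ') := by
    have : D.P τ * D.V i * D.P τ - D.P τ' * D.V i * D.P τ'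
        = (D.P τ - D.P τ') * D.V i * D.P τ + D.P τ' * D.V i * (D.P τ - D.P τ') := by
      simp only [Matrix.sub_mul, Matrix.mul_sub]; abel
    rw [this, hP.sub_eq h h']
    simp only [Matrix.neg_mul, Matrix.mul_neg, Matrix.sum_mul, Matrix.mul_sum, Matrix.smul_mul,
      Matrix.mul_smul, smul_add, Finset.sum_add_distrib, neg_add]
    simp only [Matrix.mul_assoc]
  have e2 : (D.Lam meth τ * D.V i).trace - (D.Lam meth τ' * D.V i).trace
      = -∑ j, (τ j - τ' j) * (D.Lam meth τ * D.V j * D.Lam meth τ' * D.V i).trace := by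
    rw [← Matrix.trace_sub, ← Matrix.sub_mul, hL.sub_eq h h']
    simp only [Matrix.neg_mul, Matrix.sum_mul, Matrix.smul_mul, Matrix.trace_neg,
      Matrix.trace_sum, Matrix.trace_smul, smul_eq_mul]
  have e3 : y ⬝ᵥ ((D.P τ * D.V i * D.P τ) *ᵥ y) - y ⬝ᵥ ((D.P τ' * D.V i * D.P τ') *ᵥ y)
      = -∑ j, (τ j - τ' j) * (y ⬝ᵥ ((D.P τ * D.V j * D.P τ' * D.V i * D.P τ) *ᵥ y)
        + y ⬝ᵥ ((D.P τ' * D.V i * D.P τ * D.V j * D.P τ') *ᵥ y)) := by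
    rw [← dotProduct_sub, ← Matrix.sub_mulVec, e1, Matrix.neg_mulVec, dotProduct_neg,
      Matrix.sum_mulVec, dotProduct_sum]
    congr 1
    refine Finset.sum_congr rfl fun j _ => ?_
    rw [Matrix.smul_mulVec, dotProduct_smul, Matrix.add_mulVec, dotProduct_add, smul_eq_mul]
  have e4 : ∀ j, (τ j - τ' j) *
      (1 / 2 * (D.Lam meth τ * D.V j * D.Lam meth τ' * D.V i).trace
        - 1 / 2 * (y ⬝ᵥ ((D.P τ * D.V j * D.P τ' * D.V i * D.P τ) *ᵥ y)
          + y ⬝ᵥ ((D.P τ' * D.V i * D.P τ * D.V j * D.P τ') *ᵥ y)))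
      = 1 / 2 * ((τ j - τ' j) * (D.Lam meth τ * D.V j * D.Lam meth τ' * D.V i).trace)
        - 1 / 2 * ((τ j - τ' j) * (y ⬝ᵥ ((D.P τ * D.V j * D.P τ' * D.V i * D.P τ) *ᵥ y)
        + y ⬝ᵥ ((D.P τ' * D.V i * D.P τ * D.V j * D.P τ') *ᵥ y))) := fun j => by ring
  rw [Finset.sum_congr rfl fun j _ => e4 j, Finset.sum_sub_distrib, ← Finset.mul_sum,
    ← Finset.mul_sum, score, score]
  linarith

/-- The mean `Xβ` drops out because `P X = 0`, and the remaining form is written with the vectors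
that `quad_increment_le` estimates. -/
theorem quad_five (hσ : ∀ i, 0 < σ i) (h : (D.cov τ).PosDef) (h' : (D.cov τ').PosDef)
    (i j : Fin (q + 1)) (β : Fin p → ℝ) (w : D.Noise → ℝ) :
    (D.X *ᵥ β + D.H σ *ᵥ w) ⬝ᵥ ((D.P τ * D.V j * D.P τ' * D.V i * D.P τ) *ᵥ
        (D.X *ᵥ β + D.H σ *ᵥ w))
      = (D.Bm σ D.P j *ᵥ (D.Gam σ D.P τ *ᵥ w)) ⬝ᵥ
        (D.Gam σ D.P τ' *ᵥ (D.Bm σ D.P i *ᵥ (D.Gam σ D.P τ *ᵥ w))) := by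
  have hP := D.isResolvent_P
  have e2 : (D.X *ᵥ β + D.H σ *ᵥ w) ᵥ* D.P τ = (D.H σ *ᵥ w) ᵥ* D.P τ := by
    rw [Matrix.add_vecMul, ← Matrix.mulVec_transpose _ (D.X *ᵥ β), hP.symm h, Matrix.mulVec_mulVec,
      P_mul_X h]
    simp
  have e1 : D.P τ *ᵥ (D.X *ᵥ β + D.H σ *ᵥ w) = D.P τ *ᵥ (D.H σ *ᵥ w) := by
    rw [Matrix.mulVec_add, Matrix.mulVec_mulVec, P_mul_X h]; simp
  have e3 : ∀ y : Fin D.n → ℝ, y ⬝ᵥ ((D.P τ * D.V j * D.P τ' * D.V i * D.P τ) *ᵥ y)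
      = (y ᵥ* D.P τ) ⬝ᵥ ((D.V j * D.P τ' * D.V i) *ᵥ (D.P τ *ᵥ y)) := fun y => by
    rw [← Matrix.dotProduct_mulVec, Matrix.mulVec_mulVec, Matrix.mulVec_mulVec]
    simp only [Matrix.mul_assoc]
  have e4 : D.Gam σ D.P τ * D.Bm σ D.P j * D.Gam σ D.P τ' * D.Bm σ D.P i * D.Gam σ D.P τ
      = (D.H σ)ᵀ * (D.P τ * D.V j * D.P τ' * D.V i * D.P τ) * D.H σ := by
    rw [Matrix.mul_assoc, Matrix.mul_assoc, ← Matrix.mul_assoc (D.Gam σ D.P τ'),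
      hP.Gam_mul_Bm hσ h, hP.Gam_mul_Bm_mul_Gam hσ h' h]
    calc _ = (D.H σ)ᵀ * D.P τ * D.V j * (D.P σ * (D.H σ * (D.H σ)ᵀ) * D.P τ') * D.V i * D.P τ
          * D.H σ := by simp only [Matrix.mul_assoc]
      _ = _ := by
        rw [H_mul_transpose hσ, hP.mul_cov_mul' (hP.pd hσ) h']; simp only [Matrix.mul_assoc]
  rw [e3, e2, e1, ← e3]
  have e5 : (D.H σ *ᵥ w) ⬝ᵥ ((D.P τ * D.V j * D.P τ' * D.V i * D.P τ) *ᵥ (D.H σ *ᵥ w))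
      = w ⬝ᵥ ((D.Gam σ D.P τ * D.Bm σ D.P j * D.Gam σ D.P τ' * D.Bm σ D.P i * D.Gam σ D.P τ)
        *ᵥ w) := by
    rw [e4, Matrix.mul_assoc (D.H σ)ᵀ, ← Matrix.mulVec_mulVec w (D.H σ)ᵀ,
      Matrix.dotProduct_mulVec w, Matrix.vecMul_transpose, Matrix.mulVec_mulVec]
  rw [e5]
  have e6 : D.Gam σ D.P τ * D.Bm σ D.P j * D.Gam σ D.P τ' * D.Bm σ D.P i * D.Gam σ D.P τ
      = (D.Bm σ D.P j * D.Gam σ D.P τ)ᵀ * (D.Gam σ D.P τ' * (D.Bm σ D.P i * D.Gam σ D.P τ)) := by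
    rw [Matrix.transpose_mul, hP.Bm_transpose hσ, hP.Gam_transpose hσ h]
    simp only [Matrix.mul_assoc]
  rw [e6, ← Matrix.mulVec_mulVec, Matrix.dotProduct_mulVec w, Matrix.vecMul_transpose]
  simp only [Matrix.mulVec_mulVec]

/-- The increments of the score are approximated by those of its expected linearization. -/
theorem score_increment_le (meth : Method) {κ c₁ : ℝ} (hσ : ∀ i, 0 < σ i)
    (hκ : ∀ i, 1 / σ i ≤ κ) (h1 : 1 ≤ D.dstar σ)
    (hc₁ : ∀ i, fro (D.Bm σ (D.Lam meth) i) ≤ c₁ * D.d σ i) (hτ : D.Near σ τ κ)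
    (hτ' : D.Near σ τ' κ) (i : Fin (q + 1)) (β : Fin p → ℝ) (w : D.Noise → ℝ) :
    |D.score meth τ (D.X *ᵥ β + D.H σ *ᵥ w) i - D.score meth τ' (D.X *ᵥ β + D.H σ *ᵥ w) i
        - ∑ j, D.hess meth σ i j * (τ j - τ' j)|
      ≤ D.d σ i * ((1 + 8 * κ + 2 * κ * c₁ ^ 2) *
          (1 + D.scaledL1 σ τ + D.scaledL1 σ τ') / D.dstar σ) * D.ctrl σ w
        * ∑ j, D.d σ j * |τ j - τ' j| := by
  have hP := D.isResolvent_P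
  have hL := D.isResolvent_Lam meth
  have hκ0 := kappa_pos hσ hκ
  have hds : 0 < D.dstar σ := by linarith
  have hpd := posDef_of_half_le (D := D) hσ hτ.half_le
  have hpd' := posDef_of_half_le (D := D) hσ hτ'.half_le
  have hU := one_le_ctrl (D := D) (σ := σ) w
  rw [score_sub meth hpd hpd', ← Finset.sum_sub_distrib, Finset.mul_sum]
  refine (Finset.abs_sum_le_sum_abs _ _).trans (Finset.sum_le_sum fun j _ => ?_)
  rw [quad_five hσ hpd hpd', quad_five hσ hpd' hpd]
  have T1 := trace_increment_le hσ hκ h1 hL hc₁ hτ hτ' i j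
  have T2 := quad_increment_le hσ hκ h1 hτ hτ' i j w
  have T3 := quad_increment_le hσ hκ h1 hτ' hτ j i w
  have s1 : 0 ≤ D.scaledL1 σ τ := scaledL1_nonneg
  have s2 : 0 ≤ D.scaledL1 σ τ' := scaledL1_nonneg
  have di : 0 ≤ D.d σ i := d_nonneg i
  have dj : 0 ≤ D.d σ j := d_nonneg j
  set t1 := (D.Lam meth τ * D.V j * D.Lam meth τ' * D.V i).trace
  set t2 := (D.Bm σ D.P j *ᵥ (D.Gam σ D.P τ *ᵥ w)) ⬝ᵥ
        (D.Gam σ D.P τ' *ᵥ (D.Bm σ D.P i *ᵥ (D.Gam σ D.P τ *ᵥ w)))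
  set t3 := (D.Bm σ D.P i *ᵥ (D.Gam σ D.P τ' *ᵥ w)) ⬝ᵥ
        (D.Gam σ D.P τ *ᵥ (D.Bm σ D.P j *ᵥ (D.Gam σ D.P τ' *ᵥ w)))
  rw [Matrix.trace_mul_comm (D.Bm σ D.P i)] at T3
  have e : (τ j - τ' j) * (1 / 2 * t1 - 1 / 2 * (t2 + t3)) - D.hess meth σ i j * (τ j - τ' j)
      = (τ j - τ' j) * (1 / 2 * (t1 - (D.Bm σ (D.Lam meth) j * D.Bm σ (D.Lam meth) i).trace)
        - 1 / 2 * (t2 - (D.Bm σ D.P j * D.Bm σ D.P i).trace)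
        - 1 / 2 * (t3 - (D.Bm σ D.P j * D.Bm σ D.P i).trace)) := by
    rw [hess, Matrix.of_apply, Matrix.trace_mul_comm (D.Bm σ (D.Lam meth) i),
      Matrix.trace_mul_comm (D.Bm σ D.P i)]
    ring
  rw [e, abs_mul]
  set u1 := t1 - (D.Bm σ (D.Lam meth) j * D.Bm σ (D.Lam meth) i).trace
  set u2 := t2 - (D.Bm σ D.P j * D.Bm σ D.P i).trace
  set u3 := t3 - (D.Bm σ D.P j * D.Bm σ D.P i).trace
  have hb : |1 / 2 * u1 - 1 / 2 * u2 - 1 / 2 * u3| ≤ 1 / 2 * |u1| + 1 / 2 * |u2| + 1 / 2 * |u3| := by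
    have a1 := abs_sub (1 / 2 * u1 - 1 / 2 * u2) (1 / 2 * u3)
    have a2 := abs_sub (1 / 2 * u1) (1 / 2 * u2)
    rw [abs_mul, abs_mul, abs_of_pos (by norm_num : (0 : ℝ) < 1 / 2)] at a2
    rw [abs_mul (1 / 2) u3, abs_of_pos (by norm_num : (0 : ℝ) < 1 / 2)] at a1
    linarith
  set N := D.scaledL1 σ τ
  set N' := D.scaledL1 σ τ'
  set U := D.ctrl σ w
  have hX : 1 / 2 * |u1| + 1 / 2 * |u2| + 1 / 2 * |u3|
      ≤ D.d σ i * ((1 + 8 * κ + 2 * κ * c₁ ^ 2) * (1 + N + N') / D.dstar σ) * U * D.d σ j := by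
    have k1 : |u1| ≤ D.d σ i * D.d σ j / D.dstar σ * U * (4 * κ * c₁ ^ 2 * (N + N')) := by
      refine T1.trans ?_
      have : c₁ ^ 2 * (D.d σ i * D.d σ j) * (4 * κ * (N + N') / D.dstar σ)
        = D.d σ i * D.d σ j / D.dstar σ * 1 * (4 * κ * c₁ ^ 2 * (N + N')) := by ring
      rw [this]
      gcongr
    have k2 : |u2| ≤ D.d σ i * D.d σ j / D.dstar σ * U * (1 + 8 * κ * (N + N')) :=
      T2.trans (le_of_eq (by ring))
    have k3 : |u3| ≤ D.d σ i * D.d σ j / D.dstar σ * U * (1 + 8 * κ * (N + N')) :=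
      T3.trans (le_of_eq (by ring))
    have k4 : 1 / 2 * |u1| + 1 / 2 * |u2| + 1 / 2 * |u3|
        ≤ D.d σ i * D.d σ j / D.dstar σ * U *
          (2 * κ * c₁ ^ 2 * (N + N') + (1 + 8 * κ * (N + N'))) := by linarith
    refine k4.trans ?_
    have k5 : D.d σ i * ((1 + 8 * κ + 2 * κ * c₁ ^ 2) * (1 + N + N') / D.dstar σ) * U * D.d σ j
      = D.d σ i * D.d σ j / D.dstar σ * U * ((1 + 8 * κ + 2 * κ * c₁ ^ 2) * (1 + N + N')) := by ring
    rw [k5]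
    have hU0 : 0 ≤ U := by linarith
    have hc0 : 0 ≤ κ * c₁ ^ 2 := by positivity
    refine mul_le_mul_of_nonneg_left ?_ (by positivity)
    have e6 : (1 + 8 * κ + 2 * κ * c₁ ^ 2) * (1 + N + N')
      = 2 * κ * c₁ ^ 2 * (N + N') + (1 + 8 * κ * (N + N'))
        + (N + N') + 8 * κ + 2 * (κ * c₁ ^ 2) := by ring
    linarith
  calc _ ≤ |τ j - τ' j| * (D.d σ i * ((1 + 8 * κ + 2 * κ * c₁ ^ 2) * (1 + N + N') / D.dstar σ) * U
        * D.d σ j) := mul_le_mul_of_nonneg_left (hb.trans hX) (abs_nonneg _)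
    _ = _ := by ring

end Design
end EmpBLUP

end

/-! ### The information matrix, and the comparison of ML with REML -/

noncomputable section
namespace EmpBLUP

set_option linter.unusedSectionVars false

open scoped Matrix.Norms.L2Operator

/-- A form that is coercive in scaled coordinates is invertible, and the entries of its inverse
are small. -/
theorem coercive_inv {n : ℕ} {N : Matrix (Fin n) (Fin n) ℝ} {d : Fin n → ℝ} {c : ℝ} (hc : 0 < c)
    (hd : ∀ i, 0 < d i) (h : ∀ x : Fin n → ℝ, c * ∑ i, (d i * x i) ^ 2 ≤ x ⬝ᵥ (N *ᵥ x)) :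
    N * N⁻¹ = 1 ∧ N⁻¹ * N = 1 ∧ ∀ i j, |N⁻¹ i j| ≤ 1 / (c * d i * d j) := by
  have hinj : Function.Injective N.mulVec := by
    intro x y hxy
    have h0 : N *ᵥ (x - y) = 0 := by rw [Matrix.mulVec_sub]; exact sub_eq_zero.2 hxy
    have h1 := h (x - y)
    rw [h0, dotProduct_zero] at h1
    have h2 : ∑ i, (d i * (x - y) i) ^ 2 = 0 :=
      le_antisymm (nonpos_of_mul_nonpos_right h1 hc) (Finset.sum_nonneg fun i _ => sq_nonneg _)
    ext i
    have h3 := (Finset.sum_eq_zero_iff_of_nonneg fun i _ => sq_nonneg _).1 h2 i (Finset.mem_univ i)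
    have h4 := (mul_eq_zero.1 (pow_eq_zero_iff two_ne_zero |>.1 h3)).resolve_left (hd i).ne'
    exact sub_eq_zero.1 h4
  have hu : IsUnit N.det := (Matrix.isUnit_iff_isUnit_det _).1 (Matrix.mulVec_injective_iff_isUnit.1 hinj)
  refine ⟨Matrix.mul_nonsing_inv _ hu, Matrix.nonsing_inv_mul _ hu, fun i j => ?_⟩
  -- Test coercivity on the `j`-th column `u` of the inverse, for which the form equals `u j`. This
  -- bounds `u j` first, and then every entry of the column.
  set u : Fin n → ℝ := N⁻¹ *ᵥ Pi.single j 1 with hud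
  have hNu : N *ᵥ u = Pi.single j 1 := by
    rw [hud, Matrix.mulVec_mulVec, Matrix.mul_nonsing_inv _ hu, Matrix.one_mulVec]
  have hui : ∀ i, u i = N⁻¹ i j := fun i => by simp [hud]
  have h1 := h u
  rw [hNu, dotProduct_single, mul_one] at h1
  have hs : ∀ i, (d i * u i) ^ 2 ≤ ∑ i, (d i * u i) ^ 2 := fun i =>
    Finset.single_le_sum (f := fun i => (d i * u i) ^ 2) (fun _ _ => sq_nonneg _) (Finset.mem_univ i)
  have hj := hd j
  have hi := hd i
  have h2 : c * (d j * u j) ^ 2 ≤ u j := (mul_le_mul_of_nonneg_left (hs j) hc.le).trans h1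
  have huj0 : 0 ≤ u j := le_trans (by positivity) h2
  have huj : u j ≤ 1 / (c * d j ^ 2) := by
    rcases huj0.eq_or_lt with h0 | h0
    · rw [← h0]; positivity
    · rw [le_div_iff₀ (by positivity)]
      refine le_of_mul_le_mul_right (a := u j) ?_ h0
      calc u j * (c * d j ^ 2) * u j = c * (d j * u j) ^ 2 := by ring
        _ ≤ 1 * u j := by rw [one_mul]; exact h2
  have h3 : (d i * u i) ^ 2 ≤ (1 / (c * d j)) ^ 2 := by
    have h4 : c * (d i * u i) ^ 2 ≤ 1 / (c * d j ^ 2) :=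
      (mul_le_mul_of_nonneg_left (hs i) hc.le).trans (h1.trans huj)
    refine le_of_mul_le_mul_left (a := c) ?_ hc
    refine h4.trans (le_of_eq ?_)
    field_simp
  have h5 := abs_le_of_sq_le_sq h3 (by positivity)
  have h6 : |d i * u i| ≤ 1 / (c * d j) := h5
  rw [abs_mul, abs_of_pos hi, hui] at h6
  have e : 1 / (c * d i * d j) = 1 / (c * d j) / d i := by field_simp
  rw [e, le_div_iff₀ hi, mul_comm]
  exact h6

/-- Compression by `Q` is undone one side at a time, so that the defect `R - Q` stands as a factor
in each trace. In the application it is the projection onto the whitened fixed effects, of rank `p`.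
-/
theorem trace_sub_compression {a : Type} [Fintype a] {Q R S T : Matrix a a ℝ} (hQ : Q * Q = Q)
    (hS : R * S = S) (hT : R * T = T) :
    (S * T).trace - (Q * S * Q * (Q * T * Q)).trace
      = ((R - Q) * (S * T)).trace + ((R - Q) * (T * Q * S)).trace := by
  have a1 : (Q * S * Q * (Q * T * Q)).trace = (Q * S * Q * T).trace := by
    have : Q * S * Q * (Q * T * Q) = (Q * S * (Q * Q) * T) * Q := by simp only [Matrix.mul_assoc]
    rw [this, hQ, Matrix.trace_mul_comm]
    have : Q * (Q * S * Q * T) = (Q * Q) * S * Q * T := by simp only [Matrix.mul_assoc]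
    rw [this, hQ]
  have a2 : (R - Q) * (S * T) = S * T - Q * S * T := by
    rw [Matrix.sub_mul, ← Matrix.mul_assoc, hS, ← Matrix.mul_assoc]
  have a3 : (R - Q) * (T * Q * S) = T * (Q * S) - (Q * T) * (Q * S) := by
    rw [Matrix.sub_mul, ← Matrix.mul_assoc, ← Matrix.mul_assoc, hT]
    simp only [Matrix.mul_assoc]
  rw [a1, a2, a3, Matrix.trace_sub, Matrix.trace_sub, Matrix.trace_mul_comm T,
    Matrix.trace_mul_comm (Q * T), ← Matrix.mul_assoc (Q * S) Q T]
  ring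

namespace Design

variable {p q : ℕ} {D : Design p q} {σ τ τ' : Param q}

variable (D) in
/-- The whitened projection onto the fixed effects. -/
def fixProj (σ : Param q) : Matrix D.Noise D.Noise ℝ :=
  D.Gam σ (fun τ => (D.cov τ)⁻¹) σ - D.Gam σ D.P σ

section

variable (hσ : ∀ i, 0 < σ i)
include hσ

theorem fixProj_eq : D.fixProj σ
    = (D.H σ)ᵀ * ((D.cov σ)⁻¹ * D.X * D.M σ * D.Xᵀ * (D.cov σ)⁻¹) * D.H σ := by
  rw [fixProj, Gam, Gam, ← Matrix.sub_mul, ← Matrix.mul_sub, cov_inv_sub_P]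

theorem fixProj_transpose : (D.fixProj σ)ᵀ = D.fixProj σ := by
  rw [fixProj, Matrix.transpose_sub, D.isResolvent_inv.Gam_transpose hσ (D.isResolvent_inv.pd hσ),
    D.isResolvent_P.Gam_transpose hσ (D.isResolvent_P.pd hσ)]

theorem inv_mul_cov_mul_P : (D.cov σ)⁻¹ * D.cov σ * D.P σ = D.P σ := by
  rw [cov_inv_mul (D.isResolvent_P.pd hσ), Matrix.one_mul]

theorem projInv_mul_proj :
    D.Gam σ (fun τ => (D.cov τ)⁻¹) σ * D.Gam σ D.P σ = D.Gam σ D.P σ := by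
  calc _ = (D.H σ)ᵀ * ((D.cov σ)⁻¹ * (D.H σ * (D.H σ)ᵀ) * D.P σ) * D.H σ := by
        simp only [Gam, Matrix.mul_assoc]
    _ = _ := by rw [H_mul_transpose hσ, inv_mul_cov_mul_P hσ]; rfl

theorem proj_mul_projInv :
    D.Gam σ D.P σ * D.Gam σ (fun τ => (D.cov τ)⁻¹) σ = D.Gam σ D.P σ := by
  have := congrArg Matrix.transpose (projInv_mul_proj (D := D) hσ)
  rwa [Matrix.transpose_mul, D.isResolvent_inv.Gam_transpose hσ (D.isResolvent_inv.pd hσ),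
    D.isResolvent_P.Gam_transpose hσ (D.isResolvent_P.pd hσ)] at this

theorem fixProj_mul_self : D.fixProj σ * D.fixProj σ = D.fixProj σ := by
  rw [fixProj, Matrix.sub_mul, Matrix.mul_sub, Matrix.mul_sub, projInv_mul_proj hσ,
    proj_mul_projInv hσ, D.isResolvent_P.Gam_mul_Gam hσ (D.isResolvent_P.pd hσ),
    D.isResolvent_inv.Gam_mul_Gam hσ (D.isResolvent_inv.pd hσ)]
  abel

theorem trace_fixProj : (D.fixProj σ).trace = p := by
  rw [fixProj_eq hσ, Matrix.mul_assoc, Matrix.trace_mul_comm]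
  have hpd := D.isResolvent_P.pd hσ
  have e1 : (D.cov σ)⁻¹ * D.X * D.M σ * D.Xᵀ * (D.cov σ)⁻¹ * D.H σ * (D.H σ)ᵀ
      = (D.cov σ)⁻¹ * D.X * (D.M σ * D.Xᵀ * ((D.cov σ)⁻¹ * (D.H σ * (D.H σ)ᵀ))) := by
    simp only [Matrix.mul_assoc]
  rw [e1, H_mul_transpose hσ, cov_inv_mul hpd, Matrix.mul_one, Matrix.trace_mul_comm]
  have e2 : D.M σ * D.Xᵀ * ((D.cov σ)⁻¹ * D.X) = D.M σ * (D.Xᵀ * (D.cov σ)⁻¹ * D.X) := by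
    simp only [Matrix.mul_assoc]
  rw [e2, M_mul_info hpd]; simp

/-- A projection of trace `p` has squared Frobenius norm `p`; inserting it twice gives a bound that
involves `p` and not the dimension of the noise. -/
theorem abs_trace_fixProj_mul_le (Y : Matrix D.Noise D.Noise ℝ) :
    |(D.fixProj σ * Y).trace| ≤ p * ‖Y‖ := by
  have hf : fro (D.fixProj σ) ^ 2 = p := by
    rw [fro_sq, fixProj_transpose hσ, fixProj_mul_self hσ, trace_fixProj hσ]
  have e : (D.fixProj σ * Y).trace = (D.fixProj σ * (D.fixProj σ * Y)).trace := by
    rw [← Matrix.mul_assoc, fixProj_mul_self hσ]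
  rw [e]
  refine (abs_trace_mul_le _ _).trans ?_
  calc _ ≤ fro (D.fixProj σ) * (fro (D.fixProj σ) * ‖Y‖) :=
        mul_le_mul_of_nonneg_left (fro_mul_le' _ _) (fro_nonneg _)
    _ = fro (D.fixProj σ) ^ 2 * ‖Y‖ := by ring
    _ = _ := by rw [hf]

/-- From `P = P Σ Σ⁻¹ = Σ⁻¹ Σ P`: the REML matrices are the compressions of the ML matrices to the
error contrasts. -/
theorem Bm_P_eq (i : Fin (q + 1)) : D.Bm σ D.P i
    = D.Gam σ D.P σ * D.Bm σ (fun τ => (D.cov τ)⁻¹) i * D.Gam σ D.P σ := by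
  have hpd := D.isResolvent_P.pd hσ
  calc _ = (D.H σ)ᵀ * (D.P σ * D.cov σ * (D.cov σ)⁻¹) * D.V i * ((D.cov σ)⁻¹ * D.cov σ * D.P σ)
          * D.H σ := by
        rw [inv_mul_cov_mul_P hσ, Matrix.mul_assoc (D.P σ), cov_mul_inv hpd, Matrix.mul_one]; rfl
    _ = (D.H σ)ᵀ * (D.P σ * (D.H σ * (D.H σ)ᵀ) * (D.cov σ)⁻¹) * D.V i
          * ((D.cov σ)⁻¹ * (D.H σ * (D.H σ)ᵀ) * D.P σ) * D.H σ := by rw [H_mul_transpose hσ]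
    _ = _ := by simp only [Gam, Bm, Matrix.mul_assoc]

variable {κ : ℝ} (hκ : ∀ i, 1 / σ i ≤ κ)
include hκ

theorem abs_trace_sub_le (i : Fin (q + 1)) :
    |(D.Bm σ (fun τ => (D.cov τ)⁻¹) i).trace - (D.Bm σ D.P i).trace| ≤ p * κ := by
  have hR := D.isResolvent_inv
  have e : (D.Bm σ (fun τ => (D.cov τ)⁻¹) i).trace - (D.Bm σ D.P i).trace
      = (D.fixProj σ * D.Bm σ (fun τ => (D.cov τ)⁻¹) i).trace := by
    rw [fixProj, Matrix.sub_mul, Matrix.trace_sub, hR.proj_mul_Bm hσ, Bm_P_eq hσ,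
      Matrix.trace_mul_comm, ← Matrix.mul_assoc, D.isResolvent_P.Gam_mul_Gam hσ
        (D.isResolvent_P.pd hσ)]
  rw [e]
  refine (abs_trace_fixProj_mul_le hσ _).trans ?_
  exact mul_le_mul_of_nonneg_left ((hR.opNorm_Bm_le hσ i).trans (hκ i)) (Nat.cast_nonneg p)

theorem abs_trace_mul_sub_le (i j : Fin (q + 1)) :
    |(D.Bm σ (fun τ => (D.cov τ)⁻¹) i * D.Bm σ (fun τ => (D.cov τ)⁻¹) j).trace
      - (D.Bm σ D.P i * D.Bm σ D.P j).trace| ≤ 2 * p * κ ^ 2 := by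
  have hR := D.isResolvent_inv
  have hP := D.isResolvent_P
  have hQQ := hP.Gam_mul_Gam hσ (hP.pd hσ)
  have hκ0 := kappa_pos hσ hκ
  set C : Fin (q + 1) → Matrix D.Noise D.Noise ℝ := D.Bm σ (fun τ => (D.cov τ)⁻¹) with hC
  set Q := D.Gam σ D.P σ with hQ
  have hCn : ∀ i, ‖C i‖ ≤ κ := fun i => (hR.opNorm_Bm_le hσ i).trans (hκ i)
  have hQn : ‖Q‖ ≤ 1 := hP.opNorm_proj_le hσ
  have e : (C i * C j).trace - (D.Bm σ D.P i * D.Bm σ D.P j).trace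
      = (D.fixProj σ * (C i * C j)).trace + (D.fixProj σ * (C j * Q * C i)).trace := by
    rw [Bm_P_eq hσ, Bm_P_eq hσ]
    exact trace_sub_compression hQQ (hR.proj_mul_Bm hσ i) (hR.proj_mul_Bm hσ j)
  rw [e]
  have b1 : ‖C i * C j‖ ≤ κ ^ 2 := by
    refine (norm_mul_le _ _).trans ?_
    rw [sq]
    exact mul_le_mul (hCn i) (hCn j) (norm_nonneg _) hκ0.le
  have b2 : ‖C j * Q * C i‖ ≤ κ ^ 2 := by
    refine (norm_mul_le _ _).trans ?_
    rw [sq]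
    refine mul_le_mul ?_ (hCn i) (norm_nonneg _) hκ0.le
    refine (norm_mul_le _ _).trans ?_
    calc ‖C j‖ * ‖Q‖ ≤ κ * 1 := mul_le_mul (hCn j) hQn (norm_nonneg _) hκ0.le
      _ = κ := mul_one _
  have hp : (0 : ℝ) ≤ p := Nat.cast_nonneg p
  refine (abs_add_le _ _).trans ?_
  have c1 := (abs_trace_fixProj_mul_le (D := D) hσ (C i * C j)).trans
    (mul_le_mul_of_nonneg_left b1 hp)
  have c2 := (abs_trace_fixProj_mul_le (D := D) hσ (C j * Q * C i)).trans
    (mul_le_mul_of_nonneg_left b2 hp)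
  linarith

theorem abs_trace_Lam_sub_le (meth : Method) (i : Fin (q + 1)) :
    |(D.Bm σ (D.Lam meth) i).trace - (D.Bm σ D.P i).trace| ≤ p * κ := by
  have hκ0 := kappa_pos hσ hκ
  cases meth
  · simp only [Lam, sub_self, abs_zero]; positivity
  · exact abs_trace_sub_le hσ hκ i

theorem abs_trace_Lam_mul_sub_le (meth : Method) (i j : Fin (q + 1)) :
    |(D.Bm σ (D.Lam meth) i * D.Bm σ (D.Lam meth) j).trace
      - (D.Bm σ D.P i * D.Bm σ D.P j).trace| ≤ 2 * p * κ ^ 2 := by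
  cases meth
  · simp only [Lam, sub_self, abs_zero]; positivity
  · exact abs_trace_mul_sub_le hσ hκ i j

/-- The squared norm exceeds `d_i ^ 2` by at most a constant, which is absorbed because `d_i ≥ 1`.
-/
theorem fro_Lam_le (meth : Method) (h1 : 1 ≤ D.dstar σ) (i : Fin (q + 1)) :
    fro (D.Bm σ (D.Lam meth) i) ≤ (1 + 2 * p * κ ^ 2) * D.d σ i := by
  have hL := D.isResolvent_Lam meth
  have hP := D.isResolvent_P
  have hd : 1 ≤ D.d σ i := h1.trans (dstar_le i)
  have hc : (0 : ℝ) ≤ 2 * p * κ ^ 2 := by positivity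
  rw [← sq_le_sq₀ (fro_nonneg _) (by positivity), fro_sq, hL.Bm_transpose hσ]
  have h2 := (abs_le.1 (abs_trace_Lam_mul_sub_le (D := D) hσ hκ meth i i)).2
  have h3 : (D.Bm σ D.P i * D.Bm σ D.P i).trace = D.d σ i ^ 2 := by
    rw [← fro_Bm hσ, fro_sq, hP.Bm_transpose hσ]
  rw [h3] at h2
  have h4 : 1 ≤ D.d σ i ^ 2 := one_le_pow₀ hd
  have h5 : 2 * p * κ ^ 2 ≤ (2 * p * κ ^ 2) * D.d σ i ^ 2 := le_mul_of_one_le_right hc h4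
  rw [mul_pow]
  have h6 : (1 + 2 * p * κ ^ 2) ^ 2 * D.d σ i ^ 2
      = D.d σ i ^ 2 + (2 * p * κ ^ 2) * D.d σ i ^ 2 + (2 * p * κ ^ 2) * D.d σ i ^ 2
        + (2 * p * κ ^ 2) ^ 2 * D.d σ i ^ 2 := by ring
  rw [h6]
  have h7 : 0 ≤ (2 * p * κ ^ 2) * D.d σ i ^ 2 := by positivity
  have h8 : 0 ≤ (2 * p * κ ^ 2) ^ 2 * D.d σ i ^ 2 := by positivity
  linarith

/-- Minus the expected Hessian is half the matrix of traces for `P`, minus half the bounded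
difference between the ML and REML traces. The first part is coercive by identifiability; `hbig`
lets the second consume half of the constant, whence `c / 4`. -/
theorem neg_hess_coercive (meth : Method) {c : ℝ} (h1 : 1 ≤ D.dstar σ)
    (hcor : ∀ x : Fin (q + 1) → ℝ, c * (x ⬝ᵥ x) ≤ x ⬝ᵥ (D.cor σ *ᵥ x))
    (hbig : 4 * p * κ ^ 2 * (q + 1) ≤ c * D.dstar σ ^ 2) (x : Fin (q + 1) → ℝ) :
    c / 4 * ∑ i, (D.d σ i * x i) ^ 2 ≤ x ⬝ᵥ ((-D.hess meth σ) *ᵥ x) := by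
  have hP := D.isResolvent_P
  have hd : ∀ i, 0 < D.d σ i := fun i => by linarith [dstar_le (D := D) (σ := σ) i]
  set S := ∑ i, (D.d σ i * x i) ^ 2 with hS
  have h2 := hcor fun i => D.d σ i * x i
  have e1 : (fun i => D.d σ i * x i) ⬝ᵥ (D.cor σ *ᵥ fun i => D.d σ i * x i)
      = ∑ i, ∑ j, x i * x j * (D.Bm σ D.P i * D.Bm σ D.P j).trace := by
    simp only [dotProduct, Matrix.mulVec, Finset.mul_sum, cor, Matrix.of_apply]
    refine Finset.sum_congr rfl fun i _ => Finset.sum_congr rfl fun j _ => ?_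
    rw [hP.trace_Bm_mul_Bm hσ]
    have := (hd i).ne'; have := (hd j).ne'
    field_simp
  have e2 : (fun i => D.d σ i * x i) ⬝ᵥ (fun i => D.d σ i * x i) = S := by
    simp [dotProduct, hS, sq]
  rw [e1, e2] at h2
  have e3 : x ⬝ᵥ ((-D.hess meth σ) *ᵥ x)
      = 1 / 2 * ∑ i, ∑ j, x i * x j * (D.Bm σ D.P i * D.Bm σ D.P j).trace
        - 1 / 2 * ∑ i, ∑ j, x i * x j *
          ((D.Bm σ (D.Lam meth) i * D.Bm σ (D.Lam meth) j).trace
            - (D.Bm σ D.P i * D.Bm σ D.P j).trace) := by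
    simp only [dotProduct, Matrix.mulVec, Finset.mul_sum, hess, Matrix.of_apply, Matrix.neg_apply]
    rw [← Finset.sum_sub_distrib]
    refine Finset.sum_congr rfl fun i _ => ?_
    rw [← Finset.sum_sub_distrib]
    exact Finset.sum_congr rfl fun j _ => by ring
  have hsq : D.dstar σ ^ 2 * ∑ i, x i ^ 2 ≤ S := by
    rw [hS, Finset.mul_sum]
    refine Finset.sum_le_sum fun i _ => ?_
    rw [mul_pow]
    have : D.dstar σ ^ 2 ≤ D.d σ i ^ 2 := pow_le_pow_left₀ (by linarith) (dstar_le i) 2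
    exact mul_le_mul_of_nonneg_right this (sq_nonneg _)
  have h4 : ∑ i, ∑ j, x i * x j *
          ((D.Bm σ (D.Lam meth) i * D.Bm σ (D.Lam meth) j).trace
            - (D.Bm σ D.P i * D.Bm σ D.P j).trace) ≤ 2 * p * κ ^ 2 * ((q + 1) * ∑ i, x i ^ 2) := by
    have h5 : (∑ i, |x i|) ^ 2 ≤ (q + 1) * ∑ i, x i ^ 2 := by
      have := sq_sum_le_card_mul_sum_sq (s := Finset.univ) (f := fun i => |x i|)
      simpa using this
    refine le_trans ?_ (mul_le_mul_of_nonneg_left h5 (by positivity))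
    rw [sq (∑ i, |x i|), Finset.sum_mul_sum, Finset.mul_sum]
    refine Finset.sum_le_sum fun i _ => ?_
    rw [Finset.mul_sum]
    refine Finset.sum_le_sum fun j _ => ?_
    refine (le_abs_self _).trans ?_
    rw [abs_mul, abs_mul, mul_comm (2 * p * κ ^ 2)]
    exact mul_le_mul_of_nonneg_left (abs_trace_Lam_mul_sub_le hσ hκ meth i j) (by positivity)
  have h6 : 2 * p * κ ^ 2 * ((q + 1) * ∑ i, x i ^ 2) ≤ c / 2 * S := by
    have hx : 0 ≤ ∑ i, x i ^ 2 := Finset.sum_nonneg fun i _ => sq_nonneg _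
    have h7 := mul_le_mul_of_nonneg_right hbig hx
    have hc0 : 0 ≤ c := by
      have : (0 : ℝ) ≤ 4 * p * κ ^ 2 * (q + 1) := by positivity
      have h8 := this.trans hbig
      exact nonneg_of_mul_nonneg_left h8 (by positivity)
    have h9 := mul_le_mul_of_nonneg_left hsq hc0
    linarith
  rw [e3]
  linarith

end

end Design
end EmpBLUP

end

/-! ### Derivatives with respect to the variance components -/

noncomputable section
namespace EmpBLUP

set_option linter.unusedSectionVars false

section Pderivs

variable {q : ℕ}

/-- The function `f` is differentiable at `τ`, with partial derivatives `g`. -/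
def HasPderivs (f : Param q → ℝ) (g : Fin (q + 1) → ℝ) (τ : Param q) : Prop :=
  HasFDerivAt f (∑ i, g i • (EuclideanSpace.proj i : Param q →L[ℝ] ℝ)) τ

theorem HasPderivs.pderiv_eq {f : Param q → ℝ} {g : Fin (q + 1) → ℝ} {τ : Param q}
    (h : HasPderivs f g τ) (i : Fin (q + 1)) : pderiv i f τ = g i := by
  rw [pderiv, HasFDerivAt.fderiv h]
  simp [PiLp.single_apply]

theorem HasPderivs.fderiv_apply {f : Param q → ℝ} {g : Fin (q + 1) → ℝ} {τ : Param q}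
    (h : HasPderivs f g τ) (x : Param q) : fderiv ℝ f τ x = ∑ i, x i * g i := by
  rw [HasFDerivAt.fderiv h]
  simp [mul_comm]

theorem HasPderivs.fderiv_eq_zero_iff {f : Param q → ℝ} {g : Fin (q + 1) → ℝ} {τ : Param q}
    (h : HasPderivs f g τ) : fderiv ℝ f τ = 0 ↔ ∀ i, g i = 0 := by
  constructor
  · intro h0 i
    rw [← h.pderiv_eq i, pderiv, h0]; rfl
  · intro h0
    ext x
    rw [h.fderiv_apply]
    simp [h0]

theorem hasPderivs_of_differentiableAt {f : Param q → ℝ} {g : Fin (q + 1) → ℝ} {τ : Param q}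
    (hf : DifferentiableAt ℝ f τ)
    (hg : ∀ i, HasDerivAt (fun s : ℝ => f (τ + s • EuclideanSpace.single i 1)) (g i) 0) :
    HasPderivs f g τ := by
  have e : fderiv ℝ f τ = ∑ i, g i • (EuclideanSpace.proj i : Param q →L[ℝ] ℝ) := by
    have hi : ∀ i, fderiv ℝ f τ (EuclideanSpace.single i 1) = g i := fun i =>
      (hf.hasFDerivAt.hasLineDerivAt (EuclideanSpace.single i 1)).unique (hg i)
    ext x
    have hx : x = ∑ i, x i • (EuclideanSpace.single i 1 : Param q) := by
      ext j; simp [Pi.single_apply]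
    conv_lhs => rw [hx]
    rw [map_sum]
    simp [hi, mul_comm]
  rw [HasPderivs, ← e]
  exact hf.hasFDerivAt

/-- Carathéodory's criterion: exact slopes that are continuous at the point give the derivative. Fed
with the resolvent identity, it avoids differentiating a matrix inverse. -/
theorem hasPderivs_of_slope {f : Param q → ℝ} {φ : Fin (q + 1) → Param q → ℝ} {τ : Param q}
    (hf : ∀ᶠ τ' in 𝓝 τ, f τ' - f τ = ∑ i, (τ' i - τ i) * φ i τ')
    (hφ : ∀ i, ContinuousAt (φ i) τ) : HasPderivs f (fun i => φ i τ) τ := by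
  rw [HasPderivs, hasFDerivAt_iff_isLittleO]
  have h1 : (fun τ' : Param q => ∑ i, (τ' i - τ i) * (φ i τ' - φ i τ))
      =o[𝓝 τ] fun τ' => τ' - τ := by
    refine Asymptotics.IsLittleO.fun_sum (A := fun i τ' => (τ' i - τ i) * (φ i τ' - φ i τ)) fun i _ => ?_
    have ha : (fun τ' : Param q => τ' i - τ i) =O[𝓝 τ] fun τ' => τ' - τ :=
      IsBigO.of_bound (g := fun τ' : Param q => τ' - τ) 1 (Eventually.of_forall fun τ' => by
        rw [one_mul]; exact PiLp.norm_apply_le (τ' - τ) i)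
    have hb : (fun τ' : Param q => φ i τ' - φ i τ) =o[𝓝 τ] fun _ => (1 : ℝ) := by
      rw [isLittleO_one_iff]
      have := (hφ i).tendsto.sub_const (φ i τ)
      rwa [sub_self] at this
    have := ha.norm_right.mul_isLittleO hb
    simp only [mul_one] at this
    exact this.of_norm_right
  refine h1.congr' ?_ EventuallyEq.rfl
  filter_upwards [hf] with τ' h
  rw [h, _root_.sum_apply, ← Finset.sum_sub_distrib]
  refine Finset.sum_congr rfl fun i _ => ?_
  simp only [_root_.smul_apply, PiLp.proj_apply, PiLp.sub_apply, smul_eq_mul]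
  ring

theorem HasPderivs.add {f f' : Param q → ℝ} {g g' : Fin (q + 1) → ℝ} {τ : Param q}
    (h : HasPderivs f g τ) (h' : HasPderivs f' g' τ) :
    HasPderivs (fun x => f x + f' x) (fun i => g i + g' i) τ := by
  have := HasFDerivAt.add h h'
  rw [HasPderivs]
  refine this.congr_fderiv ?_
  simp only [add_smul, Finset.sum_add_distrib]

theorem HasPderivs.const_mul {f : Param q → ℝ} {g : Fin (q + 1) → ℝ} {τ : Param q}
    (h : HasPderivs f g τ) (c : ℝ) : HasPderivs (fun x => c * f x) (fun i => c * g i) τ := by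
  have := HasFDerivAt.const_mul h c
  rw [HasPderivs]
  refine this.congr_fderiv ?_
  simp only [mul_smul, Finset.smul_sum]

theorem eventually_pos {τ : Param q} (hτ : ∀ i, 0 < τ i) : ∀ᶠ τ' in 𝓝 τ, ∀ i, 0 < τ' i := by
  rw [eventually_all]
  intro i
  have : ContinuousAt (fun τ' : Param q => τ' i) τ := by fun_prop
  exact this.eventually (lt_mem_nhds (hτ i))

end Pderivs

section Cont

variable {S : Type*} [TopologicalSpace S] {x : S} {a b c : Type*} [Fintype a] [Fintype b] [Fintype c]

theorem continuousAt_matrix_mul {A : S → Matrix a b ℝ} {B : S → Matrix b c ℝ}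
    (hA : ContinuousAt A x) (hB : ContinuousAt B x) : ContinuousAt (fun s => A s * B s) x :=
  (continuous_fst.matrix_mul continuous_snd : Continuous fun z : Matrix a b ℝ × Matrix b c ℝ =>
    z.1 * z.2).continuousAt.comp (hA.prodMk hB)

theorem continuousAt_matrix_mulVec {A : S → Matrix a b ℝ} {v : S → b → ℝ}
    (hA : ContinuousAt A x) (hv : ContinuousAt v x) : ContinuousAt (fun s => A s *ᵥ v s) x :=
  (continuous_fst.matrix_mulVec continuous_snd : Continuous fun z : Matrix a b ℝ × (b → ℝ) =>
    z.1 *ᵥ z.2).continuousAt.comp (hA.prodMk hv)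

theorem continuousAt_dotProduct {u v : S → b → ℝ}
    (hu : ContinuousAt u x) (hv : ContinuousAt v x) : ContinuousAt (fun s => u s ⬝ᵥ v s) x :=
  (continuous_fst.dotProduct continuous_snd : Continuous fun z : (b → ℝ) × (b → ℝ) =>
    z.1 ⬝ᵥ z.2).continuousAt.comp (hu.prodMk hv)

theorem continuousAt_matrix_trace {A : S → Matrix b b ℝ} (hA : ContinuousAt A x) :
    ContinuousAt (fun s => (A s).trace) x :=
  (continuous_id.matrix_trace : Continuous fun z : Matrix b b ℝ => z.trace).continuousAt.comp hA

theorem continuousAt_matrix_inv_of_posDef [DecidableEq b] {A : S → Matrix b b ℝ}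
    (hA : ContinuousAt A x) (h : (A x).PosDef) : ContinuousAt (fun s => (A s)⁻¹) x := by
  refine ContinuousAt.comp (f := A) (g := fun B => B⁻¹) (continuousAt_matrix_inv _ ?_) hA
  rw [Ring.inverse_eq_inv']
  exact continuousAt_inv₀ h.det_pos.ne'

end Cont

section LogDet

variable {q : ℕ} {b : Type*} [Fintype b] [DecidableEq b]

/-- Jacobi's formula. The determinant is a polynomial in the parameter, hence differentiable, and
along a coordinate line it factors as a constant times `det (1 + s C)`. -/
theorem hasPderivs_log_det (N : Fin (q + 1) → Matrix b b ℝ) {τ : Param q}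
    (h : (∑ i, τ i • N i).PosDef) :
    HasPderivs (fun τ' => Real.log (∑ i, τ' i • N i).det)
      (fun i => ((∑ i, τ i • N i)⁻¹ * N i).trace) τ := by
  have hd : (∑ i, τ i • N i).det ≠ 0 := h.det_pos.ne'
  have hdiff : DifferentiableAt ℝ (fun τ' : Param q => (∑ i, τ' i • N i).det) τ := by
    simp only [Matrix.det_apply]
    refine DifferentiableAt.fun_sum fun s _ => DifferentiableAt.const_smul ?_ _
    simp only [Matrix.sum_apply, Matrix.smul_apply, smul_eq_mul]
    fun_prop
  refine hasPderivs_of_differentiableAt (hdiff.log hd) fun i => ?_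
  have e : ∀ s : ℝ, (∑ j, (τ + s • (EuclideanSpace.single i 1 : Param q)) j • N j).det
      = (∑ i, τ i • N i).det * (1 + s • ((∑ i, τ i • N i)⁻¹ * N i)).det := fun s => by
    rw [← Matrix.det_mul, Matrix.mul_add, Matrix.mul_one, Matrix.mul_smul, ← Matrix.mul_assoc,
      Matrix.mul_nonsing_inv _ (isUnit_iff_ne_zero.2 hd), Matrix.one_mul]
    congr 1
    simp [PiLp.single_apply, add_smul, Finset.sum_add_distrib]
  simp only [e]
  set C := (∑ i, τ i • N i)⁻¹ * N i with hC
  have hder : HasDerivAt (fun s : ℝ => (1 + s • C).det) C.trace 0 := by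
    have h1 : HasDerivAt (fun s : ℝ => 1 + C.trace * s) C.trace 0 := by
      simpa using ((hasDerivAt_id (0 : ℝ)).const_mul C.trace).const_add 1
    -- `Matrix.det_one_add_smul` writes the determinant as `1 + s tr C` plus `s ^ 2` times a
    -- polynomial; the last term has derivative zero at `s = 0`.
    have h2 := ((Polynomial.hasDerivAt (Matrix.det (1 + (Polynomial.X : Polynomial ℝ) •
      C.map Polynomial.C)).divX.divX (0 : ℝ))).mul ((hasDerivAt_id (0 : ℝ)).pow 2)
    have h3 := h1.add h2
    have h4 := h3.congr_of_eventuallyEq (f₁ := fun s : ℝ => (1 + s • C).det)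
      (Eventually.of_forall fun s => Matrix.det_one_add_smul s C)
    exact h4.congr_deriv (by simp)
  have h0 : (1 + (0 : ℝ) • C).det = 1 := by simp
  have h4 := (hder.const_mul (∑ i, τ i • N i).det).log (by rw [h0, mul_one]; exact hd)
  rw [h0, mul_one] at h4
  convert h4 using 1
  field_simp

end LogDet

namespace Design

variable {p q : ℕ} {D : Design p q} {τ τ' : Param q}

theorem continuous_cov : Continuous D.cov := by
  unfold cov
  fun_prop

theorem continuousAt_cov_inv (h : (D.cov τ).PosDef) : ContinuousAt (fun τ' => (D.cov τ')⁻¹) τ :=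
  continuousAt_matrix_inv_of_posDef continuous_cov.continuousAt h

theorem continuousAt_M (h : (D.cov τ).PosDef) : ContinuousAt D.M τ :=
  continuousAt_matrix_inv_of_posDef (continuousAt_matrix_mul (continuousAt_matrix_mul
    continuousAt_const (continuousAt_cov_inv h)) continuousAt_const) (info_posDef h)

theorem continuousAt_P (h : (D.cov τ).PosDef) : ContinuousAt D.P τ := by
  have hc := continuousAt_cov_inv h
  exact hc.sub (continuousAt_matrix_mul (continuousAt_matrix_mul (continuousAt_matrix_mul
    (continuousAt_matrix_mul hc continuousAt_const) (continuousAt_M h)) continuousAt_const) hc)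

theorem continuousAt_Lam (meth : Method) (h : (D.cov τ).PosDef) : ContinuousAt (D.Lam meth) τ := by
  cases meth
  · exact continuousAt_P h
  · exact continuousAt_cov_inv h

theorem T_injective : Function.Injective D.T.mulVec := by
  have h1 : Module.finrank ℝ (LinearMap.range D.T.mulVecLin) = D.n - p := D.rank_T
  have h2 := LinearMap.finrank_range_add_finrank_ker D.T.mulVecLin
  rw [h1, Module.finrank_fin_fun] at h2
  have h3 : Module.finrank ℝ (LinearMap.ker D.T.mulVecLin) = 0 := by omega
  have h4 := Submodule.finrank_eq_zero.1 h3
  exact LinearMap.ker_eq_bot.1 h4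

/-- The range of `X` lies in the kernel of `Tᵀ`, and both have dimension `p`. -/
theorem exists_eq_X_mulVec {v : Fin D.n → ℝ} (hv : D.Tᵀ *ᵥ v = 0) : ∃ b, v = D.X *ᵥ b := by
  have hle : LinearMap.range D.X.mulVecLin ≤ LinearMap.ker D.Tᵀ.mulVecLin := by
    rintro _ ⟨b, rfl⟩
    rw [LinearMap.mem_ker, Matrix.mulVecLin_apply, Matrix.mulVecLin_apply, Matrix.mulVec_mulVec,
      D.T_mul_X, Matrix.zero_mulVec]
  have h1 : Module.finrank ℝ (LinearMap.range D.X.mulVecLin) = p := D.rank_X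
  have h2 : Module.finrank ℝ (LinearMap.range D.Tᵀ.mulVecLin) = D.n - p := by
    have := D.rank_T
    rwa [← Matrix.rank_transpose] at this
  have h3 := LinearMap.finrank_range_add_finrank_ker D.Tᵀ.mulVecLin
  rw [h2, Module.finrank_fin_fun] at h3
  have h4 := D.p_lt_n
  have h5 := Submodule.eq_of_le_of_finrank_eq hle (by omega)
  have h6 : v ∈ LinearMap.ker D.Tᵀ.mulVecLin := hv
  rw [← h5] at h6
  obtain ⟨b, hb⟩ := h6
  exact ⟨b, hb.symm⟩

theorem contrast_posDef (h : (D.cov τ).PosDef) : (D.Tᵀ * D.cov τ * D.T).PosDef := by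
  have := h.conjTranspose_mul_mul_same (B := D.T) D.T_injective
  rwa [Matrix.conjTranspose_eq_transpose_of_trivial] at this

/-- With `R` the right-hand side, evaluate `P Σ R` twice. It is `R` because `Xᵀ T = 0`; it is `P`
because the columns of `1 - Σ R` are killed by `Tᵀ`, hence lie in the range of `X`, which `P`
annihilates. -/
theorem P_eq_contrast (h : (D.cov τ).PosDef) :
    D.P τ = D.T * (D.Tᵀ * D.cov τ * D.T)⁻¹ * D.Tᵀ := by
  set R := D.T * (D.Tᵀ * D.cov τ * D.T)⁻¹ * D.Tᵀ with hR
  have hinv : D.Tᵀ * D.cov τ * D.T * (D.Tᵀ * D.cov τ * D.T)⁻¹ = 1 :=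
    Matrix.mul_nonsing_inv _ ((Matrix.isUnit_iff_isUnit_det _).1 (contrast_posDef h).isUnit)
  have hXT : D.Xᵀ * D.T = 0 := by
    have := congrArg Matrix.transpose D.T_mul_X
    rwa [Matrix.transpose_mul, Matrix.transpose_transpose, Matrix.transpose_zero] at this
  have hPc : D.P τ * D.cov τ = 1 - (D.cov τ)⁻¹ * D.X * D.M τ * D.Xᵀ := by
    have := congrArg Matrix.transpose (cov_mul_P h)
    rw [Matrix.transpose_mul, P_transpose h, cov_transpose h] at this
    rw [this]
    simp only [Matrix.transpose_sub, Matrix.transpose_one, Matrix.transpose_mul,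
      Matrix.transpose_transpose, cov_inv_transpose h, M_transpose h, Matrix.mul_assoc]
  have h1 : D.P τ * D.cov τ * R = R := by
    rw [hPc, Matrix.sub_mul, Matrix.one_mul, hR]
    have : (D.cov τ)⁻¹ * D.X * D.M τ * D.Xᵀ * (D.T * (D.Tᵀ * D.cov τ * D.T)⁻¹ * D.Tᵀ)
        = (D.cov τ)⁻¹ * D.X * D.M τ * (D.Xᵀ * D.T) * ((D.Tᵀ * D.cov τ * D.T)⁻¹ * D.Tᵀ) := by
      simp only [Matrix.mul_assoc]
    rw [this, hXT]; simp
  have h2 : D.Tᵀ * (1 - D.cov τ * R) = 0 := by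
    rw [Matrix.mul_sub, Matrix.mul_one, hR]
    have : D.Tᵀ * (D.cov τ * (D.T * (D.Tᵀ * D.cov τ * D.T)⁻¹ * D.Tᵀ))
        = (D.Tᵀ * D.cov τ * D.T * (D.Tᵀ * D.cov τ * D.T)⁻¹) * D.Tᵀ := by
      simp only [Matrix.mul_assoc]
    rw [this, hinv, Matrix.one_mul, sub_self]
  have h3 : D.P τ * (1 - D.cov τ * R) = 0 := by
    refine Matrix.ext_of_mulVec_single fun j => ?_
    obtain ⟨b, hb⟩ := exists_eq_X_mulVec (D := D)
      (v := (1 - D.cov τ * R) *ᵥ Pi.single j 1) (by rw [Matrix.mulVec_mulVec, h2, Matrix.zero_mulVec])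
    rw [← Matrix.mulVec_mulVec, hb, Matrix.mulVec_mulVec, P_mul_X h, Matrix.zero_mulVec,
      Matrix.zero_mulVec]
  rw [Matrix.mul_sub, Matrix.mul_one, ← Matrix.mul_assoc, h1, sub_eq_zero] at h3
  exact h3

theorem hasPderivs_log_det_cov (h : (D.cov τ).PosDef) :
    HasPderivs (fun τ' => Real.log (D.cov τ').det) (fun i => ((D.cov τ)⁻¹ * D.V i).trace) τ :=
  hasPderivs_log_det D.V h

theorem contrast_cov (τ : Param q) :
    D.Tᵀ * D.cov τ * D.T = ∑ i, τ i • (D.Tᵀ * D.V i * D.T) := by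
  simp only [cov, Matrix.mul_sum, Matrix.sum_mul, Matrix.mul_smul, Matrix.smul_mul]

theorem hasPderivs_log_det_contrast (h : (D.cov τ).PosDef) :
    HasPderivs (fun τ' => Real.log (D.Tᵀ * D.cov τ' * D.T).det)
      (fun i => (D.P τ * D.V i).trace) τ := by
  have h' := contrast_posDef h
  have e : (fun i => (D.P τ * D.V i).trace)
      = fun i => ((D.Tᵀ * D.cov τ * D.T)⁻¹ * (D.Tᵀ * D.V i * D.T)).trace := by
    funext i
    rw [P_eq_contrast h, Matrix.mul_assoc, Matrix.mul_assoc, Matrix.trace_mul_comm]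
    simp only [Matrix.mul_assoc]
  rw [e]
  simp only [contrast_cov] at h' ⊢
  exact hasPderivs_log_det _ h'

theorem hasPderivs_quad (hτ : ∀ i, 0 < τ i) (y : Fin D.n → ℝ) :
    HasPderivs (fun τ' => y ⬝ᵥ (D.P τ' *ᵥ y))
      (fun i => -(y ⬝ᵥ ((D.P τ * D.V i * D.P τ) *ᵥ y))) τ := by
  have h : (D.cov τ).PosDef := (D.mem_admissible hτ).2
  refine hasPderivs_of_slope (φ := fun i τ' => -(y ⬝ᵥ ((D.P τ' * D.V i * D.P τ) *ᵥ y))) ?_ ?_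
  · filter_upwards [eventually_pos hτ] with τ' hτ'
    have h' : (D.cov τ').PosDef := (D.mem_admissible hτ').2
    rw [← dotProduct_sub, ← Matrix.sub_mulVec, D.isResolvent_P.sub_eq h' h, Matrix.neg_mulVec,
      Matrix.sum_mulVec, dotProduct_neg, dotProduct_sum, ← Finset.sum_neg_distrib]
    refine Finset.sum_congr rfl fun i _ => ?_
    rw [Matrix.smul_mulVec, dotProduct_smul, smul_eq_mul]; ring
  · intro i
    exact (continuousAt_dotProduct continuousAt_const (continuousAt_matrix_mulVec
      (continuousAt_matrix_mul (continuousAt_matrix_mul (continuousAt_P h) continuousAt_const)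
        continuousAt_const) continuousAt_const)).neg

theorem hasPderivs_crit (meth : Method) (hτ : ∀ i, 0 < τ i) (y : Fin D.n → ℝ) :
    HasPderivs (fun τ' => D.crit meth τ' y) (D.score meth τ y) τ := by
  have h : (D.cov τ).PosDef := (D.mem_admissible hτ).2
  cases meth
  · have := ((hasPderivs_log_det_contrast h).add (hasPderivs_quad hτ y)).const_mul (-(1 / 2))
    refine (congrArg (fun g => HasPderivs _ g τ) ?_).mp this
    funext i
    simp only [score, Lam]; ring
  · have := ((hasPderivs_log_det_cov h).add (hasPderivs_quad hτ y)).const_mul (-(1 / 2))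
    refine (congrArg (fun g => HasPderivs _ g τ) ?_).mp this
    funext i
    simp only [score, Lam]; ring

theorem fderiv_crit_eq_zero_iff (meth : Method) (hτ : ∀ i, 0 < τ i) (y : Fin D.n → ℝ) :
    fderiv ℝ (fun τ' => D.crit meth τ' y) τ = 0 ↔ ∀ i, D.score meth τ y i = 0 :=
  (hasPderivs_crit meth hτ y).fderiv_eq_zero_iff

/-- `score_sub` exhibits exact slopes of the score, so the second derivatives are their values on
the diagonal. -/
theorem pderiv_pderiv_crit (meth : Method) (hτ : ∀ i, 0 < τ i) (y : Fin D.n → ℝ)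
    (i j : Fin (q + 1)) :
    pderiv i (fun τ₁ => pderiv j (fun τ₂ => D.crit meth τ₂ y) τ₁) τ
      = 1 / 2 * (D.Lam meth τ * D.V i * D.Lam meth τ * D.V j).trace
        - 1 / 2 * (y ⬝ᵥ ((D.P τ * D.V i * D.P τ * D.V j * D.P τ) *ᵥ y)
          + y ⬝ᵥ ((D.P τ * D.V j * D.P τ * D.V i * D.P τ) *ᵥ y)) := by
  have h : (D.cov τ).PosDef := (D.mem_admissible hτ).2
  refine HasPderivs.pderiv_eq (g := fun i =>
    1 / 2 * (D.Lam meth τ * D.V i * D.Lam meth τ * D.V j).trace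
        - 1 / 2 * (y ⬝ᵥ ((D.P τ * D.V i * D.P τ * D.V j * D.P τ) *ᵥ y)
          + y ⬝ᵥ ((D.P τ * D.V j * D.P τ * D.V i * D.P τ) *ᵥ y))) ?_ i
  refine hasPderivs_of_slope (φ := fun i τ' =>
    1 / 2 * (D.Lam meth τ' * D.V i * D.Lam meth τ * D.V j).trace
        - 1 / 2 * (y ⬝ᵥ ((D.P τ' * D.V i * D.P τ * D.V j * D.P τ') *ᵥ y)
          + y ⬝ᵥ ((D.P τ * D.V j * D.P τ' * D.V i * D.P τ) *ᵥ y))) ?_ ?_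
  · filter_upwards [eventually_pos hτ] with τ' hτ'
    have h' : (D.cov τ').PosDef := (D.mem_admissible hτ').2
    rw [(hasPderivs_crit meth hτ' y).pderiv_eq, (hasPderivs_crit meth hτ y).pderiv_eq,
      score_sub meth h' h]
  · intro i
    have hP := continuousAt_P h
    have hL := continuousAt_Lam meth h
    have cm := fun {A B : Param q → Matrix (Fin D.n) (Fin D.n) ℝ} (hA : ContinuousAt A τ)
      (hB : ContinuousAt B τ) => continuousAt_matrix_mul hA hB
    have cq := fun {A : Param q → Matrix (Fin D.n) (Fin D.n) ℝ} (hA : ContinuousAt A τ) =>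
      continuousAt_dotProduct (continuousAt_const (y := y))
        (continuousAt_matrix_mulVec hA (continuousAt_const (y := y)))
    have cc := fun (A : Matrix (Fin D.n) (Fin D.n) ℝ) =>
      (continuousAt_const (y := A) : ContinuousAt (fun _ : Param q => A) τ)
    refine (ContinuousAt.const_mul (continuousAt_matrix_trace
      (cm (cm (cm hL (cc _)) (cc _)) (cc _))) _).sub (ContinuousAt.const_mul (ContinuousAt.add ?_ ?_) _)
    · exact cq (cm (cm (cm (cm hP (cc _)) (cc _)) (cc _)) hP)
    · exact cq (cm (cm (cm (cc _) hP) (cc _)) (cc _))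

variable (D) in
/-- The derivative of `G` in the `i`-th variance component. -/
def dG (i : Fin (q + 1)) : Matrix D.RE D.RE ℝ := Matrix.diagonal fun j => if j.1.succ = i then 1 else 0

theorem G_sub (τ τ' : Param q) : D.G τ' - D.G τ = ∑ i, (τ' i - τ i) • D.dG i := by
  ext a b
  simp only [G, dG, Matrix.sub_apply, Matrix.sum_apply, Matrix.smul_apply, Matrix.diagonal_apply,
    smul_eq_mul]
  split_ifs with hab
  · simp
  · simp

variable (D) in
/-- The vector `Z G_i m - V_i s`, which is `Σ ∂s/∂σ_i`. -/
def sSlope (τ : Param q) (i : Fin (q + 1)) : Fin D.n → ℝ :=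
  D.Zfull *ᵥ (D.dG i *ᵥ D.m) - D.V i *ᵥ D.s τ

theorem cov_mulVec_s (h : (D.cov τ).PosDef) : D.cov τ *ᵥ D.s τ = D.Zfull *ᵥ (D.G τ *ᵥ D.m) := by
  rw [s, Matrix.mulVec_mulVec, Matrix.mulVec_mulVec]
  simp only [← Matrix.mul_assoc]
  rw [cov_mul_inv h, Matrix.one_mul]

/-- Apply `Σ(τ')` to the difference: `Σ s = Z G m` is linear in the parameter, so only increments of
`G` and `Σ` remain. -/
theorem s_sub (h : (D.cov τ).PosDef) (h' : (D.cov τ').PosDef) :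
    D.s τ' - D.s τ = ∑ i, (τ' i - τ i) • ((D.cov τ')⁻¹ *ᵥ D.sSlope τ i) := by
  have e : D.cov τ' *ᵥ (D.s τ' - D.s τ) = ∑ i, (τ' i - τ i) • D.sSlope τ i := by
    have e1 : D.cov τ' *ᵥ D.s τ = D.cov τ *ᵥ D.s τ + ∑ i, (τ' i - τ i) • (D.V i *ᵥ D.s τ) := by
      rw [← sub_eq_iff_eq_add', ← Matrix.sub_mulVec, cov_sub, Matrix.sum_mulVec]
      simp only [Matrix.smul_mulVec]
    rw [Matrix.mulVec_sub, cov_mulVec_s h', e1, cov_mulVec_s h]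
    have e2 : D.Zfull *ᵥ (D.G τ' *ᵥ D.m) - D.Zfull *ᵥ (D.G τ *ᵥ D.m)
        = ∑ i, (τ' i - τ i) • (D.Zfull *ᵥ (D.dG i *ᵥ D.m)) := by
      rw [← Matrix.mulVec_sub, ← Matrix.sub_mulVec, G_sub, Matrix.sum_mulVec]
      simp only [Matrix.smul_mulVec, Matrix.mulVec_sum, Matrix.mulVec_smul]
    rw [← sub_sub, e2, ← Finset.sum_sub_distrib]
    simp only [sSlope, smul_sub]
  have := congrArg (fun v => (D.cov τ')⁻¹ *ᵥ v) e
  simp only [Matrix.mulVec_mulVec, cov_inv_mul h', Matrix.one_mulVec, Matrix.mulVec_sum,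
    Matrix.mulVec_smul] at this
  exact this

theorem ds_eq (hτ : ∀ i, 0 < τ i) (i : Fin (q + 1)) :
    D.ds τ i = (D.cov τ)⁻¹ *ᵥ D.sSlope τ i := by
  have h : (D.cov τ).PosDef := (D.mem_admissible hτ).2
  funext a
  refine HasPderivs.pderiv_eq (g := fun i => ((D.cov τ)⁻¹ *ᵥ D.sSlope τ i) a) ?_ i
  refine hasPderivs_of_slope (φ := fun i τ' => ((D.cov τ')⁻¹ *ᵥ D.sSlope τ i) a) ?_ ?_
  · filter_upwards [eventually_pos hτ] with τ' hτ'
    have h' : (D.cov τ').PosDef := (D.mem_admissible hτ').2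
    have := congrFun (s_sub h h') a
    simpa [Finset.sum_apply] using this
  · intro i
    exact (continuous_apply a).continuousAt.comp
      (continuousAt_matrix_mulVec (continuousAt_cov_inv h) continuousAt_const)

theorem residual_eq (h : (D.cov τ).PosDef) (y : Fin D.n → ℝ) :
    y - D.X *ᵥ D.betaTilde τ y = D.cov τ *ᵥ (D.P τ *ᵥ y) := by
  rw [Matrix.mulVec_mulVec, cov_mul_P h, Matrix.sub_mulVec, Matrix.one_mulVec, betaTilde,
    Matrix.mulVec_mulVec]
  simp only [Matrix.mul_assoc]

theorem betaTilde_X (h : (D.cov τ).PosDef) (b : Fin p → ℝ) : D.betaTilde τ (D.X *ᵥ b) = b := by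
  rw [betaTilde, Matrix.mulVec_mulVec]
  have : D.M τ * D.Xᵀ * (D.cov τ)⁻¹ * D.X = D.M τ * (D.Xᵀ * (D.cov τ)⁻¹ * D.X) := by
    simp only [Matrix.mul_assoc]
  rw [this, M_mul_info h, Matrix.one_mulVec]

/-- The difference is the generalized least squares estimate at `τ'` applied to the residual `Σ(τ)
P(τ) y`. With `Σ(τ')` in place of `Σ(τ)` that estimate would vanish, because `Xᵀ P = 0`; only the
difference of covariances is left. -/
theorem betaTilde_sub (h : (D.cov τ).PosDef) (h' : (D.cov τ').PosDef) (y : Fin D.n → ℝ) :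
    D.betaTilde τ' y - D.betaTilde τ y = -∑ i, (τ' i - τ i) •
      ((D.M τ' * D.Xᵀ * (D.cov τ')⁻¹) *ᵥ (D.V i *ᵥ (D.P τ *ᵥ y))) := by
  have e1 : D.betaTilde τ' (y - D.X *ᵥ D.betaTilde τ y) = D.betaTilde τ' y - D.betaTilde τ y := by
    have : D.betaTilde τ' (D.X *ᵥ D.betaTilde τ y) = D.betaTilde τ y := betaTilde_X h' _
    simp only [betaTilde, Matrix.mulVec_sub] at this ⊢
    rw [this]
  have e2 : D.cov τ *ᵥ (D.P τ *ᵥ y) = D.cov τ' *ᵥ (D.P τ *ᵥ y)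
      - ∑ i, (τ' i - τ i) • (D.V i *ᵥ (D.P τ *ᵥ y)) := by
    have := congrArg (fun S => S *ᵥ (D.P τ *ᵥ y)) (D.cov_sub τ τ')
    simp only [Matrix.sub_mulVec, Matrix.sum_mulVec, Matrix.smul_mulVec] at this
    rw [← this, sub_sub_cancel]
  have e3 : (D.M τ' * D.Xᵀ * (D.cov τ')⁻¹) *ᵥ (D.cov τ' *ᵥ (D.P τ *ᵥ y)) = 0 := by
    have : D.M τ' * D.Xᵀ * (D.cov τ')⁻¹ * D.cov τ' * D.P τ
        = D.M τ' * (D.Xᵀ * (((D.cov τ')⁻¹ * D.cov τ') * D.P τ)) := by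
      simp only [Matrix.mul_assoc]
    rw [Matrix.mulVec_mulVec, Matrix.mulVec_mulVec, this, cov_inv_mul h', Matrix.one_mul, X_mul_P h,
      Matrix.mul_zero, Matrix.zero_mulVec]
  rw [← e1, residual_eq h, e2, betaTilde, Matrix.mulVec_sub, e3, zero_sub, Matrix.mulVec_sum]
  simp only [Matrix.mulVec_smul]

theorem t_sub (h : (D.cov τ).PosDef) (h' : (D.cov τ').PosDef) (y : Fin D.n → ℝ) :
    D.t τ' y - D.t τ y = ∑ i, (τ' i - τ i) *
      (((D.cov τ')⁻¹ *ᵥ D.sSlope τ i) ⬝ᵥ (D.cov τ *ᵥ (D.P τ *ᵥ y))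
        - (D.l - D.Xᵀ *ᵥ D.s τ') ⬝ᵥ
          ((D.M τ' * D.Xᵀ * (D.cov τ')⁻¹) *ᵥ (D.V i *ᵥ (D.P τ *ᵥ y)))) := by
  have e : D.t τ' y - D.t τ y = (D.s τ' - D.s τ) ⬝ᵥ (y - D.X *ᵥ D.betaTilde τ y)
      + (D.l - D.Xᵀ *ᵥ D.s τ') ⬝ᵥ (D.betaTilde τ' y - D.betaTilde τ y) := by
    have hx : ∀ b, (D.Xᵀ *ᵥ D.s τ') ⬝ᵥ b = D.s τ' ⬝ᵥ (D.X *ᵥ b) := fun b => by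
      rw [Matrix.dotProduct_mulVec, Matrix.mulVec_transpose]
    simp only [t, sub_dotProduct, dotProduct_sub, hx]
    ring
  rw [e, residual_eq h, s_sub h h', betaTilde_sub h h', sum_dotProduct, dotProduct_neg,
    dotProduct_sum, ← sub_eq_add_neg, ← Finset.sum_sub_distrib]
  refine Finset.sum_congr rfl fun i _ => ?_
  rw [smul_dotProduct, dotProduct_smul, smul_eq_mul, smul_eq_mul]
  ring

variable (D) in
/-- The vector `h` with `∂t/∂σ_i = h'Py`. -/
def tSlope (τ : Param q) (i : Fin (q + 1)) : Fin D.n → ℝ :=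
  D.sSlope τ i - D.V i *ᵥ ((D.cov τ)⁻¹ *ᵥ (D.X *ᵥ (D.M τ *ᵥ (D.l - D.Xᵀ *ᵥ D.s τ))))

theorem continuousAt_s (h : (D.cov τ).PosDef) : ContinuousAt D.s τ := by
  refine continuousAt_matrix_mulVec (continuousAt_matrix_mul (continuousAt_matrix_mul
    (continuousAt_cov_inv h) continuousAt_const) ?_) continuousAt_const
  refine Continuous.continuousAt ?_
  unfold G
  fun_prop

/-- The BLUP depends on the parameter through error contrasts only: its derivatives are linear forms
in `P y`, free of `β`. -/
theorem hasPderivs_t (hτ : ∀ i, 0 < τ i) (y : Fin D.n → ℝ) :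
    HasPderivs (fun τ' => D.t τ' y) (fun i => D.tSlope τ i ⬝ᵥ (D.P τ *ᵥ y)) τ := by
  have h : (D.cov τ).PosDef := (D.mem_admissible hτ).2
  have e : (fun i => D.tSlope τ i ⬝ᵥ (D.P τ *ᵥ y)) = fun i =>
      ((D.cov τ)⁻¹ *ᵥ D.sSlope τ i) ⬝ᵥ (D.cov τ *ᵥ (D.P τ *ᵥ y))
        - (D.l - D.Xᵀ *ᵥ D.s τ) ⬝ᵥ
          ((D.M τ * D.Xᵀ * (D.cov τ)⁻¹) *ᵥ (D.V i *ᵥ (D.P τ *ᵥ y))) := by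
    funext i
    have adj : ∀ {a b : ℕ} (S : Matrix (Fin a) (Fin b) ℝ) (u v), (S *ᵥ u) ⬝ᵥ v = u ⬝ᵥ (Sᵀ *ᵥ v) :=
      fun S u v => by rw [Matrix.dotProduct_mulVec, Matrix.vecMul_transpose]
    rw [tSlope, sub_dotProduct, adj, adj, adj, adj, adj, Matrix.mulVec_mulVec _ _ (D.cov τ),
      cov_inv_transpose h, cov_inv_mul h, Matrix.one_mulVec, M_transpose h, V_transpose]
    simp only [Matrix.mulVec_mulVec, Matrix.mul_assoc]
  rw [e]
  refine hasPderivs_of_slope (φ := fun i τ' =>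
    ((D.cov τ')⁻¹ *ᵥ D.sSlope τ i) ⬝ᵥ (D.cov τ *ᵥ (D.P τ *ᵥ y))
        - (D.l - D.Xᵀ *ᵥ D.s τ') ⬝ᵥ
          ((D.M τ' * D.Xᵀ * (D.cov τ')⁻¹) *ᵥ (D.V i *ᵥ (D.P τ *ᵥ y)))) ?_ ?_
  · filter_upwards [eventually_pos hτ] with τ' hτ'
    exact t_sub h (D.mem_admissible hτ').2 y
  · intro i
    have hc := continuousAt_cov_inv h
    refine (continuousAt_dotProduct (continuousAt_matrix_mulVec hc continuousAt_const)
      continuousAt_const).sub (continuousAt_dotProduct (continuousAt_const.sub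
        (continuousAt_matrix_mulVec continuousAt_const (continuousAt_s h)))
        (continuousAt_matrix_mulVec (continuousAt_matrix_mul (continuousAt_matrix_mul
          (continuousAt_M h) continuousAt_const) hc) continuousAt_const))

end Design
end EmpBLUP

end

/-! ### Measurability, the law of the data, and the error of the BLUP -/

noncomputable section
namespace EmpBLUP

set_option linter.unusedSectionVars false

theorem mulVec_dotProduct {a b : Type*} [Fintype a] [Fintype b] (S : Matrix a b ℝ) (u : b → ℝ)
    (v : a → ℝ) : (S *ᵥ u) ⬝ᵥ v = u ⬝ᵥ (Sᵀ *ᵥ v) := by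
  rw [Matrix.dotProduct_mulVec, Matrix.vecMul_transpose]

section MeasurableMatrix

variable {a b c : Type} [Fintype a] [Fintype b] [Fintype c] {S : Type*} [MeasurableSpace S]

instance matrixMeasurableSpace : MeasurableSpace (Matrix a b ℝ) :=
  inferInstanceAs (MeasurableSpace (a → b → ℝ))

instance matrixBorelSpace : BorelSpace (Matrix a b ℝ) :=
  inferInstanceAs (BorelSpace (a → b → ℝ))

instance matrixSecondCountable : SecondCountableTopology (Matrix a b ℝ) :=
  inferInstanceAs (SecondCountableTopology (a → b → ℝ))

theorem measurable_matrix_mul {A : S → Matrix a b ℝ} {B : S → Matrix b c ℝ}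
    (hA : Measurable A) (hB : Measurable B) : Measurable fun s => A s * B s :=
  (continuous_fst.matrix_mul continuous_snd : Continuous fun z : Matrix a b ℝ × Matrix b c ℝ =>
    z.1 * z.2).measurable.comp (hA.prodMk hB)

theorem measurable_matrix_mulVec {A : S → Matrix a b ℝ} {v : S → b → ℝ}
    (hA : Measurable A) (hv : Measurable v) : Measurable fun s => A s *ᵥ v s :=
  (continuous_fst.matrix_mulVec continuous_snd : Continuous fun z : Matrix a b ℝ × (b → ℝ) =>
    z.1 *ᵥ z.2).measurable.comp (hA.prodMk hv)

theorem measurable_dotProduct {u v : S → b → ℝ}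
    (hu : Measurable u) (hv : Measurable v) : Measurable fun s => u s ⬝ᵥ v s :=
  (continuous_fst.dotProduct continuous_snd : Continuous fun z : (b → ℝ) × (b → ℝ) =>
    z.1 ⬝ᵥ z.2).measurable.comp (hu.prodMk hv)

theorem measurable_matrix_trace {A : S → Matrix b b ℝ} (hA : Measurable A) :
    Measurable fun s => (A s).trace :=
  (continuous_id.matrix_trace : Continuous fun z : Matrix b b ℝ => z.trace).measurable.comp hA

theorem measurable_matrix_inv [DecidableEq b] {A : S → Matrix b b ℝ} (hA : Measurable A) :
    Measurable fun s => (A s)⁻¹ := by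
  have hdet : Measurable fun s => (A s).det :=
    (continuous_id.matrix_det : Continuous fun z : Matrix b b ℝ => z.det).measurable.comp hA
  have hadj : Measurable fun s => (A s).adjugate :=
    (continuous_id.matrix_adjugate :
      Continuous fun z : Matrix b b ℝ => z.adjugate).measurable.comp hA
  have e : (fun s => (A s)⁻¹) = fun s => (A s).det⁻¹ • (A s).adjugate := by
    funext s; rw [Matrix.inv_def, Ring.inverse_eq_inv']
  rw [e]
  exact (continuous_fst.smul continuous_snd : Continuous fun z : ℝ × Matrix b b ℝ =>
    z.1 • z.2).measurable.comp (hdet.inv.prodMk hadj)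

theorem measurable_matrix_sub {A B : S → Matrix a b ℝ} (hA : Measurable A) (hB : Measurable B) :
    Measurable fun s => A s - B s :=
  (continuous_fst.sub continuous_snd : Continuous fun z : Matrix a b ℝ × Matrix a b ℝ =>
    z.1 - z.2).measurable.comp (hA.prodMk hB)

end MeasurableMatrix

namespace Design

variable {p q : ℕ} {D : Design p q} {σ τ : Param q}

section Measurability

variable (D)

theorem measurable_cov_inv : Measurable fun τ => (D.cov τ)⁻¹ :=
  measurable_matrix_inv continuous_cov.measurable

theorem measurable_M : Measurable D.M :=
  measurable_matrix_inv (measurable_matrix_mul (measurable_matrix_mul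
    measurable_const D.measurable_cov_inv) measurable_const)

theorem measurable_P : Measurable D.P :=
  measurable_matrix_sub D.measurable_cov_inv (measurable_matrix_mul (measurable_matrix_mul
    (measurable_matrix_mul (measurable_matrix_mul D.measurable_cov_inv measurable_const)
      D.measurable_M) measurable_const) D.measurable_cov_inv)

theorem measurable_Lam (meth : Method) : Measurable (D.Lam meth) := by
  cases meth
  · exact D.measurable_P
  · exact D.measurable_cov_inv

theorem measurable_s : Measurable D.s := by
  refine measurable_matrix_mulVec (measurable_matrix_mul (measurable_matrix_mul
    D.measurable_cov_inv measurable_const) ?_) measurable_const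
  refine Continuous.measurable ?_
  unfold G
  fun_prop

theorem measurable_t : Measurable fun z : Param q × (Fin D.n → ℝ) => D.t z.1 z.2 := by
  have hb : Measurable fun z : Param q × (Fin D.n → ℝ) => D.betaTilde z.1 z.2 :=
    measurable_matrix_mulVec (measurable_matrix_mul (measurable_matrix_mul
      (D.measurable_M.comp measurable_fst) measurable_const)
      (D.measurable_cov_inv.comp measurable_fst)) measurable_snd
  exact (measurable_dotProduct measurable_const hb).add (measurable_dotProduct
    (D.measurable_s.comp measurable_fst)
    (measurable_snd.sub (measurable_matrix_mulVec measurable_const hb)))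

theorem measurable_score (meth : Method) (i : Fin (q + 1)) :
    Measurable fun z : Param q × (Fin D.n → ℝ) => D.score meth z.1 z.2 i := by
  have hf : Measurable fun z : Param q × (Fin D.n → ℝ) => z.1 := measurable_fst
  have hP := D.measurable_P.comp hf
  have hL := (D.measurable_Lam meth).comp hf
  exact ((measurable_dotProduct measurable_snd (measurable_matrix_mulVec (measurable_matrix_mul
    (measurable_matrix_mul hP measurable_const) hP) measurable_snd)).const_mul _).sub
    ((measurable_matrix_trace (measurable_matrix_mul hL measurable_const)).const_mul _)

end Measurability

section Law

variable (D)

/-- The map that sends standardized noise to `(v, e)`. -/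
def scaleEquiv (hσ : ∀ i, 0 < σ i) : (D.Noise → ℝ) ≃ᵐ D.Omega :=
  (MeasurableEquiv.sumPiEquivProdPi fun _ : D.Noise => ℝ).trans
    (MeasurableEquiv.prodCongr
      (MeasurableEquiv.piCongrRight fun j : D.RE =>
        MeasurableEquiv.mulLeft₀ (√(σ j.1.succ)) (Real.sqrt_pos.2 (hσ _)).ne')
      (MeasurableEquiv.piCongrRight fun _ : Fin D.n =>
        MeasurableEquiv.mulLeft₀ (√(σ 0)) (Real.sqrt_pos.2 (hσ _)).ne'))

variable {D}

theorem scaleEquiv_fst (hσ : ∀ i, 0 < σ i) (w : D.Noise → ℝ) :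
    (D.scaleEquiv hσ w).1 = D.J σ *ᵥ w := by
  funext j
  rw [J, Matrix.fromCols_mulVec, Matrix.zero_mulVec, add_zero, Matrix.mulVec_diagonal]
  rfl

theorem scaleEquiv_snd (hσ : ∀ i, 0 < σ i) (w : D.Noise → ℝ) :
    (D.scaleEquiv hσ w).2 = √(σ 0) • (w ∘ Sum.inr) := rfl

theorem measurePreserving_mul_gaussianReal {v : ℝ} (hv : 0 < v) :
    MeasurePreserving (fun x => √v * x) (gaussianReal 0 1) (gaussianReal 0 v.toNNReal) := by
  refine ⟨by fun_prop, ?_⟩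
  rw [gaussianReal_map_const_mul, mul_zero, mul_one]
  congr 1
  ext
  simp [Real.sq_sqrt hv.le, hv.le]

theorem measurePreserving_scaleEquiv (hσ : ∀ i, 0 < σ i) :
    MeasurePreserving (D.scaleEquiv hσ) (stdG D.Noise) (D.law σ) := by
  have h1 := measurePreserving_sumPiEquivProdPi (X := fun _ : D.Noise => ℝ)
    (fun _ => gaussianReal 0 1)
  have h2 : MeasurePreserving (fun (a : D.RE → ℝ) (j : D.RE) => √(σ j.1.succ) * a j)
      (Measure.pi fun _ => gaussianReal 0 1)
      (Measure.pi fun j : D.RE => gaussianReal 0 (σ j.1.succ).toNNReal) :=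
    measurePreserving_pi (fun _ : D.RE => gaussianReal 0 1) _
      (fun j : D.RE => measurePreserving_mul_gaussianReal (hσ j.1.succ))
  have h3 : MeasurePreserving (fun (a : Fin D.n → ℝ) (j : Fin D.n) => √(σ 0) * a j)
      (Measure.pi fun _ => gaussianReal 0 1)
      (Measure.pi fun _ : Fin D.n => gaussianReal 0 (σ 0).toNNReal) :=
    measurePreserving_pi (fun _ : Fin D.n => gaussianReal 0 1) _
      (fun _ => measurePreserving_mul_gaussianReal (hσ 0))
  exact (h2.prod h3).comp h1

theorem integral_law (hσ : ∀ i, 0 < σ i) (f : D.Omega → ℝ) :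
    ∫ ω, f ω ∂(D.law σ) = ∫ w, f (D.scaleEquiv hσ w) ∂(stdG D.Noise) :=
  ((measurePreserving_scaleEquiv hσ).integral_comp' f).symm

theorem integrable_law (hσ : ∀ i, 0 < σ i) (f : D.Omega → ℝ) :
    Integrable f (D.law σ) ↔ Integrable (fun w => f (D.scaleEquiv hσ w)) (stdG D.Noise) :=
  ((measurePreserving_scaleEquiv hσ).integrable_comp_emb (D.scaleEquiv hσ).measurableEmbedding).symm

theorem law_real (hσ : ∀ i, 0 < σ i) (E : Set D.Omega) :
    (D.law σ).real E = (stdG D.Noise).real {w | D.scaleEquiv hσ w ∈ E} := by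
  rw [Measure.real, Measure.real, ← (measurePreserving_scaleEquiv hσ).map_eq,
    (D.scaleEquiv hσ).map_apply]
  rfl

theorem obs_scaleEquiv (hσ : ∀ i, 0 < σ i) (β : Fin p → ℝ) (w : D.Noise → ℝ) :
    D.obs β (D.scaleEquiv hσ w) = D.X *ᵥ β + D.H σ *ᵥ w := by
  rw [obs, scaleEquiv_fst, scaleEquiv_snd, H, J, Matrix.fromCols_mulVec, Matrix.fromCols_mulVec,
    Matrix.zero_mulVec, add_zero, Matrix.mulVec_mulVec, Matrix.smul_mulVec, Matrix.one_mulVec,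
    add_assoc]

theorem target_scaleEquiv (hσ : ∀ i, 0 < σ i) (β : Fin p → ℝ) (w : D.Noise → ℝ) :
    D.target β (D.scaleEquiv hσ w) = D.l ⬝ᵥ β + D.m ⬝ᵥ (D.J σ *ᵥ w) := by
  rw [target, scaleEquiv_fst]

theorem measurable_response (β : Fin p → ℝ) :
    Measurable fun w : D.Noise → ℝ => D.X *ᵥ β + D.H σ *ᵥ w :=
  measurable_const.add (measurable_matrix_mulVec measurable_const measurable_id)

end Law

theorem P_mulVec_response (h : (D.cov τ).PosDef) (β : Fin p → ℝ) (w : D.Noise → ℝ) :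
    D.P τ *ᵥ (D.X *ᵥ β + D.H σ *ᵥ w) = D.P τ *ᵥ (D.H σ *ᵥ w) := by
  rw [Matrix.mulVec_add, Matrix.mulVec_mulVec, P_mul_X h, Matrix.zero_mulVec, zero_add]

theorem integral_quad (S : Matrix D.Noise D.Noise ℝ) :
    Integrable (fun w => w ⬝ᵥ (S *ᵥ w)) (stdG D.Noise) ∧
      ∫ w, w ⬝ᵥ (S *ᵥ w) ∂(stdG D.Noise) = S.trace := by
  have e : (fun w => w ⬝ᵥ (S *ᵥ w)) = fun w => quadC S w + S.trace := by
    funext w; rw [quadC, sub_add_cancel]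
  rw [e]
  refine ⟨(integrable_quadC S).add (integrable_const _), ?_⟩
  rw [integral_add (integrable_quadC S) (integrable_const _), integral_quadC]
  simp

/-- The expected second derivative of the criterion. -/
theorem A_eq_hess (hσ : ∀ i, 0 < σ i) (meth : Method) (β : Fin p → ℝ) :
    D.A meth β σ = D.hess meth σ := by
  have hP := D.isResolvent_P
  have h := hP.pd hσ
  have hq : ∀ i j w, (D.X *ᵥ β + D.H σ *ᵥ w) ⬝ᵥ ((D.P σ * D.V i * D.P σ * D.V j * D.P σ) *ᵥ
      (D.X *ᵥ β + D.H σ *ᵥ w)) = w ⬝ᵥ ((D.Bm σ D.P i * D.Bm σ D.P j) *ᵥ w) := fun i j w => by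
    rw [quad_five hσ h h, Matrix.mulVec_mulVec, Matrix.mulVec_mulVec, Matrix.mulVec_mulVec,
      hP.proj_mul_Bm hσ, hP.Bm_mul_proj hσ, hP.Bm_mul_proj hσ, mulVec_dotProduct,
      hP.Bm_transpose hσ, Matrix.mulVec_mulVec]
  ext i j
  rw [A, Matrix.of_apply, integral_law hσ]
  simp only [obs_scaleEquiv, pderiv_pderiv_crit meth hσ, hq]
  obtain ⟨i1, e1⟩ := integral_quad (D.Bm σ D.P i * D.Bm σ D.P j)
  obtain ⟨i2, e2⟩ := integral_quad (D.Bm σ D.P j * D.Bm σ D.P i)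
  have i3 : Integrable (fun w => 1 / 2 * (w ⬝ᵥ ((D.Bm σ D.P i * D.Bm σ D.P j) *ᵥ w)
      + w ⬝ᵥ ((D.Bm σ D.P j * D.Bm σ D.P i) *ᵥ w))) (stdG D.Noise) := (i1.add i2).const_mul _
  rw [integral_sub (integrable_const _) i3, integral_const_mul, integral_const_mul,
    integral_add i1 i2, e1, e2]
  simp only [hess, Matrix.of_apply]
  rw [
    ← (D.isResolvent_Lam meth).trace_Bm_mul_Bm hσ,
    Matrix.trace_mul_comm (D.Bm σ D.P j)]
  simp
  ring

variable (D) in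
/-- The coefficients of the prediction error of the BLUP. -/
def errVec (σ : Param q) : D.Noise → ℝ :=
  (D.H σ)ᵀ *ᵥ (D.s σ + (D.cov σ)⁻¹ *ᵥ (D.X *ᵥ (D.M σ *ᵥ (D.l - D.Xᵀ *ᵥ D.s σ))))
    - (D.J σ)ᵀ *ᵥ D.m

theorem t_add_X (h : (D.cov τ).PosDef) (y : Fin D.n → ℝ) (b : Fin p → ℝ) :
    D.t τ (y + D.X *ᵥ b) = D.t τ y + D.l ⬝ᵥ b := by
  have hb : D.betaTilde τ (y + D.X *ᵥ b) = D.betaTilde τ y + b := by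
    have := betaTilde_X h b
    simp only [betaTilde, Matrix.mulVec_add] at this ⊢
    rw [this]
  rw [t, hb, t, dotProduct_add, Matrix.mulVec_add, add_sub_add_right_eq_sub]
  ring

theorem t_response (h : (D.cov σ).PosDef) (β : Fin p → ℝ) (w : D.Noise → ℝ) :
    D.t σ (D.X *ᵥ β + D.H σ *ᵥ w) - (D.l ⬝ᵥ β + D.m ⬝ᵥ (D.J σ *ᵥ w)) = D.errVec σ ⬝ᵥ w := by
  rw [add_comm (D.X *ᵥ β), t_add_X h, t, errVec, sub_dotProduct, mulVec_dotProduct,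
    Matrix.transpose_transpose, mulVec_dotProduct, Matrix.transpose_transpose, add_dotProduct,
    mulVec_dotProduct, mulVec_dotProduct, mulVec_dotProduct, cov_inv_transpose h, M_transpose h,
    betaTilde, sub_dotProduct, mulVec_dotProduct, Matrix.transpose_transpose, dotProduct_sub]
  simp only [Matrix.mulVec_mulVec, Matrix.mul_assoc]
  ring

theorem predError_scaleEquiv (hσ : ∀ i, 0 < σ i) (β : Fin p → ℝ)
    (est : (Fin D.n → ℝ) → Param q) (w : D.Noise → ℝ) :
    D.predError β est (D.scaleEquiv hσ w) = D.errVec σ ⬝ᵥ w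
      + (D.t (est (D.X *ᵥ β + D.H σ *ᵥ w)) (D.X *ᵥ β + D.H σ *ᵥ w)
        - D.t σ (D.X *ᵥ β + D.H σ *ᵥ w)) := by
  rw [predError, obs_scaleEquiv, target_scaleEquiv, ← t_response (D.isResolvent_P.pd hσ) β]
  ring

/-- The error of the BLUP is uncorrelated with every error contrast. The part from the random
effects cancels because `H Jᵀ m = Z G m = Σ s`, and the part from the fixed effects dies by `P X =
0`. -/
theorem proj_mulVec_errVec (hσ : ∀ i, 0 < σ i) : D.Gam σ D.P σ *ᵥ D.errVec σ = 0 := by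
  have h := D.isResolvent_P.pd hσ
  have e1 : D.Gam σ D.P σ * (D.H σ)ᵀ = (D.H σ)ᵀ * (D.P σ * D.cov σ) := by
    rw [Gam, Matrix.mul_assoc, H_mul_transpose hσ, Matrix.mul_assoc]
  have e2 : D.Gam σ D.P σ *ᵥ ((D.J σ)ᵀ *ᵥ D.m) = (D.H σ)ᵀ *ᵥ (D.P σ *ᵥ (D.cov σ *ᵥ D.s σ)) := by
    rw [cov_mulVec_s h, Gam]
    have : (D.H σ)ᵀ * D.P σ * D.H σ * (D.J σ)ᵀ = (D.H σ)ᵀ * (D.P σ * (D.H σ * (D.J σ)ᵀ)) := by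
      simp only [Matrix.mul_assoc]
    rw [Matrix.mulVec_mulVec, this, H_mul_J_transpose hσ]
    simp only [Matrix.mulVec_mulVec]
  have e3 : D.P σ * D.cov σ * (D.cov σ)⁻¹ * D.X = 0 := by
    rw [Matrix.mul_assoc (D.P σ), cov_mul_inv h, Matrix.mul_one, P_mul_X h]
  have e4 : (D.P σ * D.cov σ) *ᵥ
      ((D.cov σ)⁻¹ *ᵥ (D.X *ᵥ (D.M σ *ᵥ (D.l - D.Xᵀ *ᵥ D.s σ)))) = 0 := by
    rw [Matrix.mulVec_mulVec, Matrix.mulVec_mulVec, e3, Matrix.zero_mulVec]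
  rw [errVec, Matrix.mulVec_sub, e2, Matrix.mulVec_mulVec, e1, ← Matrix.mulVec_mulVec,
    Matrix.mulVec_add, e4, add_zero, Matrix.mulVec_mulVec (D.s σ) (D.P σ), sub_self]

/-- With `k = Σ⁻¹ X M (l - Xᵀ s)` the error vector is `Hᵀ (s + k) - Jᵀ m`. The cross terms of `k`
with `s` cancel; what remains is `m'Gm - s'Σs`, which is `g₁`, and `k'Σk`, which is `g₂`. -/
theorem errVec_dotProduct_self (hσ : ∀ i, 0 < σ i) :
    D.errVec σ ⬝ᵥ D.errVec σ = D.g₁ σ + D.g₂ σ := by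
  have h := D.isResolvent_P.pd hσ
  set g := D.l - D.Xᵀ *ᵥ D.s σ with hg
  set k := (D.cov σ)⁻¹ *ᵥ (D.X *ᵥ (D.M σ *ᵥ g)) with hk
  have hck : D.cov σ *ᵥ k = D.X *ᵥ (D.M σ *ᵥ g) := by
    rw [hk, Matrix.mulVec_mulVec, cov_mul_inv h, Matrix.one_mulVec]
  have hkk : k ⬝ᵥ (D.cov σ *ᵥ k) = D.blueVar σ g := by
    rw [hck, hk, mulVec_dotProduct, mulVec_dotProduct, mulVec_dotProduct, cov_inv_transpose h,
      M_transpose h, blueVar]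
    congr 1
    have : D.M σ * D.Xᵀ * (D.cov σ)⁻¹ * D.X * D.M σ
        = D.M σ * (D.Xᵀ * (D.cov σ)⁻¹ * D.X) * D.M σ := by simp only [Matrix.mul_assoc]
    simp only [Matrix.mulVec_mulVec, ← Matrix.mul_assoc]
    rw [this, M_mul_info h, Matrix.one_mul]
  have hHH : ∀ u v, ((D.H σ)ᵀ *ᵥ u) ⬝ᵥ ((D.H σ)ᵀ *ᵥ v) = u ⬝ᵥ (D.cov σ *ᵥ v) := fun u v => by
    rw [mulVec_dotProduct, Matrix.transpose_transpose, Matrix.mulVec_mulVec, H_mul_transpose hσ]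
  have hHJ : ∀ u, ((D.H σ)ᵀ *ᵥ u) ⬝ᵥ ((D.J σ)ᵀ *ᵥ D.m) = u ⬝ᵥ (D.cov σ *ᵥ D.s σ) := fun u => by
    rw [mulVec_dotProduct, Matrix.transpose_transpose, Matrix.mulVec_mulVec, H_mul_J_transpose hσ,
      cov_mulVec_s h, Matrix.mulVec_mulVec]
  have hJJ : ((D.J σ)ᵀ *ᵥ D.m) ⬝ᵥ ((D.J σ)ᵀ *ᵥ D.m) = D.m ⬝ᵥ (D.G σ *ᵥ D.m) := by
    rw [mulVec_dotProduct, Matrix.transpose_transpose, Matrix.mulVec_mulVec, J_mul_transpose hσ]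
  have hsym : k ⬝ᵥ (D.cov σ *ᵥ D.s σ) = D.s σ ⬝ᵥ (D.cov σ *ᵥ k) := by
    rw [dotProduct_comm, mulVec_dotProduct, cov_transpose h]
  have hg1 : D.g₁ σ = D.m ⬝ᵥ (D.G σ *ᵥ D.m) - D.s σ ⬝ᵥ (D.cov σ *ᵥ D.s σ) := by
    rw [g₁, Matrix.sub_mulVec, dotProduct_sub, cov_mulVec_s h, s, mulVec_dotProduct]
    congr 2
    have hGt : (D.G σ)ᵀ = D.G σ := by rw [G, Matrix.diagonal_transpose]
    simp only [Matrix.transpose_mul, cov_inv_transpose h, hGt, Matrix.mulVec_mulVec,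
      Matrix.mul_assoc]
  rw [errVec, ← hg, ← hk, sub_dotProduct, dotProduct_sub, dotProduct_sub,
    dotProduct_comm ((D.J σ)ᵀ *ᵥ D.m) ((D.H σ)ᵀ *ᵥ _), hHH, hHJ, hJJ, g₂, ← hg, ← hkk, hg1,
    Matrix.mulVec_add, add_dotProduct, add_dotProduct, dotProduct_add, dotProduct_add, hsym]
  ring

/-- `H Q = Σ P H` differs from `H` by a matrix with left factor `X`. The reflection thus amounts to
a translation of the data along the fixed effects, which invariant statistics ignore. -/
theorem H_mul_reflection (hσ : ∀ i, 0 < σ i) : D.H σ * (2 • D.Gam σ D.P σ - 1)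
    = D.H σ - 2 • (D.X * (D.M σ * D.Xᵀ * (D.cov σ)⁻¹ * D.H σ)) := by
  have h := D.isResolvent_P.pd hσ
  have : D.H σ * D.Gam σ D.P σ = D.cov σ * D.P σ * D.H σ := by
    rw [Gam, ← H_mul_transpose hσ]; simp only [Matrix.mul_assoc]
  rw [Matrix.mul_sub, Matrix.mul_smul, this, cov_mul_P h, Matrix.mul_one, Matrix.sub_mul,
    Matrix.one_mul]
  simp only [Matrix.mul_assoc]
  module

theorem response_reflection (hσ : ∀ i, 0 < σ i) (β : Fin p → ℝ) (w : D.Noise → ℝ) :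
    ∃ b, D.X *ᵥ β + D.H σ *ᵥ ((2 • D.Gam σ D.P σ - 1) *ᵥ w)
      = (D.X *ᵥ β + D.H σ *ᵥ w) + D.X *ᵥ b := by
  refine ⟨-(2 • ((D.M σ * D.Xᵀ * (D.cov σ)⁻¹ * D.H σ) *ᵥ w)), ?_⟩
  rw [Matrix.mulVec_mulVec, H_mul_reflection hσ, Matrix.sub_mulVec, Matrix.smul_mulVec,
    ← Matrix.mulVec_mulVec, Matrix.mulVec_neg, Matrix.mulVec_smul]
  abel

/-- The prediction error of the BLUP is orthogonal to the translation invariant statistics. -/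
theorem integral_errVec_mul (hσ : ∀ i, 0 < σ i) (β : Fin p → ℝ) {F : (Fin D.n → ℝ) → ℝ}
    (hF : Measurable F) (hinv : ∀ y (b : Fin p → ℝ), F (y + D.X *ᵥ b) = F y) :
    ∫ w, (D.errVec σ ⬝ᵥ w) * F (D.X *ᵥ β + D.H σ *ᵥ w) ∂(stdG D.Noise) = 0 := by
  have hP := D.isResolvent_P
  have h := hP.pd hσ
  refine integral_dotProduct_mul_eq_zero (F := fun w : D.Noise → ℝ => F (D.X *ᵥ β + D.H σ *ᵥ w))
    (hP.Gam_transpose hσ h) (hP.Gam_mul_Gam hσ h) (proj_mulVec_errVec hσ)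
    (hF.comp (measurable_response β)) fun w => ?_
  obtain ⟨b, hb⟩ := response_reflection hσ β w
  rw [hb, hinv]

theorem measurable_t_sub {est : (Fin D.n → ℝ) → Param q} (hm : Measurable est) :
    Measurable fun y => D.t (est y) y - D.t σ y :=
by
  have h1 : Measurable fun y => (est y, y) := hm.prodMk measurable_id
  have h2 : Measurable fun y : Fin D.n → ℝ => (σ, y) := measurable_const.prodMk measurable_id
  have h3 := D.measurable_t.comp h1
  have h4 := D.measurable_t.comp h2
  exact h3.sub h4

theorem t_sub_invariant (hσ : ∀ i, 0 < σ i) {est : (Fin D.n → ℝ) → Param q}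
    (hadm : ∀ y, est y ∈ D.admissible)
    (hinv : ∀ y (b : Fin p → ℝ), est (y + D.X *ᵥ b) = est y) (y : Fin D.n → ℝ) (b : Fin p → ℝ) :
    D.t (est (y + D.X *ᵥ b)) (y + D.X *ᵥ b) - D.t σ (y + D.X *ᵥ b)
      = D.t (est y) y - D.t σ y := by
  rw [hinv, t_add_X (hadm _).2, t_add_X (D.isResolvent_P.pd hσ)]
  ring

end Design
end EmpBLUP

end

/-! ### The linear approximation and its second moment -/

noncomputable section
namespace EmpBLUP

set_option linter.unusedSectionVars false

open scoped Matrix.Norms.L2Operator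

section MixedMoments

variable {ι : Type} [Fintype ι] [DecidableEq ι]

/-- The symmetric part of the rank-one matrix `g h'`. -/
def symProd (g h : ι → ℝ) : Matrix ι ι ℝ :=
  (1 / 2 : ℝ) • (Matrix.vecMulVec g h + (Matrix.vecMulVec g h)ᵀ)

theorem symProd_transpose (g h : ι → ℝ) : (symProd g h)ᵀ = symProd g h := by
  rw [symProd, Matrix.transpose_smul, Matrix.transpose_add, Matrix.transpose_transpose, add_comm]

theorem dotProduct_mul_dotProduct (g h w : ι → ℝ) :
    (g ⬝ᵥ w) * (h ⬝ᵥ w) = quadC (symProd g h) w + g ⬝ᵥ h := by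
  rw [dotProduct_sq_eq_quadC, symProd, quadC_smul, quadC_add, quadC_transpose]
  ring

/-- A sum of two rank-one matrices: its trace against `M` costs the operator norm of `M`. The
Frobenius norm would not do, as it grows with the information. -/
theorem abs_trace_symProd_mul_le (g h : ι → ℝ) (M : Matrix ι ι ℝ) :
    |(symProd g h * M).trace| ≤ vn g * vn h * ‖M‖ := by
  have h1 : ∀ u v : ι → ℝ, |(Matrix.vecMulVec u v * M).trace| ≤ vn u * vn v * ‖M‖ := fun u v => by
    rw [Matrix.vecMulVec_mul, Matrix.trace_vecMulVec, ← Matrix.mulVec_transpose]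
    refine (abs_dotProduct_le _ _).trans ?_
    have := vn_mulVec_le Mᵀ v
    rw [opNorm_transpose] at this
    nlinarith [vn_nonneg u, vn_nonneg v]
  have h2 := h1 g h
  have h3 := h1 h g
  rw [symProd, Matrix.transpose_vecMulVec, Matrix.smul_mul, Matrix.trace_smul, Matrix.add_mul,
    Matrix.trace_add, smul_eq_mul, abs_mul, abs_of_nonneg (by norm_num : (0 : ℝ) ≤ 1 / 2)]
  have := abs_add_le (Matrix.vecMulVec g h * M).trace (Matrix.vecMulVec h g * M).trace
  nlinarith

theorem integrable_mixed (g h : ι → ℝ) (S R : Matrix ι ι ℝ) (b c : ℝ) :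
    Integrable (fun w => (g ⬝ᵥ w) * (h ⬝ᵥ w) *
      ((1 / 2 * quadC S w + b) * (1 / 2 * quadC R w + c))) (stdG ι) := by
  have hl : ∀ (S : Matrix ι ι ℝ) (b : ℝ), UnifMom (fun _ : Unit => stdG ι)
      fun _ w => 1 / 2 * quadC S w + b := fun S b =>
    ((single_unifMom_quadC S).const_mul _).add (unifMom_const (c := fun _ => b) fun _ => le_rfl)
  exact (((single_unifMom_dotProduct g).mul (single_unifMom_dotProduct h)).mul
    ((hl S b).mul (hl R c))).integrable ()

/-- The product of two linear forms is a centered quadratic form plus the constant `g ⬝ᵥ h`, so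
moments of at most three centered forms suffice. The constant produces the leading term, in which
the linear and quadratic factors look independent; every other term contains `symProd` and stays
bounded. -/
theorem integral_mixed (g h : ι → ℝ) {S R : Matrix ι ι ℝ} (hS : Sᵀ = S) (hR : Rᵀ = R) (b c : ℝ) :
    ∫ w, (g ⬝ᵥ w) * (h ⬝ᵥ w) * ((1 / 2 * quadC S w + b) * (1 / 2 * quadC R w + c)) ∂(stdG ι)
      = g ⬝ᵥ h * (1 / 2 * (S * R).trace + b * c) + (2 * (symProd g h * (S * R)).trace
        + c * (symProd g h * S).trace + b * (symProd g h * R).trace) := by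
  set A := symProd g h with hA
  have hAt : Aᵀ = A := symProd_transpose g h
  have e : (fun w => (g ⬝ᵥ w) * (h ⬝ᵥ w) * ((1 / 2 * quadC S w + b) * (1 / 2 * quadC R w + c)))
      = fun w => 1 / 4 * (quadC A w * quadC S w * quadC R w) + (c / 2 * (quadC A w * quadC S w)
        + (b / 2 * (quadC A w * quadC R w) + (b * c * quadC A w
        + (g ⬝ᵥ h / 4 * (quadC S w * quadC R w) + (g ⬝ᵥ h * c / 2 * quadC S w
        + (g ⬝ᵥ h * b / 2 * quadC R w + g ⬝ᵥ h * (b * c))))))) := by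
    funext w
    rw [dotProduct_mul_dotProduct]
    ring
  have i3 := (integrable_quadC_mul_mul A S R).const_mul (1 / 4 : ℝ)
  have i4 := (integrable_quadC_mul A S).const_mul (c / 2)
  have i5 := (integrable_quadC_mul A R).const_mul (b / 2)
  have i6 := (integrable_quadC A).const_mul (b * c)
  have i7 := (integrable_quadC_mul S R).const_mul (g ⬝ᵥ h / 4)
  have i8 := (integrable_quadC S).const_mul (g ⬝ᵥ h * c / 2)
  have i9 := (integrable_quadC R).const_mul (g ⬝ᵥ h * b / 2)
  have i10 : Integrable (fun _ : ι → ℝ => g ⬝ᵥ h * (b * c)) (stdG ι) := integrable_const _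
  have j9 := i9.add i10
  have j8 := i8.add j9
  have j7 := i7.add j8
  have j6 := i6.add j7
  have j5 := i5.add j6
  have j4 := i4.add j5
  rw [e]
  erw [integral_add i3 j4]
  erw [integral_add i4 j5]
  erw [integral_add i5 j6]
  erw [integral_add i6 j7]
  erw [integral_add i7 j8]
  erw [integral_add i8 j9]
  erw [integral_add i9 i10]
  simp only [integral_const_mul, integral_quadC, integral_quadC_mul hAt hS,
    integral_quadC_mul hAt hR, integral_quadC_mul hS hR, integral_quadC_mul_mul hAt hS hR,
    integral_const, probReal_univ, smul_eq_mul, Matrix.mul_assoc]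
  ring

end MixedMoments

namespace Design

variable {p q : ℕ} {D : Design p q} {σ τ : Param q}

variable (D) in
/-- The coefficients of the linear forms `∂t/∂σ_i`. -/
def hvec (σ : Param q) (i : Fin (q + 1)) : D.Noise → ℝ := (D.H σ)ᵀ *ᵥ (D.P σ *ᵥ D.tSlope σ i)

variable (D) in
/-- The deterministic part of the score at `σ`. -/
def bias (meth : Method) (σ : Param q) (i : Fin (q + 1)) : ℝ :=
  1 / 2 * ((D.Bm σ D.P i).trace - (D.Bm σ (D.Lam meth) i).trace)

variable (D) in
/-- The linear approximation of `t(σ̂) - t(σ)`. -/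
def lin (meth : Method) (σ : Param q) (w : D.Noise → ℝ) : ℝ :=
  ∑ i, ∑ k, (-D.hess meth σ)⁻¹ i k *
    ((D.hvec σ i ⬝ᵥ w) * (1 / 2 * quadC (D.Bm σ D.P k) w + D.bias meth σ k))

theorem tSlope_dotProduct (h : (D.cov σ).PosDef) (i : Fin (q + 1)) (β : Fin p → ℝ)
    (w : D.Noise → ℝ) :
    D.tSlope σ i ⬝ᵥ (D.P σ *ᵥ (D.X *ᵥ β + D.H σ *ᵥ w)) = D.hvec σ i ⬝ᵥ w := by
  rw [P_mulVec_response h, hvec, mulVec_dotProduct, Matrix.transpose_transpose, mulVec_dotProduct,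
    P_transpose h]

theorem score_eq (hσ : ∀ i, 0 < σ i) (meth : Method) (i : Fin (q + 1)) (β : Fin p → ℝ)
    (w : D.Noise → ℝ) : D.score meth σ (D.X *ᵥ β + D.H σ *ᵥ w) i
      = 1 / 2 * quadC (D.Bm σ D.P i) w + D.bias meth σ i := by
  have hP := D.isResolvent_P
  have h := hP.pd hσ
  rw [score, quad_P_V_P hσ h, (D.isResolvent_Lam meth).trace_mul_V hσ h,
    (D.isResolvent_Lam meth).proj_mul_Bm hσ, hP.proj_mul_Bm hσ, hP.Bm_mul_proj hσ, bias, quadC]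
  ring

theorem abs_bias_le {κ : ℝ} (hσ : ∀ i, 0 < σ i) (hκ : ∀ i, 1 / σ i ≤ κ) (meth : Method)
    (i : Fin (q + 1)) : |D.bias meth σ i| ≤ p * κ := by
  have h1 := abs_trace_Lam_sub_le (D := D) hσ hκ meth i
  have hκ0 := kappa_pos hσ hκ
  have h2 : (0 : ℝ) ≤ p * κ := by positivity
  rw [bias, abs_mul, abs_of_nonneg (by norm_num : (0 : ℝ) ≤ 1 / 2), abs_sub_comm]
  linarith

theorem blueVar_nonneg (h : (D.cov σ).PosDef) (c : Fin p → ℝ) : 0 ≤ D.blueVar σ c :=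
  quad_nonneg_of_posSemidef (M_posDef h).posSemidef c

section Slopes

variable {κ : ℝ} (hσ : ∀ i, 0 < σ i) (hκ : ∀ i, 1 / σ i ≤ κ)
include hσ

theorem sSlope_eq (i : Fin (q + 1)) : D.sSlope σ i = D.cov σ *ᵥ D.ds σ i := by
  rw [ds_eq hσ, Matrix.mulVec_mulVec, cov_mul_inv (D.isResolvent_P.pd hσ), Matrix.one_mulVec]

theorem vn_J_transpose_le (m : D.RE → ℝ) :
    vn ((D.J σ)ᵀ *ᵥ m) ≤ √(∑ i, σ i) * vn m := by
  have hS : 0 ≤ ∑ i, σ i := Finset.sum_nonneg fun i _ => (hσ i).le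
  rw [← sq_le_sq₀ (vn_nonneg _) (mul_nonneg (Real.sqrt_nonneg _) (vn_nonneg _)), mul_pow,
    Real.sq_sqrt hS, vn_sq, vn_sq, mulVec_dotProduct, Matrix.transpose_transpose,
    Matrix.mulVec_mulVec, J_mul_transpose hσ]
  simp only [dotProduct, G, Matrix.mulVec_diagonal, Finset.mul_sum]
  refine Finset.sum_le_sum fun j _ => ?_
  have := Finset.single_le_sum (f := fun i => σ i) (fun i _ => (hσ i).le)
    (Finset.mem_univ j.1.succ)
  nlinarith [mul_self_nonneg (m j)]

omit hσ in
theorem vn_dG_le (i : Fin (q + 1)) (m : D.RE → ℝ) : vn (D.dG i *ᵥ m) ≤ vn m := by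
  rw [← sq_le_sq₀ (vn_nonneg _) (vn_nonneg _), vn_sq, vn_sq]
  simp only [dotProduct, dG, Matrix.mulVec_diagonal]
  refine Finset.sum_le_sum fun j _ => ?_
  split_ifs
  · simp
  · simpa using mul_self_nonneg (m j)

/-- On the block of the `i`-th effect `G` is the scalar `σ i`; elsewhere, and everywhere for `i =
0`, `dG i` vanishes. Producing the factor `G` allows the substitution `Z G = H Jᵀ`. -/
theorem G_mulVec_dG (i : Fin (q + 1)) (m : D.RE → ℝ) :
    D.dG i *ᵥ m = (1 / σ i) • (D.G σ *ᵥ (D.dG i *ᵥ m)) := by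
  funext j
  simp only [dG, G, Matrix.mulVec_diagonal, Pi.smul_apply, smul_eq_mul]
  split_ifs with hj
  · rw [hj]; field_simp [(hσ i).ne']
  · simp

/-- Once `Z` is eliminated through `Z G = H Jᵀ`, only matrices with operator norms bounded
independently of the design remain. -/
theorem H_transpose_ds (i : Fin (q + 1)) :
    (D.H σ)ᵀ *ᵥ D.ds σ i
      = (1 / σ i) • (D.Gam σ (fun τ => (D.cov τ)⁻¹) σ *ᵥ ((D.J σ)ᵀ *ᵥ (D.dG i *ᵥ D.m)))
        - D.Bm σ (fun τ => (D.cov τ)⁻¹) i *ᵥ ((D.J σ)ᵀ *ᵥ D.m) := by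
  have e1 : ∀ v, D.Gam σ (fun τ => (D.cov τ)⁻¹) σ *ᵥ ((D.J σ)ᵀ *ᵥ v)
      = (D.H σ)ᵀ *ᵥ ((D.cov σ)⁻¹ *ᵥ (D.Zfull *ᵥ (D.G σ *ᵥ v))) := fun v => by
    rw [Gam, Matrix.mulVec_mulVec, Matrix.mul_assoc, H_mul_J_transpose hσ]
    simp only [Matrix.mulVec_mulVec, Matrix.mul_assoc]
  have e2 : D.Bm σ (fun τ => (D.cov τ)⁻¹) i *ᵥ ((D.J σ)ᵀ *ᵥ D.m)
      = (D.H σ)ᵀ *ᵥ ((D.cov σ)⁻¹ *ᵥ (D.V i *ᵥ D.s σ)) := by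
    rw [Bm, Matrix.mulVec_mulVec, Matrix.mul_assoc, H_mul_J_transpose hσ, s]
    simp only [Matrix.mulVec_mulVec, Matrix.mul_assoc]
  rw [ds_eq hσ, sSlope, Matrix.mulVec_sub, Matrix.mulVec_sub, e1, e2]
  congr 1
  conv_lhs => rw [G_mulVec_dG hσ i D.m]
  simp only [Matrix.mulVec_smul]

include hκ

theorem vn_H_transpose_ds_le (i : Fin (q + 1)) :
    vn ((D.H σ)ᵀ *ᵥ D.ds σ i) ≤ 2 * κ * (√(∑ i, σ i) * vn D.m) := by
  have hκ0 := kappa_pos hσ hκ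
  have hI := D.isResolvent_inv
  have hi : 0 < 1 / σ i := one_div_pos.2 (hσ i)
  rw [H_transpose_ds hσ]
  refine (vn_sub_le _ _).trans ?_
  rw [vn_smul, abs_of_pos hi]
  have h1 := (hI.vn_proj_le hσ ((D.J σ)ᵀ *ᵥ (D.dG i *ᵥ D.m))).trans
    ((vn_J_transpose_le hσ _).trans
      (mul_le_mul_of_nonneg_left (vn_dG_le i D.m) (Real.sqrt_nonneg _)))
  have h2 := (vn_mulVec_le (D.Bm σ (fun τ => (D.cov τ)⁻¹) i) ((D.J σ)ᵀ *ᵥ D.m)).trans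
    (mul_le_mul ((hI.opNorm_Bm_le hσ i).trans (hκ i)) (vn_J_transpose_le hσ D.m) (vn_nonneg _)
      hκ0.le)
  have h3 := mul_le_mul (hκ i) h1 (vn_nonneg _) hκ0.le
  linarith

omit hκ

theorem cov_mul_P_mul_cov : D.cov σ * D.P σ * D.cov σ = D.cov σ - D.X * D.M σ * D.Xᵀ := by
  have h := D.isResolvent_P.pd hσ
  rw [cov_mul_P h, Matrix.sub_mul, Matrix.one_mul, Matrix.mul_assoc _ _ (D.cov σ), cov_inv_mul h,
    Matrix.mul_one]

theorem H_transpose_P_dot (u v : Fin D.n → ℝ) :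
    ((D.H σ)ᵀ *ᵥ (D.P σ *ᵥ u)) ⬝ᵥ ((D.H σ)ᵀ *ᵥ (D.P σ *ᵥ v)) = u ⬝ᵥ (D.P σ *ᵥ v) := by
  have h := D.isResolvent_P.pd hσ
  have e : D.P σ * (D.H σ * ((D.H σ)ᵀ * D.P σ)) = D.P σ := by
    rw [← Matrix.mul_assoc (D.H σ), H_mul_transpose hσ, ← Matrix.mul_assoc,
      D.isResolvent_P.mul_cov_mul h h]
  rw [mulVec_dotProduct, Matrix.transpose_transpose, mulVec_dotProduct, P_transpose h]
  simp only [Matrix.mulVec_mulVec, e]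

theorem Gam_mul_H_transpose : D.Gam σ D.P σ * (D.H σ)ᵀ = (D.H σ)ᵀ * (D.P σ * D.cov σ) := by
  rw [Gam, Matrix.mul_assoc, H_mul_transpose hσ, Matrix.mul_assoc]

/-- Since `Σ P Σ = Σ - X M Xᵀ`, the Gram matrix of these vectors is that of `g₃`, minus covariances
of the estimated combinations `(Xᵀ ∂s/∂σ_i)'β`, which consistency makes negligible. -/
theorem sSlope_dot (i j : Fin (q + 1)) :
    ((D.H σ)ᵀ *ᵥ (D.P σ *ᵥ D.sSlope σ i)) ⬝ᵥ ((D.H σ)ᵀ *ᵥ (D.P σ *ᵥ D.sSlope σ j))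
      = ((D.gradS σ)ᵀ * D.cov σ * D.gradS σ) i j
        - (D.Xᵀ *ᵥ D.ds σ i) ⬝ᵥ (D.M σ *ᵥ (D.Xᵀ *ᵥ D.ds σ j)) := by
  have h := D.isResolvent_P.pd hσ
  have e : ((D.gradS σ)ᵀ * D.cov σ * D.gradS σ) i j = D.ds σ i ⬝ᵥ (D.cov σ *ᵥ D.ds σ j) := by
    rw [Matrix.mul_assoc, Matrix.mul_apply, dotProduct]
    rfl
  rw [H_transpose_P_dot hσ, sSlope_eq hσ, sSlope_eq hσ, mulVec_dotProduct, cov_transpose h,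
    Matrix.mulVec_mulVec, Matrix.mulVec_mulVec, cov_mul_P_mul_cov hσ, e,
    Matrix.sub_mulVec, dotProduct_sub, mulVec_dotProduct, Matrix.transpose_transpose]
  simp only [Matrix.mulVec_mulVec, Matrix.mul_assoc]

include hκ

theorem vn_sSlope_le (i : Fin (q + 1)) :
    vn ((D.H σ)ᵀ *ᵥ (D.P σ *ᵥ D.sSlope σ i)) ≤ 2 * κ * (√(∑ i, σ i) * vn D.m) := by
  have e : (D.H σ)ᵀ *ᵥ (D.P σ *ᵥ D.sSlope σ i) = D.Gam σ D.P σ *ᵥ ((D.H σ)ᵀ *ᵥ D.ds σ i) := by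
    rw [sSlope_eq hσ, Matrix.mulVec_mulVec (D.ds σ i) (D.Gam σ D.P σ), Gam_mul_H_transpose hσ]
    simp only [Matrix.mulVec_mulVec]
  rw [e]
  exact (D.isResolvent_P.vn_proj_le hσ _).trans (vn_H_transpose_ds_le hσ hκ i)

/-- The difference comes from the dependence of the generalized least squares estimator on the
parameter. It is a bounded operator applied to `Hᵀ k` with `k = Σ⁻¹ X M (l - Xᵀ s)`, whose squared
length is exactly the variance `blueVar`. -/
theorem vn_hvec_sub_le (i : Fin (q + 1)) :
    vn (D.hvec σ i - (D.H σ)ᵀ *ᵥ (D.P σ *ᵥ D.sSlope σ i))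
      ≤ κ * √(D.blueVar σ (D.l - D.Xᵀ *ᵥ D.s σ)) := by
  have hP := D.isResolvent_P
  have hI := D.isResolvent_inv
  have h := hP.pd hσ
  have hκ0 := kappa_pos hσ hκ
  set g := D.l - D.Xᵀ *ᵥ D.s σ with hg
  set k := (D.cov σ)⁻¹ *ᵥ (D.X *ᵥ (D.M σ *ᵥ g)) with hk
  have hkk : vn ((D.H σ)ᵀ *ᵥ k) ^ 2 = D.blueVar σ g := by
    rw [vn_sq, mulVec_dotProduct, Matrix.transpose_transpose, Matrix.mulVec_mulVec,
      H_mul_transpose hσ, hk, Matrix.mulVec_mulVec _ (D.cov σ), cov_mul_inv h, Matrix.one_mulVec,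
      mulVec_dotProduct, mulVec_dotProduct, mulVec_dotProduct, cov_inv_transpose h,
      M_transpose h, blueVar]
    congr 1
    have : D.M σ * D.Xᵀ * (D.cov σ)⁻¹ * D.X * D.M σ
        = D.M σ * (D.Xᵀ * (D.cov σ)⁻¹ * D.X) * D.M σ := by simp only [Matrix.mul_assoc]
    simp only [Matrix.mulVec_mulVec, ← Matrix.mul_assoc]
    rw [this, M_mul_info h, Matrix.one_mul]
  have e : D.hvec σ i - (D.H σ)ᵀ *ᵥ (D.P σ *ᵥ D.sSlope σ i)
      = -(D.Gam σ D.P σ *ᵥ (D.Bm σ (fun τ => (D.cov τ)⁻¹) i *ᵥ ((D.H σ)ᵀ *ᵥ k))) := by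
    have e1 : D.Bm σ (fun τ => (D.cov τ)⁻¹) i *ᵥ ((D.H σ)ᵀ *ᵥ k)
        = (D.H σ)ᵀ *ᵥ ((D.cov σ)⁻¹ *ᵥ (D.V i *ᵥ k)) := by
      rw [Bm, Matrix.mulVec_mulVec, Matrix.mul_assoc, H_mul_transpose hσ, Matrix.mul_assoc,
        cov_inv_mul h, Matrix.mul_one]
      simp only [Matrix.mulVec_mulVec, Matrix.mul_assoc]
    have e2 : ∀ v, D.Gam σ D.P σ *ᵥ ((D.H σ)ᵀ *ᵥ ((D.cov σ)⁻¹ *ᵥ v))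
        = (D.H σ)ᵀ *ᵥ (D.P σ *ᵥ v) := fun v => by
      rw [Matrix.mulVec_mulVec _ (D.Gam σ D.P σ), Gam_mul_H_transpose hσ, Matrix.mulVec_mulVec,
        Matrix.mul_assoc, Matrix.mul_assoc, cov_mul_inv h, Matrix.mul_one, Matrix.mulVec_mulVec]
    rw [e1, e2, hvec, tSlope, ← hg, ← hk, Matrix.mulVec_sub, Matrix.mulVec_sub, sub_sub_cancel_left]
  have h1 := (hP.vn_proj_le hσ (D.Bm σ (fun τ => (D.cov τ)⁻¹) i *ᵥ ((D.H σ)ᵀ *ᵥ k))).trans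
    ((vn_mulVec_le _ _).trans (mul_le_mul_of_nonneg_right
      ((hI.opNorm_Bm_le hσ i).trans (hκ i)) (vn_nonneg _)))
  have h2 : vn ((D.H σ)ᵀ *ᵥ k) = √(D.blueVar σ g) := by
    rw [← hkk, Real.sqrt_sq (vn_nonneg _)]
  have h3 : ∀ v : D.Noise → ℝ, vn (-v) = vn v := fun v => by
    rw [← neg_one_smul ℝ v, vn_smul]; simp
  rw [e, h3, ← h2]
  exact h1

/-- A bound of the linear forms `∂t/∂σ_i`. -/
theorem vn_hvec_le (i : Fin (q + 1)) :
    vn (D.hvec σ i) ≤ 2 * κ * (√(∑ i, σ i) * vn D.m)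
      + κ * √(D.blueVar σ (D.l - D.Xᵀ *ᵥ D.s σ)) := by
  have := vn_add_le ((D.H σ)ᵀ *ᵥ (D.P σ *ᵥ D.sSlope σ i))
    (D.hvec σ i - (D.H σ)ᵀ *ᵥ (D.P σ *ᵥ D.sSlope σ i))
  rw [add_sub_cancel] at this
  linarith [vn_sSlope_le (D := D) hσ hκ i, vn_hvec_sub_le (D := D) hσ hκ i]

/-- Two corrections to `sSlope_dot`: the fixed-effect covariance, bounded by Cauchy–Schwarz for the
form `M`, and the replacement of `hvec` by its part from `∂s/∂σ`. -/
theorem abs_hvec_dot_sub_le (i j : Fin (q + 1)) :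
    |D.hvec σ i ⬝ᵥ D.hvec σ j - ((D.gradS σ)ᵀ * D.cov σ * D.gradS σ) i j|
      ≤ √(D.blueVar σ (D.Xᵀ *ᵥ D.ds σ i)) * √(D.blueVar σ (D.Xᵀ *ᵥ D.ds σ j))
        + κ * √(D.blueVar σ (D.l - D.Xᵀ *ᵥ D.s σ)) * (4 * κ * (√(∑ i, σ i) * vn D.m)
          + κ * √(D.blueVar σ (D.l - D.Xᵀ *ᵥ D.s σ))) := by
  have h := D.isResolvent_P.pd hσ
  have hκ0 := kappa_pos hσ hκ
  set a := fun i => (D.H σ)ᵀ *ᵥ (D.P σ *ᵥ D.sSlope σ i) with ha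
  set r := 2 * κ * (√(∑ i, σ i) * vn D.m) with hr
  set e := κ * √(D.blueVar σ (D.l - D.Xᵀ *ᵥ D.s σ)) with he
  have har : ∀ i, vn (a i) ≤ r := fun i => vn_sSlope_le hσ hκ i
  have hfe : ∀ i, vn (D.hvec σ i - a i) ≤ e := fun i => vn_hvec_sub_le hσ hκ i
  have hr0 : 0 ≤ r := (vn_nonneg _).trans (har i)
  have he0 : 0 ≤ e := (vn_nonneg _).trans (hfe i)
  have hM := sq_dotProduct_mulVec_le (M_posDef h).posSemidef (D.Xᵀ *ᵥ D.ds σ i) (D.Xᵀ *ᵥ D.ds σ j)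
  have hM' : |(D.Xᵀ *ᵥ D.ds σ i) ⬝ᵥ (D.M σ *ᵥ (D.Xᵀ *ᵥ D.ds σ j))|
      ≤ √(D.blueVar σ (D.Xᵀ *ᵥ D.ds σ i)) * √(D.blueVar σ (D.Xᵀ *ᵥ D.ds σ j)) := by
    rw [← Real.sqrt_mul (blueVar_nonneg h _)]
    exact Real.abs_le_sqrt hM
  have hdec : D.hvec σ i ⬝ᵥ D.hvec σ j - ((D.gradS σ)ᵀ * D.cov σ * D.gradS σ) i j
      = -((D.Xᵀ *ᵥ D.ds σ i) ⬝ᵥ (D.M σ *ᵥ (D.Xᵀ *ᵥ D.ds σ j)))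
        + (a i ⬝ᵥ (D.hvec σ j - a j) + (D.hvec σ i - a i) ⬝ᵥ a j
          + (D.hvec σ i - a i) ⬝ᵥ (D.hvec σ j - a j)) := by
    have := sSlope_dot (D := D) hσ i j
    have h2 : a i ⬝ᵥ a j = ((D.gradS σ)ᵀ * D.cov σ * D.gradS σ) i j
        - (D.Xᵀ *ᵥ D.ds σ i) ⬝ᵥ (D.M σ *ᵥ (D.Xᵀ *ᵥ D.ds σ j)) := this
    simp only [sub_dotProduct, dotProduct_sub]
    linarith
  have b1 := (abs_dotProduct_le (a i) (D.hvec σ j - a j)).trans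
    (mul_le_mul (har i) (hfe j) (vn_nonneg _) hr0)
  have b2 := (abs_dotProduct_le (D.hvec σ i - a i) (a j)).trans
    (mul_le_mul (hfe i) (har j) (vn_nonneg _) he0)
  have b3 := (abs_dotProduct_le (D.hvec σ i - a i) (D.hvec σ j - a j)).trans
    (mul_le_mul (hfe i) (hfe j) (vn_nonneg _) he0)
  rw [hdec]
  refine (abs_add_le _ _).trans (add_le_add (by rwa [abs_neg]) ?_)
  have b4 := abs_add_le (a i ⬝ᵥ (D.hvec σ j - a j) + (D.hvec σ i - a i) ⬝ᵥ a j)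
    ((D.hvec σ i - a i) ⬝ᵥ (D.hvec σ j - a j))
  have b5 := abs_add_le (a i ⬝ᵥ (D.hvec σ j - a j)) ((D.hvec σ i - a i) ⬝ᵥ a j)
  have : 4 * κ * (√(∑ i, σ i) * vn D.m) = 2 * r := by rw [hr]; ring
  rw [this]
  linarith

/-- The second moment of the linear approximation. -/
theorem abs_integral_lin_sq_sub_le (meth : Method) {K r η : ℝ} (h1 : 1 ≤ D.dstar σ) (hK : 0 ≤ K)
    (hN' : (-D.hess meth σ)⁻¹ * -D.hess meth σ = 1)
    (hNK : ∀ i j, |(-D.hess meth σ)⁻¹ i j| ≤ K / (D.d σ i * D.d σ j))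
    (hr : ∀ i, vn (D.hvec σ i) ≤ r)
    (hη : ∀ i j, |D.hvec σ i ⬝ᵥ D.hvec σ j - ((D.gradS σ)ᵀ * D.cov σ * D.gradS σ) i j| ≤ η) :
    |∫ w, D.lin meth σ w ^ 2 ∂(stdG D.Noise)
        - ((D.gradS σ)ᵀ * D.cov σ * D.gradS σ * (-D.hess meth σ)⁻¹).trace|
      ≤ ((q : ℝ) + 1) ^ 4 * K ^ 2 * (r ^ 2 * (p * κ ^ 2 + 2 * κ ^ 2 + 2 * p * κ ^ 2 + p ^ 2 * κ ^ 2)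
          / D.dstar σ ^ 4 + η * (1 / 2 + p * κ ^ 2) / D.dstar σ ^ 2) := by
  have hP := D.isResolvent_P
  have hκ0 := kappa_pos hσ hκ
  set N := (-D.hess meth σ)⁻¹ with hNdef
  set G := (D.gradS σ)ᵀ * D.cov σ * D.gradS σ with hG
  set B := D.Bm σ D.P with hB
  set b := D.bias meth σ with hb
  set x := fun (i : Fin (q + 1)) (w : D.Noise → ℝ) => D.hvec σ i ⬝ᵥ w with hx
  set a := fun (i : Fin (q + 1)) (w : D.Noise → ℝ) => 1 / 2 * quadC (B i) w + b i with ha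
  set E := fun i j k l => ∫ w, x i w * x j w * (a k w * a l w) ∂(stdG D.Noise) with hE
  have hint : ∀ i j k l, Integrable (fun w => x i w * x j w * (a k w * a l w)) (stdG D.Noise) :=
    fun i j k l => integrable_mixed _ _ _ _ _ _
  have hsq : ∀ w, D.lin meth σ w ^ 2
      = ∑ i, ∑ j, ∑ k, ∑ l, N i k * N j l * (x i w * x j w * (a k w * a l w)) := fun w => by
    rw [lin, sq, Finset.sum_mul_sum]
    refine Finset.sum_congr rfl fun i _ => Finset.sum_congr rfl fun j _ => ?_
    rw [Finset.sum_mul_sum]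
    refine Finset.sum_congr rfl fun k _ => Finset.sum_congr rfl fun l _ => ?_
    simp only [hx, ha]; ring
  have hI : ∫ w, D.lin meth σ w ^ 2 ∂(stdG D.Noise)
      = ∑ i, ∑ j, ∑ k, ∑ l, N i k * N j l * E i j k l := by
    simp_rw [hsq]
    rw [integral_finsetSum _ fun i _ => integrable_finsetSum _ fun j _ =>
      integrable_finsetSum _ fun k _ => integrable_finsetSum _ fun l _ => (hint i j k l).const_mul _]
    refine Finset.sum_congr rfl fun i _ => ?_
    rw [integral_finsetSum _ fun j _ =>
      integrable_finsetSum _ fun k _ => integrable_finsetSum _ fun l _ => (hint i j k l).const_mul _]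
    refine Finset.sum_congr rfl fun j _ => ?_
    rw [integral_finsetSum _ fun k _ => integrable_finsetSum _ fun l _ =>
      (hint i j k l).const_mul _]
    refine Finset.sum_congr rfl fun k _ => ?_
    rw [integral_finsetSum _ fun l _ => (hint i j k l).const_mul _]
    exact Finset.sum_congr rfl fun l _ => integral_const_mul _ _
  -- `N (-A) Nᵀ = Nᵀ` puts the trace into the same fourfold sum as the second moment, so the
  -- comparison can be made term by term.
  have hT : (G * N).trace = ∑ i, ∑ j, ∑ k, ∑ l, N i k * N j l * (G i j * (-D.hess meth σ) k l) := by
    have e1 : ∀ i j, ∑ k, ∑ l, N i k * N j l * (G i j * (-D.hess meth σ) k l) = G i j * N j i := by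
      intro i j
      have e2 : N j i = (N * (-D.hess meth σ * Nᵀ)) i j := by
        rw [← Matrix.mul_assoc, hN', Matrix.one_mul, Matrix.transpose_apply]
      rw [e2, Matrix.mul_apply, Finset.mul_sum]
      refine Finset.sum_congr rfl fun k _ => ?_
      rw [Matrix.mul_apply, Finset.mul_sum, Finset.mul_sum]
      refine Finset.sum_congr rfl fun l _ => ?_
      rw [Matrix.transpose_apply]; ring
    simp_rw [e1]
    rfl
  have hd : ∀ i, D.dstar σ ≤ D.d σ i := fun i => dstar_le i
  have hd0 : ∀ i, 0 < D.d σ i := fun i => by linarith [hd i]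
  have hr0 : 0 ≤ r := (vn_nonneg _).trans (hr 0)
  have hη0 : 0 ≤ η := (abs_nonneg _).trans (hη 0 0)
  have hp0 : (0 : ℝ) ≤ p := p.cast_nonneg
  set δ := r ^ 2 * (p * κ ^ 2 + 2 * κ ^ 2 + 2 * p * κ ^ 2 + p ^ 2 * κ ^ 2) with hδ
  have hδ0 : 0 ≤ δ := by positivity
  have hBn : ∀ i, ‖B i‖ ≤ κ := fun i => (hP.opNorm_Bm_le hσ i).trans (hκ i)
  have hbn : ∀ i, |b i| ≤ p * κ := fun i => abs_bias_le hσ hκ meth i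
  -- The deviation splits into terms bounded by the constant `δ` and one term of size `η d_k d_l`,
  -- from replacing the inner product of the `hvec` by the entry of `G`. The entries of `N` supply
  -- four factors `1/d`, so the first kind is of order `d_*⁻⁴` and the second `η d_*⁻²`.
  have hEb : ∀ i j k l, |E i j k l - G i j * (-D.hess meth σ) k l|
      ≤ δ + η * (1 / 2 + p * κ ^ 2) * (D.d σ k * D.d σ l) := by
    intro i j k l
    have hh : |D.hvec σ i ⬝ᵥ D.hvec σ j| ≤ r ^ 2 := by
      refine (abs_dotProduct_le _ _).trans ?_
      rw [sq]
      exact mul_le_mul (hr i) (hr j) (vn_nonneg _) hr0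
    have hA : (-D.hess meth σ) k l = (B k * B l).trace
        - 1 / 2 * (D.Bm σ (D.Lam meth) k * D.Bm σ (D.Lam meth) l).trace := by
      simp only [Matrix.neg_apply, hess, Matrix.of_apply, hB]; ring
    have ht := abs_trace_Lam_mul_sub_le (D := D) hσ hκ meth k l
    have htr : |(B k * B l).trace| ≤ D.d σ k * D.d σ l := by
      refine (abs_trace_mul_le _ _).trans ?_
      rw [hB, fro_Bm hσ, fro_Bm hσ]
    have e1 : E i j k l - G i j * (-D.hess meth σ) k l
        = D.hvec σ i ⬝ᵥ D.hvec σ j * (1 / 2 * ((D.Bm σ (D.Lam meth) k * D.Bm σ (D.Lam meth) l).trace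
            - (B k * B l).trace))
          + (2 * (symProd (D.hvec σ i) (D.hvec σ j) * (B k * B l)).trace
          + (b l * (symProd (D.hvec σ i) (D.hvec σ j) * B k).trace
            + b k * (symProd (D.hvec σ i) (D.hvec σ j) * B l).trace)
          + D.hvec σ i ⬝ᵥ D.hvec σ j * (b k * b l))
          + (D.hvec σ i ⬝ᵥ D.hvec σ j - G i j) * (-D.hess meth σ) k l := by
      have e0 : E i j k l = _ := integral_mixed (D.hvec σ i) (D.hvec σ j)
        (hP.Bm_transpose hσ k) (hP.Bm_transpose hσ l) (b k) (b l)
      rw [e0, hA]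
      ring
    have hvv : vn (D.hvec σ i) * vn (D.hvec σ j) ≤ r ^ 2 := by
      rw [sq]; exact mul_le_mul (hr i) (hr j) (vn_nonneg _) hr0
    have hsym : ∀ (S : Matrix D.Noise D.Noise ℝ) (c : ℝ), ‖S‖ ≤ c →
        |(symProd (D.hvec σ i) (D.hvec σ j) * S).trace| ≤ r ^ 2 * c := fun S c hS =>
      (abs_trace_symProd_mul_le _ _ _).trans
        (mul_le_mul hvv hS (norm_nonneg _) (by positivity))
    have s1 := hsym (B k * B l) (κ * κ) ((norm_mul_le _ _).trans
      (mul_le_mul (hBn k) (hBn l) (norm_nonneg _) hκ0.le))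
    have s2 := hsym (B k) κ (hBn k)
    have s3 := hsym (B l) κ (hBn l)
    have q1 : |D.hvec σ i ⬝ᵥ D.hvec σ j * (1 / 2 * ((D.Bm σ (D.Lam meth) k *
        D.Bm σ (D.Lam meth) l).trace - (B k * B l).trace))| ≤ r ^ 2 * (p * κ ^ 2) := by
      rw [abs_mul]
      refine mul_le_mul hh ?_ (abs_nonneg _) (by positivity)
      rw [abs_mul, abs_of_nonneg (by norm_num : (0 : ℝ) ≤ 1 / 2)]
      linarith
    have q2 : |2 * (symProd (D.hvec σ i) (D.hvec σ j) * (B k * B l)).trace| ≤ 2 * (r ^ 2 * (κ * κ)) := by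
      rw [abs_mul, abs_of_nonneg (zero_le_two : (0 : ℝ) ≤ 2)]
      linarith
    have q3 : ∀ l S, ‖S‖ ≤ κ → |b l * (symProd (D.hvec σ i) (D.hvec σ j) * S).trace|
        ≤ p * κ * (r ^ 2 * κ) := fun l S hS => by
      rw [abs_mul]
      exact mul_le_mul (hbn l) (hsym S κ hS) (abs_nonneg _) (by positivity)
    have q4 : |D.hvec σ i ⬝ᵥ D.hvec σ j * (b k * b l)| ≤ r ^ 2 * (p * κ * (p * κ)) := by
      rw [abs_mul, abs_mul]
      exact mul_le_mul hh (mul_le_mul (hbn k) (hbn l) (abs_nonneg _) (by positivity))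
        (by positivity) (by positivity)
    have q5 : |(D.hvec σ i ⬝ᵥ D.hvec σ j - G i j) * (-D.hess meth σ) k l|
        ≤ η * (1 / 2 + p * κ ^ 2) * (D.d σ k * D.d σ l) := by
      rw [abs_mul, mul_assoc]
      refine mul_le_mul (hη i j) ?_ (abs_nonneg _) hη0
      have hdd : 1 ≤ D.d σ k * D.d σ l := one_le_mul_of_one_le_of_one_le
        (h1.trans (hd k)) (h1.trans (hd l))
      have e2 : (-D.hess meth σ) k l = 1 / 2 * (B k * B l).trace - 1 / 2 *
          ((D.Bm σ (D.Lam meth) k * D.Bm σ (D.Lam meth) l).trace - (B k * B l).trace) := by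
        rw [hA]; ring
      rw [e2]
      refine (abs_sub _ _).trans ?_
      rw [abs_mul, abs_mul, abs_of_nonneg (by norm_num : (0 : ℝ) ≤ 1 / 2)]
      have : p * κ ^ 2 ≤ p * κ ^ 2 * (D.d σ k * D.d σ l) :=
        le_mul_of_one_le_right (by positivity) hdd
      linarith
    rw [e1]
    have t1 := abs_add_three
      (D.hvec σ i ⬝ᵥ D.hvec σ j * (1 / 2 * ((D.Bm σ (D.Lam meth) k *
        D.Bm σ (D.Lam meth) l).trace - (B k * B l).trace)))
      (2 * (symProd (D.hvec σ i) (D.hvec σ j) * (B k * B l)).trace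
          + (b l * (symProd (D.hvec σ i) (D.hvec σ j) * B k).trace
            + b k * (symProd (D.hvec σ i) (D.hvec σ j) * B l).trace)
          + D.hvec σ i ⬝ᵥ D.hvec σ j * (b k * b l))
      ((D.hvec σ i ⬝ᵥ D.hvec σ j - G i j) * (-D.hess meth σ) k l)
    have t2 := abs_add_three (2 * (symProd (D.hvec σ i) (D.hvec σ j) * (B k * B l)).trace)
      (b l * (symProd (D.hvec σ i) (D.hvec σ j) * B k).trace
            + b k * (symProd (D.hvec σ i) (D.hvec σ j) * B l).trace)
      (D.hvec σ i ⬝ᵥ D.hvec σ j * (b k * b l))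
    have t3 := abs_add_le (b l * (symProd (D.hvec σ i) (D.hvec σ j) * B k).trace)
      (b k * (symProd (D.hvec σ i) (D.hvec σ j) * B l).trace)
    have q31 := q3 l _ (hBn k)
    have q32 := q3 k _ (hBn l)
    rw [hδ]
    linarith
  rw [hI, hT]
  simp only [← Finset.sum_sub_distrib, ← mul_sub]
  have hterm : ∀ i j k l, |N i k * N j l * (E i j k l - G i j * (-D.hess meth σ) k l)|
      ≤ K ^ 2 * (δ / D.dstar σ ^ 4 + η * (1 / 2 + p * κ ^ 2) / D.dstar σ ^ 2) := by
    intro i j k l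
    have hs0 : 0 < D.dstar σ := by linarith
    rw [abs_mul, abs_mul]
    have n1 : |N i k| * |N j l| ≤ K / (D.d σ i * D.d σ k) * (K / (D.d σ j * D.d σ l)) :=
      mul_le_mul (hNK i k) (hNK j l) (abs_nonneg _)
        (div_nonneg hK (mul_nonneg (hd0 i).le (hd0 k).le))
    refine (mul_le_mul n1 (hEb i j k l) (abs_nonneg _) (by
      have := hd0 i; have := hd0 j; have := hd0 k; have := hd0 l; positivity)).trans ?_
    have e3 : K / (D.d σ i * D.d σ k) * (K / (D.d σ j * D.d σ l))
        * (δ + η * (1 / 2 + p * κ ^ 2) * (D.d σ k * D.d σ l))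
        = K ^ 2 * (δ / (D.d σ i * D.d σ k * (D.d σ j * D.d σ l))
          + η * (1 / 2 + p * κ ^ 2) / (D.d σ i * D.d σ j)) := by
      have := (hd0 i).ne'; have := (hd0 j).ne'; have := (hd0 k).ne'; have := (hd0 l).ne'
      field_simp
    rw [e3]
    have m2 : ∀ i j, D.dstar σ ^ 2 ≤ D.d σ i * D.d σ j := fun i j => by
      rw [sq]; exact mul_le_mul (hd i) (hd j) hs0.le (hd0 i).le
    have m4 : D.dstar σ ^ 4 ≤ D.d σ i * D.d σ k * (D.d σ j * D.d σ l) := by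
      have := mul_le_mul (m2 i k) (m2 j l) (by positivity) (mul_nonneg (hd0 i).le (hd0 k).le)
      calc D.dstar σ ^ 4 = D.dstar σ ^ 2 * D.dstar σ ^ 2 := by ring
        _ ≤ _ := this
    have hηp : 0 ≤ η * (1 / 2 + p * κ ^ 2) := by positivity
    refine mul_le_mul_of_nonneg_left (add_le_add ?_ ?_) (by positivity)
    · exact div_le_div_of_nonneg_left hδ0 (by positivity) m4
    · exact div_le_div_of_nonneg_left hηp (by positivity) (m2 i j)
  set c := K ^ 2 * (δ / D.dstar σ ^ 4 + η * (1 / 2 + p * κ ^ 2) / D.dstar σ ^ 2) with hc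
  have hsum : ∀ f : Fin (q + 1) → ℝ, ∀ c', (∀ i, |f i| ≤ c') → |∑ i, f i| ≤ (q + 1) * c' := by
    intro f c' hf
    refine (Finset.abs_sum_le_sum_abs _ _).trans ?_
    refine (Finset.sum_le_sum fun i _ => hf i).trans ?_
    simp
  have := hsum _ _ fun i => hsum _ _ fun j => hsum _ _ fun k => hsum _ _ fun l => hterm i j k l
  refine this.trans (le_of_eq ?_)
  rw [hc]; ring

end Slopes

end Design
end EmpBLUP

end

/-! ### A root of the score equation by a contracting Newton iteration -/

noncomputable section
namespace EmpBLUP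

set_option linter.unusedSectionVars false

open scoped Matrix.Norms.L2Operator

namespace Design

variable {p q : ℕ} (D : Design p q) (meth : Method) (σ : Param q)

/-- The parameter with scaled coordinates `x` about `σ`. -/
def toParam (x : Fin (q + 1) → ℝ) : Param q := WithLp.toLp 2 fun i => σ i + x i / D.d σ i

/-- A modified Newton step for the score equation, in scaled coordinates. -/
def step (y : Fin D.n → ℝ) (x : Fin (q + 1) → ℝ) : Fin (q + 1) → ℝ :=
  open scoped Classical in
  if ∀ i, 0 < D.toParam σ x i then
    fun i => x i + D.d σ i * ∑ j, (-D.hess meth σ)⁻¹ i j * D.score meth (D.toParam σ x) y j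
  else x

/-- The limit of the modified Newton iterates, in scaled coordinates. -/
def stepLimit (y : Fin D.n → ℝ) : Fin (q + 1) → ℝ :=
  limUnder atTop fun n => (D.step meth σ y)^[n] 0

/-- The estimator defined by the modified Newton iteration. -/
def newtonEst (y : Fin D.n → ℝ) : Param q :=
  open scoped Classical in
  if ∀ i, 0 < D.toParam σ (D.stepLimit meth σ y) i then D.toParam σ (D.stepLimit meth σ y) else σ

variable {D} {meth} {σ}

theorem toParam_apply (x : Fin (q + 1) → ℝ) (i : Fin (q + 1)) :
    D.toParam σ x i = σ i + x i / D.d σ i := rfl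

theorem measurable_toParam : Measurable (D.toParam σ) := by
  refine Continuous.measurable ?_
  unfold toParam
  fun_prop

theorem measurableSet_pos : MeasurableSet {τ : Param q | ∀ i, 0 < τ i} := by
  have : {τ : Param q | ∀ i, 0 < τ i} = ⋂ i, {τ : Param q | 0 < τ i} := by ext; simp
  rw [this]
  refine MeasurableSet.iInter fun i => measurableSet_lt measurable_const ?_
  exact Continuous.measurable (by fun_prop)

theorem measurable_step :
    Measurable fun z : (Fin D.n → ℝ) × (Fin (q + 1) → ℝ) => D.step meth σ z.1 z.2 := by
  classical
  have hτ : Measurable fun z : (Fin D.n → ℝ) × (Fin (q + 1) → ℝ) => D.toParam σ z.2 :=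
    measurable_toParam.comp measurable_snd
  have hz : Measurable fun z : (Fin D.n → ℝ) × (Fin (q + 1) → ℝ) => (D.toParam σ z.2, z.1) :=
    hτ.prodMk measurable_fst
  have hx : Measurable fun z : (Fin D.n → ℝ) × (Fin (q + 1) → ℝ) => z.2 := measurable_snd
  unfold step
  refine Measurable.ite (hτ measurableSet_pos) ?_ hx
  refine measurable_pi_lambda _ fun i => ?_
  refine ((measurable_pi_apply i).comp hx).add (Measurable.const_mul ?_ _)
  refine Finset.measurable_sum _ fun j _ => Measurable.const_mul ?_ _
  exact (D.measurable_score meth j).comp hz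

/-- Taking the limit of explicit iterates gives measurability without selecting a root; `limUnder`
is measurable even where the iterates diverge. -/
theorem measurable_stepLimit : Measurable (D.stepLimit meth σ) := by
  have h : ∀ n : ℕ, Measurable fun y => (D.step meth σ y)^[n] 0 := by
    intro n
    induction n with
    | zero => exact measurable_const
    | succ n ih =>
      simp only [Function.iterate_succ_apply']
      exact measurable_step.comp (measurable_id.prodMk ih)
  exact (StronglyMeasurable.limUnder fun n => (h n).stronglyMeasurable).measurable

theorem measurable_newtonEst : Measurable (D.newtonEst meth σ) := by
  classical
  have h : Measurable fun y => D.toParam σ (D.stepLimit meth σ y) :=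
    measurable_toParam.comp measurable_stepLimit
  unfold newtonEst
  exact Measurable.ite (h measurableSet_pos) h measurable_const

theorem newtonEst_pos (hσ : ∀ i, 0 < σ i) (y : Fin D.n → ℝ) (i : Fin (q + 1)) :
    0 < D.newtonEst meth σ y i := by
  unfold newtonEst
  split_ifs with h
  · exact h i
  · exact hσ i

/-- The data enter the iteration only through the score at positive parameters, so the symmetries of
the score pass to the estimator. -/
theorem newtonEst_congr {y y' : Fin D.n → ℝ} (h : ∀ τ : Param q, (∀ i, 0 < τ i) → ∀ i,
    D.score meth τ y' i = D.score meth τ y i) : D.newtonEst meth σ y' = D.newtonEst meth σ y := by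
  have h1 : D.step meth σ y' = D.step meth σ y := by
    funext x
    unfold step
    split_ifs with hx
    · simp only [h _ hx]
    · rfl
  have h2 : D.stepLimit meth σ y' = D.stepLimit meth σ y := by rw [stepLimit, h1, stepLimit]
  rw [newtonEst, h2, newtonEst]

theorem newtonEst_neg (y : Fin D.n → ℝ) : D.newtonEst meth σ (-y) = D.newtonEst meth σ y := by
  refine newtonEst_congr fun τ _ i => ?_
  simp only [score, Matrix.mulVec_neg, neg_dotProduct, dotProduct_neg, neg_neg]

theorem newtonEst_add_X (y : Fin D.n → ℝ) (b : Fin p → ℝ) :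
    D.newtonEst meth σ (y + D.X *ᵥ b) = D.newtonEst meth σ y := by
  refine newtonEst_congr fun τ hτ i => ?_
  have h := (D.mem_admissible hτ).2
  have hX : ∀ z : Fin D.n → ℝ, z ⬝ᵥ ((D.P τ * D.V i * D.P τ) *ᵥ z)
      = (D.P τ *ᵥ z) ⬝ᵥ (D.V i *ᵥ (D.P τ *ᵥ z)) := fun z => by
    rw [mulVec_dotProduct, P_transpose h]
    simp only [Matrix.mulVec_mulVec, Matrix.mul_assoc]
  have e : D.P τ *ᵥ (y + D.X *ᵥ b) = D.P τ *ᵥ y := by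
    rw [Matrix.mulVec_add, Matrix.mulVec_mulVec, P_mul_X h, Matrix.zero_mulVec, add_zero]
  simp only [score, hX, e]

/-- The modified Newton iteration converges to a root of the score equation. -/
theorem newtonEst_spec {κ K R : ℝ} (hσ : ∀ i, 0 < σ i) (hκ : ∀ i, 1 / σ i ≤ κ)
    (h1 : 1 ≤ D.dstar σ) (hK : 0 < K) (hR : 0 < R)
    (hN : -D.hess meth σ * (-D.hess meth σ)⁻¹ = 1) (hN' : (-D.hess meth σ)⁻¹ * -D.hess meth σ = 1)
    (hNK : ∀ i j, |(-D.hess meth σ)⁻¹ i j| ≤ K / (D.d σ i * D.d σ j))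
    (β : Fin p → ℝ) (w : D.Noise → ℝ) (hctrl : D.ctrl σ w ≤ R)
    (hscore : ∀ i, |D.score meth σ (D.X *ᵥ β + D.H σ *ᵥ w) i| ≤ R * D.d σ i)
    (ha : ∀ i, 2 * (2 * (q + 1) * K * R) ≤ σ i * D.dstar σ)
    (hb : 2 * κ * ((q + 1) * (2 * (q + 1) * K * R)) ≤ D.dstar σ)
    (hc : 2 * ((q + 1) ^ 2 * K * ((1 + 8 * κ + 2 * κ * (1 + 2 * p * κ ^ 2) ^ 2)
      * (1 + 2 * ((q + 1) * (2 * (q + 1) * K * R)))) * R) ≤ D.dstar σ) :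
    (∀ i, D.score meth (D.newtonEst meth σ (D.X *ᵥ β + D.H σ *ᵥ w)) (D.X *ᵥ β + D.H σ *ᵥ w) i = 0) ∧
      D.scaledL1 σ (D.newtonEst meth σ (D.X *ᵥ β + D.H σ *ᵥ w))
        ≤ (q + 1) * (2 * (q + 1) * K * R) := by
  classical
  set y := D.X *ᵥ β + D.H σ *ᵥ w with hy
  -- Twice the bound on the first step from the origin, so that a contraction with factor `1/2` maps
  -- the ball into itself.
  set r := 2 * (q + 1) * K * R with hr
  set N := (-D.hess meth σ)⁻¹ with hNdef
  set F := D.step meth σ y with hF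
  have hr0 : 0 < r := by positivity
  have hs0 : 0 < D.dstar σ := by linarith
  have hd : ∀ i, D.dstar σ ≤ D.d σ i := fun i => dstar_le i
  have hd0 : ∀ i, 0 < D.d σ i := fun i => by linarith [hd i]
  have hκ0 := kappa_pos hσ hκ
  set B : Set (Fin (q + 1) → ℝ) := Metric.closedBall 0 r with hB
  have hxB : ∀ x ∈ B, ∀ i, |x i| ≤ r := fun x hx i => by
    have : ‖x‖ ≤ r := by simpa [hB] using hx
    exact (norm_le_pi_norm x i).trans this
  have hL1 : ∀ x, D.scaledL1 σ (D.toParam σ x) = ∑ i, |x i| := fun x => by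
    unfold scaledL1
    refine Finset.sum_congr rfl fun i _ => ?_
    rw [toParam_apply, add_sub_cancel_left, abs_div, abs_of_pos (hd0 i),
      mul_div_cancel₀ _ (hd0 i).ne']
  have hL1B : ∀ x ∈ B, D.scaledL1 σ (D.toParam σ x) ≤ (q + 1) * r := fun x hx => by
    rw [hL1]
    refine (Finset.sum_le_sum fun i _ => hxB x hx i).trans ?_
    simp
  have hhalf : ∀ x ∈ B, ∀ i, σ i / 2 ≤ D.toParam σ x i := fun x hx i => by
    have h2 : |x i / D.d σ i| ≤ σ i / 2 := by
      rw [abs_div, abs_of_pos (hd0 i), div_le_iff₀ (hd0 i)]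
      have := mul_le_mul_of_nonneg_left (hd i) (hσ i).le
      linarith [hxB x hx i, ha i]
    rw [toParam_apply]
    linarith [(abs_le.1 h2).1]
  have hpos : ∀ x ∈ B, ∀ i, 0 < D.toParam σ x i := fun x hx i =>
    lt_of_lt_of_le (half_pos (hσ i)) (hhalf x hx i)
  have hnear : ∀ x ∈ B, D.Near σ (D.toParam σ x) κ := fun x hx =>
    ⟨hhalf x hx, (mul_le_mul_of_nonneg_left (hL1B x hx) (by positivity)).trans hb⟩
  have hFx : ∀ x ∈ B, F x = fun i => x i + D.d σ i *
      ∑ j, N i j * D.score meth (D.toParam σ x) y j := fun x hx => by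
    rw [hF, step, if_pos (hpos x hx)]
  have h0B : (0 : Fin (q + 1) → ℝ) ∈ B := Metric.mem_closedBall_self hr0.le
  have hτ0 : D.toParam σ 0 = σ := by
    ext i; rw [toParam_apply]; simp
  have hF0 : ‖F 0‖ ≤ r / 2 := by
    rw [pi_norm_le_iff_of_nonneg (by positivity)]
    intro i
    rw [hFx 0 h0B, hτ0]
    simp only [Pi.zero_apply, zero_add]
    rw [Real.norm_eq_abs, abs_mul, abs_of_pos (hd0 i)]
    have h2 : |∑ j, N i j * D.score meth σ y j| ≤ ∑ _j : Fin (q + 1), K * R / D.d σ i := by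
      refine (Finset.abs_sum_le_sum_abs _ _).trans (Finset.sum_le_sum fun j _ => ?_)
      rw [abs_mul]
      refine (mul_le_mul (hNK i j) (hscore j) (abs_nonneg _)
        (div_nonneg hK.le (mul_nonneg (hd0 i).le (hd0 j).le))).trans (le_of_eq ?_)
      have := (hd0 i).ne'; have := (hd0 j).ne'
      field_simp
    refine (mul_le_mul_of_nonneg_left h2 (hd0 i).le).trans (le_of_eq ?_)
    have := (hd0 i).ne'
    simp only [Finset.sum_const, Finset.card_univ, Fintype.card_fin, nsmul_eq_mul, hr]
    push_cast
    field_simp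
  have hlip : ∀ x ∈ B, ∀ x' ∈ B, ‖F x - F x'‖ ≤ 1 / 2 * ‖x - x'‖ := by
    intro x hx x' hx'
    rw [pi_norm_le_iff_of_nonneg (by positivity)]
    intro i
    set C := (1 + 8 * κ + 2 * κ * (1 + 2 * p * κ ^ 2) ^ 2) with hC
    have hC0 : 0 < C := by positivity
    have hsub : ∀ j, D.toParam σ x j - D.toParam σ x' j = (x j - x' j) / D.d σ j := fun j => by
      rw [toParam_apply, toParam_apply]; ring
    have hinc := fun j => score_increment_le meth hσ hκ h1 (fro_Lam_le hσ hκ meth h1) (hnear x hx)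
      (hnear x' hx') j β w
    rw [← hC, ← hy] at hinc
    have hsum : ∑ j, D.d σ j * |D.toParam σ x j - D.toParam σ x' j| ≤ (q + 1) * ‖x - x'‖ := by
      have : ∀ j, D.d σ j * |D.toParam σ x j - D.toParam σ x' j| ≤ ‖x - x'‖ := fun j => by
        rw [hsub, abs_div, abs_of_pos (hd0 j), mul_div_cancel₀ _ (hd0 j).ne']
        exact norm_le_pi_norm (x - x') j
      refine (Finset.sum_le_sum fun j _ => this j).trans ?_
      simp
    have hctrl0 : 0 ≤ D.ctrl σ w := zero_le_one.trans (one_le_ctrl w)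
    have hinc' : ∀ j, |D.score meth (D.toParam σ x) y j - D.score meth (D.toParam σ x') y j
        - ∑ k, D.hess meth σ j k * (D.toParam σ x k - D.toParam σ x' k)|
        ≤ D.d σ j * (C * (1 + 2 * ((q + 1) * r)) / D.dstar σ) * R * ((q + 1) * ‖x - x'‖) := by
      intro j
      refine (hinc j).trans ?_
      have hA := hL1B x hx
      have hA' := hL1B x' hx'
      have hn := scaledL1_nonneg (D := D) (σ := σ) (τ := D.toParam σ x)
      have hn' := scaledL1_nonneg (D := D) (σ := σ) (τ := D.toParam σ x')
      have hdj := hd0 j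
      have hle : 1 + D.scaledL1 σ (D.toParam σ x) + D.scaledL1 σ (D.toParam σ x')
          ≤ 1 + 2 * ((q + 1) * r) := by linarith
      refine mul_le_mul (mul_le_mul (mul_le_mul_of_nonneg_left ?_ hdj.le) hctrl hctrl0
        (by positivity)) hsum (Finset.sum_nonneg fun j _ => mul_nonneg (hd0 j).le (abs_nonneg _))
        (by positivity)
      exact div_le_div_of_nonneg_right (mul_le_mul_of_nonneg_left hle hC0.le) hs0.le
    -- The inverse information cancels the linear part of the increment exactly; the Lipschitz
    -- constant is therefore the relative linearization error, which `hc` makes at most `1/2`.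
    have hid : F x i - F x' i = D.d σ i * ∑ j, N i j *
        (D.score meth (D.toParam σ x) y j - D.score meth (D.toParam σ x') y j
          - ∑ k, D.hess meth σ j k * (D.toParam σ x k - D.toParam σ x' k)) := by
      have e1 : ∑ j, N i j * ∑ k, D.hess meth σ j k * (D.toParam σ x k - D.toParam σ x' k)
          = -((x i - x' i) / D.d σ i) := by
        have e2 : N * D.hess meth σ = -1 := by
          rw [← neg_inj, neg_neg, ← Matrix.mul_neg, hN']
        have e3 := congrArg (fun S : Matrix (Fin (q + 1)) (Fin (q + 1)) ℝ =>
          (S *ᵥ fun k => D.toParam σ x k - D.toParam σ x' k) i) e2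
        simp only [← Matrix.mulVec_mulVec, Matrix.neg_mulVec, Matrix.one_mulVec, Pi.neg_apply,
          hsub] at e3
        simp only [hsub]
        exact e3
      have e4 : ∀ a b c : Fin (q + 1) → ℝ, ∑ j, N i j * (a j - b j - c j)
          = ∑ j, N i j * a j - ∑ j, N i j * b j - ∑ j, N i j * c j := fun a b c => by
        rw [← Finset.sum_sub_distrib, ← Finset.sum_sub_distrib]
        exact Finset.sum_congr rfl fun j _ => by ring
      rw [hFx x hx, hFx x' hx', e4, e1]
      have := (hd0 i).ne'
      field_simp
      ring
    rw [Pi.sub_apply, Real.norm_eq_abs, hid, abs_mul, abs_of_pos (hd0 i)]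
    have h2 : |∑ j, N i j *
        (D.score meth (D.toParam σ x) y j - D.score meth (D.toParam σ x') y j
          - ∑ k, D.hess meth σ j k * (D.toParam σ x k - D.toParam σ x' k))|
        ≤ ∑ _j : Fin (q + 1), K * (C * (1 + 2 * ((q + 1) * r)) / D.dstar σ) * R
            * ((q + 1) * ‖x - x'‖) / D.d σ i := by
      refine (Finset.abs_sum_le_sum_abs _ _).trans (Finset.sum_le_sum fun j _ => ?_)
      rw [abs_mul]
      refine (mul_le_mul (hNK i j) (hinc' j) (abs_nonneg _)
        (div_nonneg hK.le (mul_nonneg (hd0 i).le (hd0 j).le))).trans (le_of_eq ?_)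
      have := (hd0 i).ne'; have := (hd0 j).ne'
      field_simp
    refine (mul_le_mul_of_nonneg_left h2 (hd0 i).le).trans ?_
    simp only [Finset.sum_const, Finset.card_univ, Fintype.card_fin, nsmul_eq_mul]
    push_cast
    have e5 : D.d σ i * (((q : ℝ) + 1) * (K * (C * (1 + 2 * ((q + 1) * r)) / D.dstar σ) * R
            * ((q + 1) * ‖x - x'‖) / D.d σ i))
        = ((q + 1) ^ 2 * K * (C * (1 + 2 * ((q + 1) * r))) * R) / D.dstar σ * ‖x - x'‖ := by
      have := (hd0 i).ne'
      field_simp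
    rw [e5]
    refine mul_le_mul_of_nonneg_right ?_ (norm_nonneg _)
    rw [div_le_iff₀ hs0]
    linarith
  have hmaps : Set.MapsTo F B B := fun x hx => by
    have h2 := hlip x hx 0 h0B
    rw [sub_zero] at h2
    have h3 : ‖x‖ ≤ r := by simpa [hB] using hx
    have h4 : ‖F x‖ ≤ ‖F x - F 0‖ + ‖F 0‖ := by
      have := norm_add_le (F x - F 0) (F 0)
      rwa [sub_add_cancel] at this
    have : ‖F x‖ ≤ r := by linarith
    simpa [hB] using this
  have hcontr : ContractingWith (1 / 2) (hmaps.restrict F B B) := by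
    refine ⟨by norm_num, LipschitzWith.of_dist_le_mul fun x x' => ?_⟩
    have := hlip x x.2 x' x'.2
    rw [Subtype.dist_eq, Subtype.dist_eq, dist_eq_norm, dist_eq_norm]
    simpa using this
  obtain ⟨z, hzB, hfix, hlim, -⟩ := hcontr.exists_fixedPoint' (IsClosed.isComplete
    Metric.isClosed_closedBall) hmaps h0B (edist_ne_top _ _)
  have hz : D.stepLimit meth σ y = z := hlim.limUnder_eq
  have hest : D.newtonEst meth σ y = D.toParam σ z := by
    rw [newtonEst, hz, if_pos (hpos z hzB)]
  rw [hest]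
  refine ⟨fun i => ?_, hL1B z hzB⟩
  -- A fixed point makes the Newton correction vanish, and invertibility of the information
  -- transfers this to the score.
  have h3 : N *ᵥ (fun j => D.score meth (D.toParam σ z) y j) = 0 := by
    funext i
    have h4 := congrFun (hfix : F z = z) i
    rw [hFx z hzB] at h4
    have h5 : D.d σ i * ∑ j, N i j * D.score meth (D.toParam σ z) y j = 0 := by
      linarith
    exact (mul_eq_zero.1 h5).resolve_left (hd0 i).ne'
  have h4 : (fun j => D.score meth (D.toParam σ z) y j) = 0 := by
    have := congrArg (fun v => (-D.hess meth σ) *ᵥ v) h3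
    simpa only [Matrix.mulVec_mulVec, hN, Matrix.one_mulVec, Matrix.mulVec_zero] using this
  exact congrFun h4 i

end Design
end EmpBLUP

end

/-! ### Existence of score estimators -/

noncomputable section
namespace EmpBLUP

set_option linter.unusedSectionVars false

open scoped Matrix.Norms.L2Operator

theorem eventually_mul_rpow_lt (C : ℝ) {a b : ℝ} (hab : a < b) :
    ∀ᶠ x : ℝ in atTop, C * x ^ a < x ^ b := by
  have h := (tendsto_rpow_atTop (sub_pos.2 hab)).eventually_gt_atTop C
  filter_upwards [h, eventually_gt_atTop 0] with x hx h0
  have := mul_lt_mul_of_pos_right hx (Real.rpow_pos_of_pos h0 a)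
  rwa [← Real.rpow_add h0, sub_add_cancel] at this

namespace Design

variable {p q : ℕ}

section

variable {D : Design p q} {σ τ : Param q}

variable (D) in
/-- A random variable that dominates the score at `σ` and the stochastic terms of its increments. -/
def envelope (σ : Param q) (κ : ℝ) (w : D.Noise → ℝ) : ℝ :=
  D.ctrl σ w + ∑ i, |quadC ((D.d σ i)⁻¹ • D.Bm σ D.P i) w| + p * κ

theorem ctrl_le_envelope {κ : ℝ} (hκ : 0 ≤ κ) (w : D.Noise → ℝ) :
    D.ctrl σ w ≤ D.envelope σ κ w := by
  have h1 : 0 ≤ ∑ i, |quadC ((D.d σ i)⁻¹ • D.Bm σ D.P i) w| :=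
    Finset.sum_nonneg fun i _ => abs_nonneg _
  have h2 : 0 ≤ p * κ := by positivity
  rw [envelope]; linarith

theorem abs_score_le {κ : ℝ} (hσ : ∀ i, 0 < σ i) (hκ : ∀ i, 1 / σ i ≤ κ) (h1 : 1 ≤ D.dstar σ)
    (meth : Method) (w : D.Noise → ℝ) (i : Fin (q + 1)) :
    |1 / 2 * quadC (D.Bm σ D.P i) w + D.bias meth σ i| ≤ D.envelope σ κ w * D.d σ i := by
  have hκ0 := kappa_pos hσ hκ
  have hd : 1 ≤ D.d σ i := h1.trans (dstar_le i)
  have hb := abs_bias_le (D := D) hσ hκ meth i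
  have hq : |quadC (D.Bm σ D.P i) w| = D.d σ i * |quadC ((D.d σ i)⁻¹ • D.Bm σ D.P i) w| := by
    have hd0 : 0 < D.d σ i := by linarith
    rw [quadC_smul, abs_mul (D.d σ i)⁻¹, abs_of_pos (inv_pos.2 hd0), ← mul_assoc,
      mul_inv_cancel₀ hd0.ne', one_mul]
  have hs := Finset.single_le_sum (f := fun i => |quadC ((D.d σ i)⁻¹ • D.Bm σ D.P i) w|)
    (fun i _ => abs_nonneg _) (Finset.mem_univ i)
  have hc := one_le_ctrl (D := D) (σ := σ) w
  have h2 : |1 / 2 * quadC (D.Bm σ D.P i) w + D.bias meth σ i|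
      ≤ 1 / 2 * |quadC (D.Bm σ D.P i) w| + p * κ := by
    refine (abs_add_le _ _).trans (add_le_add ?_ hb)
    rw [abs_mul, abs_of_nonneg (by norm_num : (0 : ℝ) ≤ 1 / 2)]
  refine h2.trans ?_
  rw [hq, envelope]
  have h3 : (p : ℝ) * κ ≤ p * κ * D.d σ i := le_mul_of_one_le_right (by positivity) hd
  have h4 : 1 / 2 * (D.d σ i * |quadC ((D.d σ i)⁻¹ • D.Bm σ D.P i) w|)
      ≤ (∑ i, |quadC ((D.d σ i)⁻¹ • D.Bm σ D.P i) w|) * D.d σ i := by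
    have := mul_le_mul_of_nonneg_right hs (by positivity : 0 ≤ D.d σ i)
    have h5 := mul_nonneg (by positivity : 0 ≤ D.d σ i)
      (abs_nonneg (quadC ((D.d σ i)⁻¹ • D.Bm σ D.P i) w))
    nlinarith
  have h6 : 0 ≤ D.ctrl σ w * D.d σ i := by positivity
  nlinarith

theorem scaledDist_le : D.scaledDist σ τ ≤ D.scaledL1 σ τ := by
  rw [scaledDist, Real.sqrt_le_left scaledL1_nonneg, scaledL1]
  have h0 : ∀ i, 0 ≤ D.d σ i * |τ i - σ i| := fun i => mul_nonneg (d_nonneg i) (abs_nonneg _)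
  rw [sq (∑ i, _), Finset.sum_mul]
  refine Finset.sum_le_sum fun i _ => ?_
  calc (D.d σ i * (τ i - σ i)) ^ 2 = D.d σ i * |τ i - σ i| * (D.d σ i * |τ i - σ i|) := by
        rw [← sq, mul_pow, mul_pow, sq_abs]
    _ ≤ _ := mul_le_mul_of_nonneg_left
        (Finset.single_le_sum (f := fun i => D.d σ i * |τ i - σ i|) (fun i _ => h0 i)
          (Finset.mem_univ i)) (h0 i)

end

variable {D : ℕ → Design p q} {σ : Param q} {κ : ℝ}

theorem unifMom_scaled_quadC (hσ : ∀ i, 0 < σ i) (i : Fin (q + 1)) :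
    UnifMom (fun k => stdG (D k).Noise)
      fun k w => quadC (((D k).d σ i)⁻¹ • (D k).Bm σ (D k).P i) w := by
  refine unifMom_quadC (r := 1) fun k => ?_
  rw [fro_smul, fro_Bm hσ, abs_of_nonneg (inv_nonneg.2 (d_nonneg i))]
  exact inv_mul_le_one

/-- The Frobenius norm of `B_i B_j` is at most `κ d_j`, so each form becomes bounded in all moments
once it is divided by `d_j`. -/
theorem unifMom_ctrl (hσ : ∀ i, 0 < σ i) (hκ : ∀ i, 1 / σ i ≤ κ) :
    UnifMom (fun k => stdG (D k).Noise) fun k w => (D k).ctrl σ w := by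
  have hκ0 := kappa_pos hσ hκ
  have h1 : ∀ i j, UnifMom (fun k => stdG (D k).Noise) fun k w =>
      |quadC ((D k).Bm σ (D k).P i * (D k).Bm σ (D k).P j) w| / (D k).d σ j := by
    intro i j
    have h2 : UnifMom (fun k => stdG (D k).Noise) fun k w => quadC (((D k).d σ j)⁻¹ •
        ((D k).Bm σ (D k).P i * (D k).Bm σ (D k).P j)) w := by
      refine unifMom_quadC (r := κ) fun k => ?_
      have h3 := (fro_mul_le ((D k).Bm σ (D k).P i) ((D k).Bm σ (D k).P j)).trans
        (mul_le_mul_of_nonneg_right (((D k).isResolvent_P.opNorm_Bm_le hσ i).trans (hκ i))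
          (fro_nonneg _))
      rw [fro_Bm hσ] at h3
      have hd : 0 ≤ (D k).d σ j := d_nonneg j
      rw [fro_smul, abs_of_nonneg (inv_nonneg.2 hd)]
      refine (mul_le_mul_of_nonneg_left h3 (inv_nonneg.2 hd)).trans ?_
      rw [mul_left_comm]
      exact mul_le_of_le_one_right hκ0.le inv_mul_le_one
    refine h2.abs.mono (fun k => ?_) fun k w => le_of_eq ?_
    · exact ((continuous_quadC _).abs.div_const _).aestronglyMeasurable
    · rw [quadC_smul, abs_mul ((D k).d σ j)⁻¹, abs_of_nonneg (inv_nonneg.2 (d_nonneg j)),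
        div_eq_inv_mul]
  exact (unifMom_const (c := fun _ => 1) (C := 1) (by simp)).add
    (unifMom_sum _ fun i _ => unifMom_sum _ fun j _ => h1 i j)

theorem unifMom_envelope (hσ : ∀ i, 0 < σ i) (hκ : ∀ i, 1 / σ i ≤ κ) :
    UnifMom (fun k => stdG (D k).Noise) fun k w => (D k).envelope σ κ w :=
  ((unifMom_ctrl hσ hκ).add (unifMom_sum _ fun i _ => (unifMom_scaled_quadC hσ i).abs)).add
    (unifMom_const (c := fun _ => p * κ) fun _ => le_rfl)

theorem tendsto_dstar (hinf : InfinitelyInformative D σ) :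
    Tendsto (fun k => (D k).dstar σ) atTop atTop := by
  rw [tendsto_atTop]
  intro b
  have h : ∀ i, ∀ᶠ k in atTop, b ≤ (D k).d σ i := fun i => (hinf i).eventually_ge_atTop b
  filter_upwards [eventually_all.2 h] with k hk
  exact Finset.le_inf' _ _ fun i _ => hk i

/-- Properties of the information matrix that hold for large `k`. -/
structure Regular (D : Design p q) (meth : Method) (σ : Param q) (K : ℝ) : Prop where
  one_le : 1 ≤ D.dstar σ
  mul_inv : -D.hess meth σ * (-D.hess meth σ)⁻¹ = 1
  inv_mul : (-D.hess meth σ)⁻¹ * -D.hess meth σ = 1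
  abs_inv_le : ∀ i j, |(-D.hess meth σ)⁻¹ i j| ≤ K / (D.d σ i * D.d σ j)

theorem eventually_regular (hσ : ∀ i, 0 < σ i) (hinf : InfinitelyInformative D σ)
    (hid : AsymptoticallyIdentifiable D σ) (meth : Method) :
    ∃ K > 0, ∀ᶠ k in atTop, (D k).Regular meth σ K := by
  obtain ⟨κ, hκ⟩ : ∃ κ, ∀ i, 1 / σ i ≤ κ :=
    ⟨∑ i, 1 / σ i, fun i => Finset.single_le_sum (f := fun i => 1 / σ i)
      (fun i _ => (one_div_pos.2 (hσ i)).le) (Finset.mem_univ i)⟩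
  obtain ⟨c, hc, hcor⟩ := hid
  -- The reciprocal of the coercivity constant `c / 4` of `neg_hess_coercive`.
  refine ⟨4 / c, by positivity, ?_⟩
  have ht := tendsto_dstar hinf
  have hsq : Tendsto (fun k => c * (D k).dstar σ ^ 2) atTop atTop :=
    ((tendsto_pow_atTop two_ne_zero).comp ht).const_mul_atTop hc
  filter_upwards [hcor, ht.eventually_ge_atTop 1,
    hsq.eventually_ge_atTop (4 * p * κ ^ 2 * (q + 1))] with k hk h1 hbig
  have hd0 : ∀ i, 0 < (D k).d σ i := fun i => by
    linarith [dstar_le (D := D k) (σ := σ) i]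
  obtain ⟨e1, e2, e3⟩ := coercive_inv (by positivity : 0 < c / 4) hd0
    (neg_hess_coercive hσ hκ meth h1 hk hbig)
  refine ⟨h1, e1, e2, fun i j => (e3 i j).trans (le_of_eq ?_)⟩
  have := (hd0 i).ne'; have := (hd0 j).ne'
  field_simp

/-- Outside an event of negligible probability, the Newton iteration yields a root of the score
equation near `σ`. -/
theorem isScoreEstimator_newtonEst (hσ : ∀ i, 0 < σ i) (hinf : InfinitelyInformative D σ)
    (hid : AsymptoticallyIdentifiable D σ) (meth : Method) (β : Fin p → ℝ) :
    IsScoreEstimator meth D β σ fun k => (D k).newtonEst meth σ where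
  measurable k := measurable_newtonEst
  mem k y := (D k).mem_admissible (newtonEst_pos hσ y)
  even k y := newtonEst_neg y
  invariant k y b := newtonEst_add_X y b
  root ρ hρ0 hρ1 g hg := by
    obtain ⟨κ, hκ⟩ : ∃ κ, ∀ i, 1 / σ i ≤ κ :=
      ⟨∑ i, 1 / σ i, fun i => Finset.single_le_sum (f := fun i => 1 / σ i)
        (fun i _ => (one_div_pos.2 (hσ i)).le) (Finset.mem_univ i)⟩
    have hκ0 := kappa_pos hσ hκ
    obtain ⟨K, hK, hreg⟩ := eventually_regular hσ hinf hid meth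
    have ht := tendsto_dstar hinf
    -- The envelope is allowed to reach `R = d_*^ε`. The contraction condition grows like `R ^ 2`
    -- and must stay below `d_*`, whence `1/4`; the radius is a constant times `R` and must stay
    -- below `d_*^(1 - ρ)`, whence the second entry.
    set ε := min (1 / 4) ((1 - ρ) / 2) with hε
    have hε0 : 0 < ε := lt_min (by norm_num) (by linarith)
    have hε1 : ε ≤ 1 / 4 := min_le_left _ _
    have hε2 : ε ≤ (1 - ρ) / 2 := min_le_right _ _
    -- Markov's inequality of order `m` at level `d_*^ε` gives `d_*^(-ε m) ≤ d_*^(-g)`.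
    obtain ⟨m, hm⟩ := exists_nat_ge (g / ε)
    obtain ⟨C, hC0, hC⟩ := (unifMom_envelope (D := D) hσ hκ).tail m
    set c := 1 + 8 * κ + 2 * κ * (1 + 2 * p * κ ^ 2) ^ 2 with hc
    have hc0 : 0 < c := by positivity
    have ea : ∀ i, ∀ᶠ x : ℝ in atTop, 2 * (2 * (q + 1) * K) / σ i * x ^ ε < x ^ (1 : ℝ) := fun i =>
      eventually_mul_rpow_lt _ (by linarith)
    have eb : ∀ᶠ x : ℝ in atTop, 2 * κ * ((q + 1) * (2 * (q + 1) * K)) * x ^ ε < x ^ (1 : ℝ) :=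
      eventually_mul_rpow_lt _ (by linarith)
    have ec : ∀ᶠ x : ℝ in atTop, 2 * ((q + 1) ^ 2 * K * (c * (1 + 2 * ((q + 1) * (2 * (q + 1) * K)))))
        * x ^ (2 * ε) < x ^ (1 : ℝ) := eventually_mul_rpow_lt _ (by linarith)
    have ed : ∀ᶠ x : ℝ in atTop, (q + 1) * (2 * (q + 1) * K) * x ^ ε < x ^ (1 - ρ) :=
      eventually_mul_rpow_lt _ (by linarith)
    refine IsBigO.of_bound C ?_
    filter_upwards [hreg, ht.eventually (eventually_all.2 ea), ht.eventually eb, ht.eventually ec,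
      ht.eventually ed] with k hk ha hb hcc hd
    have h1 := hk.one_le
    have h0 : 0 < (D k).dstar σ := by linarith
    set x := (D k).dstar σ with hx
    set R := x ^ ε with hR
    have hR1 : 1 ≤ R := Real.one_le_rpow h1 hε0.le
    have hR0 : 0 < R := by linarith
    have hRR : x ^ (2 * ε) = R * R := by
      rw [hR, ← Real.rpow_add h0]; ring_nf
    rw [Real.rpow_one] at hb hcc
    have hsub : {w | (D k).scaleEquiv hσ w ∈ {ω | ¬ (
        fderiv ℝ (fun τ => (D k).crit meth τ ((D k).obs β ω))
          ((D k).newtonEst meth σ ((D k).obs β ω)) = 0 ∧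
        (D k).scaledDist σ ((D k).newtonEst meth σ ((D k).obs β ω)) < x ^ (1 - ρ))}}
        ⊆ {w | R ≤ |(D k).envelope σ κ w|} := by
      intro w hw
      simp only [Set.mem_ofPred_eq, obs_scaleEquiv] at hw ⊢
      by_contra hcon
      apply hw
      have hU : (D k).envelope σ κ w ≤ R := (le_abs_self _).trans (not_le.1 hcon).le
      have hspec := newtonEst_spec (D := D k) (meth := meth) hσ hκ h1 hK hR0 hk.mul_inv hk.inv_mul
        hk.abs_inv_le β w ((ctrl_le_envelope hκ0.le w).trans hU) (fun i => by
          rw [score_eq hσ]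
          exact (abs_score_le hσ hκ h1 meth w i).trans
            (mul_le_mul_of_nonneg_right hU (d_nonneg i))) (fun i => by
          have := ha i
          rw [Real.rpow_one, div_mul_eq_mul_div, div_lt_iff₀ (hσ i)] at this
          linarith) (by
          have : 2 * κ * ((q + 1) * (2 * (q + 1) * K * R))
            = 2 * κ * ((q + 1) * (2 * (q + 1) * K)) * R := by ring
          rw [this]; exact hb.le) (by
          refine le_trans ?_ hcc.le
          rw [hRR, ← hc]
          have h2 : 1 + 2 * (((q : ℝ) + 1) * (2 * (q + 1) * K * R))
              ≤ (1 + 2 * ((q + 1) * (2 * (q + 1) * K))) * R := by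
            have : 2 * (((q : ℝ) + 1) * (2 * (q + 1) * K * R))
              = 2 * ((q + 1) * (2 * (q + 1) * K)) * R := by ring
            linarith
          calc _ ≤ 2 * (((q : ℝ) + 1) ^ 2 * K * (c * ((1 + 2 * ((q + 1) * (2 * (q + 1) * K))) * R)) * R) := by
                gcongr
            _ = _ := by ring)
      refine ⟨(fderiv_crit_eq_zero_iff meth (newtonEst_pos hσ _) _).2 hspec.1, ?_⟩
      refine lt_of_le_of_lt (scaledDist_le.trans hspec.2) ?_
      have : ((q : ℝ) + 1) * (2 * (q + 1) * K * R) = (q + 1) * (2 * (q + 1) * K) * R := by ring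
      rw [this]; exact hd
    rw [Real.norm_of_nonneg measureReal_nonneg, Real.norm_of_nonneg (by positivity), law_real hσ]
    refine (measureReal_mono hsub).trans ((hC k R hR0).trans ?_)
    rw [div_eq_mul_inv]
    refine mul_le_mul_of_nonneg_left ?_ hC0
    rw [hR, ← Real.rpow_natCast, ← Real.rpow_mul h0.le, ← Real.rpow_neg h0.le]
    refine Real.rpow_le_rpow_of_exponent_le h1 (neg_le_neg ?_)
    rw [div_le_iff₀ hε0] at hm
    linarith

end Design
end EmpBLUP

end

/-! ### Linearization of the root and of the predictor -/

noncomputable section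
namespace EmpBLUP

set_option linter.unusedSectionVars false

open scoped Matrix.Norms.L2Operator

/-- First-order Taylor formula with a quadratic remainder. -/
theorem abs_taylor_remainder_le {E : Type*} [NormedAddCommGroup E] [NormedSpace ℝ E] {f : E → ℝ}
    {x y : E} {δ B : ℝ} (hf : ∀ z ∈ Metric.closedBall x δ, ContDiffAt ℝ 2 f z)
    (hB : ∀ z ∈ Metric.closedBall x δ, ‖iteratedFDeriv ℝ 2 f z‖ ≤ B) (hy : ‖y - x‖ ≤ δ) :
    |f y - f x - fderiv ℝ f x (y - x)| ≤ B * ‖y - x‖ ^ 2 := by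
  have hδ : 0 ≤ δ := (norm_nonneg _).trans hy
  have hx : x ∈ Metric.closedBall x δ := Metric.mem_closedBall_self hδ
  have hB0 : 0 ≤ B := (norm_nonneg _).trans (hB x hx)
  have hd : ∀ z ∈ Metric.closedBall x δ, DifferentiableAt ℝ f z := fun z hz =>
    (hf z hz).differentiableAt (by norm_num)
  have hd2 : ∀ z ∈ Metric.closedBall x δ, DifferentiableAt ℝ (fderiv ℝ f) z := fun z hz =>
    ((hf z hz).fderiv_right (m := 1) (by norm_num)).differentiableAt (by norm_num)
  have h2 : ∀ z ∈ Metric.closedBall x δ, ‖fderiv ℝ (fderiv ℝ f) z‖ ≤ B := fun z hz => by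
    rw [← norm_iteratedFDeriv_one, norm_iteratedFDeriv_fderiv]
    exact hB z hz
  have hL : ∀ z ∈ Metric.closedBall x δ, ‖fderiv ℝ f z - fderiv ℝ f x‖ ≤ B * ‖z - x‖ :=
    fun z hz => (convex_closedBall x δ).norm_image_sub_le_of_norm_fderiv_le hd2 h2 hx hz
  have hsub : Metric.closedBall x ‖y - x‖ ⊆ Metric.closedBall x δ :=
    Metric.closedBall_subset_closedBall hy
  have := (convex_closedBall x ‖y - x‖).norm_image_sub_le_of_norm_fderiv_le' (𝕜 := ℝ)
    (f := f) (φ := fderiv ℝ f x) (C := B * ‖y - x‖) (fun z hz => hd z (hsub hz))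
    (fun z hz => (hL z (hsub hz)).trans (mul_le_mul_of_nonneg_left (by
      rw [← dist_eq_norm]; exact hz) hB0))
    (Metric.mem_closedBall_self (norm_nonneg _))
    (show y ∈ Metric.closedBall x ‖y - x‖ by rw [Metric.mem_closedBall, dist_eq_norm])
  rw [Real.norm_eq_abs] at this
  linarith [this, sq (‖y - x‖), mul_assoc B ‖y - x‖ ‖y - x‖]

namespace Design

variable {p q : ℕ} {D : Design p q} {σ τ : Param q}

theorem norm_param_le (x : Param q) : ‖x‖ ≤ ∑ i, |x i| := by
  rw [EuclideanSpace.norm_eq, Real.sqrt_le_left (Finset.sum_nonneg fun i _ => abs_nonneg _)]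
  exact Finset.sum_sq_le_sq_sum_of_nonneg (s := Finset.univ) (f := fun i => |x i|)
    fun i _ => abs_nonneg _

theorem norm_sub_le_scaledL1 (h1 : 0 < D.dstar σ) :
    ‖τ - σ‖ ≤ D.scaledL1 σ τ / D.dstar σ :=
  (norm_param_le (τ - σ)).trans (by simpa using sum_abs_le h1)

theorem scaledL1_le : D.scaledL1 σ τ ≤ (q + 1) * D.scaledDist σ τ := by
  have : ∀ i, D.d σ i * |τ i - σ i| ≤ D.scaledDist σ τ := fun i => by
    rw [← abs_of_nonneg (d_nonneg (D := D) (σ := σ) i), ← abs_mul]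
    exact Real.abs_le_sqrt (Finset.single_le_sum
      (f := fun i => (D.d σ i * (τ i - σ i)) ^ 2) (fun i _ => sq_nonneg _) (Finset.mem_univ i))
  refine (Finset.sum_le_card_nsmul _ _ _ fun i _ => this i).trans (le_of_eq ?_)
  simp

/-- Linearization of a root of the score equation. -/
theorem abs_root_sub_lin_le {meth : Method} {κ K : ℝ} (hσ : ∀ i, 0 < σ i)
    (hκ : ∀ i, 1 / σ i ≤ κ) (hreg : D.Regular meth σ K) (hK : 0 ≤ K) (hτ : D.Near σ τ κ)
    (β : Fin p → ℝ) (w : D.Noise → ℝ)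
    (hroot : ∀ i, D.score meth τ (D.X *ᵥ β + D.H σ *ᵥ w) i = 0) :
    |∑ i, (τ i - σ i) * (D.hvec σ i ⬝ᵥ w) - D.lin meth σ w|
      ≤ (q + 1) * K * (1 + 8 * κ + 2 * κ * (1 + 2 * p * κ ^ 2) ^ 2)
        * ((1 + D.scaledL1 σ τ) * D.scaledL1 σ τ) / D.dstar σ ^ 2
        * (D.ctrl σ w * ∑ i, |D.hvec σ i ⬝ᵥ w|) := by
  set y := D.X *ᵥ β + D.H σ *ᵥ w with hy
  set c := 1 + 8 * κ + 2 * κ * (1 + 2 * p * κ ^ 2) ^ 2 with hc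
  set N := (-D.hess meth σ)⁻¹ with hN
  set x := fun i => D.hvec σ i ⬝ᵥ w with hx
  set ℓ := D.scaledL1 σ τ with hℓ
  have hκ0 := kappa_pos hσ hκ
  have h1 := hreg.one_le
  have h0 : 0 < D.dstar σ := by linarith
  have hℓ0 : 0 ≤ ℓ := scaledL1_nonneg
  have hc0 : 0 ≤ c := by positivity
  have hd0 : ∀ i, 0 < D.d σ i := fun i => h0.trans_le (dstar_le i)
  have hctrl : 0 ≤ D.ctrl σ w := by linarith [one_le_ctrl (D := D) (σ := σ) w]
  have hσσ : D.scaledL1 σ σ = 0 := by simp [scaledL1]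
  have hself : D.Near σ σ κ := ⟨fun i => by linarith [hσ i], by rw [hσσ]; linarith⟩
  set err := fun i => D.score meth τ y i - D.score meth σ y i
    - ∑ j, D.hess meth σ i j * (τ j - σ j) with herr
  set E := c * (1 + ℓ) / D.dstar σ * D.ctrl σ w * ℓ with hE
  have hE0 : 0 ≤ E := by positivity
  have herr_le : ∀ i, |err i| ≤ D.d σ i * E := fun i => by
    have := score_increment_le meth hσ hκ h1 (fro_Lam_le hσ hκ meth h1) hτ hself i β w
    rw [hσσ, add_zero, ← hc] at this
    refine this.trans (le_of_eq ?_)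
    rw [hE, hℓ, scaledL1]
    ring
  -- At a root the increment of the score is minus its value at `σ`. Solving the linearized equation
  -- exactly leaves the linearization error `err` as the only deviation from `lin`.
  have hsol : ∀ i, τ i - σ i = ∑ k, N i k * (D.score meth σ y k + err k) := fun i => by
    have h2 : ∀ k, D.score meth σ y k + err k = ((-D.hess meth σ) *ᵥ fun j => τ j - σ j) k := by
      intro k
      rw [Matrix.neg_mulVec]
      simp only [herr, hroot k, Pi.neg_apply, Matrix.mulVec, dotProduct]
      ring
    simp only [h2]
    have h3 : N *ᵥ ((-D.hess meth σ) *ᵥ fun j => τ j - σ j) = fun j => τ j - σ j := by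
      rw [Matrix.mulVec_mulVec, hreg.inv_mul, Matrix.one_mulVec]
    exact (congrFun h3 i).symm
  have hdiff : ∑ i, (τ i - σ i) * x i - D.lin meth σ w = ∑ i, ∑ k, N i k * (x i * err k) := by
    rw [lin, ← Finset.sum_sub_distrib]
    refine Finset.sum_congr rfl fun i _ => ?_
    rw [hsol i, Finset.sum_mul, ← Finset.sum_sub_distrib]
    refine Finset.sum_congr rfl fun k _ => ?_
    rw [hy, score_eq hσ]
    ring
  rw [hdiff]
  have hterm : ∀ i k, |N i k * (x i * err k)| ≤ K * E / D.dstar σ * |x i| := fun i k => by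
    rw [abs_mul, abs_mul]
    calc |N i k| * (|x i| * |err k|)
        ≤ K / (D.d σ i * D.d σ k) * (|x i| * (D.d σ k * E)) := by
          have := div_nonneg hK (mul_pos (hd0 i) (hd0 k)).le
          gcongr
          · exact hreg.abs_inv_le i k
          · exact herr_le k
      _ = K * E / D.d σ i * |x i| := by
          have := (hd0 i).ne'; have := (hd0 k).ne'
          field_simp
      _ ≤ K * E / D.dstar σ * |x i| := by
          gcongr
          exact dstar_le i
  calc |∑ i, ∑ k, N i k * (x i * err k)| ≤ ∑ i, ∑ k, |N i k * (x i * err k)| :=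
        (Finset.abs_sum_le_sum_abs _ _).trans
          (Finset.sum_le_sum fun i _ => Finset.abs_sum_le_sum_abs _ _)
    _ ≤ ∑ i, ∑ _k : Fin (q + 1), K * E / D.dstar σ * |x i| :=
        Finset.sum_le_sum fun i _ => Finset.sum_le_sum fun k _ => hterm i k
    _ = (q + 1) * (K * E / D.dstar σ * ∑ i, |x i|) := by
        simp only [Finset.sum_const, Finset.card_univ, Fintype.card_fin, nsmul_eq_mul,
          ← Finset.mul_sum]
        push_cast; ring
    _ = _ := by
        simp only [hE, hx]; field_simp

/-- Linearization of an expansion with coefficients of class `C²`. -/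
theorem abs_t_sub_sub_le {J : ℕ} {lam : Fin J → Param q → ℝ} {W : Fin J → (Fin D.n → ℝ) → ℝ}
    {B : Fin J → ℝ} {δ : ℝ} (hσ : ∀ i, 0 < σ i)
    (hexp : ∀ τ ∈ D.admissible, ∀ y, D.t τ y = ∑ j, lam j τ * W j y)
    (hlam : ∀ j, ∀ τ ∈ Metric.closedBall σ δ,
      ContDiffAt ℝ 2 (lam j) τ ∧ ‖iteratedFDeriv ℝ 2 (lam j) τ‖ ≤ B j)
    (hτ : τ ∈ D.admissible) (hδ : ‖τ - σ‖ ≤ δ) (β : Fin p → ℝ) (w : D.Noise → ℝ) :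
    |D.t τ (D.X *ᵥ β + D.H σ *ᵥ w) - D.t σ (D.X *ᵥ β + D.H σ *ᵥ w)
        - ∑ i, (τ i - σ i) * (D.hvec σ i ⬝ᵥ w)|
      ≤ ‖τ - σ‖ ^ 2 * ∑ j, B j * |W j (D.X *ᵥ β + D.H σ *ᵥ w)| := by
  set y := D.X *ᵥ β + D.H σ *ᵥ w with hy
  have hσm := D.mem_admissible hσ
  have hx : σ ∈ Metric.closedBall σ δ := Metric.mem_closedBall_self ((norm_nonneg _).trans hδ)
  have hd : ∀ j, HasFDerivAt (lam j) (fderiv ℝ (lam j) σ) σ := fun j =>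
    (((hlam j σ hx).1).differentiableAt (by norm_num)).hasFDerivAt
  have ht : HasFDerivAt (fun τ' => D.t τ' y) (∑ j, W j y • fderiv ℝ (lam j) σ) σ := by
    have h1 : HasFDerivAt (fun τ' => ∑ j, lam j τ' * W j y)
        (∑ j, W j y • fderiv ℝ (lam j) σ) σ :=
      HasFDerivAt.fun_sum fun j _ => (hd j).mul_const (W j y)
    refine h1.congr_of_eventuallyEq ?_
    filter_upwards [eventually_pos hσ] with τ' hτ'
    exact hexp τ' (D.mem_admissible hτ') y
  -- By uniqueness of the derivative at `σ`, the first-order term of the expansion is the explicit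
  -- Gaussian linear form, whatever the `λ_j` and `W_j` are; these survive only in the quadratic
  -- remainder.
  have hlin : ∑ i, (τ i - σ i) * (D.hvec σ i ⬝ᵥ w)
      = ∑ j, fderiv ℝ (lam j) σ (τ - σ) * W j y := by
    have h2 := (hasPderivs_t (D := D) hσ y).fderiv_apply (τ - σ)
    rw [ht.fderiv] at h2
    simp only [_root_.sum_apply, _root_.smul_apply, smul_eq_mul] at h2
    simp only [hy, tSlope_dotProduct hσm.2] at h2
    rw [← hy] at h2
    simpa [mul_comm] using h2.symm
  rw [hexp τ hτ, hexp σ hσm, hlin, ← Finset.sum_sub_distrib, ← Finset.sum_sub_distrib,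
    Finset.mul_sum]
  refine (Finset.abs_sum_le_sum_abs _ _).trans (Finset.sum_le_sum fun j _ => ?_)
  have h3 := abs_taylor_remainder_le (fun z hz => (hlam j z hz).1) (fun z hz => (hlam j z hz).2) hδ
  rw [← sub_mul, ← sub_mul, abs_mul]
  calc _ ≤ B j * ‖τ - σ‖ ^ 2 * |W j y| := mul_le_mul_of_nonneg_right h3 (abs_nonneg _)
    _ = _ := by ring

theorem continuous_lin {meth : Method} : Continuous fun w => D.lin meth σ w := by
  refine continuous_finsetSum _ fun i _ => continuous_finsetSum _ fun k _ => continuous_const.mul ?_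
  refine Continuous.mul ?_ ((continuous_const.mul (continuous_quadC _)).add continuous_const)
  exact continuous_const.dotProduct continuous_id

theorem abs_lin_le {meth : Method} {κ K : ℝ} (hσ : ∀ i, 0 < σ i)
    (hκ : ∀ i, 1 / σ i ≤ κ) (hreg : D.Regular meth σ K) (hK : 0 ≤ K) (w : D.Noise → ℝ) :
    |D.lin meth σ w| ≤
      (q + 1) * K * (D.envelope σ κ w * ∑ i, |D.hvec σ i ⬝ᵥ w|) / D.dstar σ := by
  have hκ0 := kappa_pos hσ hκ
  have h1 := hreg.one_le
  have h0 : 0 < D.dstar σ := by linarith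
  have hd0 : ∀ i, 0 < D.d σ i := fun i => h0.trans_le (dstar_le i)
  have henv : 0 ≤ D.envelope σ κ w := by
    linarith [one_le_ctrl (D := D) (σ := σ) w, ctrl_le_envelope (D := D) (σ := σ) hκ0.le w]
  have hterm : ∀ i k, |(-D.hess meth σ)⁻¹ i k *
      ((D.hvec σ i ⬝ᵥ w) * (1 / 2 * quadC (D.Bm σ D.P k) w + D.bias meth σ k))|
      ≤ K * D.envelope σ κ w / D.dstar σ * |D.hvec σ i ⬝ᵥ w| := fun i k => by
    rw [abs_mul, abs_mul]
    calc _ ≤ K / (D.d σ i * D.d σ k) * (|D.hvec σ i ⬝ᵥ w| * (D.envelope σ κ w * D.d σ k)) := by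
          have := div_nonneg hK (mul_pos (hd0 i) (hd0 k)).le
          gcongr
          · exact hreg.abs_inv_le i k
          · exact abs_score_le hσ hκ h1 meth w k
      _ = K * D.envelope σ κ w / D.d σ i * |D.hvec σ i ⬝ᵥ w| := by
          have := (hd0 i).ne'; have := (hd0 k).ne'
          field_simp
      _ ≤ _ := by
          gcongr
          exact dstar_le i
  calc |D.lin meth σ w| ≤ ∑ i, ∑ k, |(-D.hess meth σ)⁻¹ i k *
      ((D.hvec σ i ⬝ᵥ w) * (1 / 2 * quadC (D.Bm σ D.P k) w + D.bias meth σ k))| :=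
        (Finset.abs_sum_le_sum_abs _ _).trans
          (Finset.sum_le_sum fun i _ => Finset.abs_sum_le_sum_abs _ _)
    _ ≤ ∑ i, ∑ _k : Fin (q + 1), K * D.envelope σ κ w / D.dstar σ * |D.hvec σ i ⬝ᵥ w| :=
        Finset.sum_le_sum fun i _ => Finset.sum_le_sum fun k _ => hterm i k
    _ = (q + 1) * (K * D.envelope σ κ w / D.dstar σ * ∑ i, |D.hvec σ i ⬝ᵥ w|) := by
        simp only [Finset.sum_const, Finset.card_univ, Fintype.card_fin, nsmul_eq_mul,
          ← Finset.mul_sum]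
        push_cast; ring
    _ = _ := by ring

end Design
end EmpBLUP

end

/-! ### Second moments with the help of a rare exceptional event -/

noncomputable section
namespace EmpBLUP

set_option linter.unusedSectionVars false

section SecondMoments

/-- Truncation at `T`: above it, `u ^ 2 = u ^ (2 - b) * u ^ b` with a negative exponent `2 - b`. A
moment of order `b > 2` thus controls squares on rare events. -/
theorem sq_le_add_rpow {u T b : ℝ} (hu : 0 ≤ u) (hT : 0 < T) (hb : 2 < b) :
    u ^ 2 ≤ T ^ 2 + T ^ (2 - b) * u ^ b := by
  rcases le_total u T with h | h
  · have h1 : u ^ 2 ≤ T ^ 2 := pow_le_pow_left₀ hu h 2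
    have h2 : 0 ≤ T ^ (2 - b) * u ^ b := by positivity
    linarith
  · have hu0 : 0 < u := hT.trans_le h
    have h1 : u ^ 2 = u ^ (2 - b) * u ^ b := by
      rw [← Real.rpow_add hu0, sub_add_cancel]; norm_num
    have h2 : u ^ (2 - b) ≤ T ^ (2 - b) :=
      Real.rpow_le_rpow_of_nonpos hT h (by linarith)
    have h3 : u ^ (2 - b) * u ^ b ≤ T ^ (2 - b) * u ^ b :=
      mul_le_mul_of_nonneg_right h2 (by positivity)
    have h4 : 0 ≤ T ^ 2 := by positivity
    linarith

variable {Ω : Type*} [MeasurableSpace Ω] {μ : Measure Ω} [IsProbabilityMeasure μ]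
  {Δ L Y U : Ω → ℝ}

/-- Expand `Δ = L + R` and apply the weighted inequality `2 |L R| ≤ η L ^ 2 + R ^ 2 / η`. The weight
is left free, to be balanced against the size of the remainder. -/
theorem abs_integral_sq_sub_le {η : ℝ} (hη : 0 < η) (hΔ : Integrable (fun ω => Δ ω ^ 2) μ)
    (hL : Integrable (fun ω => L ω ^ 2) μ) (hR : Integrable (fun ω => (Δ ω - L ω) ^ 2) μ) :
    |∫ ω, Δ ω ^ 2 ∂μ - ∫ ω, L ω ^ 2 ∂μ|
      ≤ η * ∫ ω, L ω ^ 2 ∂μ + (1 + 1 / η) * ∫ ω, (Δ ω - L ω) ^ 2 ∂μ := by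
  rw [← integral_sub hΔ hL, ← integral_const_mul, ← integral_const_mul,
    ← integral_add (hL.const_mul _) (hR.const_mul _)]
  refine (abs_integral_le_integral_abs).trans (integral_mono (hΔ.sub hL).abs
    ((hL.const_mul _).add (hR.const_mul _)) fun ω => ?_)
  set R := Δ ω - L ω with hRdef
  have e : Δ ω ^ 2 - L ω ^ 2 = R ^ 2 + 2 * (L ω * R) := by rw [hRdef]; ring
  have h1 : 2 * |L ω * R| ≤ η * L ω ^ 2 + 1 / η * R ^ 2 := by
    have h2 : 0 ≤ (η * |L ω| - |R|) ^ 2 / η := by positivity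
    have h3 : (η * |L ω| - |R|) ^ 2 / η = η * |L ω| ^ 2 + 1 / η * |R| ^ 2 - 2 * (|L ω| * |R|) := by
      field_simp; ring
    rw [h3, sq_abs, sq_abs] at h2
    rw [abs_mul]; linarith
  change |Δ ω ^ 2 - L ω ^ 2| ≤ _
  rw [e]
  refine (abs_add_le _ _).trans ?_
  rw [abs_of_nonneg (sq_nonneg R), abs_mul, abs_of_pos (by norm_num : (0 : ℝ) < 2)]
  linarith

theorem integrable_sq_of_abs_le_sum {J : ℕ} {W : Fin J → Ω → ℝ} {b c : ℝ} (hb : 2 < b)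
    (hW : ∀ j, Measurable (W j)) (hWb : ∀ j, Integrable (fun ω => |W j ω| ^ b) μ)
    (hΔ : Measurable Δ) (hΔW : ∀ ω, |Δ ω| ≤ c * ∑ j, |W j ω|) :
    Integrable (fun ω => Δ ω ^ 2) μ := by
  have h2 : ∀ j, Integrable (fun ω => W j ω ^ 2) μ := fun j => by
    refine ((integrable_const (1 : ℝ)).add (hWb j)).mono' ((hW j).pow_const 2).aestronglyMeasurable
      (ae_of_all _ fun ω => ?_)
    have := sq_le_add_rpow (abs_nonneg (W j ω)) one_pos hb
    rw [Real.one_rpow, one_mul, one_pow, sq_abs] at this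
    rw [Real.norm_of_nonneg (sq_nonneg _)]
    exact this
  refine ((integrable_finsetSum Finset.univ fun j _ => h2 j).const_mul (c ^ 2 * J)).mono'
    (hΔ.pow_const 2).aestronglyMeasurable (ae_of_all _ fun ω => ?_)
  rw [Real.norm_of_nonneg (sq_nonneg _), ← sq_abs]
  have h3 := sq_sum_le_card_mul_sum_sq (s := Finset.univ) (f := fun j => |W j ω|)
  simp only [sq_abs, Finset.card_univ, Fintype.card_fin] at h3
  calc |Δ ω| ^ 2 ≤ (c * ∑ j, |W j ω|) ^ 2 := pow_le_pow_left₀ (abs_nonneg _) (hΔW ω) 2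
    _ = c ^ 2 * (∑ j, |W j ω|) ^ 2 := by ring
    _ ≤ c ^ 2 * (J * ∑ j, W j ω ^ 2) := mul_le_mul_of_nonneg_left h3 (sq_nonneg c)
    _ = _ := by ring

/-- The mean square distance of `Δ` and `L` when `|Δ - L| ≤ aY` outside an event of small
probability and crude moment bounds hold everywhere. -/
theorem integral_sub_sq_le {J : ℕ} {W : Fin J → Ω → ℝ} {a b c T x π CU CY CW : ℝ}
    (hΔ : Measurable Δ) (hL : Measurable L) (hY : Measurable Y)
    (hb : 2 < b) (hT : 0 < T) (hx : 0 < x) (hΔW : ∀ ω, |Δ ω| ≤ c * ∑ j, |W j ω|)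
    (hWb : ∀ j, Integrable (fun ω => |W j ω| ^ b) μ ∧ ∫ ω, |W j ω| ^ b ∂μ ≤ CW)
    (hLU : ∀ ω, |L ω| ≤ U ω / x) (hU : Integrable (fun ω => U ω ^ 4) μ)
    (hU' : ∫ ω, U ω ^ 4 ∂μ ≤ CU) (hY2 : Integrable (fun ω => Y ω ^ 2) μ)
    (hY2' : ∫ ω, Y ω ^ 2 ∂μ ≤ CY) (hπ : μ.real {ω | a * Y ω < |Δ ω - L ω|} ≤ π) :
    Integrable (fun ω => (Δ ω - L ω) ^ 2) μ ∧
      ∫ ω, (Δ ω - L ω) ^ 2 ∂μ ≤ a ^ 2 * CY + 2 * (c ^ 2 * J) * (J * (T ^ 2 * π + T ^ (2 - b) * CW))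
        + 2 / x ^ 2 * (CU / x + x * π) := by
  set E := {ω | a * Y ω < |Δ ω - L ω|} with hE
  have hEm : MeasurableSet E :=
    measurableSet_lt (hY.const_mul a) (hΔ.sub hL).abs
  set χ : Ω → ℝ := E.indicator 1 with hχ
  have hχi : Integrable χ μ := (integrable_const (1 : ℝ)).indicator hEm
  have hχπ : ∫ ω, χ ω ∂μ ≤ π := by
    rw [hχ, integral_indicator_one hEm]; exact hπ
  have hχ0 : ∀ ω, 0 ≤ χ ω := fun ω => Set.indicator_nonneg (fun _ _ => zero_le_one) ω
  have hTb : 0 < T ^ (2 - b) := Real.rpow_pos_of_pos hT _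
  have hint : ∀ j, Integrable (fun ω => T ^ 2 * χ ω + T ^ (2 - b) * |W j ω| ^ b) μ := fun j =>
    (hχi.const_mul _).add ((hWb j).1.const_mul _)
  have i1 := hY2.const_mul (a ^ 2)
  have i2 : Integrable (fun ω => 2 * (c ^ 2 * J) *
      ∑ j, (T ^ 2 * χ ω + T ^ (2 - b) * |W j ω| ^ b)) μ :=
    (integrable_finsetSum Finset.univ fun j _ => hint j).const_mul _
  have i3 : Integrable (fun ω => 2 / x ^ 2 * (U ω ^ 4 / x + x * χ ω)) μ :=
    ((hU.div_const x).add (hχi.const_mul x)).const_mul _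
  have i12 : Integrable (fun ω => a ^ 2 * Y ω ^ 2 + 2 * (c ^ 2 * J) *
      ∑ j, (T ^ 2 * χ ω + T ^ (2 - b) * |W j ω| ^ b)) μ := i1.add i2
  have i123 : Integrable (fun ω => a ^ 2 * Y ω ^ 2 + 2 * (c ^ 2 * J) *
      ∑ j, (T ^ 2 * χ ω + T ^ (2 - b) * |W j ω| ^ b) + 2 / x ^ 2 * (U ω ^ 4 / x + x * χ ω)) μ :=
    i12.add i3
  have hpt : ∀ ω, (Δ ω - L ω) ^ 2 ≤ a ^ 2 * Y ω ^ 2 + 2 * (c ^ 2 * J) *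
      ∑ j, (T ^ 2 * χ ω + T ^ (2 - b) * |W j ω| ^ b) + 2 / x ^ 2 * (U ω ^ 4 / x + x * χ ω) := by
    intro ω
    have hWn : ∀ j, 0 ≤ T ^ (2 - b) * |W j ω| ^ b := fun j => by positivity
    by_cases hω : ω ∈ E
    · have e : χ ω = 1 := by rw [hχ, Set.indicator_of_mem hω]; rfl
      have h1 : Δ ω ^ 2 ≤ c ^ 2 * J * ∑ j, (T ^ 2 * χ ω + T ^ (2 - b) * |W j ω| ^ b) := by
        have h3 := sq_sum_le_card_mul_sum_sq (s := Finset.univ) (f := fun j => |W j ω|)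
        simp only [Finset.card_univ, Fintype.card_fin] at h3
        rw [← sq_abs (Δ ω)]
        calc |Δ ω| ^ 2 ≤ (c * ∑ j, |W j ω|) ^ 2 := pow_le_pow_left₀ (abs_nonneg _) (hΔW ω) 2
          _ = c ^ 2 * (∑ j, |W j ω|) ^ 2 := by ring
          _ ≤ c ^ 2 * (J * ∑ j, |W j ω| ^ 2) := mul_le_mul_of_nonneg_left h3 (sq_nonneg c)
          _ ≤ c ^ 2 * (J * ∑ j, (T ^ 2 * χ ω + T ^ (2 - b) * |W j ω| ^ b)) := by
              gcongr with j _
              rw [e, mul_one]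
              exact sq_le_add_rpow (abs_nonneg _) hT hb
          _ = _ := by ring
      have h2 : L ω ^ 2 ≤ 1 / x ^ 2 * (U ω ^ 4 / x + x * χ ω) := by
        have h3 : |L ω| ^ 2 ≤ (U ω / x) ^ 2 := pow_le_pow_left₀ (abs_nonneg _) (hLU ω) 2
        -- Truncation of `U` at level `√x`, from `(U ^ 2 - x) ^ 2 ≥ 0`. Since this is used on `E`
        -- only, the summand `x` is weighted by the probability of `E`.
        have h4 : U ω ^ 2 ≤ U ω ^ 4 / x + x := by
          have h5 : 0 ≤ (U ω ^ 2 - x) ^ 2 / x := by positivity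
          have h6 : (U ω ^ 2 - x) ^ 2 / x = U ω ^ 4 / x + x - 2 * U ω ^ 2 := by
            field_simp; ring
          have h7 := sq_nonneg (U ω)
          linarith
        rw [sq_abs] at h3
        rw [e, mul_one]
        calc L ω ^ 2 ≤ (U ω / x) ^ 2 := h3
          _ = 1 / x ^ 2 * U ω ^ 2 := by ring
          _ ≤ _ := by gcongr
      have h3 : (Δ ω - L ω) ^ 2 ≤ 2 * Δ ω ^ 2 + 2 * L ω ^ 2 := by
        linarith [sq_nonneg (Δ ω + L ω), sq_nonneg (Δ ω - L ω), add_sq (Δ ω) (L ω),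
          sub_sq (Δ ω) (L ω)]
      have h4 : 0 ≤ a ^ 2 * Y ω ^ 2 := by positivity
      have h5 : 2 / x ^ 2 * (U ω ^ 4 / x + x * χ ω)
        = 2 * (1 / x ^ 2 * (U ω ^ 4 / x + x * χ ω)) := by ring
      rw [h5]
      linarith
    · have h1 : (Δ ω - L ω) ^ 2 ≤ a ^ 2 * Y ω ^ 2 := by
        rw [← sq_abs, ← mul_pow]
        exact pow_le_pow_left₀ (abs_nonneg _) (not_lt.1 hω) 2
      have h2 : 0 ≤ ∑ j, (T ^ 2 * χ ω + T ^ (2 - b) * |W j ω| ^ b) :=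
        Finset.sum_nonneg fun j _ => add_nonneg (mul_nonneg (sq_nonneg T) (hχ0 ω)) (hWn j)
      have h3 : 0 ≤ 2 * (c ^ 2 * J) * ∑ j, (T ^ 2 * χ ω + T ^ (2 - b) * |W j ω| ^ b) :=
        mul_nonneg (by positivity) h2
      have h4 : 0 ≤ 2 / x ^ 2 * (U ω ^ 4 / x + x * χ ω) :=
        mul_nonneg (by positivity) (add_nonneg (by positivity) (mul_nonneg hx.le (hχ0 ω)))
      linarith
  have hi : Integrable (fun ω => (Δ ω - L ω) ^ 2) μ :=
    i123.mono' ((hΔ.sub hL).pow_const 2).aestronglyMeasurable (ae_of_all _ fun ω => by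
      rw [Real.norm_of_nonneg (sq_nonneg _)]; exact hpt ω)
  refine ⟨hi, (integral_mono hi i123 hpt).trans ?_⟩
  rw [integral_add i12 i3, integral_add i1 i2, integral_const_mul, integral_const_mul,
    integral_const_mul, integral_finsetSum _ fun j _ => hint j,
    integral_add (hU.div_const x) (hχi.const_mul x), integral_div, integral_const_mul]
  have hj : ∑ j, ∫ ω, T ^ 2 * χ ω + T ^ (2 - b) * |W j ω| ^ b ∂μ
      ≤ J * (T ^ 2 * π + T ^ (2 - b) * CW) := by
    refine (Finset.sum_le_card_nsmul _ _ (T ^ 2 * π + T ^ (2 - b) * CW) fun j _ => ?_).trans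
      (le_of_eq (by simp; ring))
    rw [integral_add (hχi.const_mul _) ((hWb j).1.const_mul _), integral_const_mul,
      integral_const_mul]
    gcongr
    exact (hWb j).2
  gcongr

/-- Here `T = x ^ γ` with `γ = (2 α + 3) / (b - 2)`, chosen so that `x ^ (2 α) * T ^ (2 - b) = x ^
(-3)`, where `x ^ α` is the order of `J`. The exponent required of the probability then also gives
`x ^ (2 α) * T ^ 2 * π = O(x ^ (-3))`. -/
theorem integral_sub_sq_le_of_rpow {J : ℕ} {W : Fin J → Ω → ℝ}
    {α a b c x CJ CP CU CY CW : ℝ}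
    (hΔ : Measurable Δ) (hL : Measurable L) (hY : Measurable Y)
    (hα : 0 ≤ α) (hb : 2 < b) (hx : 1 ≤ x) (hΔW : ∀ ω, |Δ ω| ≤ c * ∑ j, |W j ω|)
    (hWb : ∀ j, Integrable (fun ω => |W j ω| ^ b) μ ∧ ∫ ω, |W j ω| ^ b ∂μ ≤ CW)
    (hLU : ∀ ω, |L ω| ≤ U ω / x) (hU : Integrable (fun ω => U ω ^ 4) μ)
    (hU' : ∫ ω, U ω ^ 4 ∂μ ≤ CU) (hY2 : Integrable (fun ω => Y ω ^ 2) μ)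
    (hY2' : ∫ ω, Y ω ^ 2 ∂μ ≤ CY) (hCY : 0 ≤ CY) (hCP : 0 ≤ CP) (hCW : 0 ≤ CW)
    (ha : a ^ 2 ≤ 1 / x ^ 3) (hJ : (J : ℝ) ≤ CJ * x ^ α)
    (hπ : μ.real {ω | a * Y ω < |Δ ω - L ω|}
      ≤ CP * x ^ (-(2 * α + 2 * ((2 * α + 3) / (b - 2)) + 3))) :
    Integrable (fun ω => (Δ ω - L ω) ^ 2) μ ∧
      ∫ ω, (Δ ω - L ω) ^ 2 ∂μ ≤ (CY + 2 * c ^ 2 * (CJ ^ 2 * (CP + CW)) + 2 * (CU + CP)) / x ^ 3 := by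
  have hx0 : 0 < x := by linarith
  set γ := (2 * α + 3) / (b - 2) with hγ
  have hγ0 : 0 ≤ γ := div_nonneg (by linarith) (by linarith)
  have hγb : γ * (2 - b) = -(2 * α + 3) := by
    rw [hγ]
    have : b - 2 ≠ 0 := by linarith
    field_simp; ring
  obtain ⟨h1, h2⟩ := integral_sub_sq_le hΔ hL hY hb (Real.rpow_pos_of_pos hx0 γ) hx0 hΔW hWb hLU hU
    hU' hY2 hY2' hπ
  refine ⟨h1, h2.trans ?_⟩
  set z := x ^ (-(3 : ℝ)) with hz
  have hz3 : z = 1 / x ^ 3 := by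
    rw [hz, Real.rpow_neg hx0.le, one_div, ← Real.rpow_natCast x 3]; norm_num
  have e1 : (x ^ α) ^ 2 * ((x ^ γ) ^ 2 * (CP * x ^ (-(2 * α + 2 * γ + 3)))) = CP * z := by
    have : (x ^ α) ^ 2 * (x ^ γ) ^ 2 * x ^ (-(2 * α + 2 * γ + 3)) = z := by
      rw [hz, ← Real.rpow_natCast, ← Real.rpow_natCast, ← Real.rpow_mul hx0.le,
        ← Real.rpow_mul hx0.le, ← Real.rpow_add hx0, ← Real.rpow_add hx0]
      congr 1; push_cast; ring
    rw [← this]; ring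
  have e2 : (x ^ α) ^ 2 * ((x ^ γ) ^ (2 - b) * CW) = CW * z := by
    have : (x ^ α) ^ 2 * (x ^ γ) ^ (2 - b) = z := by
      rw [hz, ← Real.rpow_natCast, ← Real.rpow_mul hx0.le, ← Real.rpow_mul hx0.le, hγb,
        ← Real.rpow_add hx0]
      congr 1; push_cast; ring
    rw [← this]; ring
  have e3 : x ^ (-(2 * α + 2 * γ + 3)) ≤ z :=
    Real.rpow_le_rpow_of_exponent_le hx (by linarith)
  have hz0 : 0 ≤ z := by positivity
  set S := (x ^ γ) ^ 2 * (CP * x ^ (-(2 * α + 2 * γ + 3))) + (x ^ γ) ^ (2 - b) * CW with hS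
  have hS0 : 0 ≤ S := by positivity
  have t2 : 2 * (c ^ 2 * J) * (J * S) ≤ 2 * c ^ 2 * (CJ ^ 2 * (CP + CW)) * z := by
    have h3 : (J : ℝ) ^ 2 ≤ (CJ * x ^ α) ^ 2 := pow_le_pow_left₀ (Nat.cast_nonneg J) hJ 2
    calc 2 * (c ^ 2 * J) * (J * S) = 2 * c ^ 2 * ((J : ℝ) ^ 2 * S) := by ring
      _ ≤ 2 * c ^ 2 * ((CJ * x ^ α) ^ 2 * S) := by gcongr
      _ = 2 * c ^ 2 * CJ ^ 2 * ((x ^ α) ^ 2 * S) := by ring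
      _ = 2 * c ^ 2 * CJ ^ 2 * (CP * z + CW * z) := by rw [hS, mul_add, e1, e2]
      _ = _ := by ring
  have t1 : a ^ 2 * CY ≤ CY * z := by
    rw [hz3, mul_comm]; exact mul_le_mul_of_nonneg_left ha hCY
  have t3 : 2 / x ^ 2 * (CU / x + x * (CP * x ^ (-(2 * α + 2 * γ + 3)))) ≤ 2 * (CU + CP) * z := by
    have h4 : 2 / x ^ 2 * (CU / x) = 2 * CU * z := by
      rw [hz3]; field_simp
    have h5 : 2 / x ^ 2 * (x * (CP * x ^ (-(2 * α + 2 * γ + 3)))) ≤ 2 * CP * z := by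
      calc 2 / x ^ 2 * (x * (CP * x ^ (-(2 * α + 2 * γ + 3))))
          = 2 * CP * x ^ (-(2 * α + 2 * γ + 3)) * x⁻¹ := by field_simp
        _ ≤ 2 * CP * z * 1 := by
            gcongr
            exact inv_le_one_of_one_le₀ hx
        _ = _ := by ring
    rw [mul_add, h4]; linarith
  calc _ ≤ CY * z + 2 * c ^ 2 * (CJ ^ 2 * (CP + CW)) * z + 2 * (CU + CP) * z := by
        linarith
    _ = _ := by rw [hz3]; ring

end SecondMoments

end EmpBLUP

end

/-! ### Decomposition of the mean square error -/

noncomputable section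
namespace EmpBLUP

set_option linter.unusedSectionVars false

open scoped Matrix.Norms.L2Operator

theorem isLittleO_zpow_of_abs_le {f u x : ℕ → ℝ} (hx : ∀ᶠ k in atTop, 0 < x k)
    (hu : Tendsto u atTop (𝓝 0)) (h : ∀ᶠ k in atTop, |f k| ≤ u k / x k ^ 2) :
    f =o[atTop] fun k => x k ^ (-2 : ℤ) := by
  rw [isLittleO_iff]
  intro c hc
  filter_upwards [hx, h, hu.eventually_lt_const hc] with k h0 h1 h2
  rw [Real.norm_eq_abs, Real.norm_of_nonneg (zpow_nonneg h0.le _), zpow_neg, ← div_eq_mul_inv]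
  refine h1.trans ?_
  rw [show x k ^ (2 : ℤ) = x k ^ 2 from zpow_ofNat _ 2]
  gcongr

namespace Design

variable {p q : ℕ}

section

variable {D : Design p q} {σ τ : Param q}

/-- On the event where the score equation has the root `τ` near `σ`, the effect of estimating the
variance components is approximated by `lin`. -/
theorem abs_t_sub_sub_lin_le {meth : Method} {κ K R δ : ℝ} {J : ℕ} {lam : Fin J → Param q → ℝ}
    {W : Fin J → (Fin D.n → ℝ) → ℝ} {B : Fin J → ℝ} (hσ : ∀ i, 0 < σ i)
    (hκ : ∀ i, 1 / σ i ≤ κ) (hreg : D.Regular meth σ K) (hK : 0 ≤ K)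
    (hexp : ∀ τ ∈ D.admissible, ∀ y, D.t τ y = ∑ j, lam j τ * W j y)
    (hlam : ∀ j, ∀ τ ∈ Metric.closedBall σ δ,
      ContDiffAt ℝ 2 (lam j) τ ∧ ‖iteratedFDeriv ℝ 2 (lam j) τ‖ ≤ B j) (hB : ∀ j, 0 ≤ B j)
    (hR : 1 ≤ R) (hτ : D.scaledDist σ τ ≤ R) (hR1 : ∀ i, (q + 1) * R / D.dstar σ ≤ σ i / 2)
    (hR2 : 2 * κ * ((q + 1) * R) ≤ D.dstar σ) (hR3 : (q + 1) * R / D.dstar σ ≤ δ)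
    (β : Fin p → ℝ) (w : D.Noise → ℝ)
    (hroot : fderiv ℝ (fun τ' => D.crit meth τ' (D.X *ᵥ β + D.H σ *ᵥ w)) τ = 0) :
    |D.t τ (D.X *ᵥ β + D.H σ *ᵥ w) - D.t σ (D.X *ᵥ β + D.H σ *ᵥ w) - D.lin meth σ w|
      ≤ R ^ 2 / D.dstar σ ^ 2 *
        ((q + 1) * K * (1 + 8 * κ + 2 * κ * (1 + 2 * p * κ ^ 2) ^ 2) * ((q + 2) * (q + 1))
            * (D.ctrl σ w * ∑ i, |D.hvec σ i ⬝ᵥ w|)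
          + (q + 1) ^ 2 * ∑ j, B j * |W j (D.X *ᵥ β + D.H σ *ᵥ w)|) := by
  have hκ0 := kappa_pos hσ hκ
  have h1 := hreg.one_le
  have h0 : 0 < D.dstar σ := by linarith
  have hℓ : D.scaledL1 σ τ ≤ (q + 1) * R := scaledL1_le.trans (by gcongr)
  have hℓ0 : 0 ≤ D.scaledL1 σ τ := scaledL1_nonneg
  have hnorm : ‖τ - σ‖ ≤ (q + 1) * R / D.dstar σ :=
    (norm_sub_le_scaledL1 h0).trans (by gcongr)
  have hnear : D.Near σ τ κ := by
    refine ⟨fun i => ?_, (by gcongr : _ ≤ 2 * κ * ((q + 1) * R)).trans hR2⟩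
    have h2 : |τ i - σ i| ≤ ‖τ - σ‖ := by
      simpa using PiLp.norm_apply_le (p := 2) (τ - σ) i
    linarith [(abs_le.1 (h2.trans (hnorm.trans (hR1 i)))).1]
  have hτ0 : ∀ i, 0 < τ i := fun i => (half_pos (hσ i)).trans_le (hnear.half_le i)
  have hs := (fderiv_crit_eq_zero_iff meth hτ0 _).1 hroot
  have a1 := abs_root_sub_lin_le hσ hκ hreg hK hnear β w hs
  have a2 := abs_t_sub_sub_le hσ hexp hlam (D.mem_admissible hτ0) (hnorm.trans hR3) β w
  set c := 1 + 8 * κ + 2 * κ * (1 + 2 * p * κ ^ 2) ^ 2 with hc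
  set C := D.ctrl σ w * ∑ i, |D.hvec σ i ⬝ᵥ w| with hC
  set S := ∑ j, B j * |W j (D.X *ᵥ β + D.H σ *ᵥ w)| with hS
  have hc0 : 0 ≤ c := by positivity
  have hC0 : 0 ≤ C := mul_nonneg (by linarith [one_le_ctrl (D := D) (σ := σ) w])
    (Finset.sum_nonneg fun i _ => abs_nonneg _)
  have hS0 : 0 ≤ S := Finset.sum_nonneg fun j _ => mul_nonneg (hB j) (abs_nonneg _)
  have b1 : (1 + D.scaledL1 σ τ) * D.scaledL1 σ τ ≤ (q + 2) * (q + 1) * R ^ 2 := by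
    calc _ ≤ (R + (q + 1) * R) * ((q + 1) * R) := by gcongr
      _ = _ := by ring
  have b2 : ‖τ - σ‖ ^ 2 ≤ (q + 1) ^ 2 * R ^ 2 / D.dstar σ ^ 2 := by
    refine (pow_le_pow_left₀ (norm_nonneg _) hnorm 2).trans (le_of_eq ?_)
    rw [div_pow, mul_pow]
  have c1 : (q + 1) * K * c * ((1 + D.scaledL1 σ τ) * D.scaledL1 σ τ) / D.dstar σ ^ 2 * C
      ≤ (q + 1) * K * c * ((q + 2) * (q + 1) * R ^ 2) / D.dstar σ ^ 2 * C := by gcongr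
  have c2 : ‖τ - σ‖ ^ 2 * S ≤ (q + 1) ^ 2 * R ^ 2 / D.dstar σ ^ 2 * S := by gcongr
  have e : D.t τ (D.X *ᵥ β + D.H σ *ᵥ w) - D.t σ (D.X *ᵥ β + D.H σ *ᵥ w) - D.lin meth σ w
      = (D.t τ (D.X *ᵥ β + D.H σ *ᵥ w) - D.t σ (D.X *ᵥ β + D.H σ *ᵥ w)
          - ∑ i, (τ i - σ i) * (D.hvec σ i ⬝ᵥ w))
        + (∑ i, (τ i - σ i) * (D.hvec σ i ⬝ᵥ w) - D.lin meth σ w) := by ring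
  rw [e]
  refine (abs_add_le _ _).trans ((add_le_add (a2.trans c2) (a1.trans c1)).trans (le_of_eq ?_))
  ring

theorem integrable_errVec_sq : Integrable (fun w => (D.errVec σ ⬝ᵥ w) ^ 2) (stdG D.Noise) :=
  ((unifMom_dotProduct (K := Unit) (ι := fun _ => D.Noise) (h := fun _ => D.errVec σ)
    fun _ => le_rfl).pow 2).integrable ()

variable {est : (Fin D.n → ℝ) → Param q} {β : Fin p → ℝ}

theorem integrable_errVec_mul (hm : Measurable est)
    (hΔ : Integrable (fun w => (D.t (est (D.X *ᵥ β + D.H σ *ᵥ w)) (D.X *ᵥ β + D.H σ *ᵥ w)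
      - D.t σ (D.X *ᵥ β + D.H σ *ᵥ w)) ^ 2) (stdG D.Noise)) :
    Integrable (fun w => (D.errVec σ ⬝ᵥ w) *
      (D.t (est (D.X *ᵥ β + D.H σ *ᵥ w)) (D.X *ᵥ β + D.H σ *ᵥ w)
      - D.t σ (D.X *ᵥ β + D.H σ *ᵥ w))) (stdG D.Noise) := by
  have h1 : Measurable fun w : D.Noise → ℝ => D.errVec σ ⬝ᵥ w :=
    (Continuous.dotProduct continuous_const continuous_id).measurable
  have h2 := (measurable_t_sub (σ := σ) hm).comp (measurable_response (D := D) (σ := σ) β)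
  refine ((integrable_errVec_sq (D := D) (σ := σ)).add hΔ).mono' (h1.mul h2).aestronglyMeasurable
    (ae_of_all _ fun w => ?_)
  rw [Real.norm_eq_abs, abs_mul]
  simp only [Pi.add_apply]
  set u := D.errVec σ ⬝ᵥ w
  set v := D.t (est (D.X *ᵥ β + D.H σ *ᵥ w)) (D.X *ᵥ β + D.H σ *ᵥ w)
    - D.t σ (D.X *ᵥ β + D.H σ *ᵥ w)
  nlinarith [sq_nonneg (|u| - |v|), sq_abs u, sq_abs v, sq_nonneg u, sq_nonneg v]

theorem integrable_predError_sq (hσ : ∀ i, 0 < σ i) (hm : Measurable est)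
    (hΔ : Integrable (fun w => (D.t (est (D.X *ᵥ β + D.H σ *ᵥ w)) (D.X *ᵥ β + D.H σ *ᵥ w)
      - D.t σ (D.X *ᵥ β + D.H σ *ᵥ w)) ^ 2) (stdG D.Noise)) :
    Integrable (fun ω => D.predError β est ω ^ 2) (D.law σ) := by
  rw [integrable_law hσ]
  simp only [predError_scaleEquiv, add_sq, mul_assoc]
  exact (integrable_errVec_sq.add ((integrable_errVec_mul hm hΔ).const_mul 2)).add hΔ

/-- The decomposition of the mean square error into the error of the BLUP and the effect of
estimating the variance components. -/
theorem MSE_eq (hσ : ∀ i, 0 < σ i) (hm : Measurable est) (hadm : ∀ y, est y ∈ D.admissible)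
    (hinv : ∀ y (b : Fin p → ℝ), est (y + D.X *ᵥ b) = est y)
    (hΔ : Integrable (fun w => (D.t (est (D.X *ᵥ β + D.H σ *ᵥ w)) (D.X *ᵥ β + D.H σ *ᵥ w)
      - D.t σ (D.X *ᵥ β + D.H σ *ᵥ w)) ^ 2) (stdG D.Noise)) :
    D.MSE β σ est = D.g₁ σ + D.g₂ σ +
      ∫ w, (D.t (est (D.X *ᵥ β + D.H σ *ᵥ w)) (D.X *ᵥ β + D.H σ *ᵥ w)
        - D.t σ (D.X *ᵥ β + D.H σ *ᵥ w)) ^ 2 ∂(stdG D.Noise) := by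
  rw [MSE, integral_law hσ]
  simp only [predError_scaleEquiv, add_sq, mul_assoc]
  have i1 := integrable_errVec_sq (D := D) (σ := σ)
  have i2 := (integrable_errVec_mul hm hΔ).const_mul 2
  have i12 : Integrable (fun w => (D.errVec σ ⬝ᵥ w) ^ 2 + 2 * ((D.errVec σ ⬝ᵥ w) *
      (D.t (est (D.X *ᵥ β + D.H σ *ᵥ w)) (D.X *ᵥ β + D.H σ *ᵥ w)
      - D.t σ (D.X *ᵥ β + D.H σ *ᵥ w)))) (stdG D.Noise) := i1.add i2
  rw [integral_add i12 hΔ, integral_add i1 i2, integral_const_mul,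
    integral_errVec_mul hσ β (measurable_t_sub (σ := σ) hm) (t_sub_invariant hσ hadm hinv),
    ← errVec_dotProduct_self hσ, ← integral_dotProduct_mul]
  simp only [sq, mul_zero, add_zero]

end

variable {D : ℕ → Design p q} {σ : Param q} {κ : ℝ}

theorem exists_vn_hvec_le (hσ : ∀ i, 0 < σ i) (hκ : ∀ i, 1 / σ i ≤ κ)
    (hm : ∃ C : ℝ, ∀ k, ∑ j, (D k).m j ^ 2 ≤ C) (hfix : FixedPartNegligible D σ) :
    ∃ r, (∀ k, vn (D k).m ≤ r) ∧ ∀ k i, vn ((D k).hvec σ i) ≤ r := by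
  have hκ0 := kappa_pos hσ hκ
  obtain ⟨C, hC⟩ := hm
  have hvm : ∀ k, vn (D k).m ≤ √C := fun k => by
    refine Real.le_sqrt_of_sq_le ?_
    rw [vn_sq]
    refine le_trans (le_of_eq ?_) (hC k)
    simp [dotProduct, sq]
  obtain ⟨v, hv⟩ := hfix.1.sqrt.bddAbove_range
  refine ⟨√C + (2 * κ * (√(∑ i, σ i) * √C) + κ * v), fun k => ?_, fun k i => ?_⟩
  · have hv0 : 0 ≤ v := (Real.sqrt_nonneg _).trans (hv (Set.mem_range_self 0))
    have := hvm k
    have h2 : 0 ≤ 2 * κ * (√(∑ i, σ i) * √C) + κ * v := by positivity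
    linarith
  · have h1 := vn_hvec_le (D := D k) hσ hκ i
    have h2 : 2 * κ * (√(∑ i, σ i) * vn (D k).m) ≤ 2 * κ * (√(∑ i, σ i) * √C) := by
      gcongr; exact hvm k
    have h3 : κ * √((D k).blueVar σ ((D k).l - (D k).Xᵀ *ᵥ (D k).s σ)) ≤ κ * v := by
      gcongr; exact hv (Set.mem_range_self k)
    linarith [Real.sqrt_nonneg C]

theorem exists_tendsto_abs_hvec_dot_sub_le (hσ : ∀ i, 0 < σ i) (hκ : ∀ i, 1 / σ i ≤ κ)
    (hm : ∃ C : ℝ, ∀ k, ∑ j, (D k).m j ^ 2 ≤ C) (hfix : FixedPartNegligible D σ) :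
    ∃ η : ℕ → ℝ, Tendsto η atTop (𝓝 0) ∧ ∀ k i j, |(D k).hvec σ i ⬝ᵥ (D k).hvec σ j
      - (((D k).gradS σ)ᵀ * (D k).cov σ * (D k).gradS σ) i j| ≤ η k := by
  have hκ0 := kappa_pos hσ hκ
  obtain ⟨r, hr, -⟩ := exists_vn_hvec_le hσ hκ hm hfix
  set u := fun k => √((D k).blueVar σ ((D k).l - (D k).Xᵀ *ᵥ (D k).s σ)) with hu
  set v := fun k => ∑ i, √((D k).blueVar σ ((D k).Xᵀ *ᵥ (D k).ds σ i)) with hv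
  have tu : Tendsto u atTop (𝓝 0) := by simpa using hfix.1.sqrt
  have tv : Tendsto v atTop (𝓝 0) := by
    have := tendsto_finsetSum (Finset.univ : Finset (Fin (q + 1)))
      fun i _ => (hfix.2 i).sqrt
    simpa using this
  refine ⟨fun k => v k * v k + κ * u k * (4 * κ * (√(∑ i, σ i) * r) + κ * u k), ?_,
    fun k i j => (abs_hvec_dot_sub_le hσ hκ i j).trans ?_⟩
  · have h1 := (tv.mul tv).add ((tu.const_mul κ).mul
      ((tu.const_mul κ).const_add (4 * κ * (√(∑ i, σ i) * r))))
    simpa using h1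
  · have hs : ∀ i, √((D k).blueVar σ ((D k).Xᵀ *ᵥ (D k).ds σ i)) ≤ v k := fun i =>
      Finset.single_le_sum (f := fun i => √((D k).blueVar σ ((D k).Xᵀ *ᵥ (D k).ds σ i)))
        (fun i _ => Real.sqrt_nonneg _) (Finset.mem_univ i)
    have hu0 : 0 ≤ u k := Real.sqrt_nonneg _
    have hv0 : 0 ≤ v k := (Real.sqrt_nonneg _).trans (hs i)
    have := hr k
    refine add_le_add (mul_le_mul (hs i) (hs j) (Real.sqrt_nonneg _) hv0) ?_
    change κ * u k * (4 * κ * (√(∑ i, σ i) * vn (D k).m) + κ * u k)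
      ≤ κ * u k * (4 * κ * (√(∑ i, σ i) * r) + κ * u k)
    gcongr

/-- The second moment of the linear approximation. -/
theorem integral_lin_sq_isLittleO (hσ : ∀ i, 0 < σ i)
    (hm : ∃ C : ℝ, ∀ k, ∑ j, (D k).m j ^ 2 ≤ C) (hinf : InfinitelyInformative D σ)
    (hid : AsymptoticallyIdentifiable D σ) (hfix : FixedPartNegligible D σ) (meth : Method)
    (β : Fin p → ℝ) :
    (fun k => ∫ w, (D k).lin meth σ w ^ 2 ∂(stdG (D k).Noise) - (D k).g₃ meth β σ)
      =o[atTop] fun k => (D k).dstar σ ^ (-2 : ℤ) := by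
  obtain ⟨κ, hκ⟩ : ∃ κ, ∀ i, 1 / σ i ≤ κ :=
    ⟨∑ i, 1 / σ i, fun i => Finset.single_le_sum (f := fun i => 1 / σ i)
      (fun i _ => (one_div_pos.2 (hσ i)).le) (Finset.mem_univ i)⟩
  obtain ⟨K, hK, hreg⟩ := eventually_regular hσ hinf hid meth
  obtain ⟨r, -, hr⟩ := exists_vn_hvec_le hσ hκ hm hfix
  obtain ⟨η, hη, hη'⟩ := exists_tendsto_abs_hvec_dot_sub_le hσ hκ hm hfix
  have ht := tendsto_dstar hinf
  set c := r ^ 2 * (p * κ ^ 2 + 2 * κ ^ 2 + 2 * p * κ ^ 2 + p ^ 2 * κ ^ 2) with hc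
  refine isLittleO_zpow_of_abs_le (u := fun k => ((q : ℝ) + 1) ^ 4 * K ^ 2 *
    (c / (D k).dstar σ ^ 2 + η k * (1 / 2 + p * κ ^ 2))) (ht.eventually_gt_atTop 0) ?_ ?_
  · have h1 : Tendsto (fun k => c / (D k).dstar σ ^ 2) atTop (𝓝 0) :=
      ((tendsto_pow_atTop two_ne_zero).comp ht).const_div_atTop c
    simpa using (h1.add (hη.mul_const (1 / 2 + p * κ ^ 2))).const_mul (((q : ℝ) + 1) ^ 4 * K ^ 2)
  · filter_upwards [hreg] with k hk
    have h0 : 0 < (D k).dstar σ := by linarith [hk.one_le]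
    have h1 := abs_integral_lin_sq_sub_le hσ hκ meth hk.one_le hK.le hk.inv_mul hk.abs_inv_le
      (hr k) (hη' k)
    rw [g₃, A_eq_hess hσ]
    refine h1.trans (le_of_eq ?_)
    rw [hc]; field_simp

end Design
end EmpBLUP

end

/-! ### The effect of estimating the variance components -/

noncomputable section
namespace EmpBLUP

set_option linter.unusedSectionVars false

open scoped Matrix.Norms.L2Operator

/-- Cauchy–Schwarz with weights `B j`: the bound involves their sum and not the number of terms,
which may grow with the model. -/
theorem integral_sq_sum_mul_le {Ω : Type*} [MeasurableSpace Ω] {μ : Measure Ω}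
    [IsProbabilityMeasure μ] {J : ℕ} {W : Fin J → Ω → ℝ} {B : Fin J → ℝ} {b C CW : ℝ} (hb : 2 < b)
    (hW : ∀ j, Measurable (W j))
    (hWb : ∀ j, Integrable (fun ω => |W j ω| ^ b) μ ∧ ∫ ω, |W j ω| ^ b ∂μ ≤ CW)
    (hB : ∀ j, 0 ≤ B j) (hBC : ∑ j, B j ≤ C) (hCW : 0 ≤ CW) :
    Integrable (fun ω => (∑ j, B j * |W j ω|) ^ 2) μ ∧
      ∫ ω, (∑ j, B j * |W j ω|) ^ 2 ∂μ ≤ C * (C * (1 + CW)) := by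
  have hC : 0 ≤ C := (Finset.sum_nonneg fun j _ => hB j).trans hBC
  have hi : ∀ j, Integrable (fun ω => B j * (1 + |W j ω| ^ b)) μ := fun j =>
    ((integrable_const (1 : ℝ)).add (hWb j).1).const_mul _
  have hi2 : Integrable (fun ω => C * ∑ j, B j * (1 + |W j ω| ^ b)) μ :=
    (integrable_finsetSum _ fun j _ => hi j).const_mul C
  have hpt : ∀ ω, (∑ j, B j * |W j ω|) ^ 2 ≤ C * ∑ j, B j * (1 + |W j ω| ^ b) := fun ω => by
    have h1 := Finset.sum_sq_le_sum_mul_sum_of_sq_le_mul Finset.univ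
      (r := fun j => B j * |W j ω|) (f := B) (g := fun j => B j * |W j ω| ^ 2)
      (fun j _ => hB j) (fun j _ => mul_nonneg (hB j) (sq_nonneg _)) (fun j _ => le_of_eq (by ring))
    refine h1.trans (mul_le_mul hBC (Finset.sum_le_sum fun j _ =>
      mul_le_mul_of_nonneg_left ?_ (hB j))
      (Finset.sum_nonneg fun j _ => mul_nonneg (hB j) (sq_nonneg _)) hC)
    have := sq_le_add_rpow (abs_nonneg (W j ω)) one_pos hb
    rwa [Real.one_rpow, one_mul, one_pow] at this
  have hm : Measurable fun ω => (∑ j, B j * |W j ω|) ^ 2 :=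
    (Finset.measurable_fun_sum _ fun j _ => (hW j).abs.const_mul (B j)).pow_const 2
  have hI : Integrable (fun ω => (∑ j, B j * |W j ω|) ^ 2) μ :=
    hi2.mono' hm.aestronglyMeasurable (ae_of_all _ fun ω => by
      rw [Real.norm_of_nonneg (sq_nonneg _)]; exact hpt ω)
  refine ⟨hI, (integral_mono hI hi2 hpt).trans ?_⟩
  rw [integral_const_mul, integral_finsetSum _ fun j _ => hi j]
  refine mul_le_mul_of_nonneg_left ?_ hC
  calc ∑ j, ∫ ω, B j * (1 + |W j ω| ^ b) ∂μ ≤ ∑ j, B j * (1 + CW) := by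
        refine Finset.sum_le_sum fun j _ => ?_
        rw [integral_const_mul, integral_add (integrable_const _) (hWb j).1, integral_const,
          probReal_univ, one_smul]
        exact mul_le_mul_of_nonneg_left (by linarith [(hWb j).2]) (hB j)
    _ = (∑ j, B j) * (1 + CW) := by rw [Finset.sum_mul]
    _ ≤ C * (1 + CW) := by gcongr

namespace Design

variable {p q : ℕ} {D : ℕ → Design p q} {σ : Param q}

/-- The crude bound for the exceptional event, where nothing is known about the estimate except that
it is admissible. -/
theorem abs_t_sub_le {D : Design p q} {J : ℕ} {lam : Fin J → Param q → ℝ}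
    {W : Fin J → (Fin D.n → ℝ) → ℝ} {C : ℝ} {τ τ' : Param q}
    (hexp : ∀ τ ∈ D.admissible, ∀ y, D.t τ y = ∑ j, lam j τ * W j y)
    (hC : ∀ j, ∀ τ ∈ D.admissible, |lam j τ| ≤ C) (hτ : τ ∈ D.admissible)
    (hτ' : τ' ∈ D.admissible) (y : Fin D.n → ℝ) :
    |D.t τ y - D.t τ' y| ≤ 2 * C * ∑ j, |W j y| := by
  rw [hexp τ hτ, hexp τ' hτ', ← Finset.sum_sub_distrib, Finset.mul_sum]
  refine (Finset.abs_sum_le_sum_abs _ _).trans (Finset.sum_le_sum fun j _ => ?_)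
  rw [← sub_mul, abs_mul]
  refine mul_le_mul_of_nonneg_right ?_ (abs_nonneg _)
  refine (abs_sub _ _).trans ?_
  linarith [hC j τ hτ, hC j τ' hτ']

theorem continuous_ctrl {D : Design p q} : Continuous fun w => D.ctrl σ w :=
  continuous_const.add (continuous_finsetSum _ fun _ _ => continuous_finsetSum _ fun _ _ =>
    (continuous_quadC _).abs.div_const _)

/-- The effect of estimating the variance components is square integrable and has the second moment
of its linear approximation, up to a remainder. -/
theorem integrable_and_isLittleO (hσ : ∀ i, 0 < σ i)
    (hm : ∃ C : ℝ, ∀ k, ∑ j, (D k).m j ^ 2 ≤ C) (hinf : InfinitelyInformative D σ)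
    (hid : AsymptoticallyIdentifiable D σ) (hfix : FixedPartNegligible D σ) {β : Fin p → ℝ}
    (hexp : HasExpansion D β σ) {meth : Method} {est : (k : ℕ) → (Fin (D k).n → ℝ) → Param q}
    (hest : IsScoreEstimator meth D β σ est) :
    (∀ k, Integrable (fun w => ((D k).t (est k ((D k).X *ᵥ β + (D k).H σ *ᵥ w))
      ((D k).X *ᵥ β + (D k).H σ *ᵥ w) - (D k).t σ ((D k).X *ᵥ β + (D k).H σ *ᵥ w)) ^ 2)
      (stdG (D k).Noise)) ∧
    (fun k => ∫ w, ((D k).t (est k ((D k).X *ᵥ β + (D k).H σ *ᵥ w))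
      ((D k).X *ᵥ β + (D k).H σ *ᵥ w) - (D k).t σ ((D k).X *ᵥ β + (D k).H σ *ᵥ w)) ^ 2
      ∂(stdG (D k).Noise) - ∫ w, (D k).lin meth σ w ^ 2 ∂(stdG (D k).Noise))
      =o[atTop] fun k => (D k).dstar σ ^ (-2 : ℤ) := by
  obtain ⟨κ, hκ⟩ : ∃ κ, ∀ i, 1 / σ i ≤ κ :=
    ⟨∑ i, 1 / σ i, fun i => Finset.single_le_sum (f := fun i => 1 / σ i)
      (fun i _ => (one_div_pos.2 (hσ i)).le) (Finset.mem_univ i)⟩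
  have hκ0 := kappa_pos hσ hκ
  obtain ⟨K, hK, hreg⟩ := eventually_regular hσ hinf hid meth
  obtain ⟨r, -, hr⟩ := exists_vn_hvec_le hσ hκ hm hfix
  obtain ⟨α, b, δ, C, J, lam, W, B, hα, hb, hδ, hJ, hexpand, hWm, hWb, hlamC, -, hlam, hBC⟩ := hexp
  have ht := tendsto_dstar hinf
  set y : ∀ k, ((D k).Noise → ℝ) → Fin (D k).n → ℝ := fun k w =>
    (D k).X *ᵥ β + (D k).H σ *ᵥ w with hy
  have hym : ∀ k, Measurable (y k) := fun k => measurable_response β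
  set Δ : ∀ k, ((D k).Noise → ℝ) → ℝ := fun k w =>
    (D k).t (est k (y k w)) (y k w) - (D k).t σ (y k w) with hΔ
  have hΔm : ∀ k, Measurable (Δ k) := fun k =>
    (measurable_t_sub (σ := σ) (hest.measurable k)).comp (hym k)
  have hΔW : ∀ k w, |Δ k w| ≤ 2 * C * ∑ j, |W k j (y k w)| := fun k w =>
    abs_t_sub_le (hexpand k) (hlamC k) (hest.mem k _) ((D k).mem_admissible hσ) _
  have hWb' : ∀ k j, Integrable (fun w => |W k j (y k w)| ^ b) (stdG (D k).Noise) ∧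
      ∫ w, |W k j (y k w)| ^ b ∂(stdG (D k).Noise) ≤ |C| := fun k j => by
    obtain ⟨h1, h2⟩ := hWb k j
    rw [integrable_law hσ] at h1
    rw [integral_law hσ] at h2
    simp only [obs_scaleEquiv] at h1 h2
    exact ⟨h1, h2.trans (le_abs_self C)⟩
  have hWm' : ∀ k j, Measurable fun w => W k j (y k w) := fun k j => (hWm k j).comp (hym k)
  have hB : ∀ k j, 0 ≤ B k j := fun k j =>
    (norm_nonneg _).trans (hlam k j σ (Metric.mem_closedBall_self hδ.le)).2
  have hΔ2 : ∀ k, Integrable (fun w => Δ k w ^ 2) (stdG (D k).Noise) := fun k =>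
    integrable_sq_of_abs_le_sum hb (hWm' k) (fun j => (hWb' k j).1) (hΔm k) (hΔW k)
  refine ⟨hΔ2, ?_⟩
  have hslope : UnifMom (fun k => stdG (D k).Noise) fun k w => ∑ i, |(D k).hvec σ i ⬝ᵥ w| :=
    unifMom_sum _ fun i _ => (unifMom_dotProduct (h := fun k => (D k).hvec σ i)
      fun k => hr k i).abs
  set U : ∀ k, ((D k).Noise → ℝ) → ℝ := fun k w =>
    (q + 1) * K * ((D k).envelope σ κ w * ∑ i, |(D k).hvec σ i ⬝ᵥ w|) with hU
  have hUm : UnifMom (fun k => stdG (D k).Noise) U :=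
    ((unifMom_envelope hσ hκ).mul hslope).const_mul _
  set c₁ := (q + 1) * K * (1 + 8 * κ + 2 * κ * (1 + 2 * p * κ ^ 2) ^ 2) * ((q + 2) * (q + 1))
    with hc₁
  set Y₁ : ∀ k, ((D k).Noise → ℝ) → ℝ := fun k w =>
    c₁ * ((D k).ctrl σ w * ∑ i, |(D k).hvec σ i ⬝ᵥ w|) with hY₁
  have hY₁m : UnifMom (fun k => stdG (D k).Noise) Y₁ :=
    ((unifMom_ctrl hσ hκ).mul hslope).const_mul _
  set S : ∀ k, ((D k).Noise → ℝ) → ℝ := fun k w => ∑ j, B k j * |W k j (y k w)| with hS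
  set Y : ∀ k, ((D k).Noise → ℝ) → ℝ := fun k w => Y₁ k w + (q + 1) ^ 2 * S k w with hY
  obtain ⟨M₁, hM₁⟩ := (hY₁m.pow 2).integral_bdd
  obtain ⟨M₂, hM₂⟩ := (hUm.pow 2).integral_bdd
  obtain ⟨M₄, hM₄⟩ := (hUm.pow 4).integral_bdd
  have hint : ∀ {k} {f : ((D k).Noise → ℝ) → ℝ} {M : ℝ},
      (Integrable f (stdG (D k).Noise) ∧ ∫ w, |f w| ∂(stdG (D k).Noise) ≤ M) →
      ∫ w, f w ∂(stdG (D k).Noise) ≤ M := fun h =>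
    (le_abs_self _).trans ((abs_integral_le_integral_abs).trans h.2)
  set CY := 2 * M₁ + 2 * ((q + 1) ^ 4 * (C * (C * (1 + |C|)))) with hCY
  have hY2 : ∀ k, Integrable (fun w => Y k w ^ 2) (stdG (D k).Noise) ∧
      ∫ w, Y k w ^ 2 ∂(stdG (D k).Noise) ≤ CY := fun k => by
    obtain ⟨h1, h2⟩ := integral_sq_sum_mul_le hb (hWm' k) (hWb' k) (hB k) (hBC k) (abs_nonneg C)
    have h3 : Integrable (fun w => 2 * Y₁ k w ^ 2 + 2 * ((q + 1) ^ 4 * S k w ^ 2))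
        (stdG (D k).Noise) := ((hM₁ k).1.const_mul 2).add ((h1.const_mul _).const_mul 2)
    have hpt : ∀ w, Y k w ^ 2 ≤ 2 * Y₁ k w ^ 2 + 2 * ((q + 1) ^ 4 * S k w ^ 2) := fun w => by
      have : 0 ≤ (Y₁ k w - (q + 1) ^ 2 * S k w) ^ 2 := sq_nonneg _
      simp only [hY]
      linarith [add_sq (Y₁ k w) ((q + 1) ^ 2 * S k w), sub_sq (Y₁ k w) ((q + 1) ^ 2 * S k w),
        (by ring : ((q + 1) ^ 2 * S k w) ^ 2 = (q + 1) ^ 4 * S k w ^ 2)]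
    have hYm : AEStronglyMeasurable (Y k) (stdG (D k).Noise) :=
      (hY₁m.1 k).add ((Finset.measurable_fun_sum _ fun j _ =>
        (hWm' k j).abs.const_mul (B k j)).const_mul _).aestronglyMeasurable
    have h4 : Integrable (fun w => Y k w ^ 2) (stdG (D k).Noise) :=
      h3.mono' (hYm.pow 2) (ae_of_all _ fun w => by
        rw [Real.norm_of_nonneg (sq_nonneg _)]; exact hpt w)
    refine ⟨h4, (integral_mono h4 h3 hpt).trans ?_⟩
    rw [integral_add ((hM₁ k).1.const_mul 2) ((h1.const_mul _).const_mul 2), integral_const_mul,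
      integral_const_mul, integral_const_mul]
    have := hint (hM₁ k)
    rw [hCY]
    gcongr
  have hCY0 : 0 ≤ CY := (integral_nonneg fun w => sq_nonneg _).trans (hY2 0).2
  obtain ⟨CJ, hCJ⟩ := hJ.bound
  -- The rate of decay of the probability that `integral_sub_sq_le_of_rpow` requires.
  set g := 2 * α + 2 * ((2 * α + 3) / (b - 2)) + 3 with hg
  have hg0 : 0 < g := by
    have : 0 ≤ (2 * α + 3) / (b - 2) := div_nonneg (by linarith) (by linarith)
    rw [hg]; linarith
  -- With `ρ = 7/8` the scaled distance stays below `R = d_*^(1/8)`. Then `R ^ 4 ≤ d_*`, so the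
  -- squared factor `(R ^ 2 / d_* ^ 2) ^ 2` of the linearization error is at most `d_*⁻³`.
  obtain ⟨CP, hCP0, hCP⟩ := (hest.root (7 / 8) (by norm_num) (by norm_num) g hg0).exists_nonneg
  have ea : ∀ i, ∀ᶠ x : ℝ in atTop, 2 * (q + 1) / σ i * x ^ (1 / 8 : ℝ) < x ^ (1 : ℝ) := fun i =>
    eventually_mul_rpow_lt _ (by norm_num)
  have eb : ∀ᶠ x : ℝ in atTop, 2 * κ * (q + 1) * x ^ (1 / 8 : ℝ) < x ^ (1 : ℝ) :=
    eventually_mul_rpow_lt _ (by norm_num)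
  have ec : ∀ᶠ x : ℝ in atTop, (q + 1) / δ * x ^ (1 / 8 : ℝ) < x ^ (1 : ℝ) :=
    eventually_mul_rpow_lt _ (by norm_num)
  set M := CY + 2 * (2 * C) ^ 2 * (CJ ^ 2 * (CP + |C|)) + 2 * (M₄ + CP) with hM
  have key : ∀ᶠ k in atTop, Integrable (fun w => (Δ k w - (D k).lin meth σ w) ^ 2)
      (stdG (D k).Noise) ∧ ∫ w, (Δ k w - (D k).lin meth σ w) ^ 2 ∂(stdG (D k).Noise)
        ≤ M / (D k).dstar σ ^ 3 := by
    filter_upwards [hreg, ht.eventually (eventually_all.2 ea), ht.eventually eb, ht.eventually ec,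
      hCJ, hCP.bound] with k hk ha hbb hcc hJk hPk
    have h1 := hk.one_le
    have h0 : 0 < (D k).dstar σ := by linarith
    set x := (D k).dstar σ with hx
    set R := x ^ (1 / 8 : ℝ) with hR
    have hR1 : 1 ≤ R := Real.one_le_rpow h1 (by norm_num)
    have hR4 : R ^ 4 ≤ x := by
      rw [hR, ← Real.rpow_natCast, ← Real.rpow_mul h0.le]
      refine (Real.rpow_le_rpow_of_exponent_le h1 (by norm_num)).trans (Real.rpow_one x).le
    rw [Real.rpow_one] at hbb hcc
    rw [Real.norm_of_nonneg (by positivity), Real.norm_of_nonneg (by positivity)] at hJk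
    rw [Real.norm_of_nonneg measureReal_nonneg, Real.norm_of_nonneg (by positivity),
      law_real hσ] at hPk
    have hYk : Measurable (Y k) := by
      refine Measurable.add (Measurable.const_mul (Measurable.mul continuous_ctrl.measurable
        (Finset.measurable_fun_sum _ fun i _ => ?_)) _) ((Finset.measurable_fun_sum _ fun j _ =>
        (hWm' k j).abs.const_mul (B k j)).const_mul _)
      exact (Continuous.dotProduct continuous_const continuous_id).abs.measurable
    refine integral_sub_sq_le_of_rpow (U := U k) (Y := Y k) (a := R ^ 2 / x ^ 2) (α := α) (b := b)
      (hΔm k) continuous_lin.measurable hYk hα hb h1 (hΔW k) (hWb' k)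
      (fun w => abs_lin_le hσ hκ hk hK.le w) (hM₄ k).1 (hint (hM₄ k)) (hY2 k).1 (hY2 k).2 hCY0 hCP0
      (abs_nonneg C) ?_ hJk ?_
    · rw [div_pow, ← pow_mul, ← pow_mul]
      calc R ^ (2 * 2) / x ^ (2 * 2) ≤ x / x ^ (2 * 2) := by gcongr
        _ = 1 / x ^ 3 := by field_simp
    · refine (measureReal_mono ?_).trans hPk
      intro w hw
      simp only [Set.mem_ofPred_eq, obs_scaleEquiv] at hw ⊢
      rintro ⟨hroot, hdist⟩
      refine absurd hw (not_lt.2 ?_)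
      norm_num only at hdist
      exact abs_t_sub_sub_lin_le hσ hκ hk hK.le (hexpand k) (hlam k) (hB k) hR1 hdist.le
        (fun i => by
          have := ha i
          rw [Real.rpow_one, div_mul_eq_mul_div, div_lt_iff₀ (hσ i)] at this
          rw [div_le_div_iff₀ h0 two_pos]
          linarith)
        (by linarith) (by
          rw [div_mul_eq_mul_div, div_lt_iff₀ hδ] at hcc
          rw [div_le_iff₀ h0]
          linarith) β w hroot
  refine isLittleO_zpow_of_abs_le (u := fun k => (M₂ + 2 * M) / √((D k).dstar σ))
    (ht.eventually_gt_atTop 0) (Tendsto.const_div_atTop (Real.tendsto_sqrt_atTop.comp ht) _) ?_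
  filter_upwards [key, hreg] with k hk hregk
  have h1 := hregk.one_le
  have h0 : 0 < (D k).dstar σ := by linarith
  set x := (D k).dstar σ with hx
  have hs : 1 ≤ √x := Real.one_le_sqrt.2 h1
  have hL : Integrable (fun w => (D k).lin meth σ w ^ 2) (stdG (D k).Noise) ∧
      ∫ w, (D k).lin meth σ w ^ 2 ∂(stdG (D k).Noise) ≤ M₂ / x ^ 2 := by
    have hpt : ∀ w, (D k).lin meth σ w ^ 2 ≤ U k w ^ 2 / x ^ 2 := fun w => by
      rw [← sq_abs, ← div_pow]
      exact pow_le_pow_left₀ (abs_nonneg _) (abs_lin_le hσ hκ hregk hK.le w) 2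
    have h3 := (hM₂ k).1.div_const (x ^ 2)
    have h4 : Integrable (fun w => (D k).lin meth σ w ^ 2) (stdG (D k).Noise) :=
      h3.mono' (continuous_lin.pow 2).aestronglyMeasurable (ae_of_all _ fun w => by
        rw [Real.norm_of_nonneg (sq_nonneg _)]; exact hpt w)
    refine ⟨h4, (integral_mono h4 h3 hpt).trans ?_⟩
    rw [integral_div]
    have := hint (hM₂ k)
    gcongr
  -- The main second moment is `O(x⁻²)` and the remainder `O(x⁻³)`; the weight `x^(-1/2)` makes both
  -- contributions `O(x^(-5/2))`.
  refine (abs_integral_sq_sub_le (η := 1 / √x) (by positivity) (hΔ2 k) hL.1 hk.1).trans ?_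
  have hM0 : 0 ≤ M / x ^ 3 := (integral_nonneg fun w => sq_nonneg _).trans hk.2
  have e : x = √x * √x := (Real.mul_self_sqrt h0.le).symm
  calc _ ≤ 1 / √x * (M₂ / x ^ 2) + (1 + 1 / (1 / √x)) * (M / x ^ 3) := by
        gcongr
        · exact hL.2
        · exact hk.2
    _ ≤ 1 / √x * (M₂ / x ^ 2) + (√x + √x) * (M / x ^ 3) := by
        rw [one_div_one_div]; gcongr
    _ = 1 / √x * (M₂ / x ^ 2) + (√x + √x) * (M / (√x * √x * x ^ 2)) := by
        rw [← e]; ring_nf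
    _ = _ := by field_simp; ring

end Design
end EmpBLUP

end

/-! ### Conclusion: existence and the expansion of the mean square error -/

theorem mainTheorem5 {p q : ℕ} (D : ℕ → EmpBLUP.Design p q) (β : Fin p → ℝ)
    (σ : EmpBLUP.Param q) (hσ : σ ∈ interior (EmpBLUP.paramSpace q))
    (hl : ∃ C : ℝ, ∀ k j, |(D k).l j| ≤ C)
    (hm : ∃ C : ℝ, ∀ k, ∑ j, (D k).m j ^ 2 ≤ C)
    (hinf : EmpBLUP.InfinitelyInformative D σ)
    (hid : EmpBLUP.AsymptoticallyIdentifiable D σ)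
    (hfix : EmpBLUP.FixedPartNegligible D σ)
    (hexp : EmpBLUP.HasExpansion D β σ)
    (meth : EmpBLUP.Method) :
    (∃ est : (k : ℕ) → (Fin (D k).n → ℝ) → EmpBLUP.Param q,
      EmpBLUP.IsScoreEstimator meth D β σ est) ∧
    ∀ est : (k : ℕ) → (Fin (D k).n → ℝ) → EmpBLUP.Param q,
      EmpBLUP.IsScoreEstimator meth D β σ est →
        (∀ k, Integrable (fun ω => (D k).predError β (est k) ω ^ 2) ((D k).law σ)) ∧
        (fun k => (D k).MSE β σ (est k) -
            ((D k).g₁ σ + (D k).g₂ σ + (D k).g₃ meth β σ))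
          =o[atTop] fun k => (D k).dstar σ ^ (-2 : ℤ) := by
  have hσ' := EmpBLUP.pos_of_mem_interior hσ
  refine ⟨⟨_, EmpBLUP.Design.isScoreEstimator_newtonEst hσ' hinf hid meth β⟩, fun est hest => ?_⟩
  obtain ⟨hint, hlim⟩ := EmpBLUP.Design.integrable_and_isLittleO hσ' hm hinf hid hfix hexp hest
  refine ⟨fun k => EmpBLUP.Design.integrable_predError_sq hσ' (hest.measurable k) (hint k), ?_⟩
  refine (hlim.add (EmpBLUP.Design.integral_lin_sq_isLittleO hσ' hm hinf hid hfix meth β)).congr_left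
    fun k => ?_
  rw [EmpBLUP.Design.MSE_eq hσ' (hest.measurable k) (hest.mem k) (hest.invariant k) (hint k)]
  ring
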